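/- Notation. Let $n\ge 1$, $N\ge 0$ be integers, $s\in\mathbb R$, $\varepsilon>0$; $(t,x)$ are the coordinates of $\mathbb R^{1+n}$, $(\tau,\xi)$ the dual variables, $\widehat u=\mathcal F u$ is the Fourier transform, and $\square=-\partial_t^2+\Delta$. For $\alpha\in\mathbb R$ let $\Lambda^\alpha,\Lambda_+^\alpha,\Lambda_-^\alpha$ be the Fourier multipliers with symbols $$(1+|\xi|^2)^{\alpha/2},\qquad (1+\tau^2+|\xi|^2)^{\alpha/2},\qquad \Bigl(1+\tfrac{(\tau^2-|\xi|^2)^2}{1+\tau^2+|\xi|^2}\Bigr)^{\alpha/2},$$ let $\widetilde\square=\Lambda_+\Lambda_-$, let $\|f\|_{H^s}=\|\Lambda^s f\|_{L^2(\mathbb R^n)}$, and let $\mathcal H^{s,\theta}$ be the space with norm $\|\Lambda^s\Lambda_-^\theta u\|_{L^2(\mathbb R^{1+n})}+\|\Lambda^{s-1}\Lambda_-^\theta\partial_t u\|_{L^2(\mathbb R^{1+n})}$; for $\theta>\frac12$ it embeds in $C_b(\mathbb R,H^s)\cap C_b^1(\mathbb R,H^{s-1})$. Let $\tau_h u=u(\cdot+h,\cdot)$.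 Hypotheses on the space. Let $\mathcal X^s$ be a Banach space of tempered distributions on $\mathbb R^{1+n}$ (we put $\|u\|_{\mathcal X^s}=\infty$ for $u\notin\mathcal X^s$) such that 1. $\mathcal X^s$ embeds continuously in $\mathcal H^{s,\theta}$ for some $\theta>\frac12$; 2. if $\widehat u,\widehat v$ are functions with $|\widehat u|\le|\widehat v|$ a.e., then $\|u\|_{\mathcal X^s}\le\|v\|_{\mathcal X^s}$; 3. there are $\gamma<2$ and $C$ such that $\|u\|_{\mathcal X^s}\le C\,\|\mathcal F\Lambda^{s-1}\Lambda_+\Lambda_-^\gamma u\|_{L^2_\xi(L^\infty_\tau)}$ for all $u$ whose Fourier transform is a function; 4. $\tau_h$ is an isomorphism of $\mathcal X^s$ for every $h\in\mathbb R$; 5. for every $\phi\in C_c^\infty(\mathbb R)$ the map $u\mapsto\phi(t)u(t,x)$ is bounded from $\mathcal X^s$ into itself. Put $\mathcal Y^{s,\varepsilon}=\widetilde\square\Lambda_-^{-\varepsilon}(\mathcal X^s)$ with $\|F\|_{\mathcal Y^{s,\varepsilon}}=\|\widetilde\square^{-1}\Lambda_-^{\varepsilon}F\|_{\mathcal X^s}$,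 and, for $\sigma\in\mathbb R$, $\mathcal X^\sigma=\Lambda^{s-\sigma}\mathcal X^s$, $\mathcal Y^{\sigma,\varepsilon}=\Lambda^{s-\sigma}\mathcal Y^{s,\varepsilon}$ with the transported norms. For $T>0$ let $\mathcal X^s_T$ be the quotient of $\mathcal X^s$ by the relation "$u(t)=v(t)$ for all $t\in[0,T]$", with the quotient norm. Below, unknowns and data take values in $\mathbb R^N$, and the same symbols denote the corresponding spaces of $\mathbb R^N$-valued distributions with components in the scalar spaces. Write $S_T=(0,T)\times\mathbb R^n$ and $\|(f,g)\|_{(s)}=\|f\|_{H^s}+\|g\|_{H^{s-1}}$. Hypotheses on the nonlinearity. Let $\mathcal N:\mathcal X^s\to\mathcal Y^{s,\varepsilon}$ commute with all $\tau_h$, be local in time (if $u=v$ on $I\times\mathbb R^n$ for an open interval $I$, then $\mathcal N(u)=\mathcal N(v)$ on $I\times\mathbb R^n$), satisfy $\mathcal N(0)=0$, and satisfy, for some continuous function $A$ and all $u,v\in\mathcal X^s$, $$\|\mathcal N(u)-\mathcal N(v)\|_{\mathcal Y^{s,\varepsilon}}\le A\bigl(\max\{\|u\|_{\mathcal X^s},\|v\|_{\mathcal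 X^s}\}\bigr)\|u-v\|_{\mathcal X^s}.$$ Then the Cauchy problem for $\square u=\mathcal N(u)$, $(u,\partial_t u)|_{t=0}=(f,g)$, is locally well-posed for data in $H^s\times H^{s-1}$: (I) (Local existence) There is a continuous function $T:[0,\infty)\to(0,\infty)$ such that for all $(f,g)\in H^s\times H^{s-1}$, with $T=T(\|(f,g)\|_{(s)})$, there is a $u\in\mathcal X^s_T$ which solves $\square u=\mathcal N(u)$ on $S_T$ with initial data $(f,g)$. (II) (Uniqueness) If $T>0$ and $u,u'\in\mathcal X^s_T$ are two solutions on $S_T$ with the same initial data $(f,g)\in H^s\times H^{s-1}$, then $u=u'$. (III) (Continuous dependence) If $T>0$ and $u\in\mathcal X^s_T$ is a solution on $S_T$ with data $(f,g)\in H^s\times H^{s-1}$, then there are $\delta>0$ and $C$ such that for all $(f',g')\in H^s\times H^{s-1}$ with $\|(f-f',g-g')\|_{(s)}<\delta$ there is a solution $u'\in\mathcal X^s_T$ on $S_T$ with data $(f',g')$, and $\|u-u'\|_{\mathcal X^s_T}\le C\|(f-f',g-g')\|_{(s)}$. (IV) (Smooth dependence) Suppose moreover that $\mathcal N:\mathcal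 X^s\to\mathcal Y^{s,\varepsilon}$ is $C^\infty$. Let $T>0$, let $\delta\mapsto(f_\delta,g_\delta)$, $\mathbb R\to H^s\times H^{s-1}$, be $C^\infty$, and suppose that there is a solution in $\mathcal X^s_T$ on $S_T$ with data $(f_0,g_0)$. Then there is $\delta_0>0$ such that for all $|\delta|\le\delta_0$ there is a solution $u_\delta\in\mathcal X^s_T$ on $S_T$ with data $(f_\delta,g_\delta)$; and for every $\delta_0>0$ with this property the map $\delta\mapsto u_\delta$, $[-\delta_0,\delta_0]\to\mathcal X^s_T$, is $C^\infty$. (Here $\mathcal X^s_T$ is a Banach space: the elements of $\mathcal X^s$ that vanish on $[0,T]$ form a closed subspace.) (V) (Persistence of higher regularity) Suppose (in addition to the hypotheses of (I)–(III)) that for every $\sigma>s$ there is a continuous function $A_\sigma$ such that $$\|\mathcal N(u)\|_{\mathcal Y^{\sigma,\varepsilon}}\le A_\sigma\bigl(\|u\|_{\mathcal X^s}\bigr)\|u\|_{\mathcal X^\sigma}\qquad\text{for all }u\in\mathcal X^s\cap\mathcal X^\sigma .$$ If $\sigma>s$, $T>0$ and $u\in\mathcal X^s_T$ is a solution on $S_T$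 with data $(f,g)\in H^\sigma\times H^{\sigma-1}$, then $u\in C([0,T],H^\sigma)\cap C^1([0,T],H^{\sigma-1})$. -/

import Mathlib

open MeasureTheory FourierTransform LineDeriv
open scoped SchwartzMap ContDiff ENNReal NNReal

noncomputable section

namespace WaveLWP

/-- Space `ℝⁿ`. -/
abbrev Sp (n : ℕ) : Type := EuclideanSpace ℝ (Fin n)

/-- Space-time `ℝ^{1+n}`; a point is `(t, x)`, a frequency is `(τ, ξ)`. -/
abbrev ST (n : ℕ) : Type := WithLp 2 (ℝ × Sp n)

/-- The point `(t, x)` of space-time. -/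
def pt {n : ℕ} (t : ℝ) (x : Sp n) : ST n := WithLp.toLp 2 (t, x)

/-! ### Fourier multipliers

Mathlib's Fourier transform has the kernel `exp (-2πi ⟨x, ξ⟩)`. The symbols below are therefore
evaluated at `2π` times Mathlib's frequency variable, which gives the operators defined with
the kernel `exp (-i ⟨x, ξ⟩)`. -/

/-- The symbol `(1 + |ξ|²)^{α/2}` on `ℝⁿ`. -/
def symS {n : ℕ} (α : ℝ) (ξ : Sp n) : ℝ := (1 + ‖(2 * Real.pi) • ξ‖ ^ 2) ^ (α / 2)

/-- The symbol `(1 + |ξ|²)^{α/2}` on `ℝ^{1+n}`. -/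
def symX {n : ℕ} (α : ℝ) (z : ST n) : ℝ := (1 + ‖(2 * Real.pi) • z.snd‖ ^ 2) ^ (α / 2)

/-- The symbol `(1 + τ² + |ξ|²)^{α/2}`. -/
def symPlus {n : ℕ} (α : ℝ) (z : ST n) : ℝ :=
  (1 + (2 * Real.pi * z.fst) ^ 2 + ‖(2 * Real.pi) • z.snd‖ ^ 2) ^ (α / 2)

/-- The symbol `(1 + (τ² - |ξ|²)² / (1 + τ² + |ξ|²))^{α/2}`. -/
def symMinus {n : ℕ} (α : ℝ) (z : ST n) : ℝ :=
  (1 + ((2 * Real.pi * z.fst) ^ 2 - ‖(2 * Real.pi) • z.snd‖ ^ 2) ^ 2 /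
    (1 + (2 * Real.pi * z.fst) ^ 2 + ‖(2 * Real.pi) • z.snd‖ ^ 2)) ^ (α / 2)

/-- The Fourier multiplier with a real symbol. -/
def mult {E : Type*} [NormedAddCommGroup E] [InnerProductSpace ℝ E] [FiniteDimensional ℝ E]
    [MeasurableSpace E] [BorelSpace E] (m : E → ℝ) : 𝓢'(E, ℂ) →L[ℂ] 𝓢'(E, ℂ) :=
  TemperedDistribution.fourierMultiplierCLM ℂ (fun x ↦ (m x : ℂ))

/-- `Λ^α` on `ℝⁿ`. -/
abbrev LamS (n : ℕ) (α : ℝ) : 𝓢'(Sp n, ℂ) →L[ℂ] 𝓢'(Sp n, ℂ) := mult (symS α)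

/-- `Λ^α` on `ℝ^{1+n}`. -/
abbrev Lam (n : ℕ) (α : ℝ) : 𝓢'(ST n, ℂ) →L[ℂ] 𝓢'(ST n, ℂ) := mult (symX α)

/-- `Λ₊^α`. -/
abbrev LamPlus (n : ℕ) (α : ℝ) : 𝓢'(ST n, ℂ) →L[ℂ] 𝓢'(ST n, ℂ) := mult (symPlus α)

/-- `Λ₋^α`. -/
abbrev LamMinus (n : ℕ) (α : ℝ) : 𝓢'(ST n, ℂ) →L[ℂ] 𝓢'(ST n, ℂ) := mult (symMinus α)

section SymbolFacts

variable {n : ℕ}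

theorem symS_temperate (α : ℝ) : (symS (n := n) α).HasTemperateGrowth := by
  have h := (Function.hasTemperateGrowth_one_add_norm_sq_rpow (Sp n) (α / 2)).comp
    ((2 * Real.pi) • ContinuousLinearMap.id ℝ (Sp n)).hasTemperateGrowth
  exact h

theorem symX_temperate (α : ℝ) : (symX (n := n) α).HasTemperateGrowth := by
  have h := (Function.hasTemperateGrowth_one_add_norm_sq_rpow (Sp n) (α / 2)).comp
    ((2 * Real.pi) • WithLp.sndL 2 ℝ ℝ (Sp n)).hasTemperateGrowth
  exact h

theorem norm_sq_two_pi (z : ST n) : ‖(2 * Real.pi) • z‖ ^ 2 =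
    (2 * Real.pi * z.fst) ^ 2 + ‖(2 * Real.pi) • z.snd‖ ^ 2 := by
  rw [WithLp.prod_norm_sq_eq_of_L2]
  simp [mul_pow]

theorem symPlus_temperate (α : ℝ) : (symPlus (n := n) α).HasTemperateGrowth := by
  have h := (Function.hasTemperateGrowth_one_add_norm_sq_rpow (ST n) (α / 2)).comp
    ((2 * Real.pi) • ContinuousLinearMap.id ℝ (ST n)).hasTemperateGrowth
  have e : symPlus (n := n) α = (fun x ↦ (1 + ‖x‖ ^ 2) ^ (α / 2)) ∘
      ⇑((2 * Real.pi) • ContinuousLinearMap.id ℝ (ST n)) := by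
    funext z
    have := norm_sq_two_pi z
    simp only [symPlus, Function.comp_apply, smul_apply,
      ContinuousLinearMap.id_apply, this, add_assoc]
  rw [e]
  exact h

theorem symMinus_temperate (α : ℝ) : (symMinus (n := n) α).HasTemperateGrowth := by
  have hq : (fun z : ST n ↦ (2 * Real.pi * z.fst) ^ 2 - ‖(2 * Real.pi) • z.snd‖ ^ 2
      ).HasTemperateGrowth := by
    have h1 := (Function.hasTemperateGrowth_norm_sq (H := ℝ)).comp
      ((2 * Real.pi) • WithLp.fstL 2 ℝ ℝ (Sp n)).hasTemperateGrowth
    have h2 := (Function.hasTemperateGrowth_norm_sq (H := Sp n)).comp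
      ((2 * Real.pi) • WithLp.sndL 2 ℝ ℝ (Sp n)).hasTemperateGrowth
    have e : (fun z : ST n ↦ (2 * Real.pi * z.fst) ^ 2 - ‖(2 * Real.pi) • z.snd‖ ^ 2) =
        (fun x : ℝ ↦ ‖x‖ ^ 2) ∘ ⇑((2 * Real.pi) • WithLp.fstL 2 ℝ ℝ (Sp n)) -
          (fun x : Sp n ↦ ‖x‖ ^ 2) ∘ ⇑((2 * Real.pi) • WithLp.sndL 2 ℝ ℝ (Sp n)) := by
      funext z
      simp [mul_pow, norm_smul]
    rw [e]
    exact h1.sub h2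
  let e := (WithLp.prodContinuousLinearEquiv 2 ℝ (ST n) ℝ).symm
  have hv : (fun z : ST n ↦ e ((2 * Real.pi) • z,
      (2 * Real.pi * z.fst) ^ 2 - ‖(2 * Real.pi) • z.snd‖ ^ 2)).HasTemperateGrowth := by
    have h1 := (e.toContinuousLinearMap ∘L ContinuousLinearMap.inl ℝ (ST n) ℝ ∘L
      ((2 * Real.pi) • ContinuousLinearMap.id ℝ (ST n))).hasTemperateGrowth
    have h2 := (e.toContinuousLinearMap ∘L
      ContinuousLinearMap.inr ℝ (ST n) ℝ).hasTemperateGrowth.comp hq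
    have e' : (fun z : ST n ↦ e ((2 * Real.pi) • z,
        (2 * Real.pi * z.fst) ^ 2 - ‖(2 * Real.pi) • z.snd‖ ^ 2)) =
        ⇑(e.toContinuousLinearMap ∘L ContinuousLinearMap.inl ℝ (ST n) ℝ ∘L
          ((2 * Real.pi) • ContinuousLinearMap.id ℝ (ST n))) +
        ⇑(e.toContinuousLinearMap ∘L ContinuousLinearMap.inr ℝ (ST n) ℝ) ∘
          (fun z : ST n ↦ (2 * Real.pi * z.fst) ^ 2 - ‖(2 * Real.pi) • z.snd‖ ^ 2) := by
      funext z
      simp only [Pi.add_apply, ContinuousLinearMap.comp_apply, Function.comp_apply,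
        ContinuousLinearEquiv.coe_coe, ← map_add]
      simp
    rw [e']
    exact h1.add h2
  have h3 := (Function.hasTemperateGrowth_one_add_norm_sq_rpow
    (WithLp 2 (ST n × ℝ)) (α / 2)).comp hv
  have h4 := h3.mul (symPlus_temperate (n := n) (-α))
  refine Eq.mp (congrArg Function.HasTemperateGrowth ?_) h4
  symm
  funext z
  have hn := norm_sq_two_pi z
  have hp : 0 < 1 + (2 * Real.pi * z.fst) ^ 2 + ‖(2 * Real.pi) • z.snd‖ ^ 2 := by positivity
  simp only [symMinus, symPlus, Pi.mul_apply, Function.comp_apply]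
  rw [WithLp.prod_norm_sq_eq_of_L2]
  have hf : (e ((2 * Real.pi) • z,
      (2 * Real.pi * z.fst) ^ 2 - ‖(2 * Real.pi) • z.snd‖ ^ 2)).fst = (2 * Real.pi) • z := rfl
  have hs : (e ((2 * Real.pi) • z,
      (2 * Real.pi * z.fst) ^ 2 - ‖(2 * Real.pi) • z.snd‖ ^ 2)).snd =
        (2 * Real.pi * z.fst) ^ 2 - ‖(2 * Real.pi) • z.snd‖ ^ 2 := rfl
  rw [hf, hs, hn, Real.norm_eq_abs, sq_abs]
  rw [neg_div, Real.rpow_neg hp.le, ← div_eq_mul_inv, ← Real.div_rpow (by positivity) hp.le]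
  congr 1
  field_simp
  ring

theorem symS_neg (α : ℝ) (ξ : Sp n) : symS α ξ * symS (-α) ξ = 1 := by
  rw [symS, symS, neg_div, ← Real.rpow_add (by positivity)]
  simp

theorem symX_neg (α : ℝ) (z : ST n) : symX α z * symX (-α) z = 1 := by
  rw [symX, symX, neg_div, ← Real.rpow_add (by positivity)]
  simp

theorem symPlus_neg (α : ℝ) (z : ST n) : symPlus α z * symPlus (-α) z = 1 := by
  rw [symPlus, symPlus, neg_div, ← Real.rpow_add (by positivity)]
  simp

theorem symMinus_neg (α : ℝ) (z : ST n) : symMinus α z * symMinus (-α) z = 1 := by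
  rw [symMinus, symMinus, neg_div, ← Real.rpow_add (by positivity)]
  simp

theorem mult_injective {E : Type*} [NormedAddCommGroup E] [InnerProductSpace ℝ E]
    [FiniteDimensional ℝ E] [MeasurableSpace E] [BorelSpace E] {m m' : E → ℝ}
    (hm : m.HasTemperateGrowth) (hm' : m'.HasTemperateGrowth) (h : ∀ x, m x * m' x = 1) :
    Function.Injective (mult m) := by
  have key : ∀ u, mult m' (mult m u) = u := by
    intro u
    have h1 : (fun x ↦ (m x : ℂ)).HasTemperateGrowth := Function.Complex.hasTemperateGrowth_ofReal.comp hm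
    have h2 : (fun x ↦ (m' x : ℂ)).HasTemperateGrowth :=
      Function.Complex.hasTemperateGrowth_ofReal.comp hm'
    rw [mult, mult, TemperedDistribution.fourierMultiplierCLM_fourierMultiplierCLM_apply h1 h2]
    have h3 : ((fun x ↦ (m x : ℂ)) * fun x ↦ (m' x : ℂ)) = fun _ ↦ (1 : ℂ) := by
      ext x
      simp only [Pi.mul_apply]
      rw [← Complex.ofReal_mul, h x, Complex.ofReal_one]
    rw [h3]
    simp
  exact Function.LeftInverse.injective key

end SymbolFacts

/-! ### Banach spaces of tempered distributions -/

universe u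

/-- A Banach space of complex-valued tempered distributions on `E`: the distributions
`toDist a`, with the norm of `a`. -/
structure DistSpace (E : Type) [NormedAddCommGroup E] [NormedSpace ℝ E] where
  carrier : Type u
  [normed : NormedAddCommGroup carrier]
  [space : NormedSpace ℂ carrier]
  [complete : CompleteSpace carrier]
  toDist : carrier →ₗ[ℂ] 𝓢'(E, ℂ)
  inj : Function.Injective toDist

attribute [instance] DistSpace.normed DistSpace.space DistSpace.complete

instance {E : Type} [NormedAddCommGroup E] [NormedSpace ℝ E] (B : DistSpace.{u} E) :
    NormedSpace ℝ B.carrier := NormedSpace.complexToReal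

section Spaces

variable {E : Type} [NormedAddCommGroup E] [InnerProductSpace ℝ E] [FiniteDimensional ℝ E]
  [MeasurableSpace E] [BorelSpace E]

/-- The image `L(B)` with the norm `‖L u‖_{L(B)} = ‖u‖_B`, for an injective operator `L`. -/
def DistSpace.image (B : DistSpace.{u} E) (L : 𝓢'(E, ℂ) →L[ℂ] 𝓢'(E, ℂ))
    (hL : Function.Injective L) : DistSpace.{u} E where
  carrier := B.carrier
  toDist := L.toLinearMap ∘ₗ B.toDist
  inj := hL.comp B.inj

/-- `L²(E)` as a space of tempered distributions. -/
def L2 (E : Type) [NormedAddCommGroup E] [InnerProductSpace ℝ E] [FiniteDimensional ℝ E]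
    [MeasurableSpace E] [BorelSpace E] : DistSpace.{0} E where
  carrier := Lp ℂ 2 (volume : Measure E)
  toDist := (Lp.toTemperedDistributionCLM ℂ (volume : Measure E) 2).toLinearMap
  inj := LinearMap.ker_eq_bot.mp Lp.ker_toTemperedDistributionCLM_eq_bot

/-- The Sobolev space `H^s(ℝⁿ) = Λ^{-s} L²`, with `‖f‖_{H^s} = ‖Λ^s f‖_{L²}`. -/
def H (n : ℕ) (s : ℝ) : DistSpace.{0} (Sp n) :=
  (L2 (Sp n)).image (LamS n (-s))
    (mult_injective (symS_temperate _) (symS_temperate _) (symS_neg _))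

/-- `𝒴^{s,ε} = □̃ Λ₋^{-ε} 𝒳^s`, where `□̃ = Λ₊ Λ₋`. -/
def Yspace {n : ℕ} (X : DistSpace.{u} (ST n)) (ε : ℝ) : DistSpace.{u} (ST n) :=
  ((X.image (LamMinus n (-ε))
    (mult_injective (symMinus_temperate _) (symMinus_temperate _) (symMinus_neg _))).image
      (LamMinus n 1)
      (mult_injective (symMinus_temperate _) (symMinus_temperate _) (symMinus_neg _))).image
        (LamPlus n 1)
        (mult_injective (symPlus_temperate _) (symPlus_temperate _) (symPlus_neg _))

/-- `Λ^α B`. With `α = s - σ` this is the passage from `𝒳^s` to `𝒳^σ`, and from `𝒴^{s,ε}` to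
`𝒴^{σ,ε}`. -/
def shift {n : ℕ} (B : DistSpace.{u} (ST n)) (α : ℝ) : DistSpace.{u} (ST n) :=
  B.image (Lam n α) (mult_injective (symX_temperate _) (symX_temperate _) (symX_neg _))

/-- A tempered distribution is real-valued if it is real on real test functions. -/
def IsRealValued (u : 𝓢'(E, ℂ)) : Prop :=
  ∀ φ : 𝓢(E, ℂ), (∀ x, (φ x).im = 0) → (u φ).im = 0

/-- The `ℝ^N`-valued distributions all of whose components belong to `B`. -/
def realSub (B : DistSpace.{u} E) (N : ℕ) : Submodule ℝ (Fin N → B.carrier) where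
  carrier := {u | ∀ i, IsRealValued (B.toDist (u i))}
  add_mem' := by
    intro u v hu hv i φ hφ
    have h1 := hu i φ hφ
    have h2 := hv i φ hφ
    simp [h1, h2]
  zero_mem' := by
    intro i φ hφ
    simp
  smul_mem' := by
    intro c u hu i φ hφ
    have h1 := hu i φ hφ
    have h2 : (c • u) i = (c : ℂ) • u i := by simp
    rw [h2, map_smul]
    simp [h1]

/-- The real Banach space of the `ℝ^N`-valued distributions with components in `B`, normed by
the maximum of the norms of the components. -/
def RVec (B : DistSpace.{u} E) (N : ℕ) : Type u := ↥(realSub B N)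

instance (B : DistSpace.{u} E) (N : ℕ) : NormedAddCommGroup (RVec B N) :=
  inferInstanceAs (NormedAddCommGroup ↥(realSub B N))

instance (B : DistSpace.{u} E) (N : ℕ) : NormedSpace ℝ (RVec B N) :=
  inferInstanceAs (NormedSpace ℝ ↥(realSub B N))

/-- The `i`-th component of an element of `RVec B N`, as a tempered distribution. -/
def comp {B : DistSpace.{u} E} {N : ℕ} (u : RVec B N) (i : Fin N) : 𝓢'(E, ℂ) :=
  B.toDist (u.1 i)

/-- `U` is (a representative of) the Fourier transform of `u`. -/
def HasFourierFun (u : 𝓢'(E, ℂ)) (U : E → ℂ) : Prop :=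
  AEStronglyMeasurable U volume ∧
    ∀ φ : 𝓢(E, ℂ), Integrable (fun z ↦ φ z * U z) volume ∧ (𝓕 u) φ = ∫ z, φ z * U z

end Spaces

section Components

variable {E : Type} [NormedAddCommGroup E] [InnerProductSpace ℝ E]

theorem comp_zero {B : DistSpace.{u} E} {N : ℕ} (i : Fin N) : comp (0 : RVec B N) i = 0 :=
  map_zero B.toDist

theorem comp_add {B : DistSpace.{u} E} {N : ℕ} (u v : RVec B N) (i : Fin N) :
    comp (u + v) i = comp u i + comp v i :=
  map_add B.toDist (u.1 i) (v.1 i)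

theorem comp_smul {B : DistSpace.{u} E} {N : ℕ} (c : ℝ) (u : RVec B N) (i : Fin N) :
    comp (c • u) i = (c : ℂ) • comp u i :=
  map_smul B.toDist (c : ℂ) (u.1 i)

end Components

section SpaceTime

variable {n : ℕ}

/-- `∂_t`. -/
def dt (u : 𝓢'(ST n, ℂ)) : 𝓢'(ST n, ℂ) := ∂_{pt 1 (0 : Sp n)} u

/-- The wave operator `□ = -∂_t² + Δ`. -/
def box (u : 𝓢'(ST n, ℂ)) : 𝓢'(ST n, ℂ) :=
  -dt (dt u) + ∑ i : Fin n,
    ∂_{pt 0 (EuclideanSpace.single i (1 : ℝ))} (∂_{pt 0 (EuclideanSpace.single i (1 : ℝ))} u)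

/-- The time translation `τ_t u = u(· + t, ·)`. -/
def timeShift (t : ℝ) : 𝓢'(ST n, ℂ) →L[ℂ] 𝓢'(ST n, ℂ) :=
  PointwiseConvergenceCLM.precomp ℂ (SchwartzMap.compSubConstCLM ℂ (pt t (0 : Sp n)))

/-- The multiplication `u ↦ φ(t) u(t, x)`. -/
def timeMul (φ : ℝ → ℝ) : 𝓢'(ST n, ℂ) →L[ℂ] 𝓢'(ST n, ℂ) :=
  TemperedDistribution.smulLeftCLM ℂ (fun z : ST n ↦ (φ z.fst : ℂ))

theorem pt_temperate (t : ℝ) : (fun x : Sp n ↦ pt t x).HasTemperateGrowth := by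
  let e := (WithLp.prodContinuousLinearEquiv 2 ℝ ℝ (Sp n)).symm
  have h1 := (e.toContinuousLinearMap ∘L ContinuousLinearMap.inr ℝ ℝ (Sp n)).hasTemperateGrowth
  have h2 := Function.HasTemperateGrowth.const (E := Sp n) (pt t (0 : Sp n))
  convert h1.add h2 using 1
  ext x : 1
  simp [pt, e, ← WithLp.toLp_add]

theorem norm_le_norm_pt (t : ℝ) (x : Sp n) : ‖x‖ ≤ 1 * (1 + ‖pt t x‖) ^ 1 := by
  have h : ‖x‖ ≤ ‖pt t x‖ := by
    apply le_of_sq_le_sq _ (norm_nonneg _)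
    rw [WithLp.prod_norm_sq_eq_of_L2]
    have h1 : (pt t x).snd = x := rfl
    rw [h1]
    nlinarith [sq_nonneg ‖(pt t x).fst‖]
  linarith

/-- The time slice `x ↦ Φ(t, x)` of a Schwartz function. -/
def sliceAt (t : ℝ) : 𝓢(ST n, ℂ) →L[ℂ] 𝓢(Sp n, ℂ) :=
  SchwartzMap.compCLM ℂ (pt_temperate t) ⟨1, 1, norm_le_norm_pt t⟩

/-- `U` is `t ↦ u(t)`: a curve of distributions on `ℝⁿ`, continuous in `t`, such that
`⟨u, Φ⟩ = ∫ ⟨U(t), Φ(t, ·)⟩ dt` for every Schwartz function `Φ`. There is at most one such `U`.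
-/
def IsPath (u : 𝓢'(ST n, ℂ)) (U : ℝ → 𝓢'(Sp n, ℂ)) : Prop :=
  Continuous U ∧ ∀ Φ : 𝓢(ST n, ℂ),
    Integrable (fun t ↦ U t (sliceAt t Φ)) volume ∧ u Φ = ∫ t, U t (sliceAt t Φ)

/-- `u = v` on the open slab `(a, b) × ℝⁿ`, in the sense of distributions. -/
def EqOnSlab (a b : ℝ) (u v : 𝓢'(ST n, ℂ)) : Prop :=
  ∀ φ : 𝓢(ST n, ℂ), HasCompactSupport φ → tsupport φ ⊆ {z | z.fst ∈ Set.Ioo a b} → u φ = v φ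

/-- `(u, ∂_t u)` takes the value `(f, g)` at `t = 0`. -/
def HasData (u : 𝓢'(ST n, ℂ)) (f g : 𝓢'(Sp n, ℂ)) : Prop :=
  (∃ U, IsPath u U ∧ U 0 = f) ∧ ∃ V, IsPath (dt u) V ∧ V 0 = g

/-! ### The hypotheses on the space -/

/-- The hypotheses of the main linear estimate on `𝒳^s`. In `solid` and in `upper`, membership
in `𝒳^s` is part of the assertion (the norm is infinite off `𝒳^s`). -/
structure MainHyp (s : ℝ) (X : DistSpace.{u} (ST n)) : Prop where
  /-- `𝒳^s` embeds in `ℋ^{s,θ}`, whose norm is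
  `‖Λ^s Λ₋^θ u‖_{L²} + ‖Λ^{s-1} Λ₋^θ ∂_t u‖_{L²}`, for some `θ > 1/2`. -/
  embeds : ∃ θ : ℝ, 1 / 2 < θ ∧ ∃ C : ℝ, ∀ u : X.carrier,
    ∃ p q : Lp ℂ 2 (volume : Measure (ST n)),
      Lam n s (LamMinus n θ (X.toDist u)) = (p : 𝓢'(ST n, ℂ)) ∧
      Lam n (s - 1) (LamMinus n θ (dt (X.toDist u))) = (q : 𝓢'(ST n, ℂ)) ∧
      ‖p‖ + ‖q‖ ≤ C * ‖u‖
  /-- `|û| ≤ |v̂|` implies `‖u‖ ≤ ‖v‖`. -/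
  solid : ∀ (u : 𝓢'(ST n, ℂ)) (U V : ST n → ℂ) (v : X.carrier),
    HasFourierFun u U → HasFourierFun (X.toDist v) V → (∀ᵐ z, ‖U z‖ ≤ ‖V z‖) →
      ∃ w : X.carrier, X.toDist w = u ∧ ‖w‖ ≤ ‖v‖
  /-- `‖u‖ ≲ ‖ℱ Λ^{s-1} Λ₊ Λ₋^γ u‖_{L²_ξ(L^∞_τ)}` for some `γ < 2`. -/
  upper : ∃ γ : ℝ, γ < 2 ∧ ∃ C : ℝ≥0, ∀ (u : 𝓢'(ST n, ℂ)) (U : ST n → ℂ),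
    HasFourierFun u U →
      (∫⁻ ξ : Sp n, (eLpNorm (fun τ : ℝ ↦ ((symX (s - 1) (pt τ ξ) * symPlus 1 (pt τ ξ) *
        symMinus γ (pt τ ξ) : ℝ) : ℂ) * U (pt τ ξ)) ⊤ volume) ^ (2 : ℝ)) ^ (1 / 2 : ℝ) < ⊤ →
      ∃ w : X.carrier, X.toDist w = u ∧ (‖w‖ₑ : ℝ≥0∞) ≤ C *
        (∫⁻ ξ : Sp n, (eLpNorm (fun τ : ℝ ↦ ((symX (s - 1) (pt τ ξ) * symPlus 1 (pt τ ξ) *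
          symMinus γ (pt τ ξ) : ℝ) : ℂ) * U (pt τ ξ)) ⊤ volume) ^ (2 : ℝ)) ^ (1 / 2 : ℝ)

/-- Every `τ_t` is bounded from `𝒳^s` to itself; since `τ_t` and `τ_{-t}` are inverse to each
other, this says that every `τ_t` is an isomorphism of `𝒳^s`. -/
def TimeInvariant (X : DistSpace.{u} (ST n)) : Prop :=
  ∀ t : ℝ, ∃ C : ℝ, ∀ u : X.carrier, ∃ v : X.carrier,
    X.toDist v = timeShift t (X.toDist u) ∧ ‖v‖ ≤ C * ‖u‖

/-- For every `φ ∈ C_c^∞(ℝ)`, multiplication by `φ(t)` is bounded from `𝒳^s` to itself. -/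
def CutoffInvariant (X : DistSpace.{u} (ST n)) : Prop :=
  ∀ φ : ℝ → ℝ, ContDiff ℝ ∞ φ → HasCompactSupport φ →
    ∃ C : ℝ, ∀ u : X.carrier, ∃ v : X.carrier,
      X.toDist v = timeMul φ (X.toDist u) ∧ ‖v‖ ≤ C * ‖u‖

/-! ### The hypotheses on the nonlinearity -/

variable {N : ℕ}

/-- `𝒩` commutes with time translations. -/
def CommutesWithTimeShift {X Y : DistSpace.{u} (ST n)} (Nl : RVec X N → RVec Y N) : Prop :=
  ∀ (t : ℝ) (u v : RVec X N), (∀ i, comp v i = timeShift t (comp u i)) →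
    ∀ i, comp (Nl v) i = timeShift t (comp (Nl u) i)

/-- `𝒩` is local in time. -/
def LocalInTime {X Y : DistSpace.{u} (ST n)} (Nl : RVec X N → RVec Y N) : Prop :=
  ∀ (a b : ℝ) (u v : RVec X N), (∀ i, EqOnSlab a b (comp u i) (comp v i)) →
    ∀ i, EqOnSlab a b (comp (Nl u) i) (comp (Nl v) i)

/-- `‖𝒩(u) - 𝒩(v)‖ ≤ A(max (‖u‖, ‖v‖)) ‖u - v‖` with a continuous function `A`. -/
def LipschitzOnBalls {X Y : DistSpace.{u} (ST n)} (Nl : RVec X N → RVec Y N) : Prop :=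
  ∃ A : ℝ → ℝ, ContinuousOn A (Set.Ici 0) ∧
    ∀ u v : RVec X N, ‖Nl u - Nl v‖ ≤ A (max ‖u‖ ‖v‖) * ‖u - v‖

/-- `‖𝒩(u)‖_{𝒴^{σ,ε}} ≤ A_σ(‖u‖_{𝒳^s}) ‖u‖_{𝒳^σ}` for all `u ∈ 𝒳^s ∩ 𝒳^σ`, with a continuous
function `A_σ`. In particular `𝒩(u) ∈ 𝒴^{σ,ε}` for these `u`. -/
def TameEstimate {X Y : DistSpace.{u} (ST n)} (Nl : RVec X N → RVec Y N) (s σ : ℝ) : Prop :=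
  ∃ A : ℝ → ℝ, ContinuousOn A (Set.Ici 0) ∧
    ∀ (u : RVec X N) (u' : RVec (shift X (s - σ)) N), (∀ i, comp u' i = comp u i) →
      ∃ w : RVec (shift Y (s - σ)) N, (∀ i, comp w i = comp (Nl u) i) ∧
        ‖w‖ ≤ A ‖u‖ * ‖u'‖

/-! ### Restriction to `[0, T]` and solutions -/

theorem IsPath.zero : IsPath (0 : 𝓢'(ST n, ℂ)) 0 := by
  refine ⟨continuous_const, fun Φ ↦ ⟨?_, ?_⟩⟩ <;> simp

theorem IsPath.add {u v : 𝓢'(ST n, ℂ)} {U V : ℝ → 𝓢'(Sp n, ℂ)} (hu : IsPath u U)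
    (hv : IsPath v V) : IsPath (u + v) (U + V) := by
  refine ⟨hu.1.add hv.1, fun Φ ↦ ⟨?_, ?_⟩⟩
  · exact (hu.2 Φ).1.add (hv.2 Φ).1
  · have h := integral_add (hu.2 Φ).1 (hv.2 Φ).1
    simp [(hu.2 Φ).2, (hv.2 Φ).2, h]

theorem IsPath.smul {u : 𝓢'(ST n, ℂ)} {U : ℝ → 𝓢'(Sp n, ℂ)} (c : ℂ) (hu : IsPath u U) :
    IsPath (c • u) (c • U) := by
  refine ⟨hu.1.const_smul c, fun Φ ↦ ⟨?_, ?_⟩⟩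
  · exact (hu.2 Φ).1.const_mul c
  · have h := integral_const_mul (μ := (volume : Measure ℝ)) c (fun t ↦ U t (sliceAt t Φ))
    simp [(hu.2 Φ).2, h]

/-- The elements `u` with `u(t) = 0` for all `t ∈ [0, T]`, so that `u ∼ v` if and only if
`u - v` is one of them. -/
def vanishSub (X : DistSpace.{u} (ST n)) (N : ℕ) (T : ℝ) : Submodule ℝ (RVec X N) where
  carrier := {u | ∀ i, ∃ U, IsPath (comp u i) U ∧ ∀ t ∈ Set.Icc 0 T, U t = 0}
  add_mem' := by
    intro u v hu hv i
    obtain ⟨U, hU, hU0⟩ := hu i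
    obtain ⟨V, hV, hV0⟩ := hv i
    refine ⟨U + V, ?_, fun t ht ↦ by simp [hU0 t ht, hV0 t ht]⟩
    rw [comp_add]
    exact hU.add hV
  zero_mem' := by
    intro i
    refine ⟨0, ?_, fun t _ ↦ rfl⟩
    rw [comp_zero]
    exact IsPath.zero
  smul_mem' := by
    intro c u hu i
    obtain ⟨U, hU, hU0⟩ := hu i
    refine ⟨(c : ℂ) • U, ?_, fun t ht ↦ by
      ext φ
      simp [hU0 t ht]⟩
    rw [comp_smul]
    exact hU.smul _

/-- The restriction space `𝒳^s_T = 𝒳^s / ∼`, with the quotient norm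
`‖u‖_{𝒳^s_T} = inf {‖v‖_{𝒳^s} | v ∼ u}`. -/
abbrev Restr (X : DistSpace.{u} (ST n)) (N : ℕ) (T : ℝ) : Type u := RVec X N ⧸ vanishSub X N T

/-- `q ∈ 𝒳^s_T` solves `□u = 𝒩(u)` on `(0, T) × ℝⁿ` with initial data `(f, g)`. -/
def Solves {X Y : DistSpace.{u} (ST n)} {s T : ℝ} (Nl : RVec X N → RVec Y N) (q : Restr X N T)
    (f : RVec (H n s) N) (g : RVec (H n (s - 1)) N) : Prop :=
  ∃ u : RVec X N, (Submodule.Quotient.mk u : Restr X N T) = q ∧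
    (∀ i, EqOnSlab 0 T (box (comp u i)) (comp (Nl u) i)) ∧
    ∀ i, HasData (comp u i) (comp f i) (comp g i)

/-- The restriction of `u` to `[0, T]` belongs to `C([0, T], H^σ) ∩ C¹([0, T], H^{σ-1})`. -/
def InEnergyClass (σ T : ℝ) (u : 𝓢'(ST n, ℂ)) : Prop :=
  ∃ U, IsPath u U ∧
    (∃ V : ℝ → (H n σ).carrier, ContinuousOn V (Set.Icc 0 T) ∧
      ∀ t ∈ Set.Icc 0 T, (H n σ).toDist (V t) = U t) ∧
    ∃ W : ℝ → (H n (σ - 1)).carrier, ContDiffOn ℝ 1 W (Set.Icc 0 T) ∧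
      ∀ t ∈ Set.Icc 0 T, (H n (σ - 1)).toDist (W t) = U t

end SpaceTime

end WaveLWP

end

open MeasureTheory FourierTransform LineDeriv
open scoped SchwartzMap ContDiff ENNReal NNReal

noncomputable section

namespace WaveLWP

set_option linter.unusedSectionVars false

/-! ### Distributions whose Fourier transform is a function -/

section FourierFunctions

variable {E : Type} [NormedAddCommGroup E] [InnerProductSpace ℝ E] [FiniteDimensional ℝ E]
  [MeasurableSpace E] [BorelSpace E]

/-! Solutions are fixed points of u ↦ W(f, g) + S 𝒩(u), where W maps data to a free wave cut off in
time and S solves □u = F with zero data near t = 0. Everything rests on one linear fact,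
`exists_isDuhamel`: for every η > 0 there are a time T > 0 and an operator S from 𝒴^{s,ε} to 𝒳^s of
norm at most η which solves the equation for |t| < T. As the norm of S can be made as small as
desired by shortening the time, the fixed point map is a contraction on balls of any size.

To build S, write F = □̃ Λ₋^{-ε} G with G in 𝒳^s and split frequencies at the level K of the symbol
of Λ₋. Above K, F is divided by the symbol of □. There □̃/□ is bounded and Λ₋^{-ε} is at most
K^{-ε}, so solidity of the norm gives an operator of norm O(K^{-ε}) (`norm_hiMul_le`,
`exists_multiplier`). Its data at t = 0 are wrong and are removed by subtracting a free wave
(`exists_eval`, `exists_isFree`). Below K, the source is, on almost every fibre ξ, an integrable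
function of τ supported within O(K) of the cone. The equation becomes E'' + |ξ|²E = -f in time and
is solved explicitly. The solution is multiplied by a bump of width T and put into 𝒳^s by the upper
estimate on the norm. The bound this needs is `exists_kernel_bound`: with weight Λ₊Λ₋ the cut-off
solution gains a factor T, with weight Λ₊Λ₋² it gains nothing, and interpolation leaves T^{2-γ}.
First K is taken large, which uses ε > 0; then T is taken small, which uses γ < 2.

Linear uniqueness, `wave_unique`, reduces to the same ordinary differential equation on fibres. The
nonlinear argument is carried out in the abstract setting `WaveSys`. For uniqueness, the distance of
u - v from the functions which vanish on (0, T) is bounded by half of itself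
(`exists_unique_short`); locality of 𝒩 permits changing v by such a function. Translations are
contractions of 𝒳^s, so short steps of fixed length cover any interval. The local solution map of
`exists_solver` is Lipschitz, and smooth when 𝒩 is, by the inverse function theorem; `exists_family`
continues it along a given solution by gluing with time cut-offs.

For persistence, W and S commute with Λ^{σ-s}. The tame estimate therefore bounds the Picard
iterates in 𝒳^σ while they converge in 𝒳^s. The limit need not be known to lie in 𝒳^σ: the L¹ masses
of its Fourier transform on the fibres inherit the σ-bounds (`exists_regular_of_approx`), and these
suffice for a curve in C(H^σ) ∩ C¹(H^{σ-1}). The length of a step depends only on the norm in 𝒳^s,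
so finitely many steps reach T. -/

theorem HasFourierFun.congr_ae {u : 𝓢'(E, ℂ)} {U U' : E → ℂ} (h : HasFourierFun u U)
    (hU : U =ᵐ[volume] U') : HasFourierFun u U' := by
  have key : ∀ φ : 𝓢(E, ℂ), (fun z ↦ φ z * U z) =ᵐ[volume] fun z ↦ φ z * U' z := by
    intro φ
    filter_upwards [hU] with z hz
    rw [hz]
  refine ⟨h.1.congr hU, fun φ ↦ ⟨(h.2 φ).1.congr (key φ), ?_⟩⟩
  rw [(h.2 φ).2]
  exact integral_congr_ae (key φ)

theorem HasFourierFun.ext {u v : 𝓢'(E, ℂ)} {U V : E → ℂ} (h : HasFourierFun u U)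
    (h' : HasFourierFun v V) (hU : U =ᵐ[volume] V) : u = v := by
  have h2 := h.congr_ae hU
  have : 𝓕 u = 𝓕 v := by
    ext φ
    rw [(h2.2 φ).2, (h'.2 φ).2]
  have e : ∀ w : 𝓢'(E, ℂ), 𝓕⁻ (𝓕 w) = w := fun w ↦ fourierInv_fourier_eq w
  rw [← e u, this, e v]

theorem HasFourierFun.zero : HasFourierFun (0 : 𝓢'(E, ℂ)) 0 := by
  refine ⟨aestronglyMeasurable_const, fun φ ↦ ⟨by simp, ?_⟩⟩
  rw [FourierTransform.fourier_zero]
  simp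

theorem HasFourierFun.add {u v : 𝓢'(E, ℂ)} {U V : E → ℂ} (h : HasFourierFun u U)
    (h' : HasFourierFun v V) : HasFourierFun (u + v) (U + V) := by
  refine ⟨h.1.add h'.1, fun φ ↦ ⟨?_, ?_⟩⟩
  · exact ((h.2 φ).1.add (h'.2 φ).1).congr (Filter.Eventually.of_forall fun z ↦ by simp [mul_add])
  · have e := integral_add (h.2 φ).1 (h'.2 φ).1
    rw [FourierTransform.fourier_add]
    simp [mul_add, (h.2 φ).2, (h'.2 φ).2, e]

theorem HasFourierFun.smul {u : 𝓢'(E, ℂ)} {U : E → ℂ} (c : ℂ) (h : HasFourierFun u U) :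
    HasFourierFun (c • u) (c • U) := by
  refine ⟨h.1.const_smul c, fun φ ↦ ⟨?_, ?_⟩⟩
  · simpa [mul_left_comm] using (h.2 φ).1.const_mul c
  · have e := integral_const_mul (μ := (volume : Measure E)) c (fun z ↦ φ z * U z)
    rw [FourierTransform.fourier_smul]
    simp [mul_left_comm, (h.2 φ).2, e]

theorem HasFourierFun.neg {u : 𝓢'(E, ℂ)} {U : E → ℂ} (h : HasFourierFun u U) :
    HasFourierFun (-u) (-U) := by
  have := h.smul (-1)
  have e : (-1 : ℂ) • u = -u := by
    ext φ
    simp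
  rwa [neg_one_smul, e] at this

theorem HasFourierFun.sub {u v : 𝓢'(E, ℂ)} {U V : E → ℂ} (h : HasFourierFun u U)
    (h' : HasFourierFun v V) : HasFourierFun (u - v) (U - V) := by
  rw [sub_eq_add_neg, sub_eq_add_neg]
  exact h.add h'.neg

theorem HasFourierFun.sum {ι : Type*} {s : Finset ι} {u : ι → 𝓢'(E, ℂ)} {U : ι → E → ℂ}
    (h : ∀ i ∈ s, HasFourierFun (u i) (U i)) :
    HasFourierFun (∑ i ∈ s, u i) (∑ i ∈ s, U i) := by
  classical
  induction s using Finset.induction_on with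
  | empty => simpa using HasFourierFun.zero
  | insert a s ha ih =>
    rw [Finset.sum_insert ha, Finset.sum_insert ha]
    exact (h a (by simp)).add (ih fun i hi ↦ h i (by simp [hi]))

/-- Fourier multipliers act on Fourier functions by multiplication. -/
theorem HasFourierFun.multiplier {u : 𝓢'(E, ℂ)} {U : E → ℂ} (h : HasFourierFun u U)
    {m : E → ℂ} (hm : m.HasTemperateGrowth) :
    HasFourierFun (TemperedDistribution.fourierMultiplierCLM ℂ m u) (fun z ↦ m z * U z) := by
  have e : ∀ φ : 𝓢(E, ℂ), (fun z ↦ φ z * (m z * U z)) =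
      fun z ↦ SchwartzMap.smulLeftCLM ℂ m φ z * U z := by
    intro φ
    ext z
    rw [SchwartzMap.smulLeftCLM_apply_apply hm]
    simp only [smul_eq_mul]
    ring
  refine ⟨hm.1.continuous.aestronglyMeasurable.mul h.1, fun φ ↦ ⟨?_, ?_⟩⟩
  · rw [e φ]
    exact (h.2 _).1
  · rw [e φ, ← (h.2 _).2, TemperedDistribution.fourierMultiplierCLM_apply,
      fourier_fourierInv_eq]
    rfl

theorem ofReal_temperate {m : E → ℝ} (hm : m.HasTemperateGrowth) :
    (fun z ↦ (m z : ℂ)).HasTemperateGrowth :=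
  Function.Complex.hasTemperateGrowth_ofReal.comp hm

theorem HasFourierFun.mult {u : 𝓢'(E, ℂ)} {U : E → ℂ} (h : HasFourierFun u U)
    {m : E → ℝ} (hm : m.HasTemperateGrowth) :
    HasFourierFun (mult m u) (fun z ↦ (m z : ℂ) * U z) :=
  h.multiplier (ofReal_temperate hm)

theorem Lp.hasFourierFun (f : Lp ℂ 2 (volume : Measure E)) :
    HasFourierFun (f : 𝓢'(E, ℂ)) (𝓕 f : Lp ℂ 2 (volume : Measure E)) := by
  refine ⟨Lp.aestronglyMeasurable _, fun φ ↦ ⟨?_, ?_⟩⟩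
  · exact (φ.memLp 2 volume).integrable_mul (Lp.memLp _)
  · rw [Lp.fourier_toTemperedDistribution_eq, Lp.toTemperedDistribution_apply]
    rfl

/-- An integrable function is a Fourier function. -/
theorem exists_hasFourierFun_of_integrable {U : E → ℂ} (hU : Integrable U) :
    ∃ u : 𝓢'(E, ℂ), HasFourierFun u U := by
  let f : Lp ℂ 1 (volume : Measure E) := hU.toL1 U
  refine ⟨𝓕⁻ (f : 𝓢'(E, ℂ)), hU.1, fun φ ↦ ⟨?_, ?_⟩⟩
  · refine (hU.bdd_mul (c := SchwartzMap.seminorm ℝ 0 0 φ) φ.continuous.aestronglyMeasurable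
      (Filter.Eventually.of_forall fun z ↦ SchwartzMap.norm_le_seminorm ℝ φ z))
  · rw [fourier_fourierInv_eq, Lp.toTemperedDistribution_apply]
    refine integral_congr_ae ?_
    filter_upwards [hU.coeFn_toL1] with z hz
    rw [hz, smul_eq_mul]

/-- The product of a symbol and an integrable function is a Fourier function. -/
theorem exists_hasFourierFun {m : E → ℝ} (hm : m.HasTemperateGrowth) {U : E → ℂ}
    (hU : Integrable U) : ∃ u : 𝓢'(E, ℂ), HasFourierFun u (fun z ↦ (m z : ℂ) * U z) := by
  obtain ⟨u, hu⟩ := exists_hasFourierFun_of_integrable hU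
  exact ⟨_, hu.mult hm⟩

/-- Pairing with a smooth bump equal to 1 near the point already forces integrability there. -/
theorem HasFourierFun.locallyIntegrable {u : 𝓢'(E, ℂ)} {U : E → ℂ} (h : HasFourierFun u U) :
    LocallyIntegrable U := by
  intro x
  let f : ContDiffBump x := ⟨1, 2, by norm_num, by norm_num⟩
  have hg₁ : HasCompactSupport (Complex.ofRealCLM ∘ f) := f.hasCompactSupport.comp_left rfl
  have hg₂ : ContDiff ℝ ∞ (Complex.ofRealCLM ∘ f) := Complex.ofRealCLM.contDiff.comp f.contDiff
  have h1 := (h.2 (hg₁.toSchwartzMap hg₂)).1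
  refine ⟨Metric.ball x 1, Metric.ball_mem_nhds x one_pos, ?_⟩
  refine (h1.integrableOn (s := Metric.ball x 1)).congr_fun (fun z hz ↦ ?_) measurableSet_ball
  have h2 : f z = 1 := f.one_of_mem_closedBall (Metric.ball_subset_closedBall hz)
  simp [h2]

/-- Uniqueness of the representative: identities between distributions can then be read as
identities almost everywhere on the Fourier side. -/
theorem HasFourierFun.ae_eq {u : 𝓢'(E, ℂ)} {U V : E → ℂ} (h : HasFourierFun u U)
    (h' : HasFourierFun u V) : U =ᵐ[volume] V := by
  refine ae_eq_of_integral_contDiff_smul_eq h.locallyIntegrable h'.locallyIntegrable ?_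
  intro g g_smooth g_cpt
  have hg₁ : HasCompactSupport (Complex.ofRealCLM ∘ g) := g_cpt.comp_left rfl
  have hg₂ : ContDiff ℝ ∞ (Complex.ofRealCLM ∘ g) := Complex.ofRealCLM.contDiff.comp g_smooth
  have e1 := (h.2 (hg₁.toSchwartzMap hg₂)).2
  have e2 := (h'.2 (hg₁.toSchwartzMap hg₂)).2
  simpa using e1.symm.trans e2

theorem HasFourierFun.apply {u : 𝓢'(E, ℂ)} {U : E → ℂ} (h : HasFourierFun u U) (φ : 𝓢(E, ℂ)) :
    u φ = ∫ z, (𝓕⁻ φ : 𝓢(E, ℂ)) z * U z := by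
  rw [← (h.2 _).2, TemperedDistribution.fourier_apply]
  congr 1
  exact (fourier_fourierInv_eq φ).symm

theorem fourierInv_neg_of_real {φ : 𝓢(E, ℂ)} (hφ : ∀ x, (φ x).im = 0) (z : E) :
    (𝓕⁻ φ : 𝓢(E, ℂ)) (-z) = (starRingEnd ℂ) ((𝓕⁻ φ : 𝓢(E, ℂ)) z) := by
  rw [SchwartzMap.fourierInv_coe, Real.fourierInv_eq, Real.fourierInv_eq, ← integral_conj]
  refine integral_congr_ae (Filter.Eventually.of_forall fun x ↦ ?_)
  have h1 : (starRingEnd ℂ) (φ x) = φ x := Complex.conj_eq_iff_im.2 (hφ x)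
  simp only [Circle.smul_def, smul_eq_mul, map_mul, h1, inner_neg_right]
  rw [AddChar.map_neg_eq_inv, Circle.coe_inv_eq_conj]

theorem HasFourierFun.isRealValued {u : 𝓢'(E, ℂ)} {U : E → ℂ} (h : HasFourierFun u U)
    (hU : ∀ᵐ z, U (-z) = (starRingEnd ℂ) (U z)) : IsRealValued u := by
  intro φ hφ
  rw [h.apply φ, ← Complex.conj_eq_iff_im, ← integral_conj, ← integral_neg_eq_self]
  refine integral_congr_ae ?_
  have hU' : ∀ᵐ z, U z = (starRingEnd ℂ) (U (-z)) := by
    have := (Measure.measurePreserving_neg (volume : Measure E)).quasiMeasurePreserving.ae hU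
    filter_upwards [this] with z hz
    simpa using hz
  filter_upwards [hU'] with z hz
  rw [map_mul, ← fourierInv_neg_of_real hφ, neg_neg, ← hz]

theorem exists_real_add_I_smul (φ : 𝓢(E, ℂ)) : ∃ a b : 𝓢(E, ℂ), (∀ x, (a x).im = 0) ∧
    (∀ x, (b x).im = 0) ∧ φ = a + Complex.I • b := by
  let re : 𝓢(E, ℂ) := 
    φ.postcompCLM (Complex.ofRealCLM ∘L Complex.reCLM)
  let im : 𝓢(E, ℂ) := 
    φ.postcompCLM (Complex.ofRealCLM ∘L Complex.imCLM)
  refine ⟨re, im, fun x ↦ ?_, fun x ↦ ?_, ?_⟩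
  · simp [re]
  · simp [im]
  · ext x
    simp [re, im, mul_comm Complex.I]

/-- The reflected conjugate of `U` represents the same Fourier transform, and representatives are
unique. Reality of `u` is known on real test functions only, so a general test function is reached
through the real and imaginary parts of its Fourier transform. -/
theorem HasFourierFun.neg_ae_eq_conj {u : 𝓢'(E, ℂ)} {U : E → ℂ} (h : HasFourierFun u U)
    (hu : IsRealValued u) : ∀ᵐ z, U (-z) = (starRingEnd ℂ) (U z) := by
  have mp := Measure.measurePreserving_neg (volume : Measure E)
  have hV : HasFourierFun u (fun z ↦ (starRingEnd ℂ) (U (-z))) := by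
    have hmeas : AEStronglyMeasurable (fun z ↦ (starRingEnd ℂ) (U (-z))) volume :=
      Complex.continuous_conj.comp_aestronglyMeasurable
        (h.1.comp_quasiMeasurePreserving mp.quasiMeasurePreserving)
    have key : ∀ a : 𝓢(E, ℂ), (∀ x, (a x).im = 0) →
        Integrable (fun z ↦ (𝓕⁻ a : 𝓢(E, ℂ)) z * (starRingEnd ℂ) (U (-z))) volume ∧
        u a = ∫ z, (𝓕⁻ a : 𝓢(E, ℂ)) z * (starRingEnd ℂ) (U (-z)) := by
      intro a ha
      have e : (fun z ↦ (𝓕⁻ a : 𝓢(E, ℂ)) z * (starRingEnd ℂ) (U (-z))) =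
          fun z ↦ (starRingEnd ℂ) ((𝓕⁻ a : 𝓢(E, ℂ)) (-z) * U (-z)) := by
        ext z
        rw [map_mul, fourierInv_neg_of_real ha, Complex.conj_conj]
      rw [e]
      refine ⟨?_, ?_⟩
      · have h1 := (h.2 (𝓕⁻ a)).1.comp_neg
        exact Complex.conjLIE.toContinuousLinearEquiv.toContinuousLinearMap.integrable_comp h1
      · have h2 := integral_conj (𝕜 := ℂ) (μ := (volume : Measure E))
          (f := fun z ↦ (𝓕⁻ a : 𝓢(E, ℂ)) (-z) * U (-z))
        rw [h2, integral_neg_eq_self (fun z ↦ (𝓕⁻ a : 𝓢(E, ℂ)) z * U z), ← h.apply a]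
        exact (Complex.conj_eq_iff_im.2 (hu a ha)).symm
    refine ⟨hmeas, fun φ ↦ ?_⟩
    obtain ⟨a, b, ha, hb, hab⟩ := exists_real_add_I_smul (𝓕 φ)
    have e : φ = 𝓕⁻ a + Complex.I • (𝓕⁻ b : 𝓢(E, ℂ)) := by
      rw [← FourierTransform.fourierInv_smul, ← FourierTransform.fourierInv_add, ← hab]
      exact (fourierInv_fourier_eq φ).symm
    have e2 : (fun z ↦ φ z * (starRingEnd ℂ) (U (-z))) = fun z ↦
        (𝓕⁻ a : 𝓢(E, ℂ)) z * (starRingEnd ℂ) (U (-z)) +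
          Complex.I * ((𝓕⁻ b : 𝓢(E, ℂ)) z * (starRingEnd ℂ) (U (-z))) := by
      ext z
      rw [e]
      simp
      ring
    refine ⟨?_, ?_⟩
    · rw [e2]
      exact (key a ha).1.add ((key b hb).1.const_mul _)
    · rw [e2, integral_add (key a ha).1 ((key b hb).1.const_mul _), integral_const_mul,
        ← (key a ha).2, ← (key b hb).2, TemperedDistribution.fourier_apply, hab]
      simp
  have h1 := h.ae_eq hV
  have h2 := mp.quasiMeasurePreserving.ae h1
  filter_upwards [h2] with z hz
  simpa using hz

end FourierFunctions

/-! ### Space-time coordinates, derivatives and translations on the Fourier side -/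

section SpaceTimeFourier

variable {n : ℕ}

@[simp] theorem pt_fst (t : ℝ) (x : Sp n) : (pt t x).fst = t := rfl

@[simp] theorem pt_snd (t : ℝ) (x : Sp n) : (pt t x).snd = x := rfl

theorem pt_neg (t : ℝ) (x : Sp n) : pt (-t) (-x) = -pt t x := rfl

theorem pt_eta (z : ST n) : pt z.fst z.snd = z := rfl

theorem inner_pt (z : ST n) (t : ℝ) (x : Sp n) :
    inner ℝ z (pt t x) = z.fst * t + inner ℝ z.snd x := by
  rw [WithLp.prod_inner_apply]
  simp [pt, mul_comm]

theorem continuous_pt : Continuous fun p : Sp n × ℝ ↦ pt p.2 p.1 := by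
  unfold pt
  fun_prop

theorem measurable_pt : Measurable fun p : Sp n × ℝ ↦ pt p.2 p.1 := continuous_pt.measurable

theorem measurePreserving_pt :
    MeasurePreserving (fun p : Sp n × ℝ ↦ pt p.2 p.1) volume volume :=
  (WithLp.volume_preserving_toLp ℝ (Sp n)).comp Measure.measurePreserving_swap

theorem measurableEmbedding_pt : MeasurableEmbedding fun p : Sp n × ℝ ↦ pt p.2 p.1 :=
  (MeasurableEquiv.toLp 2 (ℝ × Sp n)).measurableEmbedding.comp
    (MeasurableEquiv.prodComm (α := Sp n) (β := ℝ)).measurableEmbedding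

theorem integral_pt (f : ST n → ℂ) : ∫ z, f z = ∫ p : Sp n × ℝ, f (pt p.2 p.1) :=
  (measurePreserving_pt.integral_comp measurableEmbedding_pt f).symm

theorem integrable_pt {f : ST n → ℂ} :
    Integrable f ↔ Integrable fun p : Sp n × ℝ ↦ f (pt p.2 p.1) :=
  (measurePreserving_pt.integrable_comp_emb measurableEmbedding_pt).symm

theorem lintegral_pt (f : ST n → ℝ≥0∞) : ∫⁻ z, f z = ∫⁻ p : Sp n × ℝ, f (pt p.2 p.1) :=
  (measurePreserving_pt.lintegral_comp_emb measurableEmbedding_pt f).symm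

theorem ae_pt {P : ST n → Prop} (h : ∀ᵐ z, P z) : ∀ᵐ ξ : Sp n, ∀ᵐ τ : ℝ, P (pt τ ξ) :=
  Measure.ae_ae_of_ae_prod (measurePreserving_pt.quasiMeasurePreserving.ae h)

theorem HasFourierFun.lineDeriv {E : Type} [NormedAddCommGroup E] [InnerProductSpace ℝ E]
    [FiniteDimensional ℝ E] [MeasurableSpace E] [BorelSpace E] {u : 𝓢'(E, ℂ)} {U : E → ℂ}
    (h : HasFourierFun u U) (m : E) :
    HasFourierFun (∂_{m} u) (fun z ↦ 2 * Real.pi * Complex.I * (inner ℝ z m : ℝ) * U z) := by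
  rw [TemperedDistribution.lineDeriv_eq_fourierMultiplierCLM]
  have hm : (fun z ↦ ((inner ℝ z m : ℝ) : ℂ)).HasTemperateGrowth := by fun_prop
  have := (h.multiplier hm).smul (2 * Real.pi * Complex.I)
  convert this using 1
  ext z
  simp [mul_assoc]

theorem HasFourierFun.dt {u : 𝓢'(ST n, ℂ)} {U : ST n → ℂ} (h : HasFourierFun u U) :
    HasFourierFun (dt u) (fun z ↦ 2 * Real.pi * Complex.I * z.fst * U z) := by
  have := h.lineDeriv (pt 1 (0 : Sp n))
  unfold WaveLWP.dt
  simpa [inner_pt] using this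

/-- The symbol of the wave operator. -/
def symBox (z : ST n) : ℝ := (2 * Real.pi * z.fst) ^ 2 - ‖(2 * Real.pi) • z.snd‖ ^ 2

theorem HasFourierFun.box {u : 𝓢'(ST n, ℂ)} {U : ST n → ℂ} (h : HasFourierFun u U) :
    HasFourierFun (box u) (fun z ↦ (symBox z : ℂ) * U z) := by
  have h1 := h.dt.dt.neg
  have h2 := HasFourierFun.sum (s := Finset.univ) (fun (i : Fin n) _ ↦
    (h.lineDeriv (pt 0 (EuclideanSpace.single i (1 : ℝ)))).lineDeriv
      (pt 0 (EuclideanSpace.single i (1 : ℝ))))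
  have h3 := h1.add h2
  unfold WaveLWP.box
  convert h3 using 1
  ext z
  have e1 : ‖(2 * Real.pi) • z.snd‖ ^ 2 = (2 * Real.pi) ^ 2 * ∑ i, (z.snd i) ^ 2 := by
    rw [norm_smul, mul_pow, EuclideanSpace.norm_sq_eq, Real.norm_eq_abs, sq_abs]
    simp
  have e2 : ∀ i : Fin n, inner ℝ z.snd (EuclideanSpace.single i (1 : ℝ)) = z.snd i := by
    intro i
    rw [real_inner_comm]
    simp [EuclideanSpace.inner_single_left]
  simp only [symBox, e1, Pi.add_apply, Pi.neg_apply, Finset.sum_apply, inner_pt, e2]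
  push_cast
  rw [sub_mul, Finset.mul_sum, Finset.sum_mul, sub_eq_add_neg, ← Finset.sum_neg_distrib]
  congr 1
  · linear_combination (2 * Real.pi * z.fst : ℂ) ^ 2 * U z * Complex.I_sq
  · refine Finset.sum_congr rfl fun i _ ↦ ?_
    linear_combination - (2 * Real.pi * z.snd i : ℂ) ^ 2 * U z * Complex.I_sq

theorem fourierInv_compSub {E : Type} [NormedAddCommGroup E] [InnerProductSpace ℝ E]
    [FiniteDimensional ℝ E] [MeasurableSpace E] [BorelSpace E] (g : 𝓢(E, ℂ)) (a z : E) :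
    (𝓕⁻ (SchwartzMap.compSubConstCLM ℂ a g) : 𝓢(E, ℂ)) z =
      Complex.exp (2 * Real.pi * Complex.I * (inner ℝ z a : ℝ)) * (𝓕⁻ g : 𝓢(E, ℂ)) z := by
  rw [SchwartzMap.fourierInv_coe, SchwartzMap.fourierInv_coe, Real.fourierInv_eq',
    Real.fourierInv_eq', ← integral_sub_right_eq_self _ (-a), ← integral_const_mul]
  refine integral_congr_ae (Filter.Eventually.of_forall fun x ↦ ?_)
  simp only [sub_neg_eq_add, SchwartzMap.compSubConstCLM_apply, add_sub_cancel_right, smul_eq_mul,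
    inner_add_left, ← mul_assoc, ← Complex.exp_add, real_inner_comm z a]
  congr 2
  push_cast
  ring

theorem HasFourierFun.timeShift {u : 𝓢'(ST n, ℂ)} {U : ST n → ℂ} (h : HasFourierFun u U) (t : ℝ) :
    HasFourierFun (timeShift t u)
      (fun z ↦ Complex.exp (2 * Real.pi * Complex.I * (z.fst * t : ℝ)) * U z) := by
  have key : ∀ φ : 𝓢(ST n, ℂ), (fun z ↦ φ z *
      (Complex.exp (2 * Real.pi * Complex.I * (z.fst * t : ℝ)) * U z)) =
      fun z ↦ (𝓕⁻ (SchwartzMap.compSubConstCLM ℂ (pt t (0 : Sp n)) (𝓕 φ)) : 𝓢(ST n, ℂ)) z *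
        U z := by
    intro φ
    ext z
    have e : (𝓕⁻ (𝓕 φ) : 𝓢(ST n, ℂ)) = φ := fourierInv_fourier_eq φ
    rw [fourierInv_compSub, e, inner_pt]
    simp only [inner_zero_right, add_zero]
    ring
  refine ⟨?_, fun φ ↦ ⟨?_, ?_⟩⟩
  · refine AEStronglyMeasurable.mul ?_ h.1
    have : Continuous fun z : ST n ↦
        Complex.exp (2 * Real.pi * Complex.I * (z.fst * t : ℝ)) := by
      have : Continuous fun z : ST n ↦ z.fst := (WithLp.fstL 2 ℝ ℝ (Sp n)).continuous
      fun_prop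
    exact this.aestronglyMeasurable
  · rw [key]
    exact (h.2 _).1
  · rw [key, ← h.apply]
    rfl

end SpaceTimeFourier

/-! ### The symbols and the distance to the light cone -/

section Symbols

variable {n : ℕ}

theorem symS_pos (α : ℝ) (ξ : Sp n) : 0 < symS α ξ := by
  unfold symS; positivity

theorem symX_pos (α : ℝ) (z : ST n) : 0 < symX α z := by
  unfold symX; positivity

theorem symPlus_pos (α : ℝ) (z : ST n) : 0 < symPlus α z := by
  unfold symPlus; positivity

theorem symMinus_pos (α : ℝ) (z : ST n) : 0 < symMinus α z := by
  unfold symMinus; positivity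

theorem symX_pt (α τ : ℝ) (ξ : Sp n) : symX α (pt τ ξ) = symS α ξ := rfl

theorem symS_add (α β : ℝ) (ξ : Sp n) : symS (α + β) ξ = symS α ξ * symS β ξ := by
  rw [symS, symS, symS, ← Real.rpow_add (by positivity), ← add_div]

theorem symMinus_add (α β : ℝ) (z : ST n) :
    symMinus (α + β) z = symMinus α z * symMinus β z := by
  rw [symMinus, symMinus, symMinus, ← Real.rpow_add (by positivity), ← add_div]

theorem symS_mono {α β : ℝ} (h : α ≤ β) (ξ : Sp n) : symS α ξ ≤ symS β ξ :=
  Real.rpow_le_rpow_of_exponent_le (by simp) (by linarith)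

theorem symMinus_mono {α β : ℝ} (h : α ≤ β) (z : ST n) : symMinus α z ≤ symMinus β z :=
  Real.rpow_le_rpow_of_exponent_le (by simp; positivity) (by linarith)

theorem symS_zero (ξ : Sp n) : symS 0 ξ = 1 := by simp [symS]

theorem symMinus_zero (z : ST n) : symMinus 0 z = 1 := by simp [symMinus]

theorem one_le_symS (ξ : Sp n) {α : ℝ} (h : 0 ≤ α) : 1 ≤ symS α ξ := by
  rw [← symS_zero ξ]
  exact symS_mono h ξ

theorem symMinus_eq_rpow (α : ℝ) (z : ST n) : symMinus α z = symMinus 1 z ^ α := by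
  rw [symMinus, symMinus, ← Real.rpow_mul (by positivity)]
  congr 1
  ring

theorem symMinus_one_sq (z : ST n) : symMinus 1 z ^ 2 = 1 + symBox z ^ 2 /
    (1 + (2 * Real.pi * z.fst) ^ 2 + ‖(2 * Real.pi) • z.snd‖ ^ 2) := by
  rw [symMinus, ← Real.rpow_natCast, ← Real.rpow_mul (by positivity)]
  simp [symBox]

theorem symPlus_one_sq (z : ST n) : symPlus 1 z ^ 2 =
    1 + (2 * Real.pi * z.fst) ^ 2 + ‖(2 * Real.pi) • z.snd‖ ^ 2 := by
  rw [symPlus, ← Real.rpow_natCast, ← Real.rpow_mul (by positivity)]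
  simp

theorem symS_one_sq (ξ : Sp n) : symS 1 ξ ^ 2 = 1 + ‖(2 * Real.pi) • ξ‖ ^ 2 := by
  rw [symS, ← Real.rpow_natCast, ← Real.rpow_mul (by positivity)]
  simp

/-- The identity behind the choice of Λ₋: up to Λ₊, the product Λ₊Λ₋ has the size of □, so a power
of Λ₋ can be paid for with the wave operator. -/
theorem symPlus_sq_mul_symMinus_sq (z : ST n) :
    symPlus 1 z ^ 2 * symMinus 1 z ^ 2 = symPlus 1 z ^ 2 + symBox z ^ 2 := by
  rw [symMinus_one_sq, symPlus_one_sq]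
  have : 0 < 1 + (2 * Real.pi * z.fst) ^ 2 + ‖(2 * Real.pi) • z.snd‖ ^ 2 := by positivity
  field_simp

theorem symPlus_mul_symMinus_le (z : ST n) :
    symPlus 1 z * symMinus 1 z ≤ symPlus 1 z + |symBox z| := by
  refine le_of_sq_le_sq ?_ (by have := symPlus_pos 1 z; positivity)
  rw [mul_pow, symPlus_sq_mul_symMinus_sq, ← sq_abs (symBox z)]
  nlinarith [symPlus_pos 1 z, abs_nonneg (symBox z)]

theorem symPlus_one_le (z : ST n) :
    symPlus 1 z ≤ 1 + |2 * Real.pi * z.fst| + ‖(2 * Real.pi) • z.snd‖ := by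
  refine le_of_sq_le_sq ?_ (by positivity)
  rw [symPlus_one_sq, ← sq_abs (2 * Real.pi * z.fst)]
  nlinarith [abs_nonneg (2 * Real.pi * z.fst), norm_nonneg ((2 * Real.pi) • z.snd),
    mul_nonneg (abs_nonneg (2 * Real.pi * z.fst)) (norm_nonneg ((2 * Real.pi) • z.snd))]

theorem norm_le_symS_one (ξ : Sp n) : ‖(2 * Real.pi) • ξ‖ ≤ symS 1 ξ := by
  refine le_of_sq_le_sq ?_ (symS_pos 1 ξ).le
  rw [symS_one_sq]
  linarith

theorem symPlus_one_le_symX (z : ST n) : symPlus 1 z ≤ symX 1 z + |2 * Real.pi * z.fst| := by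
  have h : symX 1 z ^ 2 = 1 + ‖(2 * Real.pi) • z.snd‖ ^ 2 := symS_one_sq z.snd
  have h0 := symX_pos 1 z
  refine le_of_sq_le_sq ?_ (by positivity)
  rw [symPlus_one_sq, ← sq_abs (2 * Real.pi * z.fst)]
  nlinarith [abs_nonneg (2 * Real.pi * z.fst)]

/-- Factor (a² - b²)² = (a - b)²(a + b)² and use (a + b)² ≤ 2(1 + a² + b²). -/
theorem symMinus_one_sq_le (z : ST n) : symMinus 1 z ^ 2 ≤
    2 * (1 + (|2 * Real.pi * z.fst| - ‖(2 * Real.pi) • z.snd‖) ^ 2) := by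
  have hp : 0 < 1 + (2 * Real.pi * z.fst) ^ 2 + ‖(2 * Real.pi) • z.snd‖ ^ 2 := by positivity
  rw [symMinus_one_sq, symBox, ← sq_abs (2 * Real.pi * z.fst)]
  rw [← sq_abs (2 * Real.pi * z.fst)] at hp
  set a := |2 * Real.pi * z.fst|
  set b := ‖(2 * Real.pi) • z.snd‖
  have h : (a ^ 2 - b ^ 2) ^ 2 / (1 + a ^ 2 + b ^ 2) ≤ 2 * (a - b) ^ 2 := by
    rw [div_le_iff₀ hp]
    have : (a ^ 2 - b ^ 2) ^ 2 = (a - b) ^ 2 * (a + b) ^ 2 := by ring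
    rw [this]
    nlinarith [mul_nonneg (sq_nonneg (a - b)) (sq_nonneg (a - b)), sq_nonneg (a - b)]
  linarith

theorem le_symMinus_one_sq (z : ST n) :
    1 + (|2 * Real.pi * z.fst| - ‖(2 * Real.pi) • z.snd‖) ^ 2 ≤ 2 * symMinus 1 z ^ 2 := by
  have hp : 0 < 1 + (2 * Real.pi * z.fst) ^ 2 + ‖(2 * Real.pi) • z.snd‖ ^ 2 := by positivity
  rw [symMinus_one_sq, symBox, ← sq_abs (2 * Real.pi * z.fst)]
  rw [← sq_abs (2 * Real.pi * z.fst)] at hp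
  have ha : 0 ≤ |2 * Real.pi * z.fst| := abs_nonneg _
  have hb : 0 ≤ ‖(2 * Real.pi) • z.snd‖ := norm_nonneg _
  set a := |2 * Real.pi * z.fst|
  set b := ‖(2 * Real.pi) • z.snd‖
  have hab := mul_nonneg ha hb
  have hpos : 0 ≤ (a ^ 2 - b ^ 2) ^ 2 / (1 + a ^ 2 + b ^ 2) := by positivity
  -- At low frequency the denominator 1 + a² + b² is not controlled by a² + b², but then (a - b)² ≤
  -- 1 and the term 1 in the symbol suffices.
  rcases le_total (a ^ 2 + b ^ 2) 1 with h | h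
  · nlinarith
  · have : (a - b) ^ 2 / 2 ≤ (a ^ 2 - b ^ 2) ^ 2 / (1 + a ^ 2 + b ^ 2) := by
      rw [div_le_div_iff₀ two_pos hp]
      have e : (a ^ 2 - b ^ 2) ^ 2 = (a - b) ^ 2 * (a + b) ^ 2 := by ring
      rw [e, mul_assoc]
      refine mul_le_mul_of_nonneg_left ?_ (sq_nonneg _)
      nlinarith
    linarith

theorem symMinus_one_le_of_le {z : ST n} {d : ℝ}
    (hd : |(|2 * Real.pi * z.fst| - ‖(2 * Real.pi) • z.snd‖)| ≤ d) :
    symMinus 1 z ≤ 2 * (1 + d) := by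
  have h0 := (abs_nonneg _).trans hd
  refine le_of_sq_le_sq ?_ (by positivity)
  have h1 := symMinus_one_sq_le z
  rw [← sq_abs (|2 * Real.pi * z.fst| - ‖(2 * Real.pi) • z.snd‖)] at h1
  nlinarith [abs_nonneg (|2 * Real.pi * z.fst| - ‖(2 * Real.pi) • z.snd‖)]

theorem dist_cone_le (z : ST n) :
    |(|2 * Real.pi * z.fst| - ‖(2 * Real.pi) • z.snd‖)| ≤ 2 * symMinus 1 z := by
  refine abs_le_of_sq_le_sq ?_ (by have := symMinus_pos 1 z; positivity)
  nlinarith [le_symMinus_one_sq z, symMinus_pos 1 z]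

theorem symX_neg_arg (α : ℝ) (z : ST n) : symX α (-z) = symX α z := by
  simp [symX]

theorem symPlus_neg_arg (α : ℝ) (z : ST n) : symPlus α (-z) = symPlus α z := by
  simp [symPlus]

theorem symMinus_neg_arg (α : ℝ) (z : ST n) : symMinus α (-z) = symMinus α z := by
  simp [symMinus]

theorem symBox_neg_arg (z : ST n) : symBox (-z) = symBox z := by
  simp [symBox]

theorem symS_neg_arg (α : ℝ) (ξ : Sp n) : symS α (-ξ) = symS α ξ := by
  simp [symS]

theorem continuous_symS (α : ℝ) : Continuous (symS (n := n) α) := (symS_temperate α).1.continuous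

theorem continuous_symX (α : ℝ) : Continuous (symX (n := n) α) := (symX_temperate α).1.continuous

theorem continuous_symPlus (α : ℝ) : Continuous (symPlus (n := n) α) :=
  (symPlus_temperate α).1.continuous

theorem continuous_symMinus (α : ℝ) : Continuous (symMinus (n := n) α) :=
  (symMinus_temperate α).1.continuous

theorem continuous_fst_ST : Continuous fun z : ST n ↦ z.fst :=
  (WithLp.fstL 2 ℝ ℝ (Sp n)).continuous

theorem continuous_snd_ST : Continuous fun z : ST n ↦ z.snd :=
  (WithLp.sndL 2 ℝ ℝ (Sp n)).continuous

theorem continuous_symBox : Continuous (symBox (n := n)) := by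
  have h1 := continuous_fst_ST (n := n)
  have h2 := continuous_snd_ST (n := n)
  unfold symBox
  fun_prop

/-- This is where θ > 1/2 matters: Λ₋^{-2θ} is dominated by two translates, centred at the two
points of the cone over ξ, of one integrable function of τ. Hence the bound is uniform in ξ. -/
theorem lintegral_symMinus_le {θ : ℝ} (hθ : 1 / 2 < θ) : ∃ C : ℝ≥0, ∀ ξ : Sp n,
    ∫⁻ τ : ℝ, ENNReal.ofReal (symMinus (-(2 * θ)) (pt τ ξ)) ≤ C := by
  have hint : Integrable (fun σ : ℝ ↦ (1 + ‖σ‖ ^ 2) ^ (-(2 * θ) / 2)) :=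
    integrable_rpow_neg_one_add_norm_sq (by simp; linarith)
  let J : ℝ → ℝ := fun σ ↦ (1 + ‖σ‖ ^ 2) ^ (-(2 * θ) / 2)
  have hJ : ∀ c : ℝ, ∫⁻ τ : ℝ, ENNReal.ofReal (J (2 * Real.pi * τ + c)) =
      ∫⁻ τ : ℝ, ENNReal.ofReal (J (2 * Real.pi * τ)) := by
    intro c
    have h2 := lintegral_add_right_eq_self (μ := (volume : Measure ℝ))
      (fun τ : ℝ ↦ ENNReal.ofReal (J (2 * Real.pi * τ))) (c / (2 * Real.pi))
    rw [← h2]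
    refine lintegral_congr fun τ ↦ ?_
    congr 2
    field_simp
  have hfin : ∫⁻ τ : ℝ, ENNReal.ofReal (J (2 * Real.pi * τ)) ≠ ⊤ := by
    have h1 : Integrable (fun τ : ℝ ↦ J (2 * Real.pi * τ)) :=
      hint.comp_mul_left' (by positivity)
    exact h1.lintegral_lt_top.ne
  refine ⟨(ENNReal.ofReal ((2 : ℝ) ^ θ) * (2 * ∫⁻ τ : ℝ, ENNReal.ofReal (J (2 * Real.pi * τ)))).toNNReal, fun ξ ↦ ?_⟩
  rw [ENNReal.coe_toNNReal (ENNReal.mul_ne_top ENNReal.ofReal_ne_top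
    (ENNReal.mul_ne_top (by simp) hfin))]
  have hJm : Measurable J := by
    have : Continuous J := by
      refine Continuous.rpow_const (by fun_prop) fun x ↦ Or.inl (by positivity)
    exact this.measurable
  have hpt : ∀ τ : ℝ, ENNReal.ofReal (symMinus (-(2 * θ)) (pt τ ξ)) ≤
      ENNReal.ofReal ((2 : ℝ) ^ θ) * (ENNReal.ofReal (J (2 * Real.pi * τ + -‖(2 * Real.pi) • ξ‖)) +
        ENNReal.ofReal (J (2 * Real.pi * τ + ‖(2 * Real.pi) • ξ‖))) := by
    intro τ
    have hJ0 : ∀ σ, 0 ≤ J σ := fun σ ↦ by positivity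
    rw [← ENNReal.ofReal_add (hJ0 _) (hJ0 _), ← ENNReal.ofReal_mul (by positivity)]
    refine ENNReal.ofReal_le_ofReal ?_
    have h1 := le_symMinus_one_sq (pt τ ξ)
    simp only [pt_fst, pt_snd] at h1
    have hpos := symMinus_pos 1 (pt τ ξ)
    have h2 : symMinus (-(2 * θ)) (pt τ ξ) = ((symMinus 1 (pt τ ξ)) ^ 2) ^ (-θ) := by
      rw [symMinus_eq_rpow, ← Real.rpow_natCast, ← Real.rpow_mul hpos.le]
      congr 1
      push_cast
      ring
    have h3 : ((symMinus 1 (pt τ ξ)) ^ 2) ^ (-θ) ≤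
        ((1 + (|2 * Real.pi * τ| - ‖(2 * Real.pi) • ξ‖) ^ 2) / 2) ^ (-θ) :=
      Real.rpow_le_rpow_of_nonpos (by positivity) (by linarith) (by linarith)
    have h4 : ((1 + (|2 * Real.pi * τ| - ‖(2 * Real.pi) • ξ‖) ^ 2) / 2) ^ (-θ) =
        (2 : ℝ) ^ θ * J (|2 * Real.pi * τ| - ‖(2 * Real.pi) • ξ‖) := by
      rw [Real.div_rpow (by positivity) (by positivity), Real.rpow_neg (by positivity : (0:ℝ) ≤ 2),
        div_inv_eq_mul, mul_comm]
      simp only [J, Real.norm_eq_abs, sq_abs]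
      congr 2
      ring
    rw [h2]
    refine (h3.trans_eq h4).trans (mul_le_mul_of_nonneg_left ?_ (by positivity))
    rcases abs_cases (2 * Real.pi * τ) with ⟨h, -⟩ | ⟨h, -⟩
    · rw [h, sub_eq_add_neg]
      exact le_add_of_nonneg_right (hJ0 _)
    · rw [h]
      have : J (-(2 * Real.pi * τ) - ‖(2 * Real.pi) • ξ‖) =
          J (2 * Real.pi * τ + ‖(2 * Real.pi) • ξ‖) := by
        simp only [J, Real.norm_eq_abs, sq_abs]
        congr 2
        ring
      rw [this]
      exact le_add_of_nonneg_left (hJ0 _)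
  refine (lintegral_mono hpt).trans ?_
  rw [lintegral_const_mul _ (by fun_prop), lintegral_add_left (by fun_prop), hJ, hJ, ← two_mul]

theorem integrable_symS {α : ℝ} (hα : α < -n) : Integrable (symS (n := n) α) := by
  have h1 : Integrable (fun ξ : Sp n ↦ (1 + ‖ξ‖ ^ 2) ^ (-(-α) / 2)) :=
    integrable_rpow_neg_one_add_norm_sq (by simp; linarith)
  have h2 := h1.comp_smul (R := 2 * Real.pi) (by positivity)
  refine h2.congr (Filter.Eventually.of_forall fun ξ ↦ ?_)
  simp [symS]

end Symbols

/-! ### Fourier transform of test functions in the time frequency alone -/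

section PartialFourier

variable {n : ℕ}

theorem integral_fourier_mul_eq_flip {f g : ℝ → ℂ} (hf : Integrable f) (hg : Integrable g) :
    ∫ x, 𝓕 f x * g x = ∫ x, f x * 𝓕 g x := by
  have := VectorFourier.integral_fourierIntegral_smul_eq_flip (μ := (volume : Measure ℝ))
    (ν := (volume : Measure ℝ)) (L := innerₗ ℝ) (f := f) (g := g) Real.continuous_fourierChar
    continuous_inner hf hg
  rw [flip_innerₗ] at this
  exact this

theorem integral_fourierInv_mul_eq_flip {f g : ℝ → ℂ} (hf : Integrable f) (hg : Integrable g) :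
    ∫ x, 𝓕⁻ f x * g x = ∫ x, f x * 𝓕⁻ g x := by
  simp only [Real.fourierInv_eq_fourier_neg]
  have h1 := integral_fourier_mul_eq_flip hf hg.comp_neg
  have h2 := integral_neg_eq_self (fun x ↦ 𝓕 f x * g (-x)) volume
  simp only [neg_neg] at h2
  rw [h2, h1]
  refine integral_congr_ae (Filter.Eventually.of_forall fun x ↦ ?_)
  simp only
  congr 1
  have := Real.fourierInv_eq_fourier_comp_neg g
  rw [← Real.fourierInv_eq_fourier_neg, this]

theorem continuous_fourier {f : ℝ → ℂ} (hf : Integrable f) : Continuous (𝓕 f) :=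
  VectorFourier.fourierIntegral_continuous Real.continuous_fourierChar
    (innerSL ℝ).continuous₂ hf

theorem continuous_fourierInv {f : ℝ → ℂ} (hf : Integrable f) : Continuous (𝓕⁻ f) := by
  have : 𝓕⁻ f = fun x ↦ 𝓕 f (-x) := funext fun x ↦ Real.fourierInv_eq_fourier_neg f x
  rw [this]
  exact (continuous_fourier hf).comp continuous_neg

theorem norm_fourier_le (f : ℝ → ℂ) (x : ℝ) : ‖𝓕 f x‖ ≤ ∫ t, ‖f t‖ :=
  VectorFourier.norm_fourierIntegral_le_integral_norm _ _ _ _ _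

theorem norm_fourierInv_le (f : ℝ → ℂ) (x : ℝ) : ‖𝓕⁻ f x‖ ≤ ∫ t, ‖f t‖ := by
  rw [Real.fourierInv_eq_fourier_neg]
  exact norm_fourier_le f _

/-- The Fourier transform in the first variable, at a fixed value of the second. -/
def pft (Ψ : 𝓢(ST n, ℂ)) (ξ : Sp n) (t : ℝ) : ℂ := 𝓕 (fun τ ↦ Ψ (pt τ ξ)) t

theorem exists_bound_schwartz {E : Type} [NormedAddCommGroup E] [NormedSpace ℝ E] {m : E → ℝ}
    (hm : m.HasTemperateGrowth) (Ψ : 𝓢(E, ℂ)) : ∃ C : ℝ, 0 ≤ C ∧ ∀ z, m z * ‖Ψ z‖ ≤ C := by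
  have hm' : (fun z ↦ (m z : ℂ)).HasTemperateGrowth :=
    Function.Complex.hasTemperateGrowth_ofReal.comp hm
  let Ψ' := SchwartzMap.smulLeftCLM ℂ (fun z ↦ (m z : ℂ)) Ψ
  refine ⟨SchwartzMap.seminorm ℝ 0 0 Ψ', apply_nonneg _ _, fun z ↦ ?_⟩
  have h1 := SchwartzMap.norm_le_seminorm ℝ Ψ' z
  rw [SchwartzMap.smulLeftCLM_apply_apply hm', norm_smul, Complex.norm_real] at h1
  exact (mul_le_mul_of_nonneg_right (Real.le_norm_self _) (norm_nonneg _)).trans h1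

theorem exists_bound_schwartz_Sp (M : ℝ) (φ : 𝓢(Sp n, ℂ)) :
    ∃ C : ℝ, 0 ≤ C ∧ ∀ ξ, ‖φ ξ‖ ≤ C * symS (-M) ξ := by
  obtain ⟨C, hC, h⟩ := exists_bound_schwartz (symS_temperate M) φ
  refine ⟨C, hC, fun ξ ↦ ?_⟩
  have h1 := mul_le_mul_of_nonneg_right (h ξ) (symS_pos (-M) ξ).le
  calc ‖φ ξ‖ = (symS M ξ * symS (-M) ξ) * ‖φ ξ‖ := by rw [symS_neg, one_mul]
    _ = symS M ξ * ‖φ ξ‖ * symS (-M) ξ := by ring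
    _ ≤ _ := h1

theorem exists_bound_schwartz_ST (M : ℝ) (Ψ : 𝓢(ST n, ℂ)) :
    ∃ C : ℝ, 0 ≤ C ∧ ∀ ξ τ, ‖Ψ (pt τ ξ)‖ ≤ C * symS (-M) ξ * (1 + τ ^ 2)⁻¹ := by
  have hfst : (fun z : ST n ↦ z.fst).HasTemperateGrowth :=
    (WithLp.fstL 2 ℝ ℝ (Sp n)).hasTemperateGrowth
  have hm : (fun z : ST n ↦ symX M z * (1 + z.fst ^ 2)).HasTemperateGrowth :=
    (symX_temperate M).mul ((Function.HasTemperateGrowth.const 1).add (hfst.pow 2))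
  obtain ⟨C, hC, h⟩ := exists_bound_schwartz hm Ψ
  refine ⟨C, hC, fun ξ τ ↦ ?_⟩
  have h1 := h (pt τ ξ)
  simp only [symX_pt, pt_fst] at h1
  have hp : 0 < 1 + τ ^ 2 := by positivity
  rw [← div_eq_mul_inv, le_div_iff₀ hp]
  calc ‖Ψ (pt τ ξ)‖ * (1 + τ ^ 2) =
      (symS M ξ * symS (-M) ξ) * ‖Ψ (pt τ ξ)‖ * (1 + τ ^ 2) := by rw [symS_neg, one_mul]
    _ = (symS M ξ * (1 + τ ^ 2) * ‖Ψ (pt τ ξ)‖) * symS (-M) ξ := by ring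
    _ ≤ C * symS (-M) ξ := mul_le_mul_of_nonneg_right h1 (symS_pos _ _).le

theorem continuous_pt_left (ξ : Sp n) : Continuous fun τ : ℝ ↦ pt τ ξ := by
  unfold pt
  fun_prop

theorem integrable_schwartz_slice (Ψ : 𝓢(ST n, ℂ)) (ξ : Sp n) :
    Integrable fun τ ↦ Ψ (pt τ ξ) := by
  obtain ⟨C, hC, h⟩ := exists_bound_schwartz_ST 0 Ψ
  exact (integrable_inv_one_add_sq.const_mul (C * symS (-0) ξ)).mono'
    (Ψ.continuous.comp (continuous_pt_left ξ)).aestronglyMeasurable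
    (Filter.Eventually.of_forall fun τ ↦ h ξ τ)

theorem hasDerivAt_schwartz_slice (Ψ : 𝓢(ST n, ℂ)) (ξ : Sp n) (τ : ℝ) :
    HasDerivAt (fun τ ↦ Ψ (pt τ ξ)) ((∂_{pt 1 (0 : Sp n)} Ψ : 𝓢(ST n, ℂ)) (pt τ ξ)) τ := by
  rw [SchwartzMap.lineDerivOp_apply_eq_fderiv]
  have h1 : HasDerivAt (fun τ : ℝ ↦ pt τ ξ) (pt 1 (0 : Sp n)) τ := by
    have h := ((hasDerivAt_id τ).smul_const (pt 1 (0 : Sp n))).add_const (pt 0 ξ)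
    rw [one_smul] at h
    refine h.congr_of_eventuallyEq (Filter.Eventually.of_forall fun r ↦ ?_)
    simp [pt, ← WithLp.toLp_smul, ← WithLp.toLp_add]
  exact (Ψ.hasFDerivAt (pt τ ξ)).comp_hasDerivAt τ h1

theorem pft_lineDeriv (Ψ : 𝓢(ST n, ℂ)) (ξ : Sp n) (t : ℝ) :
    pft (∂_{pt 1 (0 : Sp n)} Ψ) ξ t = (2 * Real.pi * Complex.I * t) * pft Ψ ξ t := by
  have h1 : deriv (fun τ ↦ Ψ (pt τ ξ)) =
      fun τ ↦ (∂_{pt 1 (0 : Sp n)} Ψ : 𝓢(ST n, ℂ)) (pt τ ξ) :=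
    funext fun τ ↦ (hasDerivAt_schwartz_slice Ψ ξ τ).deriv
  have h2 := Real.fourier_deriv (integrable_schwartz_slice Ψ ξ)
    (fun τ ↦ (hasDerivAt_schwartz_slice Ψ ξ τ).differentiableAt)
    (by rw [h1]; exact integrable_schwartz_slice _ ξ)
  rw [h1] at h2
  exact congrFun h2 t

/-- Two derivatives in τ become the factor (2πit)², which gives the decay in t; the decay in ξ is
that of `Ψ`. -/
theorem exists_bound_pft (M : ℝ) (Ψ : 𝓢(ST n, ℂ)) :
    ∃ C : ℝ, 0 ≤ C ∧ ∀ ξ t, ‖pft Ψ ξ t‖ ≤ C * symS (-M) ξ * (1 + t ^ 2)⁻¹ := by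
  have key : ∀ Ψ : 𝓢(ST n, ℂ), ∃ C : ℝ, 0 ≤ C ∧ ∀ ξ t, ‖pft Ψ ξ t‖ ≤ C * symS (-M) ξ := by
    intro Ψ
    obtain ⟨C, hC, h⟩ := exists_bound_schwartz_ST M Ψ
    refine ⟨C * Real.pi, by positivity, fun ξ t ↦ (norm_fourier_le _ _).trans ?_⟩
    calc ∫ τ, ‖Ψ (pt τ ξ)‖ ≤ ∫ τ : ℝ, C * symS (-M) ξ * (1 + τ ^ 2)⁻¹ :=
          integral_mono_of_nonneg (Filter.Eventually.of_forall fun τ ↦ norm_nonneg _)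
            (integrable_inv_one_add_sq.const_mul _) (Filter.Eventually.of_forall fun τ ↦ h ξ τ)
      _ = C * Real.pi * symS (-M) ξ := by
          rw [integral_const_mul, integral_univ_inv_one_add_sq]
          ring
  obtain ⟨C₁, hC₁, h₁⟩ := key Ψ
  obtain ⟨C₂, hC₂, h₂⟩ := key (∂_{pt 1 (0 : Sp n)} (∂_{pt 1 (0 : Sp n)} Ψ))
  refine ⟨C₁ + C₂, by positivity, fun ξ t ↦ ?_⟩
  have hp : 0 < 1 + t ^ 2 := by positivity
  rw [← div_eq_mul_inv, le_div_iff₀ hp]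
  have h3 := h₂ ξ t
  rw [pft_lineDeriv, pft_lineDeriv, ← mul_assoc, norm_mul, ← sq, norm_pow] at h3
  have h4 : ‖(2 * Real.pi * Complex.I * t : ℂ)‖ ^ 2 = (2 * Real.pi) ^ 2 * t ^ 2 := by
    simp [abs_of_pos Real.pi_pos, mul_pow]
  rw [h4] at h3
  have h5 : (1 : ℝ) ≤ (2 * Real.pi) ^ 2 := by nlinarith [Real.pi_gt_three]
  have h6 := h₁ ξ t
  nlinarith [mul_nonneg (sq_nonneg t) (norm_nonneg (pft Ψ ξ t)),
    mul_le_mul_of_nonneg_right h5 (mul_nonneg (sq_nonneg t) (norm_nonneg (pft Ψ ξ t)))]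

theorem continuous_pft (Ψ : 𝓢(ST n, ℂ)) : Continuous fun q : Sp n × ℝ ↦ pft Ψ q.1 q.2 := by
  obtain ⟨C, hC, h⟩ := exists_bound_schwartz_ST 0 Ψ
  simp only [pft, Real.fourier_real_eq]
  refine continuous_of_dominated (bound := fun τ ↦ C * (1 + τ ^ 2)⁻¹) (fun q ↦ ?_) (fun q ↦ ?_)
    (integrable_inv_one_add_sq.const_mul _) (Filter.Eventually.of_forall fun τ ↦ ?_)
  · have h1 : Continuous fun τ ↦ Ψ (pt τ q.1) := Ψ.continuous.comp (continuous_pt_left _)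
    have h2 : Continuous fun τ : ℝ ↦ Real.fourierChar (-(τ * q.2)) :=
      Real.continuous_fourierChar.comp (by fun_prop)
    exact (h2.smul h1).aestronglyMeasurable
  · refine Filter.Eventually.of_forall fun τ ↦ ?_
    rw [Circle.norm_smul]
    simpa [symS_zero] using h q.1 τ
  · have h1 : Continuous fun q : Sp n × ℝ ↦ Ψ (pt τ q.1) :=
      Ψ.continuous.comp (continuous_pt.comp (by fun_prop : Continuous fun q : Sp n × ℝ ↦ (q.1, τ)))
    have h2 : Continuous fun q : Sp n × ℝ ↦ Real.fourierChar (-(τ * q.2)) :=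
      Real.continuous_fourierChar.comp (by fun_prop)
    exact h2.smul h1

theorem integrable_pft (Ψ : 𝓢(ST n, ℂ)) (ξ : Sp n) : Integrable (pft Ψ ξ) := by
  obtain ⟨C, hC, h⟩ := exists_bound_pft 0 Ψ
  exact (integrable_inv_one_add_sq.const_mul (C * symS (-0) ξ)).mono'
    ((continuous_pft Ψ).comp (by fun_prop : Continuous fun t : ℝ ↦ (ξ, t))).aestronglyMeasurable
    (Filter.Eventually.of_forall fun t ↦ h ξ t)

theorem fourierInv_pft (Ψ : 𝓢(ST n, ℂ)) (ξ : Sp n) (τ : ℝ) :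
    𝓕⁻ (pft Ψ ξ) τ = Ψ (pt τ ξ) := by
  have h1 : Continuous fun τ ↦ Ψ (pt τ ξ) := Ψ.continuous.comp (continuous_pt_left _)
  exact congrFun (h1.fourierInv_fourier_eq (integrable_schwartz_slice Ψ ξ)
    (integrable_pft Ψ ξ)) τ

theorem fourier_pft (Ψ : 𝓢(ST n, ℂ)) (t : ℝ) (x : Sp n) :
    𝓕 (fun ξ ↦ pft Ψ ξ t) x = 𝓕 (Ψ : ST n → ℂ) (pt t x) := by
  rw [Real.fourier_eq, Real.fourier_eq, integral_pt]
  have hint : Integrable (fun q : Sp n × ℝ ↦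
      Real.fourierChar (-inner ℝ (pt q.2 q.1) (pt t x)) • Ψ (pt q.2 q.1)) := by
    have h2 : Integrable fun z ↦ Real.fourierChar (-inner ℝ z (pt t x)) • Ψ z :=
      (Real.fourierIntegral_convergent_iff (pt t x)).2 Ψ.integrable
    exact integrable_pt.1 h2
  rw [Measure.volume_eq_prod, integral_prod _ hint]
  refine integral_congr_ae (Filter.Eventually.of_forall fun ξ ↦ ?_)
  simp only [pft, Real.fourier_real_eq]
  rw [Circle.smul_def, ← integral_smul]
  refine integral_congr_ae (Filter.Eventually.of_forall fun τ ↦ ?_)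
  simp only [inner_pt, pt_fst, pt_snd, Circle.smul_def]
  rw [smul_smul, ← Circle.coe_mul, ← AddChar.map_add_eq_mul]
  congr 3
  ring

theorem continuous_pft_left (Ψ : 𝓢(ST n, ℂ)) (t : ℝ) : Continuous fun ξ ↦ pft Ψ ξ t :=
  (continuous_pft Ψ).comp (by fun_prop : Continuous fun ξ : Sp n ↦ (ξ, t))

theorem integrable_pft_left (Ψ : 𝓢(ST n, ℂ)) (t : ℝ) : Integrable fun ξ ↦ pft Ψ ξ t := by
  obtain ⟨C, hC, hb⟩ := exists_bound_pft (n + 1) Ψ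
  refine ((integrable_symS (n := n) (α := -(n + 1)) (by linarith)).const_mul
    (C * (1 + t ^ 2)⁻¹)).mono' (continuous_pft_left Ψ t).aestronglyMeasurable (Filter.Eventually.of_forall fun ξ ↦ ?_)
  refine (hb ξ t).trans_eq ?_
  ring

/-- Fubini for the full transform, followed by inversion in space. This connects the slices in the
definition of `IsPath` with transforms in τ. -/
theorem fourierInv_sliceAt (Φ : 𝓢(ST n, ℂ)) (t : ℝ) (ξ : Sp n) :
    (𝓕⁻ (sliceAt t Φ) : 𝓢(Sp n, ℂ)) ξ = pft (𝓕⁻ Φ) ξ t := by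
  have hΦ : 𝓕 (𝓕⁻ Φ) = Φ := fourier_fourierInv_eq Φ
  generalize (𝓕⁻ Φ : 𝓢(ST n, ℂ)) = Ψ at hΦ ⊢
  have hFg : 𝓕 (fun ξ ↦ pft Ψ ξ t) = ⇑(sliceAt t Φ) := by
    ext x
    rw [fourier_pft, ← SchwartzMap.fourier_coe, hΦ]
    rfl
  have h2 : 𝓕⁻ (𝓕 (fun ξ ↦ pft Ψ ξ t)) = (fun ξ ↦ pft Ψ ξ t) :=
    (continuous_pft_left Ψ t).fourierInv_fourier_eq (integrable_pft_left Ψ t) (by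
      rw [hFg]
      exact (sliceAt t Φ).integrable)
  rw [hFg] at h2
  rw [SchwartzMap.fourierInv_coe, h2]

end PartialFourier

/-! ### Distributions given by functions of (ξ, t), and their time slices -/

section Fibres

variable {n : ℕ}

/-- `p ξ t` is measurable and bounded, uniformly in `t`, by a function of `ξ` which is integrable
against some power of `1 + |ξ|²`. -/
def FibBound (p : Sp n → ℝ → ℂ) : Prop :=
  Measurable (Function.uncurry p) ∧ ∃ (b : Sp n → ℝ) (M : ℝ),
    Integrable (fun ξ ↦ symS (-M) ξ * b ξ) ∧ ∀ᵐ ξ, ∀ t, ‖p ξ t‖ ≤ b ξ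

/-- The Fourier transform of `u` in the space variables is the function `p ξ t`. -/
def HasFib (u : 𝓢'(ST n, ℂ)) (p : Sp n → ℝ → ℂ) : Prop :=
  FibBound p ∧ ∀ Ψ : 𝓢(ST n, ℂ), 𝓕 u Ψ = ∫ q : Sp n × ℝ, p q.1 q.2 * pft Ψ q.1 q.2

theorem FibBound.integrable {p : Sp n → ℝ → ℂ} (hp : FibBound p) (Ψ : 𝓢(ST n, ℂ)) :
    Integrable fun q : Sp n × ℝ ↦ p q.1 q.2 * pft Ψ q.1 q.2 := by
  obtain ⟨hm, b, M, hb, hbd⟩ := hp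
  obtain ⟨C, hC, h⟩ := exists_bound_pft M Ψ
  have h1 : Integrable fun q : Sp n × ℝ ↦ (symS (-M) q.1 * b q.1) * (1 + q.2 ^ 2)⁻¹ :=
    hb.mul_prod integrable_inv_one_add_sq
  have h2 : ∀ᵐ q : Sp n × ℝ, ∀ t, ‖p q.1 t‖ ≤ b q.1 :=
    Measure.quasiMeasurePreserving_fst.ae hbd
  refine (h1.const_mul C).mono' (hm.aestronglyMeasurable.mul
    (continuous_pft Ψ).aestronglyMeasurable) ?_
  filter_upwards [h2] with q hq
  rw [norm_mul]
  calc ‖p q.1 q.2‖ * ‖pft Ψ q.1 q.2‖ ≤ b q.1 * (C * symS (-M) q.1 * (1 + q.2 ^ 2)⁻¹) :=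
        mul_le_mul (hq _) (h _ _) (norm_nonneg _) ((norm_nonneg _).trans (hq 0))
    _ = _ := by ring

theorem HasFib.apply {u : 𝓢'(ST n, ℂ)} {p : Sp n → ℝ → ℂ} (h : HasFib u p) (Φ : 𝓢(ST n, ℂ)) :
    u Φ = ∫ q : Sp n × ℝ, p q.1 q.2 * pft (𝓕⁻ Φ) q.1 q.2 := by
  rw [← h.2, TemperedDistribution.fourier_apply]
  congr 1
  exact (fourier_fourierInv_eq Φ).symm

/-- `U` itself need not be integrable in τ or ξ. The weight `symX (-M) z * (1 + z.fst ^ 2)⁻¹` makes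
it so, and the reciprocal weight is a temperate symbol which restores `U`. -/
theorem exists_hasFourierFun_of_bound {U : ST n → ℂ} (hU : Measurable U) {b : Sp n → ℝ} {M : ℝ}
    (hb : Integrable (fun ξ ↦ symS (-M) ξ * b ξ)) (hbd : ∀ᵐ ξ, ∀ τ, ‖U (pt τ ξ)‖ ≤ b ξ) :
    ∃ u : 𝓢'(ST n, ℂ), HasFourierFun u U := by
  have hfst : (fun z : ST n ↦ z.fst).HasTemperateGrowth :=
    (WithLp.fstL 2 ℝ ℝ (Sp n)).hasTemperateGrowth
  have hm : (fun z : ST n ↦ symX M z * (1 + z.fst ^ 2)).HasTemperateGrowth :=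
    (symX_temperate M).mul ((Function.HasTemperateGrowth.const 1).add (hfst.pow 2))
  let V : ST n → ℂ := fun z ↦ ((symX (-M) z * (1 + z.fst ^ 2)⁻¹ : ℝ) : ℂ) * U z
  have hV : Integrable V := by
    rw [integrable_pt]
    have h1 : Integrable fun q : Sp n × ℝ ↦ (symS (-M) q.1 * b q.1) * (1 + q.2 ^ 2)⁻¹ :=
      hb.mul_prod integrable_inv_one_add_sq
    have h2 : ∀ᵐ q : Sp n × ℝ, ∀ t, ‖U (pt t q.1)‖ ≤ b q.1 :=
      Measure.quasiMeasurePreserving_fst.ae hbd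
    have hVm : Measurable V := by
      have h3 := (continuous_symX (n := n) (-M)).measurable
      have h4 := (continuous_fst_ST (n := n)).measurable
      simp only [V]
      fun_prop
    refine h1.mono' (hVm.comp measurable_pt).aestronglyMeasurable ?_
    filter_upwards [h2] with q hq
    simp only [V, symX_pt, pt_fst]
    have hs := symS_pos (-M) q.1
    rw [norm_mul, Complex.norm_real, Real.norm_of_nonneg (by positivity)]
    calc _ ≤ symS (-M) q.1 * (1 + q.2 ^ 2)⁻¹ * b q.1 :=
          mul_le_mul_of_nonneg_left (hq _) (by positivity)
      _ = _ := by ring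
  obtain ⟨u, hu⟩ := exists_hasFourierFun hm hV
  refine ⟨u, ?_⟩
  convert hu using 1
  ext z
  simp only [V]
  rw [← mul_assoc, ← Complex.ofReal_mul]
  have : symX M z * (1 + z.fst ^ 2) * (symX (-M) z * (1 + z.fst ^ 2)⁻¹) = 1 := by
    have hp : (1 + z.fst ^ 2 : ℝ) ≠ 0 := by positivity
    calc _ = (symX M z * symX (-M) z) * ((1 + z.fst ^ 2) * (1 + z.fst ^ 2)⁻¹) := by ring
      _ = 1 := by rw [symX_neg, mul_inv_cancel₀ hp, one_mul]
  rw [this]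
  simp

theorem exists_hasFourierFun_Sp {U : Sp n → ℂ} {M : ℝ}
    (hU : Integrable (fun ξ ↦ ((symS (-M) ξ : ℝ) : ℂ) * U ξ)) :
    ∃ u : 𝓢'(Sp n, ℂ), HasFourierFun u U := by
  obtain ⟨u, hu⟩ := exists_hasFourierFun (symS_temperate M) hU
  refine ⟨u, ?_⟩
  convert hu using 1
  ext ξ
  rw [← mul_assoc, ← Complex.ofReal_mul, symS_neg]
  simp

theorem measurable_fourier_fibre {α : Type*} [MeasurableSpace α] {p : α → ℝ → ℂ}
    (hp : Measurable (Function.uncurry p)) {g : α → ℝ} (hg : Measurable g) :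
    Measurable fun a ↦ 𝓕 (p a) (g a) := by
  simp only [Real.fourier_real_eq, Circle.smul_def, smul_eq_mul]
  have h1 : Measurable fun r : α × ℝ ↦
      (Real.fourierChar (-(r.2 * g r.1)) : ℂ) * p r.1 r.2 := by
    have h2 : Continuous fun s : ℝ ↦ (Real.fourierChar s : ℂ) :=
      continuous_subtype_val.comp Real.continuous_fourierChar
    exact (h2.measurable.comp (by fun_prop : Measurable fun r : α × ℝ ↦ -(r.2 * g r.1))).mul hp
  exact (h1.stronglyMeasurable.integral_prod_right).measurable

theorem measurable_fourierInv_fibre {α : Type*} [MeasurableSpace α] {p : α → ℝ → ℂ}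
    (hp : Measurable (Function.uncurry p)) {g : α → ℝ} (hg : Measurable g) :
    Measurable fun a ↦ 𝓕⁻ (p a) (g a) := by
  simp only [Real.fourierInv_eq_fourier_neg]
  exact measurable_fourier_fibre hp hg.neg

/-- The space-time Fourier transform of a function which is compactly supported in time. -/
theorem exists_hasFib_of_support {p : Sp n → ℝ → ℂ} (hp : FibBound p) {L : ℝ} (hL : 0 ≤ L)
    (hsupp : ∀ ξ t, L < |t| → p ξ t = 0) :
    (∃ u : 𝓢'(ST n, ℂ), HasFourierFun u (fun z ↦ 𝓕 (p z.snd) z.fst)) ∧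
    ∀ u : 𝓢'(ST n, ℂ), HasFourierFun u (fun z ↦ 𝓕 (p z.snd) z.fst) → HasFib u p := by
  obtain ⟨hm, b, M, hb, hbd⟩ := id hp
  have hmξ : ∀ ξ, Measurable (p ξ) := fun ξ ↦ hm.comp (by fun_prop : Measurable fun t ↦ (ξ, t))
  have hdom : ∀ᵐ ξ, ∀ t, ‖p ξ t‖ ≤ (Set.Icc (-L) L).indicator (fun _ ↦ b ξ) t := by
    filter_upwards [hbd] with ξ hξ t
    by_cases ht : t ∈ Set.Icc (-L) L
    · simpa [ht] using hξ t
    · have : L < |t| := by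
        by_contra hcon
        exact ht (abs_le.1 (not_lt.1 hcon))
      simp [ht, hsupp ξ t this]
  have hfin : volume (Set.Icc (-L) L) ≠ ⊤ := by simp
  have hind : ∀ ξ, Integrable ((Set.Icc (-L) L).indicator (fun _ : ℝ ↦ b ξ)) := fun ξ ↦
    (integrable_indicator_iff measurableSet_Icc).2 (integrableOn_const (hs := hfin))
  have hint : ∀ᵐ ξ, Integrable (p ξ) := by
    filter_upwards [hdom] with ξ hξ
    exact (hind ξ).mono' (hmξ ξ).aestronglyMeasurable (Filter.Eventually.of_forall hξ)
  have hnorm : ∀ᵐ ξ, ∀ τ, ‖𝓕 (p ξ) τ‖ ≤ 2 * L * b ξ := by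
    filter_upwards [hdom] with ξ hξ τ
    refine (norm_fourier_le _ _).trans ?_
    refine (integral_mono_of_nonneg (Filter.Eventually.of_forall fun _ ↦ norm_nonneg _) (hind ξ)
      (Filter.Eventually.of_forall hξ)).trans_eq ?_
    rw [integral_indicator measurableSet_Icc]
    rw [setIntegral_const, smul_eq_mul]
    congr 1
    rw [measureReal_def, Real.volume_Icc, ENNReal.toReal_ofReal (by linarith)]
    ring
  constructor
  · refine exists_hasFourierFun_of_bound (b := fun ξ ↦ 2 * L * b ξ) (M := M) ?_ ?_ ?_
    · have h1 : Measurable (Function.uncurry fun z : ST n ↦ p z.snd) :=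
        hm.comp ((continuous_snd_ST.measurable.comp measurable_fst).prodMk measurable_snd)
      exact measurable_fourier_fibre h1 continuous_fst_ST.measurable
    · refine (hb.const_mul (2 * L)).congr (Filter.Eventually.of_forall fun ξ ↦ ?_)
      simp only
      ring
    · simp only [pt_fst, pt_snd]
      exact hnorm
  · intro u hu
    refine ⟨hp, fun Ψ ↦ ?_⟩
    have h1 := integrable_pt.1 (hu.2 Ψ).1
    have h2 := hp.integrable Ψ
    rw [Measure.volume_eq_prod] at h1 h2
    rw [(hu.2 Ψ).2, integral_pt, Measure.volume_eq_prod, integral_prod _ h1, integral_prod _ h2]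
    refine integral_congr_ae ?_
    filter_upwards [hint] with ξ hξ
    simp only [pt_fst, pt_snd]
    -- The multiplication formula on a single fibre moves the transform from `p ξ` to the test
    -- function.
    rw [← integral_fourier_mul_eq_flip (integrable_schwartz_slice Ψ ξ) hξ]
    refine integral_congr_ae (Filter.Eventually.of_forall fun t ↦ ?_)
    simp only [pft]
    ring

/-- Inversion of the Fourier transform in time. -/
theorem HasFourierFun.hasFib {u : 𝓢'(ST n, ℂ)} {U : ST n → ℂ} (hu : HasFourierFun u U)
    (hU : Measurable U) {M : ℝ} (hi : ∀ᵐ ξ : Sp n, Integrable fun τ ↦ U (pt τ ξ))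
    (hb : Integrable (fun ξ : Sp n ↦ symS (-M) ξ * ∫ τ, ‖U (pt τ ξ)‖)) :
    HasFib u (fun ξ ↦ 𝓕⁻ (fun τ ↦ U (pt τ ξ))) := by
  have hUm : Measurable (Function.uncurry fun (ξ : Sp n) τ ↦ U (pt τ ξ)) := hU.comp measurable_pt
  have hUm2 : Measurable (Function.uncurry fun (q : Sp n × ℝ) τ ↦ U (pt τ q.1)) :=
    hUm.comp (by fun_prop : Measurable fun r : (Sp n × ℝ) × ℝ ↦ (r.1.1, r.2))
  have hp : FibBound (fun (ξ : Sp n) ↦ 𝓕⁻ (fun τ ↦ U (pt τ ξ))) :=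
    ⟨measurable_fourierInv_fibre (p := fun (q : Sp n × ℝ) τ ↦ U (pt τ q.1)) hUm2
      measurable_snd, _, M, hb,
      Filter.Eventually.of_forall fun ξ t ↦ norm_fourierInv_le _ _⟩
  refine ⟨hp, fun Ψ ↦ ?_⟩
  have h1 := integrable_pt.1 (hu.2 Ψ).1
  have h2 := hp.integrable Ψ
  rw [Measure.volume_eq_prod] at h1 h2
  rw [(hu.2 Ψ).2, integral_pt, Measure.volume_eq_prod, integral_prod _ h1, integral_prod _ h2]
  refine integral_congr_ae ?_
  filter_upwards [hi] with ξ hξ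
  rw [integral_fourierInv_mul_eq_flip hξ (integrable_pft Ψ ξ)]
  refine integral_congr_ae (Filter.Eventually.of_forall fun τ ↦ ?_)
  simp only [fourierInv_pft]
  ring

/-- Each time slice is defined by its Fourier function. Continuity is needed only after pairing with
a test function, where dominated convergence applies, and Fubini identifies the pairing with `u`. -/
theorem HasFib.exists_isPath {u : 𝓢'(ST n, ℂ)} {p : Sp n → ℝ → ℂ} (h : HasFib u p)
    (hc : ∀ᵐ ξ, Continuous (p ξ)) :
    ∃ U : ℝ → 𝓢'(Sp n, ℂ), IsPath u U ∧ ∀ t, HasFourierFun (U t) (fun ξ ↦ p ξ t) := by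
  obtain ⟨hm, b, M, hb, hbd⟩ := id h.1
  have hmt : ∀ t, Measurable fun ξ ↦ p ξ t := fun t ↦
    hm.comp (by fun_prop : Measurable fun ξ ↦ (ξ, t))
  have hex : ∀ t, ∃ v : 𝓢'(Sp n, ℂ), HasFourierFun v (fun ξ ↦ p ξ t) := by
    intro t
    refine exists_hasFourierFun_Sp (M := M) ?_
    refine hb.mono' ?_ ?_
    · exact ((Complex.continuous_ofReal.comp (continuous_symS (-M))).measurable.mul
        (hmt t)).aestronglyMeasurable
    · filter_upwards [hbd] with ξ hξ
      rw [norm_mul, Complex.norm_real, Real.norm_of_nonneg (symS_pos _ _).le]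
      exact mul_le_mul_of_nonneg_left (hξ t) (symS_pos _ _).le
  choose U hU using hex
  refine ⟨U, ⟨?_, fun Φ ↦ ?_⟩, hU⟩
  · refine PointwiseConvergenceCLM.continuous_of_continuous_eval fun φ ↦ ?_
    obtain ⟨C, hC, hφ⟩ := exists_bound_schwartz_Sp M (𝓕⁻ φ)
    have e : (fun t ↦ U t φ) = fun t ↦ ∫ ξ, (𝓕⁻ φ : 𝓢(Sp n, ℂ)) ξ * p ξ t :=
      funext fun t ↦ (hU t).apply φ
    rw [e]
    refine continuous_of_dominated (bound := fun ξ ↦ C * (symS (-M) ξ * b ξ)) (fun t ↦ ?_)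
      (fun t ↦ ?_) (hb.const_mul C) ?_
    · exact ((𝓕⁻ φ : 𝓢(Sp n, ℂ)).continuous.measurable.mul (hmt t)).aestronglyMeasurable
    · filter_upwards [hbd] with ξ hξ
      rw [norm_mul, ← mul_assoc]
      exact mul_le_mul (hφ ξ) (hξ t) (norm_nonneg _)
        (mul_nonneg hC (symS_pos _ _).le)
    · filter_upwards [hc] with ξ hξ
      exact continuous_const.mul hξ
  · have e : ∀ t, U t (sliceAt t Φ) = ∫ ξ, p ξ t * pft (𝓕⁻ Φ) ξ t := by
      intro t
      rw [(hU t).apply]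
      refine integral_congr_ae (Filter.Eventually.of_forall fun ξ ↦ ?_)
      simp only [fourierInv_sliceAt]
      ring
    have hint := h.1.integrable (𝓕⁻ Φ)
    rw [Measure.volume_eq_prod] at hint
    simp only [e]
    refine ⟨hint.integral_prod_right, ?_⟩
    rw [h.apply, Measure.volume_eq_prod, integral_prod_symm _ hint]

theorem sliceAt_eq_zero {Φ : 𝓢(ST n, ℂ)} {a b t : ℝ}
    (hΦ : tsupport Φ ⊆ {z | z.fst ∈ Set.Ioo a b}) (ht : t ∉ Set.Ioo a b) : sliceAt t Φ = 0 := by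
  ext x
  have h : pt t x ∉ tsupport Φ := fun hmem ↦ ht (hΦ hmem)
  have : Φ (pt t x) = 0 := image_eq_zero_of_notMem_tsupport h
  exact this

/-- A test function supported in the slab has zero slices, hence zero partial transforms, at all
other times. -/
theorem HasFib.eqOnSlab {u v : 𝓢'(ST n, ℂ)} {p p' : Sp n → ℝ → ℂ} (hu : HasFib u p)
    (hv : HasFib v p') {a b : ℝ} (h : ∀ᵐ ξ, ∀ t ∈ Set.Ioo a b, p ξ t = p' ξ t) :
    EqOnSlab a b u v := by
  intro Φ _ hΦ
  rw [hu.apply, hv.apply]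
  refine integral_congr_ae ?_
  have h2 : ∀ᵐ q : Sp n × ℝ, ∀ t ∈ Set.Ioo a b, p q.1 t = p' q.1 t :=
    Measure.quasiMeasurePreserving_fst.ae h
  filter_upwards [h2] with q hq
  by_cases ht : q.2 ∈ Set.Ioo a b
  · rw [hq _ ht]
  · have : pft (𝓕⁻ Φ) q.1 q.2 = 0 := by
      rw [← fourierInv_sliceAt, sliceAt_eq_zero hΦ ht, FourierTransform.fourierInv_zero]
      rfl
    rw [this, mul_zero, mul_zero]

theorem IsPath.eqOnSlab {u v : 𝓢'(ST n, ℂ)} {U V : ℝ → 𝓢'(Sp n, ℂ)} (hu : IsPath u U)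
    (hv : IsPath v V) {a b : ℝ} (h : ∀ t ∈ Set.Ioo a b, U t = V t) : EqOnSlab a b u v := by
  intro Φ _ hΦ
  rw [(hu.2 Φ).2, (hv.2 Φ).2]
  refine integral_congr_ae (Filter.Eventually.of_forall fun t ↦ ?_)
  by_cases ht : t ∈ Set.Ioo a b
  · simp only [h t ht]
  · simp [sliceAt_eq_zero hΦ ht]

end Fibres

/-! ### Density of compactly supported test functions -/

section Density

variable {E : Type} [NormedAddCommGroup E] [InnerProductSpace ℝ E] [FiniteDimensional ℝ E]

/-- Compactly supported functions are dense in the Schwartz space. -/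
theorem eq_zero_of_forall_hasCompactSupport {u : 𝓢'(E, ℂ)}
    (h : ∀ φ : 𝓢(E, ℂ), HasCompactSupport φ → u φ = 0) : u = 0 := by
  let χ : ContDiffBump (0 : E) := ⟨1, 2, by norm_num, by norm_num⟩
  have hχc : ContDiff ℝ ∞ χ := χ.contDiff
  have hB : ∀ i : ℕ, ∃ B : ℝ, 0 ≤ B ∧ ∀ x, ‖iteratedFDeriv ℝ i (fun x ↦ χ x - 1) x‖ ≤ B := by
    intro i
    rcases Nat.eq_zero_or_pos i with rfl | hi
    · refine ⟨1, zero_le_one, fun x ↦ ?_⟩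
      rw [norm_iteratedFDeriv_zero, Real.norm_eq_abs, abs_le]
      constructor <;> linarith [χ.nonneg (x := x), χ.le_one (x := x)]
    · have hcs : HasCompactSupport (iteratedFDeriv ℝ i χ) := χ.hasCompactSupport.iteratedFDeriv i
      obtain ⟨B, hB⟩ := hcs.exists_bound_of_continuous
        (hχc.continuous_iteratedFDeriv (by exact_mod_cast le_top))
      refine ⟨B, (norm_nonneg _).trans (hB 0), fun x ↦ ?_⟩
      have e : iteratedFDeriv ℝ i (fun x ↦ χ x - 1) x = iteratedFDeriv ℝ i χ x := by
        have h1 := iteratedFDeriv_sub_apply (𝕜 := ℝ) (i := i) (x := x) (f := χ)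
          (g := fun _ ↦ (1 : ℝ)) (hχc.contDiffAt.of_le (by exact_mod_cast le_top)) contDiffAt_const
        rw [iteratedFDeriv_const_of_ne hi.ne'] at h1
        simpa [Pi.sub_def] using h1
      rw [e]
      exact hB x
  choose B hB0 hB using hB
  let g : ℕ → E → ℂ := fun R x ↦ ((χ (((R : ℝ) + 1)⁻¹ • x) : ℝ) : ℂ)
  have hgcs : ∀ R, HasCompactSupport (g R) := by
    intro R
    have h1 : HasCompactSupport fun x ↦ χ (((R : ℝ) + 1)⁻¹ • x) :=
      χ.hasCompactSupport.comp_homeomorph (Homeomorph.smulOfNeZero ((R : ℝ) + 1)⁻¹ (by positivity))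
    exact h1.comp_left Complex.ofReal_zero
  have hgsm : ∀ R, ContDiff ℝ ∞ (g R) := by
    intro R
    have h1 : ContDiff ℝ ∞ fun x ↦ χ (((R : ℝ) + 1)⁻¹ • x) := hχc.comp (contDiff_const_smul _)
    exact Complex.ofRealCLM.contDiff.comp h1
  have hgt : ∀ R, (g R).HasTemperateGrowth := fun R ↦ (hgcs R).hasTemperateGrowth (hgsm R)
  have hgB : ∀ R i x, ‖iteratedFDeriv ℝ i (fun x ↦ g R x - 1) x‖ ≤
      B i * (((R : ℝ) + 1)⁻¹ * ‖x‖) := by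
    intro R i x
    set r : ℝ := ((R : ℝ) + 1)⁻¹ with hr
    have hr0 : 0 < r := by positivity
    have hr1 : r ≤ 1 := inv_le_one_of_one_le₀ (by simp)
    -- Where the dilated bump is locally 1 nothing remains. Elsewhere 1 ≤ r‖x‖, so one factor ‖x‖,
    -- absorbed below by the seminorm of index k + 1, is exchanged for the decay r in `R`.
    rcases lt_or_ge (r * ‖x‖) 1 with hx | hx
    · have hev : (fun x ↦ g R x - 1) =ᶠ[nhds x] fun _ ↦ (0 : ℂ) := by
        have : ∀ᶠ y in nhds x, r * ‖y‖ < 1 :=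
          (continuous_const.mul continuous_norm).continuousAt.eventually_lt continuousAt_const hx
        filter_upwards [this] with y hy
        have h1 : χ (r • y) = 1 := by
          refine χ.one_of_mem_closedBall ?_
          rw [mem_closedBall_zero_iff, norm_smul, Real.norm_of_nonneg hr0.le]
          exact hy.le
        simp [g, ← hr, h1]
      have h0 : iteratedFDeriv ℝ i (fun x ↦ g R x - 1) x = 0 := by
        rw [(hev.iteratedFDeriv ℝ i).eq_of_nhds]
        simp
      rw [h0, norm_zero]
      have := hB0 i
      positivity
    · let f : E → ℝ := fun x ↦ χ x - 1
      have hf : ContDiff ℝ ∞ f := hχc.sub contDiff_const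
      have e : (fun x ↦ g R x - 1) = Complex.ofRealLI ∘ (f ∘ ⇑(r • ContinuousLinearMap.id ℝ E)) := by
        ext y
        simp [g, f, ← hr]
      have hcd : ContDiff ℝ ∞ (f ∘ ⇑(r • ContinuousLinearMap.id ℝ E)) :=
        hf.comp (ContinuousLinearMap.contDiff _)
      rw [e, LinearIsometry.norm_iteratedFDeriv_comp_left _ hcd.contDiffAt
        (by exact_mod_cast le_top)]
      rw [ContinuousLinearMap.iteratedFDeriv_comp_right _ hf _ (by exact_mod_cast le_top)]
      refine (ContinuousMultilinearMap.norm_compContinuousLinearMap_le _ _).trans ?_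
      refine mul_le_mul (hB i _) ?_ (by positivity) (hB0 i)
      have hn : ‖r • ContinuousLinearMap.id ℝ E‖ ≤ 1 := by
        rw [norm_smul, Real.norm_of_nonneg hr0.le]
        exact mul_le_one₀ hr1 (norm_nonneg _) ContinuousLinearMap.norm_id_le
      refine (Finset.prod_le_one (fun _ _ ↦ norm_nonneg _) fun _ _ ↦ hn).trans hx
  ext ψ
  have htend : Filter.Tendsto (fun R ↦ SchwartzMap.smulLeftCLM ℂ (g R) ψ) Filter.atTop
      (nhds ψ) := by
    rw [(schwartz_withSeminorms ℝ E ℂ).tendsto_nhds]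
    rintro ⟨k, l⟩ ε hε
    let S : ℝ := ∑ i ∈ Finset.range (l + 1), (l.choose i : ℝ) * B i *
      SchwartzMap.seminorm ℝ (k + 1) (l - i) ψ
    have hS : 0 ≤ S := Finset.sum_nonneg fun i _ ↦ by
      have := hB0 i
      positivity
    have hbound : ∀ R, SchwartzMap.seminorm ℝ k l (SchwartzMap.smulLeftCLM ℂ (g R) ψ - ψ) ≤
        ((R : ℝ) + 1)⁻¹ * S := by
      intro R
      refine SchwartzMap.seminorm_le_bound ℝ k l _ (by positivity) fun x ↦ ?_
      have e : ⇑(SchwartzMap.smulLeftCLM ℂ (g R) ψ - ψ) = fun x ↦ (g R x - 1) * ψ x := by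
        ext y
        simp [SchwartzMap.smulLeftCLM_apply_apply (hgt R), sub_mul]
      rw [e]
      have h1 := norm_iteratedFDeriv_mul_le (𝕜 := ℝ) (f := fun x ↦ g R x - 1) (g := ψ) (n := l)
        ((hgsm R).sub contDiff_const) (ψ.smooth ⊤) x (by exact_mod_cast le_top)
      refine (mul_le_mul_of_nonneg_left h1 (by positivity)).trans ?_
      rw [Finset.mul_sum, Finset.mul_sum]
      refine Finset.sum_le_sum fun i _ ↦ ?_
      have h2 := hgB R i x
      have h3 := SchwartzMap.le_seminorm ℝ (k + 1) (l - i) ψ x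
      calc ‖x‖ ^ k * ((l.choose i : ℝ) * ‖iteratedFDeriv ℝ i (fun x ↦ g R x - 1) x‖ *
            ‖iteratedFDeriv ℝ (l - i) ψ x‖) ≤
          ‖x‖ ^ k * ((l.choose i : ℝ) * (B i * (((R : ℝ) + 1)⁻¹ * ‖x‖)) *
            ‖iteratedFDeriv ℝ (l - i) ψ x‖) := by gcongr
        _ = ((R : ℝ) + 1)⁻¹ * ((l.choose i : ℝ) * B i *
            (‖x‖ ^ (k + 1) * ‖iteratedFDeriv ℝ (l - i) ψ x‖)) := by ring
        _ ≤ _ := by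
            have := hB0 i
            gcongr
    have hlim : Filter.Tendsto (fun R : ℕ ↦ ((R : ℝ) + 1)⁻¹ * S) Filter.atTop (nhds 0) := by
      have := (tendsto_one_div_add_atTop_nhds_zero_nat (𝕜 := ℝ)).mul_const S
      simpa using this
    filter_upwards [hlim.eventually_lt_const hε] with R hR
    exact (hbound R).trans_lt hR
  have h2 : Filter.Tendsto (fun R ↦ u (SchwartzMap.smulLeftCLM ℂ (g R) ψ)) Filter.atTop
      (nhds (u ψ)) := (u.continuous.tendsto ψ).comp htend
  have h3 : ∀ R, u (SchwartzMap.smulLeftCLM ℂ (g R) ψ) = 0 := by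
    intro R
    refine h _ ((hgcs R).mono fun x hx ↦ ?_)
    rw [Function.mem_support] at hx ⊢
    rw [SchwartzMap.smulLeftCLM_apply_apply (hgt R)] at hx
    exact left_ne_zero_of_smul hx
  simp only [h3] at h2
  exact (tendsto_nhds_unique h2 tendsto_const_nhds)

end Density

/-! ### Cut-offs on the line and weak derivatives of continuous functions -/

theorem exists_cutoff {a b c d : ℝ} (hab : a < b) (hbc : b < c) (hcd : c < d) :
    ∃ φ : ℝ → ℝ, ContDiff ℝ ∞ φ ∧ HasCompactSupport φ ∧ (∀ t ∈ Set.Icc b c, φ t = 1) ∧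
      tsupport φ ⊆ Set.Ioo a d := by
  have hm : 0 < min (b - a) (d - c) := lt_min (by linarith) (by linarith)
  let f : ContDiffBump ((b + c) / 2) :=
    ⟨(c - b) / 2, (c - b) / 2 + min (b - a) (d - c) / 2, by linarith, by linarith⟩
  refine ⟨f, f.contDiff, f.hasCompactSupport, fun t ht ↦ f.one_of_mem_closedBall ?_, ?_⟩
  · rw [Metric.mem_closedBall, Real.dist_eq, abs_le]
    constructor <;> simp only [f] <;> linarith [ht.1, ht.2]
  · rw [f.tsupport_eq]
    intro t ht
    rw [Metric.mem_closedBall, Real.dist_eq, abs_le] at ht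
    simp only [f] at ht
    have h1 := min_le_left (b - a) (d - c)
    have h2 := min_le_right (b - a) (d - c)
    constructor <;> linarith [ht.1, ht.2]

/-- A continuous function that is orthogonal to all derivatives of test functions is constant. -/
theorem eq_of_forall_integral_deriv_eq_zero {a b : ℝ} {g : ℝ → ℂ} (hg : Continuous g)
    (h : ∀ φ : ℝ → ℝ, ContDiff ℝ ∞ φ → HasCompactSupport φ → tsupport φ ⊆ Set.Ioo a b →
      ∫ t, deriv φ t • g t = 0) {t : ℝ} (ht : t ∈ Set.Icc a b) : g t = g a := by
  rcases eq_or_lt_of_le (ht.1.trans ht.2) with hab | hab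
  · rw [show t = a from le_antisymm (hab ▸ ht.2) ht.1]
  let f : ContDiffBump ((a + b) / 2) := ⟨(b - a) / 8, (b - a) / 4, by linarith, by linarith⟩
  have hfs : tsupport (f.normed volume) ⊆ Set.Ioo a b := by
    rw [f.tsupport_normed_eq]
    intro x hx
    rw [Metric.mem_closedBall, Real.dist_eq, abs_le] at hx
    simp only [f] at hx
    constructor <;> linarith [hx.1, hx.2]
  set ρ : ℝ → ℝ := f.normed volume with hρ
  have hρc : ContDiff ℝ ∞ ρ := f.contDiff_normed
  have hρs : HasCompactSupport ρ := f.hasCompactSupport_normed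
  have hρ1 : ∫ x, ρ x = 1 := f.integral_normed
  set c : ℂ := ∫ t, ρ t • g t with hc
  have hae : ∀ᵐ x, x ∈ Set.Ioo a b → g x - c = 0 := by
    refine isOpen_Ioo.ae_eq_zero_of_integral_contDiff_smul_eq_zero
      ((hg.sub continuous_const).locallyIntegrable.locallyIntegrableOn _) ?_
    intro φ hφ hφc hφs
    set I : ℝ := ∫ x, φ x with hI
    -- Removing the mean makes `k` the derivative of a test function supported in (a, b).
    -- Orthogonality to it says that φ pairs to zero with g - c, for the constant c given by ρ.
    let k : ℝ → ℝ := fun x ↦ φ x - I * ρ x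
    have hk : ContDiff ℝ ∞ k := hφ.sub (contDiff_const.mul hρc)
    let K : Set ℝ := tsupport φ ∪ tsupport ρ
    have hK : IsCompact K := hφc.isCompact.union hρs.isCompact
    have hKs : K ⊆ Set.Ioo a b := Set.union_subset hφs hfs
    have hk0 : ∀ x ∉ K, k x = 0 := by
      intro x hx
      have h1 : φ x = 0 := image_eq_zero_of_notMem_tsupport fun h' ↦ hx (Or.inl h')
      have h2 : ρ x = 0 := image_eq_zero_of_notMem_tsupport fun h' ↦ hx (Or.inr h')
      simp [k, h1, h2]
    have hφi : Integrable φ := hφ.continuous.integrable_of_hasCompactSupport hφc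
    have hρi : Integrable ρ := hρc.continuous.integrable_of_hasCompactSupport hρs
    have hki : Integrable k := hφi.sub (hρi.const_mul I)
    have hk1 : ∫ x, k x = 0 := by
      rw [integral_sub hφi (hρi.const_mul I), integral_const_mul, hρ1, mul_one, sub_self]
    let η : ℝ → ℝ := fun x ↦ ∫ y in a..x, k y
    have hη' : ∀ x, HasDerivAt η (k x) x := fun x ↦
      intervalIntegral.integral_hasDerivAt_right (hki.intervalIntegrable)
        (hk.continuous.stronglyMeasurableAtFilter _ _) hk.continuous.continuousAt
    have hηd : deriv η = k := funext fun x ↦ (hη' x).deriv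
    have hηc : ContDiff ℝ ∞ η := by
      rw [contDiff_infty_iff_deriv]
      exact ⟨fun x ↦ (hη' x).differentiableAt, hηd ▸ hk⟩
    obtain ⟨a', ha'⟩ : ∃ a', a < a' ∧ ∀ x ∈ K, a' ≤ x := by
      rcases K.eq_empty_or_nonempty with hE | hE
      · exact ⟨a + 1, by linarith, by simp [hE]⟩
      · obtain ⟨x, hx, hx'⟩ := hK.exists_isLeast hE
        exact ⟨x, (hKs hx).1, fun y hy ↦ hx' hy⟩
    obtain ⟨b', hb'⟩ : ∃ b', b' < b ∧ ∀ x ∈ K, x ≤ b' := by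
      rcases K.eq_empty_or_nonempty with hE | hE
      · exact ⟨b - 1, by linarith, by simp [hE]⟩
      · obtain ⟨x, hx, hx'⟩ := hK.exists_isGreatest hE
        exact ⟨x, (hKs hx).2, fun y hy ↦ hx' hy⟩
    have hη0 : ∀ x ∉ Set.Icc a' b', η x = 0 := by
      intro x hx
      rw [Set.mem_Icc, not_and_or, not_le, not_le] at hx
      have hsplit : ∀ x, b' < x → ∫ y in Set.Iic x, k y = 0 := by
        intro x hx
        rw [setIntegral_eq_integral_of_forall_compl_eq_zero, hk1]
        intro y hy
        exact hk0 y fun h' ↦ hy ((hb'.2 y h').trans hx.le)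
      have hsplit' : ∀ x, x < a' → ∫ y in Set.Iic x, k y = 0 := by
        intro x hx
        refine setIntegral_eq_zero_of_forall_eq_zero fun y hy ↦ hk0 y fun h' ↦ ?_
        exact absurd (ha'.2 y h') (not_le.2 (lt_of_le_of_lt hy hx))
      have e : η x = (∫ y in Set.Iic x, k y) - ∫ y in Set.Iic a, k y :=
        (intervalIntegral.integral_Iic_sub_Iic hki.integrableOn hki.integrableOn).symm
      rw [e, hsplit' a ha'.1, sub_zero]
      rcases hx with hx | hx
      · exact hsplit' x hx
      · exact hsplit x hx
    have hηcs : HasCompactSupport η := HasCompactSupport.intro isCompact_Icc hη0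
    have hηs : tsupport η ⊆ Set.Ioo a b := by
      refine (closure_minimal (fun x hx ↦ ?_) isClosed_Icc).trans
        (fun x (hx : x ∈ Set.Icc a' b') ↦ ⟨ha'.1.trans_le hx.1, hx.2.trans_lt hb'.1⟩)
      by_contra hcon
      exact hx (hη0 x hcon)
    have h0 := h η hηc hηcs hηs
    rw [hηd] at h0
    have hi1 : Integrable fun x ↦ φ x • g x :=
      (hφ.continuous.smul hg).integrable_of_hasCompactSupport hφc.smul_right
    have hi2 : Integrable fun x ↦ ρ x • g x :=
      (hρc.continuous.smul hg).integrable_of_hasCompactSupport hρs.smul_right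
    have h1 : ∫ x, k x • g x = (∫ x, φ x • g x) - I • c := by
      rw [hc, ← integral_smul]
      refine Eq.trans ?_ (integral_sub hi1 (hi2.smul I))
      refine integral_congr_ae (Filter.Eventually.of_forall fun x ↦ ?_)
      simp only [k, sub_smul, mul_smul]
    have h2 : ∫ x, φ x • (g x - c) = (∫ x, φ x • g x) - I • c := by
      have : (fun x ↦ φ x • (g x - c)) = fun x ↦ φ x • g x - φ x • c := by
        ext x; rw [smul_sub]
      rw [this, integral_sub hi1 (hφi.smul_const c), integral_smul_const]
    rw [h2, ← h1, h0]
  have hcl : ∀ x ∈ Set.Icc a b, g x = c := by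
    have hopen : ∀ x ∈ Set.Ioo a b, g x = c := by
      intro x hx
      have h1 : (fun x ↦ g x) =ᵐ[volume.restrict (Set.Ioo a b)] fun _ ↦ c := by
        rw [Filter.EventuallyEq, ae_restrict_iff' measurableSet_Ioo]
        filter_upwards [hae] with y hy hy2
        exact sub_eq_zero.1 (hy hy2)
      exact Measure.eqOn_open_of_ae_eq h1 isOpen_Ioo hg.continuousOn continuousOn_const hx
    have : Set.EqOn g (fun _ ↦ c) (closure (Set.Ioo a b)) :=
      Set.EqOn.closure hopen hg continuous_const
    rw [closure_Ioo hab.ne] at this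
    exact this
  rw [hcl t ht, hcl a ⟨le_rfl, hab.le⟩]

/-- Subtracting a primitive of `l` leaves a continuous function orthogonal to all derivatives of
test functions, hence a constant. -/
theorem sub_eq_integral_of_weak_deriv {a b : ℝ} {m l : ℝ → ℂ} (hm : Continuous m)
    (hl : Continuous l)
    (h : ∀ φ : ℝ → ℝ, ContDiff ℝ ∞ φ → HasCompactSupport φ → tsupport φ ⊆ Set.Ioo a b →
      (∫ t, deriv φ t • m t) + ∫ t, φ t • l t = 0) {t : ℝ} (ht : t ∈ Set.Icc a b) :
    m t - m a = ∫ r in a..t, l r := by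
  let L : ℝ → ℂ := fun t ↦ ∫ r in a..t, l r
  have hL : ∀ x, HasDerivAt L (l x) x := fun x ↦
    intervalIntegral.integral_hasDerivAt_right (hl.intervalIntegrable _ _)
      (hl.stronglyMeasurableAtFilter _ _) hl.continuousAt
  have hLc : Continuous L := continuous_iff_continuousAt.2 fun x ↦ (hL x).continuousAt
  have key := eq_of_forall_integral_deriv_eq_zero (a := a) (b := b) (hm.sub hLc) (fun φ hφ hφc hφs ↦ by
    have hd : Continuous (deriv φ) := hφ.continuous_deriv (by simp)
    have i1 : Integrable fun t ↦ deriv φ t • m t :=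
      (hd.smul hm).integrable_of_hasCompactSupport hφc.deriv.smul_right
    have i2 : Integrable fun t ↦ deriv φ t • L t :=
      (hd.smul hLc).integrable_of_hasCompactSupport hφc.deriv.smul_right
    have i3 : Integrable fun t ↦ φ t • l t :=
      (hφ.continuous.smul hl).integrable_of_hasCompactSupport hφc.smul_right
    have i4 : Integrable fun t ↦ φ t • L t :=
      (hφ.continuous.smul hLc).integrable_of_hasCompactSupport hφc.smul_right
    have e := integral_bilinear_hasDerivAt_right_eq_neg_left_of_integrable
      (L := ContinuousLinearMap.lsmul ℝ ℝ (E := ℂ)) (u := φ) (v := L) (u' := deriv φ) (v' := l)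
      (fun x _ ↦ (hφ.differentiable (by simp) x).hasDerivAt) (fun x _ ↦ hL x) i3 i2 i4
    simp only [ContinuousLinearMap.lsmul_apply] at e
    have h1 := h φ hφ hφc hφs
    simp only [Pi.sub_apply, smul_sub]
    rw [integral_sub i1 i2]
    rw [e] at h1
    linear_combination h1) ht
  simp only [Pi.sub_apply] at key
  have hLa : L a = 0 := intervalIntegral.integral_same
  rw [hLa] at key
  change m t - m a = L t
  linear_combination key

/-! ### Product test functions, equality on slabs, paths and translations -/

section TestFunctions

variable {n : ℕ}

theorem exists_tensor {φ : ℝ → ℝ} (hφ : ContDiff ℝ ∞ φ) (hφc : HasCompactSupport φ)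
    (ψ : 𝓢(Sp n, ℂ)) (hψ : HasCompactSupport ψ) :
    ∃ Φ : 𝓢(ST n, ℂ), HasCompactSupport Φ ∧ (∀ z, Φ z = (φ z.fst : ℂ) * ψ z.snd) ∧
      tsupport Φ ⊆ {z | z.fst ∈ tsupport φ} := by
  let f : ST n → ℂ := fun z ↦ (φ z.fst : ℂ) * ψ z.snd
  have hf1 : ContDiff ℝ ∞ f := by
    have h1 : ContDiff ℝ ∞ fun z : ST n ↦ ((φ z.fst : ℝ) : ℂ) :=
      Complex.ofRealCLM.contDiff.comp (hφ.comp (WithLp.fstL 2 ℝ ℝ (Sp n)).contDiff)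
    have h2 : ContDiff ℝ ∞ fun z : ST n ↦ ψ z.snd :=
      (ψ.smooth ⊤).comp (WithLp.sndL 2 ℝ ℝ (Sp n)).contDiff
    exact h1.mul h2
  have hf2 : HasCompactSupport f := by
    refine HasCompactSupport.intro
      ((hψ.isCompact.prod hφc.isCompact).image continuous_pt) fun z hz ↦ ?_
    by_contra hne
    refine hz ⟨(z.snd, z.fst), ⟨?_, ?_⟩, pt_eta z⟩
    · exact subset_tsupport _ (right_ne_zero_of_mul hne)
    · have := left_ne_zero_of_mul hne
      exact subset_tsupport _ (by simpa using this)
  refine ⟨hf2.toSchwartzMap hf1, hf2, fun _ ↦ rfl, ?_⟩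
  refine closure_minimal (fun z hz ↦ ?_) ((isClosed_tsupport φ).preimage continuous_fst_ST)
  have := left_ne_zero_of_mul (show (φ z.fst : ℂ) * ψ z.snd ≠ 0 from hz)
  exact subset_tsupport _ (by simpa using this)

theorem sliceAt_apply (t : ℝ) (Φ : 𝓢(ST n, ℂ)) (x : Sp n) : sliceAt t Φ x = Φ (pt t x) := rfl

theorem sliceAt_lineDeriv (t : ℝ) (Φ : 𝓢(ST n, ℂ)) (e : Sp n) :
    sliceAt t (∂_{pt 0 e} Φ) = ∂_{e} (sliceAt t Φ) := by
  ext x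
  rw [sliceAt_apply, SchwartzMap.lineDerivOp_apply, SchwartzMap.lineDerivOp_apply, lineDeriv,
    lineDeriv]
  congr 1
  ext r
  rw [sliceAt_apply]
  congr 1
  simp [pt, ← WithLp.toLp_smul, ← WithLp.toLp_add]

theorem tensor_dt {φ : ℝ → ℝ} (hφ : ContDiff ℝ ∞ φ) {ψ : 𝓢(Sp n, ℂ)} {Φ : 𝓢(ST n, ℂ)}
    (hΦ : ∀ z, Φ z = (φ z.fst : ℂ) * ψ z.snd) (z : ST n) :
    (∂_{pt 1 (0 : Sp n)} Φ : 𝓢(ST n, ℂ)) z = ((deriv φ z.fst : ℝ) : ℂ) * ψ z.snd := by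
  rw [SchwartzMap.lineDerivOp_apply, lineDeriv]
  have h1 : HasDerivAt φ (deriv φ z.fst) (z.fst + 0) := by
    rw [add_zero]
    exact (hφ.differentiable (by simp) _).hasDerivAt
  have h2 := ((h1.comp_const_add z.fst 0).ofReal_comp).mul_const (ψ z.snd)
  have e : (fun r : ℝ ↦ Φ (z + r • pt 1 (0 : Sp n))) =
      fun r ↦ ((φ (z.fst + r) : ℝ) : ℂ) * ψ z.snd := by
    ext r
    rw [hΦ]
    simp [pt]
  rw [e]
  exact h2.deriv

theorem tsupport_lineDeriv_subset {E : Type} [NormedAddCommGroup E] [NormedSpace ℝ E]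
    (Φ : 𝓢(E, ℂ)) (m : E) : tsupport (∂_{m} Φ : 𝓢(E, ℂ)) ⊆ tsupport Φ := by
  have e : ((∂_{m} Φ : 𝓢(E, ℂ)) : E → ℂ) = fun x ↦ fderiv ℝ Φ x m := by
    ext x; rw [SchwartzMap.lineDerivOp_apply_eq_fderiv]
  rw [e]
  exact tsupport_fderiv_apply_subset ℝ m

theorem EqOnSlab.lineDeriv {a b : ℝ} {u v : 𝓢'(ST n, ℂ)} (h : EqOnSlab a b u v) (m : ST n) :
    EqOnSlab a b (∂_{m} u) (∂_{m} v) := by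
  intro Φ hΦ hs
  rw [TemperedDistribution.lineDerivOp_apply_apply, TemperedDistribution.lineDerivOp_apply_apply,
    map_neg, map_neg]
  congr 1
  have h1 := tsupport_lineDeriv_subset Φ m
  exact h _ (hΦ.of_isClosed_subset (isClosed_tsupport _) h1) (h1.trans hs)

theorem EqOnSlab.refl (a b : ℝ) (u : 𝓢'(ST n, ℂ)) : EqOnSlab a b u u := fun _ _ _ ↦ rfl

theorem EqOnSlab.symm {a b : ℝ} {u v : 𝓢'(ST n, ℂ)} (h : EqOnSlab a b u v) :
    EqOnSlab a b v u := fun Φ h1 h2 ↦ (h Φ h1 h2).symm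

theorem EqOnSlab.mono {a b a' b' : ℝ} {u v : 𝓢'(ST n, ℂ)} (h : EqOnSlab a b u v)
    (ha : a ≤ a') (hb : b' ≤ b) : EqOnSlab a' b' u v :=
  fun Φ h1 h2 ↦ h Φ h1 fun _ hz ↦ ⟨ha.trans_lt (h2 hz).1, (h2 hz).2.trans_le hb⟩

theorem EqOnSlab.add {a b : ℝ} {u v u' v' : 𝓢'(ST n, ℂ)} (h : EqOnSlab a b u v)
    (h' : EqOnSlab a b u' v') : EqOnSlab a b (u + u') (v + v') := by
  intro Φ h1 h2
  simp [h Φ h1 h2, h' Φ h1 h2]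

theorem EqOnSlab.neg {a b : ℝ} {u v : 𝓢'(ST n, ℂ)} (h : EqOnSlab a b u v) :
    EqOnSlab a b (-u) (-v) := by
  intro Φ h1 h2
  simp [h Φ h1 h2]

theorem EqOnSlab.sub {a b : ℝ} {u v u' v' : 𝓢'(ST n, ℂ)} (h : EqOnSlab a b u v)
    (h' : EqOnSlab a b u' v') : EqOnSlab a b (u - u') (v - v') := by
  rw [sub_eq_add_neg, sub_eq_add_neg]
  exact h.add h'.neg

theorem EqOnSlab.dt {a b : ℝ} {u v : 𝓢'(ST n, ℂ)} (h : EqOnSlab a b u v) :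
    EqOnSlab a b (dt u) (dt v) := h.lineDeriv _

theorem EqOnSlab.box {a b : ℝ} {u v : 𝓢'(ST n, ℂ)} (h : EqOnSlab a b u v) :
    EqOnSlab a b (box u) (box v) := by
  have h1 : ∀ s : Finset (Fin n), EqOnSlab a b
      (∑ i ∈ s, ∂_{pt 0 (EuclideanSpace.single i (1 : ℝ))}
        (∂_{pt 0 (EuclideanSpace.single i (1 : ℝ))} u))
      (∑ i ∈ s, ∂_{pt 0 (EuclideanSpace.single i (1 : ℝ))}
        (∂_{pt 0 (EuclideanSpace.single i (1 : ℝ))} v)) := by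
    classical
    intro s
    induction s using Finset.induction_on with
    | empty => exact EqOnSlab.refl _ _ _
    | insert i s hi ih =>
      rw [Finset.sum_insert hi, Finset.sum_insert hi]
      exact ((h.lineDeriv _).lineDeriv _).add ih
  exact h.dt.dt.neg.add (h1 _)

theorem dt_add (u v : 𝓢'(ST n, ℂ)) : dt (u + v) = dt u + dt v := lineDerivOp_add _ _ _

theorem dt_smul (c : ℂ) (u : 𝓢'(ST n, ℂ)) : dt (c • u) = c • dt u := lineDerivOp_smul _ _ _

theorem box_add (u v : 𝓢'(ST n, ℂ)) : box (u + v) = box u + box v := by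
  simp only [box, dt_add, lineDerivOp_add, Finset.sum_add_distrib]
  abel

theorem box_smul (c : ℂ) (u : 𝓢'(ST n, ℂ)) : box (c • u) = c • box u := by
  simp only [box, dt_smul, lineDerivOp_smul, smul_add, Finset.smul_sum, smul_neg]

theorem neg_eq_smul (u : 𝓢'(ST n, ℂ)) : -u = (-1 : ℂ) • u := by
  ext φ; simp

theorem dt_neg (u : 𝓢'(ST n, ℂ)) : dt (-u) = -dt u := by
  rw [neg_eq_smul, dt_smul, ← neg_eq_smul]

theorem box_neg (u : 𝓢'(ST n, ℂ)) : box (-u) = -box u := by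
  rw [neg_eq_smul, box_smul, ← neg_eq_smul]

theorem dt_sub (u v : 𝓢'(ST n, ℂ)) : dt (u - v) = dt u - dt v := by
  rw [sub_eq_add_neg, dt_add, dt_neg, ← sub_eq_add_neg]

theorem box_sub (u v : 𝓢'(ST n, ℂ)) : box (u - v) = box u - box v := by
  rw [sub_eq_add_neg, box_add, box_neg, ← sub_eq_add_neg]

theorem IsPath.neg {u : 𝓢'(ST n, ℂ)} {U : ℝ → 𝓢'(Sp n, ℂ)} (hu : IsPath u U) :
    IsPath (-u) (-U) := by
  have e : (-1 : ℂ) • U = -U := by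
    ext t φ; simp
  rw [neg_eq_smul, ← e]
  exact hu.smul _

theorem IsPath.sub {u v : 𝓢'(ST n, ℂ)} {U V : ℝ → 𝓢'(Sp n, ℂ)} (hu : IsPath u U)
    (hv : IsPath v V) : IsPath (u - v) (U - V) := by
  rw [sub_eq_add_neg, sub_eq_add_neg]
  exact hu.add hv.neg

/-- Product test functions show that t ↦ `U t ψ` vanishes almost everywhere on the open interval;
continuity then gives every t, endpoints included, and compactly supported ψ determine a tempered
distribution. The endpoints are what allow data at t = 0 to be read off from a slab. -/
theorem IsPath.eq_zero_of_eqOnSlab {u : 𝓢'(ST n, ℂ)} {U : ℝ → 𝓢'(Sp n, ℂ)} (hu : IsPath u U)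
    {a b : ℝ} (hab : a < b) (h : EqOnSlab a b u 0) {t : ℝ} (ht : t ∈ Set.Icc a b) : U t = 0 := by
  refine eq_zero_of_forall_hasCompactSupport fun ψ hψ ↦ ?_
  have hc : Continuous fun t ↦ U t ψ :=
    (PointwiseConvergenceCLM.evalCLM (RingHom.id ℂ) ℂ ψ).continuous.comp hu.1
  have hae : ∀ᵐ x, x ∈ Set.Ioo a b → U x ψ = 0 := by
    refine isOpen_Ioo.ae_eq_zero_of_integral_contDiff_smul_eq_zero
      (hc.locallyIntegrable.locallyIntegrableOn _) ?_
    intro φ hφ hφc hφs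
    obtain ⟨Φ, hΦc, hΦ, hΦs⟩ := exists_tensor hφ hφc ψ hψ
    have h1 := h Φ hΦc fun z hz ↦ hφs (hΦs hz)
    rw [(hu.2 Φ).2] at h1
    simp only [_root_.zero_apply] at h1
    rw [← h1]
    refine integral_congr_ae (Filter.Eventually.of_forall fun t ↦ ?_)
    have e : sliceAt t Φ = (φ t : ℂ) • ψ := by
      ext x
      rw [sliceAt_apply, hΦ]
      simp
    simp only [e, map_smul]
    simp
  have hopen : Set.EqOn (fun t ↦ U t ψ) 0 (Set.Ioo a b) := by
    have h1 : (fun t ↦ U t ψ) =ᵐ[volume.restrict (Set.Ioo a b)] 0 := by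
      rw [Filter.EventuallyEq, ae_restrict_iff' measurableSet_Ioo]
      filter_upwards [hae] with y hy hy2
      exact hy hy2
    exact Measure.eqOn_open_of_ae_eq h1 isOpen_Ioo hc.continuousOn continuousOn_const
  have h3 : Set.EqOn (fun t ↦ U t ψ) 0 (closure (Set.Ioo a b)) :=
    Set.EqOn.closure hopen hc continuous_const
  rw [closure_Ioo hab.ne] at h3
  exact h3 ht

theorem IsPath.eq_of_eqOnSlab {u v : 𝓢'(ST n, ℂ)} {U V : ℝ → 𝓢'(Sp n, ℂ)} (hu : IsPath u U)
    (hv : IsPath v V) {a b : ℝ} (hab : a < b) (h : EqOnSlab a b u v) {t : ℝ}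
    (ht : t ∈ Set.Icc a b) : U t = V t := by
  have h1 := h.sub (EqOnSlab.refl a b v)
  rw [sub_self] at h1
  have := (hu.sub hv).eq_zero_of_eqOnSlab hab h1 ht
  exact sub_eq_zero.1 this

theorem IsPath.unique {u : 𝓢'(ST n, ℂ)} {U V : ℝ → 𝓢'(Sp n, ℂ)} (hu : IsPath u U)
    (hv : IsPath u V) : U = V :=
  funext fun t ↦ hu.eq_of_eqOnSlab hv (show t - 1 < t + 1 by linarith) (EqOnSlab.refl _ _ _)
    ⟨by linarith, by linarith⟩

theorem timeShift_apply (h : ℝ) (u : 𝓢'(ST n, ℂ)) (Φ : 𝓢(ST n, ℂ)) :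
    timeShift h u Φ = u (SchwartzMap.compSubConstCLM ℂ (pt h (0 : Sp n)) Φ) := rfl

theorem timeShift_lineDeriv (h : ℝ) (u : 𝓢'(ST n, ℂ)) (m : ST n) :
    ∂_{m} (timeShift h u) = timeShift h (∂_{m} u) := by
  ext Φ
  rw [timeShift_apply, TemperedDistribution.lineDerivOp_apply_apply,
    TemperedDistribution.lineDerivOp_apply_apply, timeShift_apply, map_neg, map_neg, map_neg]
  congr 2
  ext z
  rw [SchwartzMap.compSubConstCLM_apply, SchwartzMap.lineDerivOp_apply,
    SchwartzMap.lineDerivOp_apply, _root_.lineDeriv, _root_.lineDeriv]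
  congr 1
  ext r
  rw [SchwartzMap.compSubConstCLM_apply]
  congr 1
  abel

theorem timeShift_dt (h : ℝ) (u : 𝓢'(ST n, ℂ)) : dt (timeShift h u) = timeShift h (dt u) :=
  timeShift_lineDeriv h u _

theorem timeShift_box (h : ℝ) (u : 𝓢'(ST n, ℂ)) : box (timeShift h u) = timeShift h (box u) := by
  simp only [box, timeShift_dt, timeShift_lineDeriv, map_add, map_neg, map_sum]

theorem timeShift_timeShift (h k : ℝ) (u : 𝓢'(ST n, ℂ)) :
    timeShift h (timeShift k u) = timeShift (h + k) u := by
  ext Φ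
  rw [timeShift_apply, timeShift_apply, timeShift_apply]
  congr 1
  ext z
  simp only [SchwartzMap.compSubConstCLM_apply]
  congr 1
  have : pt (h + k) (0 : Sp n) = pt h 0 + pt k 0 := by
    simp [pt, ← WithLp.toLp_add]
  rw [this]
  abel

theorem timeShift_zero (u : 𝓢'(ST n, ℂ)) : timeShift 0 u = u := by
  ext Φ
  rw [timeShift_apply]
  congr 1
  ext z
  rw [SchwartzMap.compSubConstCLM_apply]
  congr 1
  have : pt 0 (0 : Sp n) = 0 := rfl
  rw [this, sub_zero]

theorem EqOnSlab.timeShift {a b : ℝ} {u v : 𝓢'(ST n, ℂ)} (h : EqOnSlab a b u v) (k : ℝ) :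
    EqOnSlab (a - k) (b - k) (timeShift k u) (timeShift k v) := by
  intro Φ hΦ hs
  rw [timeShift_apply, timeShift_apply]
  have e : ((SchwartzMap.compSubConstCLM ℂ (pt k (0 : Sp n)) Φ : 𝓢(ST n, ℂ)) : ST n → ℂ) =
      Φ ∘ (Homeomorph.subRight (pt k (0 : Sp n))) := by
    ext z; rfl
  refine h _ ?_ ?_
  · rw [e]
    exact hΦ.comp_homeomorph _
  · rw [e, tsupport_comp_eq_preimage]
    intro z hz
    have := hs hz
    simp only [Set.mem_ofPred_eq, Homeomorph.coe_subRight, Set.mem_Ioo] at this ⊢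
    have e2 : (z - pt k (0 : Sp n)).fst = z.fst - k := by simp
    rw [e2] at this
    constructor <;> linarith [this.1, this.2]

theorem IsPath.timeShift {u : 𝓢'(ST n, ℂ)} {U : ℝ → 𝓢'(Sp n, ℂ)} (hu : IsPath u U) (k : ℝ) :
    IsPath (timeShift k u) (fun t ↦ U (t + k)) := by
  refine ⟨hu.1.comp (continuous_id.add continuous_const), fun Φ ↦ ?_⟩
  have h := hu.2 (SchwartzMap.compSubConstCLM ℂ (pt k (0 : Sp n)) Φ)
  have e : ∀ t, sliceAt (t + k) (SchwartzMap.compSubConstCLM ℂ (pt k (0 : Sp n)) Φ) =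
      sliceAt t Φ := by
    intro t
    ext x
    rw [sliceAt_apply, sliceAt_apply, SchwartzMap.compSubConstCLM_apply]
    congr 1
    simp [pt, ← WithLp.toLp_sub]
  have h1 := h.1.comp_add_right k
  have h2 := integral_add_right_eq_self (μ := (volume : Measure ℝ)) (fun t ↦ U t (sliceAt t
    (SchwartzMap.compSubConstCLM ℂ (pt k (0 : Sp n)) Φ))) k
  simp only [e] at h1 h2
  exact ⟨h1, by rw [timeShift_apply, h.2, h2]⟩

theorem timeMul_temperate {φ : ℝ → ℝ} (hφ : ContDiff ℝ ∞ φ) (hφc : HasCompactSupport φ) :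
    (fun z : ST n ↦ (φ z.fst : ℂ)).HasTemperateGrowth :=
  ofReal_temperate ((hφc.hasTemperateGrowth hφ).comp (WithLp.fstL 2 ℝ ℝ (Sp n)).hasTemperateGrowth)

theorem eqOnSlab_timeMul {φ : ℝ → ℝ} (hφ : ContDiff ℝ ∞ φ) (hφc : HasCompactSupport φ) {c a b : ℝ}
    (h : ∀ t ∈ Set.Ioo a b, φ t = c) (u : 𝓢'(ST n, ℂ)) :
    EqOnSlab a b (timeMul φ u) ((c : ℂ) • u) := by
  intro Φ _ hs
  rw [timeMul, TemperedDistribution.smulLeftCLM_apply_apply]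
  have : SchwartzMap.smulLeftCLM ℂ (fun z : ST n ↦ (φ z.fst : ℂ)) Φ = (c : ℂ) • Φ := by
    ext z
    rw [SchwartzMap.smulLeftCLM_apply_apply (timeMul_temperate hφ hφc), _root_.smul_apply]
    by_cases hz : z ∈ tsupport Φ
    · rw [h _ (hs hz)]
    · rw [image_eq_zero_of_notMem_tsupport hz, smul_zero, smul_zero]
  rw [this, map_smul]
  rfl

/-- The overlap `b < c` leaves room for a time cut-off which is 1 up to the midpoint of (b, c) and
vanishes beyond c. It splits a test function into one supported in (a, c) and one supported in (b,
d). -/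
theorem EqOnSlab.union {a b c d : ℝ} {u v : 𝓢'(ST n, ℂ)} (h : EqOnSlab a c u v)
    (h' : EqOnSlab b d u v) (hbc : b < c) : EqOnSlab a d u v := by
  intro Φ hΦ hs
  obtain ⟨φ, hφ, hφc, hφ1, hφs⟩ := exists_cutoff (a := min a b - 2) (b := min a b - 1)
    (c := (b + c) / 2) (d := c) (by linarith) (by linarith [min_le_right a b]) (by linarith)
  have ht := timeMul_temperate (n := n) hφ hφc
  set Φ₁ := SchwartzMap.smulLeftCLM ℂ (fun z : ST n ↦ (φ z.fst : ℂ)) Φ with hΦ₁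
  have e1 : ∀ z, Φ₁ z = (φ z.fst : ℂ) * Φ z := fun z ↦ by
    rw [hΦ₁, SchwartzMap.smulLeftCLM_apply_apply ht, smul_eq_mul]
  have s1 : tsupport Φ₁ ⊆ tsupport Φ := closure_mono fun z hz ↦ by
    rw [Function.mem_support, e1] at hz
    exact right_ne_zero_of_mul hz
  have s1' : tsupport Φ₁ ⊆ {z | z.fst ∈ tsupport φ} :=
    closure_minimal (fun z hz ↦ by
      rw [Function.mem_support, e1] at hz
      have := left_ne_zero_of_mul hz
      exact subset_tsupport _ (by simpa using this))
      ((isClosed_tsupport φ).preimage continuous_fst_ST)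
  have s2 : tsupport (Φ - Φ₁) ⊆ tsupport Φ := closure_mono fun z hz ↦ by
    rw [Function.mem_support] at hz ⊢
    intro h0
    exact hz (by simp [e1, h0])
  have s2' : tsupport (Φ - Φ₁) ⊆ (fun z : ST n ↦ z.fst) ⁻¹' (Set.Iic a ∪ Set.Ici ((b + c) / 2)) :=
    closure_minimal (fun z hz ↦ by
      rw [Function.mem_support] at hz
      by_contra hcon
      simp only [Set.mem_preimage, Set.mem_union, Set.mem_Iic, Set.mem_Ici, not_or, not_le]
        at hcon
      have : φ z.fst = 1 := hφ1 _ ⟨by linarith [min_le_left a b], hcon.2.le⟩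
      exact hz (by simp [e1, this]))
      ((isClosed_Iic.union isClosed_Ici).preimage continuous_fst_ST)
  have h1 := h Φ₁ (hΦ.of_isClosed_subset (isClosed_tsupport _) s1) fun z hz ↦
    ⟨(hs (s1 hz)).1, (hφs (s1' hz)).2⟩
  have h2 := h' (Φ - Φ₁) (hΦ.of_isClosed_subset (isClosed_tsupport _) s2) fun z hz ↦ by
    have hz1 := hs (s2 hz)
    refine ⟨?_, hz1.2⟩
    rcases s2' hz with h3 | h3
    · exact absurd hz1.1 (not_lt.2 h3)
    · exact lt_of_lt_of_le (by linarith) (show (b + c) / 2 ≤ z.fst from h3)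
  have e : Φ = Φ₁ + (Φ - Φ₁) := by abel
  rw [e, map_add, map_add, h1, h2]

/-- The weak form of the wave equation on product test functions. -/
theorem IsPath.wave_weak {u : 𝓢'(ST n, ℂ)} {U V : ℝ → 𝓢'(Sp n, ℂ)} (hU : IsPath u U)
    (hV : IsPath (dt u) V) {a b : ℝ} (h : EqOnSlab a b (box u) 0) {ψ : 𝓢(Sp n, ℂ)}
    (hψ : HasCompactSupport ψ) {φ : ℝ → ℝ} (hφ : ContDiff ℝ ∞ φ) (hφc : HasCompactSupport φ)
    (hφs : tsupport φ ⊆ Set.Ioo a b) :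
    (∫ t, deriv φ t • V t ψ) + ∫ t, φ t • U t (∑ i : Fin n,
      ∂_{EuclideanSpace.single i (1 : ℝ)} (∂_{EuclideanSpace.single i (1 : ℝ)} ψ)) = 0 := by
  obtain ⟨Φ, hΦc, hΦ, hΦs⟩ := exists_tensor hφ hφc ψ hψ
  have h1 := h Φ hΦc fun z hz ↦ hφs (hΦs hz)
  have e0 : box u Φ = WaveLWP.dt u (∂_{pt 1 (0 : Sp n)} Φ) + u (∑ i : Fin n,
      ∂_{pt 0 (EuclideanSpace.single i (1 : ℝ))}
        (∂_{pt 0 (EuclideanSpace.single i (1 : ℝ))} Φ)) := by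
    have hs : ∀ (s : Finset (Fin n)) (F : Fin n → 𝓢'(ST n, ℂ)), (∑ i ∈ s, F i) Φ =
        ∑ i ∈ s, F i Φ := fun s F ↦ by
      rw [_root_.sum_apply]
    rw [box, _root_.add_apply, hs, map_sum]
    congr 1
    · rw [_root_.neg_apply]
      conv_lhs => rw [WaveLWP.dt, TemperedDistribution.lineDerivOp_apply_apply, map_neg, neg_neg]
    · refine Finset.sum_congr rfl fun i _ ↦ ?_
      rw [TemperedDistribution.lineDerivOp_apply_apply,
        TemperedDistribution.lineDerivOp_apply_apply]
      simp only [lineDerivOp_neg, neg_neg]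
  rw [e0, (hV.2 _).2, (hU.2 _).2] at h1
  rw [_root_.zero_apply] at h1
  rw [← h1]
  congr 1
  · refine integral_congr_ae (Filter.Eventually.of_forall fun t ↦ ?_)
    have e : sliceAt t (∂_{pt 1 (0 : Sp n)} Φ) = ((deriv φ t : ℝ) : ℂ) • ψ := by
      ext x
      rw [sliceAt_apply, tensor_dt hφ hΦ]
      simp
    simp only [e, map_smul]
    simp
  · refine integral_congr_ae (Filter.Eventually.of_forall fun t ↦ ?_)
    have e : sliceAt t Φ = ((φ t : ℝ) : ℂ) • ψ := by
      ext x
      rw [sliceAt_apply, hΦ]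
      simp
    have e2 : sliceAt t (∑ i : Fin n, ∂_{pt 0 (EuclideanSpace.single i (1 : ℝ))}
        (∂_{pt 0 (EuclideanSpace.single i (1 : ℝ))} Φ)) = ((φ t : ℝ) : ℂ) • ∑ i : Fin n,
        ∂_{EuclideanSpace.single i (1 : ℝ)} (∂_{EuclideanSpace.single i (1 : ℝ)} ψ) := by
      rw [map_sum, Finset.smul_sum]
      refine Finset.sum_congr rfl fun i _ ↦ ?_
      rw [sliceAt_lineDeriv, sliceAt_lineDeriv, e, lineDerivOp_smul, lineDerivOp_smul]
    simp only [e2, map_smul]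
    simp

end TestFunctions

/-! ### Weighted norms of Fourier functions and Sobolev spaces -/

section Sobolev

variable {n : ℕ}

/-- The weighted norm `‖Λ^s b‖_{L²}` of a nonnegative function of the frequency. -/
def wnorm (s : ℝ) (b : Sp n → ℝ≥0∞) : ℝ≥0∞ :=
  (∫⁻ ξ, (ENNReal.ofReal (symS s ξ) * b ξ) ^ (2 : ℝ)) ^ (1 / 2 : ℝ)

theorem wnorm_mono {s : ℝ} {b b' : Sp n → ℝ≥0∞} (h : ∀ᵐ ξ, b ξ ≤ b' ξ) :
    wnorm s b ≤ wnorm s b' := by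
  refine ENNReal.rpow_le_rpow (lintegral_mono_ae ?_) (by norm_num)
  filter_upwards [h] with ξ hξ
  gcongr

theorem wnorm_const_mul {s : ℝ} (b : Sp n → ℝ≥0∞) {c : ℝ≥0∞} (hc : c ≠ ⊤) :
    wnorm s (fun ξ ↦ c * b ξ) = c * wnorm s b := by
  have e : ∀ ξ, (ENNReal.ofReal (symS s ξ) * (c * b ξ)) ^ (2 : ℝ) =
      c ^ (2 : ℝ) * (ENNReal.ofReal (symS s ξ) * b ξ) ^ (2 : ℝ) := by
    intro ξ
    rw [← ENNReal.mul_rpow_of_nonneg _ _ (by norm_num)]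
    congr 1
    ring
  simp only [wnorm, e]
  rw [lintegral_const_mul' _ _ (by finiteness), ENNReal.mul_rpow_of_nonneg _ _ (by norm_num),
    ← ENNReal.rpow_mul]
  norm_num

theorem wnorm_add_le {s : ℝ} {b b' : Sp n → ℝ≥0∞} (hb : AEMeasurable b) (hb' : AEMeasurable b') :
    wnorm s (fun ξ ↦ b ξ + b' ξ) ≤ wnorm s b + wnorm s b' := by
  have hm : AEMeasurable fun ξ : Sp n ↦ ENNReal.ofReal (symS s ξ) :=
    (continuous_symS s).measurable.ennreal_ofReal.aemeasurable
  have := ENNReal.lintegral_Lp_add_le (hm.mul hb) (hm.mul hb') (one_le_two (α := ℝ))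
  simp only [wnorm, mul_add]
  exact this

theorem wnorm_symS {s r : ℝ} (b : Sp n → ℝ≥0∞) :
    wnorm s (fun ξ ↦ ENNReal.ofReal (symS r ξ) * b ξ) = wnorm (s + r) b := by
  simp only [wnorm, symS_add, ENNReal.ofReal_mul (symS_pos _ _).le, mul_assoc]

theorem wnorm_eq_eLpNorm (s : ℝ) (V : Sp n → ℂ) :
    wnorm s (fun ξ ↦ ‖V ξ‖ₑ) = eLpNorm (fun ξ ↦ (symS s ξ : ℂ) * V ξ) 2 volume := by
  rw [eLpNorm_eq_lintegral_rpow_enorm_toReal (by norm_num) (by norm_num)]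
  simp only [wnorm, ENNReal.toReal_ofNat, enorm_mul]
  congr 2
  ext ξ
  congr 2
  rw [← ofReal_norm, Complex.norm_real, Real.norm_of_nonneg (symS_pos _ _).le]

theorem mult_mult {E : Type} [NormedAddCommGroup E] [InnerProductSpace ℝ E]
    [FiniteDimensional ℝ E] [MeasurableSpace E] [BorelSpace E] {m m' : E → ℝ}
    (hm : m.HasTemperateGrowth) (hm' : m'.HasTemperateGrowth) (h : ∀ x, m x * m' x = 1)
    (u : 𝓢'(E, ℂ)) : mult m' (mult m u) = u := by
  rw [mult, mult, TemperedDistribution.fourierMultiplierCLM_fourierMultiplierCLM_apply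
    (ofReal_temperate hm) (ofReal_temperate hm')]
  have h3 : ((fun x ↦ (m x : ℂ)) * fun x ↦ (m' x : ℂ)) = fun _ ↦ (1 : ℂ) := by
    ext x
    simp only [Pi.mul_apply]
    rw [← Complex.ofReal_mul, h x, Complex.ofReal_one]
  rw [h3]
  simp

theorem exists_Lp_of_hasFourierFun {E : Type} [NormedAddCommGroup E] [InnerProductSpace ℝ E]
    [FiniteDimensional ℝ E] [MeasurableSpace E] [BorelSpace E] {v : 𝓢'(E, ℂ)} {V : E → ℂ}
    (h : HasFourierFun v V) (hV : MemLp V 2) :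
    ∃ f : Lp ℂ 2 (volume : Measure E), (f : 𝓢'(E, ℂ)) = v ∧ ‖f‖ₑ = eLpNorm V 2 volume := by
  let f : Lp ℂ 2 (volume : Measure E) := 𝓕⁻ (hV.toLp V)
  have hf : 𝓕 f = hV.toLp V := fourier_fourierInv_eq _
  refine ⟨f, (Lp.hasFourierFun f).ext h ?_, ?_⟩
  · rw [hf]
    exact hV.coeFn_toLp
  · rw [← ofReal_norm, ← Lp.norm_fourier_eq, hf, ofReal_norm, Lp.enorm_toLp]

theorem exists_H {s : ℝ} {v : 𝓢'(Sp n, ℂ)} {V : Sp n → ℂ} (h : HasFourierFun v V)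
    (hV : wnorm s (fun ξ ↦ ‖V ξ‖ₑ) < ⊤) : ∃ w : (H n s).carrier, (H n s).toDist w = v := by
  have h1 := h.mult (symS_temperate s)
  obtain ⟨f, hf, -⟩ := exists_Lp_of_hasFourierFun h1
    ⟨h1.1, by rwa [← wnorm_eq_eLpNorm]⟩
  refine ⟨f, ?_⟩
  change mult (symS (-s)) (f : 𝓢'(Sp n, ℂ)) = v
  rw [hf, mult_mult (symS_temperate s) (symS_temperate (-s)) (symS_neg s)]

theorem exists_Lp_H {s : ℝ} (w : (H n s).carrier) : ∃ f : Lp ℂ 2 (volume : Measure (Sp n)),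
    (H n s).toDist w = mult (symS (-s)) (f : 𝓢'(Sp n, ℂ)) ∧ ‖w‖ₑ = ‖f‖ₑ :=
  ⟨w, rfl, rfl⟩

theorem enorm_H {s : ℝ} {w : (H n s).carrier} {V : Sp n → ℂ}
    (h : HasFourierFun ((H n s).toDist w) V) : ‖w‖ₑ = wnorm s (fun ξ ↦ ‖V ξ‖ₑ) := by
  obtain ⟨f, hf, hn⟩ := exists_Lp_H w
  have h1 := h.mult (symS_temperate s)
  rw [hf, mult_mult (symS_temperate (-s)) (symS_temperate s)
      (fun ξ ↦ by rw [mul_comm]; exact symS_neg s ξ) _] at h1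
  have h2 := (Lp.hasFourierFun f).ae_eq h1
  rw [hn, wnorm_eq_eLpNorm, ← eLpNorm_congr_ae h2, ← Lp.enorm_def, ← ofReal_norm f,
    ← Lp.norm_fourier_eq, ofReal_norm]

theorem exists_hasFourierFun_H {s : ℝ} (w : (H n s).carrier) :
    ∃ V : Sp n → ℂ, Measurable V ∧ HasFourierFun ((H n s).toDist w) V := by
  obtain ⟨f, hf, -⟩ := exists_Lp_H w
  refine ⟨fun ξ ↦ (symS (-s) ξ : ℂ) * (𝓕 f : Lp ℂ 2 (volume : Measure (Sp n))) ξ, ?_, ?_⟩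
  · exact (Complex.continuous_ofReal.comp (continuous_symS (-s))).measurable.mul
      (Lp.stronglyMeasurable _).measurable
  · rw [hf]
    exact (Lp.hasFourierFun f).mult (symS_temperate (-s))

/-- Distances are weighted L² integrals of differences of Fourier functions, so this is dominated
convergence. -/
theorem tendsto_H {s : ℝ} {ι : Type*} {l : Filter ι} [l.IsCountablyGenerated]
    {w : ι → (H n s).carrier} {w₀ : (H n s).carrier} {p : ι → Sp n → ℂ} {p₀ : Sp n → ℂ}
    (hw : ∀ i, HasFourierFun ((H n s).toDist (w i)) (p i))
    (hw₀ : HasFourierFun ((H n s).toDist w₀) p₀) {b : Sp n → ℝ≥0∞} (hb : wnorm s b < ⊤)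
    (hbd : ∀ᵐ ξ, ∀ i, ‖p i ξ - p₀ ξ‖ₑ ≤ b ξ)
    (hlim : ∀ᵐ ξ, Filter.Tendsto (fun i ↦ p i ξ) l (nhds (p₀ ξ))) :
    Filter.Tendsto w l (nhds w₀) := by
  rw [tendsto_iff_edist_tendsto_0]
  have e : ∀ i, edist (w i) w₀ = wnorm s (fun ξ ↦ ‖p i ξ - p₀ ξ‖ₑ) := by
    intro i
    rw [edist_eq_enorm_sub]
    refine enorm_H ?_
    rw [map_sub]
    exact (hw i).sub hw₀
  simp only [e, wnorm]
  have h0 : (0 : ℝ≥0∞) = (∫⁻ ξ : Sp n, 0) ^ (1 / 2 : ℝ) := by simp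
  rw [h0]
  refine ((ENNReal.continuous_rpow_const (y := 1 / 2)).tendsto _).comp ?_
  refine tendsto_lintegral_filter_of_dominated_convergence'
    (fun ξ ↦ (ENNReal.ofReal (symS s ξ) * b ξ) ^ (2 : ℝ)) ?_ ?_ ?_ ?_
  · refine Filter.Eventually.of_forall fun i ↦ ?_
    exact ((continuous_symS s).measurable.ennreal_ofReal.aemeasurable.mul
      ((hw i).1.sub hw₀.1).enorm).pow_const _
  · refine Filter.Eventually.of_forall fun i ↦ ?_
    filter_upwards [hbd] with ξ hξ
    have := hξ i
    gcongr
  · have := hb.ne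
    rw [wnorm, Ne, ENNReal.rpow_eq_top_iff_of_pos (by norm_num)] at this
    exact this
  · filter_upwards [hlim] with ξ hξ
    have h1 : Filter.Tendsto (fun i ↦ ‖p i ξ - p₀ ξ‖ₑ) l (nhds 0) := by
      have := (hξ.sub_const (p₀ ξ)).enorm
      simpa using this
    have h2 := ENNReal.Tendsto.const_mul (a := ENNReal.ofReal (symS s ξ)) h1
      (Or.inr ENNReal.ofReal_ne_top)
    have h3 := ((ENNReal.continuous_rpow_const (y := 2)).tendsto _).comp h2
    simpa [Function.comp_def] using h3

/-- Cauchy–Schwarz against (1 + |ξ|²)^{-(n+1)/2}, which is square integrable on ℝⁿ. -/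
theorem integrable_symS_mul_of_wnorm {s : ℝ} {b : Sp n → ℝ} (hb : AEStronglyMeasurable b)
    (h : wnorm s (fun ξ ↦ ‖b ξ‖ₑ) < ⊤) :
    Integrable fun ξ ↦ symS (-((n : ℝ) + 1 - s)) ξ * b ξ := by
  have h1 : MemLp (fun ξ ↦ symS s ξ * b ξ) 2 := by
    refine ⟨(continuous_symS s).aestronglyMeasurable.mul hb, ?_⟩
    rw [eLpNorm_eq_lintegral_rpow_enorm_toReal (by norm_num) (by norm_num)]
    refine lt_of_eq_of_lt ?_ h
    simp only [wnorm, ENNReal.toReal_ofNat, enorm_mul]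
    congr 2
    ext ξ
    congr 2
    rw [← ofReal_norm, Real.norm_of_nonneg (symS_pos _ _).le]
  have h2 : MemLp (symS (n := n) (-((n : ℝ) + 1))) 2 := by
    rw [memLp_two_iff_integrable_sq (continuous_symS _).aestronglyMeasurable]
    have : ∀ ξ : Sp n, symS (-((n : ℝ) + 1)) ξ ^ 2 = symS (-((n : ℝ) + 1) + -((n : ℝ) + 1)) ξ := by
      intro ξ
      rw [symS_add, sq]
    simp only [this]
    refine integrable_symS ?_
    have := n.cast_nonneg (α := ℝ)
    linarith
  refine (h2.integrable_mul h1).congr (Filter.Eventually.of_forall fun ξ ↦ ?_)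
  simp only [Pi.mul_apply]
  rw [← mul_assoc, ← symS_add]
  ring_nf

/-- The embedding `H^s ⊂ H^r`, `r ≤ s`, on the level of norms. -/
theorem wnorm_mono_exponent {r s : ℝ} (h : r ≤ s) (b : Sp n → ℝ≥0∞) : wnorm r b ≤ wnorm s b := by
  refine ENNReal.rpow_le_rpow (lintegral_mono fun ξ ↦ ?_) (by norm_num)
  have := symS_mono h ξ
  gcongr

end Sobolev

/-! ### Continuous curves in Sobolev spaces from integrable fibres -/

section Energy

variable {n : ℕ}

/-- `∫ |U(τ, ξ)| dτ`. -/
def fibMass (U : ST n → ℂ) (ξ : Sp n) : ℝ≥0∞ := ∫⁻ τ, ‖U (pt τ ξ)‖ₑ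

/-- The inverse Fourier transform in the time variable. -/
def invFib (U : ST n → ℂ) (ξ : Sp n) (t : ℝ) : ℂ := 𝓕⁻ (fun τ ↦ U (pt τ ξ)) t

/-- The symbol of `∂_t` applied to `U`. -/
def dtFun (U : ST n → ℂ) (z : ST n) : ℂ := 2 * Real.pi * Complex.I * z.fst * U z

theorem measurable_dtFun {U : ST n → ℂ} (hU : Measurable U) : Measurable (dtFun U) := by
  have := (continuous_fst_ST (n := n)).measurable
  unfold dtFun
  fun_prop

theorem measurable_fibMass {U : ST n → ℂ} (hU : Measurable U) : Measurable (fibMass U) :=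
  Measurable.lintegral_prod_right' (f := fun q : Sp n × ℝ ↦ ‖U (pt q.2 q.1)‖ₑ)
    (hU.comp measurable_pt).enorm

theorem fibMass_congr {U U' : ST n → ℂ} (h : U =ᵐ[volume] U') : fibMass U =ᵐ[volume] fibMass U' := by
  filter_upwards [ae_pt h] with ξ hξ
  refine lintegral_congr_ae ?_
  filter_upwards [hξ] with τ hτ
  rw [hτ]

theorem enorm_invFib_le (U : ST n → ℂ) (ξ : Sp n) (t : ℝ) : ‖invFib U ξ t‖ₑ ≤ fibMass U ξ := by
  rw [invFib, Real.fourierInv_eq']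
  refine (enorm_integral_le_lintegral_enorm _).trans (le_of_eq ?_)
  refine lintegral_congr fun τ ↦ ?_
  rw [enorm_smul]
  have : ‖Complex.exp (↑(2 * Real.pi * inner ℝ τ t) * Complex.I)‖ₑ = 1 := by
    rw [← ofReal_norm, Complex.norm_exp_ofReal_mul_I, ENNReal.ofReal_one]
  rw [this, one_mul]

theorem ae_lt_top_of_wnorm {s : ℝ} {b : Sp n → ℝ≥0∞} (hb : AEMeasurable b) (h : wnorm s b < ⊤) :
    ∀ᵐ ξ, b ξ < ⊤ := by
  have h1 := h.ne
  rw [wnorm, Ne, ENNReal.rpow_eq_top_iff_of_pos (by norm_num)] at h1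
  have h2 := ae_lt_top' (((continuous_symS s).measurable.ennreal_ofReal.aemeasurable.mul
    hb).pow_const (2 : ℝ)) h1
  filter_upwards [h2] with ξ hξ
  rw [ENNReal.rpow_lt_top_iff_of_pos (by norm_num)] at hξ
  by_contra hcon
  rw [not_lt, top_le_iff] at hcon
  rw [Pi.mul_apply, hcon, ENNReal.mul_top] at hξ
  · exact lt_irrefl _ hξ
  · simpa using symS_pos s ξ

theorem ae_integrable_of_wnorm {s : ℝ} {U : ST n → ℂ} (hU : Measurable U)
    (h : wnorm s (fibMass U) < ⊤) : ∀ᵐ ξ : Sp n, Integrable fun τ ↦ U (pt τ ξ) := by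
  filter_upwards [ae_lt_top_of_wnorm (measurable_fibMass hU).aemeasurable h] with ξ hξ
  exact ⟨(hU.comp (continuous_pt_left ξ).measurable).aestronglyMeasurable, hξ⟩

theorem hasFib_invFib {s : ℝ} {u : 𝓢'(ST n, ℂ)} {U : ST n → ℂ} (hu : HasFourierFun u U)
    (hU : Measurable U) (h : wnorm s (fibMass U) < ⊤) : HasFib u (invFib U) := by
  have h1 := ae_integrable_of_wnorm hU h
  have e : ∀ ξ, ∫ τ, ‖U (pt τ ξ)‖ = (fibMass U ξ).toReal := fun ξ ↦
    integral_norm_eq_lintegral_enorm (hU.comp (continuous_pt_left ξ).measurable).aestronglyMeasurable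
  refine hu.hasFib hU (M := (n : ℝ) + 1 - s) h1 ?_
  simp only [e]
  refine integrable_symS_mul_of_wnorm (measurable_fibMass hU).ennreal_toReal.aestronglyMeasurable
    (lt_of_le_of_lt (wnorm_mono (Filter.Eventually.of_forall fun ξ ↦ ?_)) h)
  rw [Real.enorm_eq_ofReal ENNReal.toReal_nonneg]
  exact ENNReal.ofReal_toReal_le

theorem ae_continuous_invFib {s : ℝ} {U : ST n → ℂ}
    (hU : Measurable U) (h : wnorm s (fibMass U) < ⊤) : ∀ᵐ ξ, Continuous (invFib U ξ) := by
  filter_upwards [ae_integrable_of_wnorm hU h] with ξ hξ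
  exact continuous_fourierInv hξ

theorem hasDerivAt_fourierInv {f : ℝ → ℂ} (hf : Integrable f)
    (hf' : Integrable fun τ : ℝ ↦ (2 * Real.pi * Complex.I * τ) * f τ) (t : ℝ) :
    HasDerivAt (𝓕⁻ f) (𝓕⁻ (fun τ : ℝ ↦ (2 * Real.pi * Complex.I * τ) * f τ) t) t := by
  have hc : (2 * Real.pi * Complex.I : ℂ) ≠ 0 := by
    simp [Real.pi_ne_zero]
  have h1 : Integrable fun τ : ℝ ↦ τ • f τ := by
    refine (hf'.const_mul (2 * Real.pi * Complex.I)⁻¹).congr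
      (Filter.Eventually.of_forall fun τ ↦ ?_)
    simp only [Complex.real_smul]
    field_simp
  have h2 := Real.hasDerivAt_fourier hf h1 (-t)
  have h3 := h2.scomp t (hasDerivAt_neg t)
  have e1 : 𝓕⁻ f = 𝓕 f ∘ Neg.neg := funext fun x ↦ Real.fourierInv_eq_fourier_neg f x
  rw [e1]
  refine h3.congr_deriv ?_
  rw [Real.fourierInv_eq_fourier_neg, Real.fourier_real_eq, Real.fourier_real_eq, ← integral_smul]
  refine integral_congr_ae (Filter.Eventually.of_forall fun τ ↦ ?_)
  simp only [Circle.smul_def, smul_eq_mul, Complex.real_smul]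
  push_cast
  ring

theorem ae_hasDerivAt_invFib {s r : ℝ} {U : ST n → ℂ} (hU : Measurable U)
    (h : wnorm s (fibMass U) < ⊤) (h' : wnorm r (fibMass (dtFun U)) < ⊤) :
    ∀ᵐ ξ, ∀ t, HasDerivAt (invFib U ξ) (invFib (dtFun U) ξ t) t := by
  filter_upwards [ae_integrable_of_wnorm hU h, ae_integrable_of_wnorm (measurable_dtFun hU) h']
    with ξ h1 h2 t
  exact hasDerivAt_fourierInv h1 h2 t

/-- A distribution whose Fourier transform has an integrable modulus on the fibres is a continuous
curve in a Sobolev space. -/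
theorem exists_path_H {s : ℝ} {u : 𝓢'(ST n, ℂ)} {U : ST n → ℂ} (hu : HasFourierFun u U)
    (hU : Measurable U) (h : wnorm s (fibMass U) < ⊤) :
    ∃ V : ℝ → (H n s).carrier, Continuous V ∧ IsPath u (fun t ↦ (H n s).toDist (V t)) ∧
      (∀ t, HasFourierFun ((H n s).toDist (V t)) (fun ξ ↦ invFib U ξ t)) ∧
      ∀ t, ‖V t‖ₑ ≤ wnorm s (fibMass U) := by
  obtain ⟨P, hP, hPf⟩ := (hasFib_invFib hu hU h).exists_isPath (ae_continuous_invFib hU h)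
  have hle : ∀ t, wnorm s (fun ξ ↦ ‖invFib U ξ t‖ₑ) ≤ wnorm s (fibMass U) := fun t ↦
    wnorm_mono (Filter.Eventually.of_forall fun ξ ↦ enorm_invFib_le U ξ t)
  have hex : ∀ t, ∃ w : (H n s).carrier, (H n s).toDist w = P t := fun t ↦
    exists_H (hPf t) ((hle t).trans_lt h)
  choose V hV using hex
  have e : (fun t ↦ (H n s).toDist (V t)) = P := funext hV
  have hVf : ∀ t, HasFourierFun ((H n s).toDist (V t)) (fun ξ ↦ invFib U ξ t) := fun t ↦ by
    rw [hV t]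
    exact hPf t
  refine ⟨V, ?_, by rw [e]; exact hP, hVf, fun t ↦ ?_⟩
  · rw [continuous_iff_continuousAt]
    intro t₀
    refine tendsto_H (p := fun t ξ ↦ invFib U ξ t) hVf (hVf t₀)
      (b := fun ξ ↦ 2 * fibMass U ξ) ?_ ?_ ?_
    · rw [wnorm_const_mul _ (by norm_num)]
      exact ENNReal.mul_lt_top (by norm_num) h
    · refine Filter.Eventually.of_forall fun ξ t ↦ ?_
      rw [two_mul]
      exact (enorm_sub_le).trans (add_le_add (enorm_invFib_le _ _ _) (enorm_invFib_le _ _ _))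
    · filter_upwards [ae_continuous_invFib hU h] with ξ hξ
      exact hξ.tendsto t₀
  · rw [enorm_H (hVf t)]
    exact hle t

/-- By the mean value inequality the difference quotients are dominated on each fibre by the mass of
`dtFun U`, so they converge in H^{s-1} to the curve of ∂_t u. -/
theorem exists_path_H_deriv {s : ℝ} {u : 𝓢'(ST n, ℂ)} {U : ST n → ℂ} (hu : HasFourierFun u U)
    (hU : Measurable U) (h : wnorm s (fibMass U) < ⊤)
    (h' : wnorm (s - 1) (fibMass (dtFun U)) < ⊤) :
    ∃ W : ℝ → (H n (s - 1)).carrier, ContDiff ℝ 1 W ∧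
      IsPath u (fun t ↦ (H n (s - 1)).toDist (W t)) := by
  have h1 : wnorm (s - 1) (fibMass U) < ⊤ := (wnorm_mono_exponent (by linarith) _).trans_lt h
  obtain ⟨W, -, hWp, hWf, -⟩ := exists_path_H hu hU h1
  obtain ⟨D, hDc, -, hDf, -⟩ := exists_path_H (u := dt u) (U := dtFun U) hu.dt
    (measurable_dtFun hU) h'
  refine ⟨W, ?_, hWp⟩
  have hd : ∀ t, HasDerivAt W (D t) t := by
    intro t₀
    rw [hasDerivAt_iff_tendsto_slope]
    refine (tendsto_H (p := fun t ξ ↦ ((t - t₀)⁻¹ : ℂ) • (invFib U ξ t - invFib U ξ t₀)) ?_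
      (hDf t₀) (b := fun ξ ↦ 2 * fibMass (dtFun U) ξ) ?_ ?_ ?_)
    · intro t
      rw [slope_def_module]
      have : (t - t₀)⁻¹ • (W t - W t₀) = ((t - t₀)⁻¹ : ℂ) • (W t - W t₀) := by
        rw [← Complex.coe_smul]
        push_cast
        rfl
      rw [this, map_smul, map_sub]
      exact ((hWf t).sub (hWf t₀)).smul _
    · rw [wnorm_const_mul _ (by norm_num)]
      exact ENNReal.mul_lt_top (by norm_num) h'
    · filter_upwards [ae_hasDerivAt_invFib hU h h',
        ae_lt_top_of_wnorm (measurable_fibMass (measurable_dtFun hU)).aemeasurable h'] with ξ hξ hf t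
      rw [two_mul]
      refine (enorm_sub_le).trans (add_le_add ?_ (enorm_invFib_le _ _ _))
      have hb : ∀ x, ‖invFib (dtFun U) ξ x‖ ≤ (fibMass (dtFun U) ξ).toReal := by
        intro x
        have := enorm_invFib_le (dtFun U) ξ x
        rw [← ofReal_norm] at this
        exact (ENNReal.ofReal_le_iff_le_toReal hf.ne).1 this
      have hmv := Convex.norm_image_sub_le_of_norm_hasDerivWithin_le
        (f := invFib U ξ) (s := Set.univ) (fun x _ ↦ (hξ x).hasDerivWithinAt) (fun x _ ↦ hb x)
        convex_univ (Set.mem_univ t₀) (Set.mem_univ t)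
      rw [← ofReal_norm, ← ENNReal.ofReal_toReal hf.ne]
      refine ENNReal.ofReal_le_ofReal ?_
      rw [norm_smul]
      have e1 : ‖((t - t₀)⁻¹ : ℂ)‖ = |t - t₀|⁻¹ := by
        rw [norm_inv, ← Complex.ofReal_sub, Complex.norm_real, Real.norm_eq_abs]
      rw [e1]
      rw [Real.norm_eq_abs] at hmv
      rcases eq_or_ne t t₀ with rfl | hne
      · simp
      · have : 0 < |t - t₀| := abs_pos.2 (sub_ne_zero.2 hne)
        rw [inv_mul_le_iff₀ this, mul_comm]
        exact hmv
    · filter_upwards [ae_hasDerivAt_invFib hU h h'] with ξ hξ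
      have := (hasDerivAt_iff_tendsto_slope.1 (hξ t₀))
      refine this.congr fun t ↦ ?_
      rw [slope_def_module, ← Complex.coe_smul]
      push_cast
      rfl
  rw [contDiff_one_iff_deriv]
  refine ⟨fun t ↦ (hd t).differentiableAt, ?_⟩
  rw [show deriv W = D from funext fun t ↦ (hd t).deriv]
  exact hDc

/-- Cauchy–Schwarz in τ against Λ₋^{-θ}, whose square has a τ-integral bounded uniformly in ξ. This
is the quantitative form of the embedding of ℋ^{s,θ} in continuous curves. -/
theorem wnorm_fibMass_le {θ : ℝ} (hθ : 1 / 2 < θ) : ∃ C : ℝ≥0, ∀ (s : ℝ) (U h : ST n → ℂ),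
    Measurable U → Measurable h →
      (∀ᵐ z, U z = ((symX (-s) z * symMinus (-θ) z : ℝ) : ℂ) * h z) →
      wnorm s (fibMass U) ≤ C * eLpNorm h 2 volume := by
  obtain ⟨C, hC⟩ := lintegral_symMinus_le (n := n) hθ
  refine ⟨C ^ (1 / 2 : ℝ), fun s U h hU hh hUh ↦ ?_⟩
  have key : ∀ᵐ ξ : Sp n, (ENNReal.ofReal (symS s ξ) * fibMass U ξ) ^ (2 : ℝ) ≤
      C * ∫⁻ τ, ‖h (pt τ ξ)‖ₑ ^ (2 : ℝ) := by
    filter_upwards [ae_pt hUh] with ξ hξ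
    have hm1 : AEMeasurable fun τ ↦ ENNReal.ofReal (symMinus (-θ) (pt τ ξ)) :=
      ((continuous_symMinus (-θ)).comp (continuous_pt_left ξ)).measurable.ennreal_ofReal.aemeasurable
    have hm2 : AEMeasurable fun τ ↦ ‖h (pt τ ξ)‖ₑ :=
      (hh.comp (continuous_pt_left ξ).measurable).enorm.aemeasurable
    have e1 : ENNReal.ofReal (symS s ξ) * fibMass U ξ =
        ∫⁻ τ, (ENNReal.ofReal (symMinus (-θ) (pt τ ξ))) * ‖h (pt τ ξ)‖ₑ := by
      rw [fibMass, ← lintegral_const_mul' _ _ ENNReal.ofReal_ne_top]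
      refine lintegral_congr_ae ?_
      filter_upwards [hξ] with τ hτ
      have hp : 0 ≤ symX (-s) (pt τ ξ) * symMinus (-θ) (pt τ ξ) :=
        mul_nonneg (symX_pos _ _).le (symMinus_pos _ _).le
      have h3 := symS_neg s ξ
      rw [hτ, enorm_mul, ← ofReal_norm (((_ : ℝ) : ℂ)), Complex.norm_real,
        Real.norm_of_nonneg hp, ← mul_assoc, ← ENNReal.ofReal_mul (symS_pos _ _).le,
        symX_pt, ← mul_assoc, h3, one_mul]
    have h2 := ENNReal.lintegral_mul_le_Lp_mul_Lq volume Real.HolderConjugate.two_two hm1 hm2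
    rw [e1]
    refine (ENNReal.rpow_le_rpow h2 (by norm_num : (0 : ℝ) ≤ 2)).trans ?_
    rw [ENNReal.mul_rpow_of_nonneg _ _ (by norm_num), ← ENNReal.rpow_mul, ← ENNReal.rpow_mul]
    norm_num
    gcongr
    refine le_trans (le_of_eq ?_) (hC ξ)
    refine lintegral_congr fun τ ↦ ?_
    rw [← ENNReal.ofReal_pow (symMinus_pos _ _).le, sq, ← symMinus_add]
    ring_nf
  have hh2 : Measurable fun p : Sp n × ℝ ↦ ‖h (pt p.2 p.1)‖ₑ ^ (2 : ℝ) :=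
    (hh.comp measurable_pt).enorm.pow_const _
  calc wnorm s (fibMass U) ≤ (∫⁻ ξ : Sp n, C * ∫⁻ τ, ‖h (pt τ ξ)‖ₑ ^ (2 : ℝ)) ^ (1 / 2 : ℝ) :=
        ENNReal.rpow_le_rpow (lintegral_mono_ae key) (by norm_num)
    _ = _ := by
        rw [lintegral_const_mul' _ _ ENNReal.coe_ne_top, ENNReal.mul_rpow_of_nonneg _ _ (by norm_num),
          ENNReal.coe_rpow_of_nonneg _ (by norm_num),
          eLpNorm_eq_lintegral_rpow_enorm_toReal (by norm_num) (by norm_num), lintegral_pt,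
          Measure.volume_eq_prod, lintegral_prod _ (by simpa using hh2.aemeasurable)]
        simp

/-- The Fourier transform of an element of `ℋ^{s,θ}`. -/
theorem exists_fibre_of_L2 {θ : ℝ} (hθ : 1 / 2 < θ) : ∃ C : ℝ≥0, ∀ (s : ℝ) (u : 𝓢'(ST n, ℂ))
    (p q : Lp ℂ 2 (volume : Measure (ST n))),
    Lam n s (LamMinus n θ u) = (p : 𝓢'(ST n, ℂ)) →
    Lam n (s - 1) (LamMinus n θ (dt u)) = (q : 𝓢'(ST n, ℂ)) →
    ∃ U : ST n → ℂ, Measurable U ∧ HasFourierFun u U ∧ wnorm s (fibMass U) ≤ C * ‖p‖ₑ ∧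
      wnorm (s - 1) (fibMass (dtFun U)) ≤ C * ‖q‖ₑ := by
  obtain ⟨C, hC⟩ := wnorm_fibMass_le (n := n) hθ
  refine ⟨C, fun s u p q hp hq ↦ ?_⟩
  have hnorm : ∀ f : Lp ℂ 2 (volume : Measure (ST n)),
      eLpNorm (𝓕 f : Lp ℂ 2 (volume : Measure (ST n))) 2 volume = ‖f‖ₑ := by
    intro f
    rw [← Lp.enorm_def, ← ofReal_norm, Lp.norm_fourier_eq, ofReal_norm]
  have hinv : ∀ (s : ℝ) (v : 𝓢'(ST n, ℂ)) (f : Lp ℂ 2 (volume : Measure (ST n))),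
      Lam n s (LamMinus n θ v) = (f : 𝓢'(ST n, ℂ)) → HasFourierFun v (fun z ↦
        ((symX (-s) z * symMinus (-θ) z : ℝ) : ℂ) * (𝓕 f : Lp ℂ 2 (volume : Measure (ST n))) z) := by
    intro s v f hf
    have h1 := ((Lp.hasFourierFun f).mult (symX_temperate (-s))).mult (symMinus_temperate (-θ))
    rw [← hf, mult_mult (symX_temperate s) (symX_temperate (-s)) (symX_neg s),
      mult_mult (symMinus_temperate θ) (symMinus_temperate (-θ)) (symMinus_neg θ)] at h1
    refine h1.congr_ae (Filter.Eventually.of_forall fun z ↦ ?_)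
    push_cast
    ring
  have hmeas : ∀ (s : ℝ) (f : Lp ℂ 2 (volume : Measure (ST n))), Measurable (fun z ↦
        ((symX (-s) z * symMinus (-θ) z : ℝ) : ℂ) * (𝓕 f : Lp ℂ 2 (volume : Measure (ST n))) z) := by
    intro s f
    have h1 := (Lp.stronglyMeasurable (𝓕 f : Lp ℂ 2 (volume : Measure (ST n)))).measurable
    have h2 := (Complex.continuous_ofReal.comp ((continuous_symX (n := n) (-s)).mul
      (continuous_symMinus (-θ)))).measurable
    exact h2.mul h1
  have hU := hinv s u p hp
  refine ⟨_, hmeas s p, hU, ?_, ?_⟩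
  · rw [← hnorm p]
    exact hC s _ _ (hmeas s p) (Lp.stronglyMeasurable _).measurable
      (Filter.Eventually.of_forall fun z ↦ rfl)
  · rw [← hnorm q]
    refine hC (s - 1) _ _ (measurable_dtFun (hmeas s p)) (Lp.stronglyMeasurable _).measurable ?_
    exact hU.dt.ae_eq (hinv (s - 1) (dt u) q hq)

/-- The embedding hypothesis enters only here. Afterwards it is used in this form: elements of 𝒳^s
have Fourier functions, with fibre masses of `U` and `dtFun U` bounded by the norm. -/
theorem exists_fibre {s : ℝ} {X : DistSpace (ST n)} (hX : MainHyp s X) :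
    ∃ C : ℝ≥0, ∀ u : X.carrier, ∃ U : ST n → ℂ, Measurable U ∧ HasFourierFun (X.toDist u) U ∧
      wnorm s (fibMass U) ≤ C * ‖u‖ₑ ∧ wnorm (s - 1) (fibMass (dtFun U)) ≤ C * ‖u‖ₑ := by
  obtain ⟨θ, hθ, C, hC⟩ := hX.embeds
  obtain ⟨C', hC'⟩ := exists_fibre_of_L2 (n := n) hθ
  refine ⟨C' * C.toNNReal, fun u ↦ ?_⟩
  obtain ⟨p, q, hp, hq, hle⟩ := hC u
  obtain ⟨U, h1, h2, h3, h4⟩ := hC' s _ p q hp hq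
  have hle' : ∀ f : Lp ℂ 2 (volume : Measure (ST n)), ‖f‖ ≤ C * ‖u‖ →
      (C' : ℝ≥0∞) * ‖f‖ₑ ≤ ↑(C' * C.toNNReal) * ‖u‖ₑ := by
    intro f hf
    rw [ENNReal.coe_mul, mul_assoc]
    gcongr
    rw [← ofReal_norm, ← ofReal_norm]
    refine (ENNReal.ofReal_le_ofReal hf).trans ?_
    refine (ENNReal.ofReal_mul' (norm_nonneg _)).le.trans ?_
    rfl
  exact ⟨U, h1, h2, h3.trans (hle' p (by linarith [norm_nonneg q])),
    h4.trans (hle' q (by linarith [norm_nonneg p]))⟩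

end Energy

/-! ### The dilated time cut-off and its derivatives -/

section Cutoff

/-- A fixed smooth function that is `1` on `[-1, 1]` and vanishes off `(-2, 2)`. -/
def bump : ContDiffBump (0 : ℝ) := ⟨1, 3 / 2, by norm_num, by norm_num⟩

/-- The `j`-th derivative of `t ↦ bump (t / T)`. -/
def cut (T : ℝ) (j : ℕ) (t : ℝ) : ℝ := T⁻¹ ^ j * iteratedDeriv j bump (T⁻¹ * t)

theorem bump_contDiff : ContDiff ℝ ∞ bump := bump.contDiff

theorem hasDerivAt_cut (T : ℝ) (j : ℕ) (t : ℝ) : HasDerivAt (cut T j) (cut T (j + 1) t) t := by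
  have h1 : HasDerivAt (iteratedDeriv j bump) (iteratedDeriv (j + 1) bump (T⁻¹ * t)) (T⁻¹ * t) := by
    rw [iteratedDeriv_succ]
    exact (bump_contDiff.differentiable_iteratedDeriv j (by exact_mod_cast ENat.natCast_lt_top j)
      _).hasDerivAt
  have h2 := (h1.comp t ((hasDerivAt_id t).const_mul T⁻¹)).const_mul (T⁻¹ ^ j)
  refine h2.congr_deriv ?_
  simp only [cut]
  ring

theorem continuous_cut (T : ℝ) (j : ℕ) : Continuous (cut T j) :=
  continuous_iff_continuousAt.2 fun t ↦ (hasDerivAt_cut T j t).continuousAt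

theorem iteratedDeriv_bump_eq_zero (j : ℕ) {t : ℝ} (ht : 2 ≤ |t|) : iteratedDeriv j bump t = 0 := by
  have h1 : tsupport (iteratedFDeriv ℝ j bump) ⊆ tsupport bump := tsupport_iteratedFDeriv_subset j
  rw [bump.tsupport_eq] at h1
  have h2 : iteratedFDeriv ℝ j bump t = 0 := image_eq_zero_of_notMem_tsupport fun hmem ↦ by
    have h3 := h1 hmem
    rw [mem_closedBall_zero_iff, Real.norm_eq_abs] at h3
    simp only [bump] at h3
    linarith
  rw [iteratedDeriv_eq_iteratedFDeriv, h2]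
  rfl

theorem cut_eq_zero {T : ℝ} (hT : 0 < T) (j : ℕ) {t : ℝ} (ht : 2 * T ≤ |t|) : cut T j t = 0 := by
  rw [cut, iteratedDeriv_bump_eq_zero j, mul_zero]
  rw [abs_mul, abs_of_pos (inv_pos.2 hT), inv_mul_eq_div, le_div_iff₀ hT]
  exact ht

theorem cut_zero_eq_one {T : ℝ} (hT : 0 < T) {t : ℝ} (ht : |t| ≤ T) : cut T 0 t = 1 := by
  rw [cut, pow_zero, one_mul, iteratedDeriv_zero]
  refine bump.one_of_mem_closedBall ?_
  rw [mem_closedBall_zero_iff, Real.norm_eq_abs, abs_mul, abs_of_pos (inv_pos.2 hT),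
    inv_mul_eq_div, div_le_iff₀ hT]
  simpa [bump] using ht

theorem cut_succ_eq_zero {T : ℝ} (hT : 0 < T) (j : ℕ) {t : ℝ} (ht : |t| < T) :
    cut T (j + 1) t = 0 := by
  have hopen : ∀ᶠ x in nhds t, |x| < T := continuous_abs.continuousAt.eventually_lt
    continuousAt_const ht
  induction j generalizing t with
  | zero =>
    have h1 : cut T 0 =ᶠ[nhds t] fun _ ↦ 1 := by
      filter_upwards [hopen] with x hx
      exact cut_zero_eq_one hT hx.le
    exact (hasDerivAt_cut T 0 t).unique ((hasDerivAt_const t (1 : ℝ)).congr_of_eventuallyEq h1)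
  | succ j ih =>
    have h1 : cut T (j + 1) =ᶠ[nhds t] fun _ ↦ 0 := by
      filter_upwards [hopen] with x hx
      exact ih hx (continuous_abs.continuousAt.eventually_lt continuousAt_const hx)
    exact (hasDerivAt_cut T (j + 1) t).unique
      ((hasDerivAt_const t (0 : ℝ)).congr_of_eventuallyEq h1)

/-- Order three suffices: the source of a cut-off solution contains the second derivative of the
cut-off, and its decay estimate differentiates once more. -/
theorem exists_bound_cut : ∃ B : ℝ, 0 ≤ B ∧ ∀ (T : ℝ), 0 < T → ∀ j ≤ 3, ∀ t,
    |cut T j t| ≤ B * T⁻¹ ^ j := by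
  have h : ∀ j : ℕ, ∃ B : ℝ, 0 ≤ B ∧ ∀ x, |iteratedDeriv j bump x| ≤ B := by
    intro j
    have hcs : HasCompactSupport (iteratedDeriv j bump) :=
      HasCompactSupport.intro (isCompact_Icc (a := (-2 : ℝ)) (b := 2)) fun x hx ↦
        iteratedDeriv_bump_eq_zero j (by
          by_contra hcon
          rw [not_le, abs_lt] at hcon
          exact hx ⟨hcon.1.le, hcon.2.le⟩)
    obtain ⟨B, hB⟩ := hcs.exists_bound_of_continuous
      (bump_contDiff.continuous_iteratedDeriv j (by exact_mod_cast le_top))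
    exact ⟨B, (norm_nonneg _).trans (hB 0), hB⟩
  choose B hB0 hB using h
  refine ⟨B 0 + B 1 + B 2 + B 3, ?_, fun T hT j hj t ↦ ?_⟩
  · have h0 := hB0 0
    have h1 := hB0 1
    have h2 := hB0 2
    have h3 := hB0 3
    positivity
  · rw [cut, abs_mul, abs_of_nonneg (by positivity : 0 ≤ T⁻¹ ^ j), mul_comm]
    refine mul_le_mul_of_nonneg_right ((hB j _).trans ?_) (by positivity)
    interval_cases j <;> linarith [hB0 0, hB0 1, hB0 2, hB0 3]

end Cutoff

/-! ### Fourier decay of compactly supported functions on the line -/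

section FourierBounds

theorem integrable_fourierChar_smul {f : ℝ → ℂ} (hf : Integrable f) (τ : ℝ) :
    Integrable fun v : ℝ ↦ Real.fourierChar (-(v * τ)) • f v := by
  have := (Real.fourierIntegral_convergent_iff (μ := volume) (f := f) τ).2 hf
  simpa [mul_comm] using this

theorem fourier_add_apply {f g : ℝ → ℂ} (hf : Integrable f) (hg : Integrable g) (τ : ℝ) :
    𝓕 (fun t ↦ f t + g t) τ = 𝓕 f τ + 𝓕 g τ := by
  rw [Real.fourier_real_eq, Real.fourier_real_eq, Real.fourier_real_eq,
    ← integral_add (integrable_fourierChar_smul hf τ) (integrable_fourierChar_smul hg τ)]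
  simp only [smul_add]

theorem fourier_sub_apply {f g : ℝ → ℂ} (hf : Integrable f) (hg : Integrable g) (τ : ℝ) :
    𝓕 (fun t ↦ f t - g t) τ = 𝓕 f τ - 𝓕 g τ := by
  rw [Real.fourier_real_eq, Real.fourier_real_eq, Real.fourier_real_eq,
    ← integral_sub (integrable_fourierChar_smul hf τ) (integrable_fourierChar_smul hg τ)]
  simp only [smul_sub]

theorem fourier_const_mul_apply (c : ℂ) (f : ℝ → ℂ) (τ : ℝ) :
    𝓕 (fun t ↦ c * f t) τ = c * 𝓕 f τ := by
  rw [Real.fourier_real_eq, Real.fourier_real_eq, ← integral_const_mul]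
  refine integral_congr_ae (Filter.Eventually.of_forall fun t ↦ ?_)
  simp only [Circle.smul_def, smul_eq_mul]
  ring

/-- A compactly supported `C¹` function on the line, with its derivative. -/
structure CptC1 (R : ℝ) (g g' : ℝ → ℂ) : Prop where
  deriv : ∀ t, HasDerivAt g (g' t) t
  cont : Continuous g'
  supp : ∀ t, R ≤ |t| → g t = 0

variable {R : ℝ} {g g' : ℝ → ℂ}

theorem CptC1.continuous (h : CptC1 R g g') : Continuous g :=
  continuous_iff_continuousAt.2 fun t ↦ (h.deriv t).continuousAt

theorem CptC1.supp' (h : CptC1 R g g') {t : ℝ} (ht : R < |t|) : g' t = 0 := by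
  have h1 : g =ᶠ[nhds t] fun _ ↦ 0 := by
    filter_upwards [continuous_abs.continuousAt.eventually_const_lt ht] with x hx
    exact h.supp x hx.le
  exact (h.deriv t).unique ((hasDerivAt_const t (0 : ℂ)).congr_of_eventuallyEq h1)

theorem integrable_of_support {g : ℝ → ℂ} (hg : Continuous g)
    (h : ∀ t, R < |t| → g t = 0) : Integrable g := by
  refine hg.integrable_of_hasCompactSupport
    (HasCompactSupport.intro (isCompact_Icc (a := -R) (b := R)) fun t ht ↦ h t ?_)
  by_contra hcon
  rw [not_lt, abs_le] at hcon
  exact ht hcon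

theorem integral_norm_le_of_support {g : ℝ → ℂ} (hR : 0 ≤ R) (hg : Continuous g)
    (h : ∀ t, R < |t| → g t = 0) {a : ℝ} (ha : ∀ t, |t| ≤ R → ‖g t‖ ≤ a) :
    ∫ t, ‖g t‖ ≤ 2 * R * a := by
  have e : ∫ t, ‖g t‖ = ∫ t in Set.Icc (-R) R, ‖g t‖ := by
    symm
    refine setIntegral_eq_integral_of_forall_compl_eq_zero fun t ht ↦ ?_
    rw [h t, norm_zero]
    by_contra hcon
    rw [not_lt, abs_le] at hcon
    exact ht hcon
  rw [e]
  calc ∫ t in Set.Icc (-R) R, ‖g t‖ ≤ ∫ _ in Set.Icc (-R) R, a := by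
        refine setIntegral_mono_on (hg.norm.integrableOn_Icc) (by simp) measurableSet_Icc ?_
        intro t ht
        exact ha t (abs_le.2 ht)
    _ = 2 * R * a := by
        rw [setIntegral_const, smul_eq_mul, Measure.real, Real.volume_Icc,
          ENNReal.toReal_ofReal (by linarith)]
        ring

theorem CptC1.fourier_deriv (h : CptC1 R g g') (τ : ℝ) :
    𝓕 g' τ = 2 * Real.pi * Complex.I * τ * 𝓕 g τ := by
  have e : _root_.deriv g = g' := funext fun t ↦ (h.deriv t).deriv
  have h1 := Real.fourier_deriv (integrable_of_support h.continuous fun t ht ↦ h.supp t ht.le)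
    (fun t ↦ (h.deriv t).differentiableAt)
    (by rw [e]; exact integrable_of_support h.cont fun t ht ↦ h.supp' ht)
  rw [e] at h1
  rw [h1]
  simp

theorem norm_fourier_le_of_support {g : ℝ → ℂ} (hR : 0 ≤ R) (hg : Continuous g)
    (h : ∀ t, R < |t| → g t = 0) {a : ℝ} (ha : ∀ t, |t| ≤ R → ‖g t‖ ≤ a) (τ : ℝ) :
    ‖𝓕 g τ‖ ≤ 2 * R * a :=
  (norm_fourier_le g τ).trans (integral_norm_le_of_support hR hg h ha)

/-- Decay of the Fourier transform away from the frequency `c`. -/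
theorem CptC1.decay (h : CptC1 R g g') (hR : 0 ≤ R) {a b c : ℝ}
    (ha : ∀ t, |t| ≤ R → ‖g t‖ ≤ a) (hb : ∀ t, |t| ≤ R → ‖g' t - Complex.I * c * g t‖ ≤ b)
    (τ : ℝ) : (1 + |2 * Real.pi * τ - c|) * ‖𝓕 g τ‖ ≤ 2 * R * (a + b) := by
  have i1 := integrable_of_support h.continuous fun t ht ↦ h.supp t ht.le
  have i2 := integrable_of_support h.cont fun t ht ↦ h.supp' ht
  have h1 := norm_fourier_le_of_support hR h.continuous (fun t ht ↦ h.supp t ht.le) ha τ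
  have h2 := norm_fourier_le_of_support (g := fun t ↦ g' t - Complex.I * c * g t) hR
    (h.cont.sub (continuous_const.mul h.continuous))
    (fun t ht ↦ by rw [h.supp' ht, h.supp t ht.le]; simp) hb τ
  -- The operator d/dt - ic has symbol i(2πτ - c), so this combination measures the distance of the
  -- frequency from `c`.
  have e : 𝓕 (fun t ↦ g' t - Complex.I * c * g t) τ =
      Complex.I * (2 * Real.pi * τ - c : ℝ) * 𝓕 g τ := by
    have h3 : 𝓕 (fun t ↦ g' t - Complex.I * c * g t) τ = 𝓕 g' τ - Complex.I * c * 𝓕 g τ := by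
      rw [fourier_sub_apply i2 (i1.const_mul _), fourier_const_mul_apply]
    rw [h3, h.fourier_deriv]
    push_cast
    ring
  rw [e, norm_mul, norm_mul, Complex.norm_I, one_mul, Complex.norm_real, Real.norm_eq_abs] at h2
  rw [add_mul, one_mul, mul_add]
  exact add_le_add h1 h2

end FourierBounds

/-! ### Cut-off solutions of the wave equation on a fibre -/

/-- `E'' + κ² E = -f`, with `E' = E₁`. -/
structure WaveODE (κ : ℝ) (E E₁ f : ℝ → ℂ) : Prop where
  deriv_zero : ∀ t, HasDerivAt E (E₁ t) t
  deriv_one : ∀ t, HasDerivAt E₁ (-(κ : ℂ) ^ 2 * E t - f t) t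
  cont : Continuous f

/-- The cut-off solution. -/
def cutV (T : ℝ) (E : ℝ → ℂ) (t : ℝ) : ℂ := (cut T 0 t : ℂ) * E t

/-- The derivative of the cut-off solution. -/
def cutD (T : ℝ) (E E₁ : ℝ → ℂ) (t : ℝ) : ℂ := (cut T 1 t : ℂ) * E t + (cut T 0 t : ℂ) * E₁ t

/-- The source of the equation solved by the cut-off solution. -/
def cutF (T : ℝ) (E E₁ f : ℝ → ℂ) (t : ℝ) : ℂ :=
  (cut T 0 t : ℂ) * f t - (cut T 2 t : ℂ) * E t - 2 * ((cut T 1 t : ℂ) * E₁ t)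

theorem CptC1.cut_mul {T : ℝ} (hT : 0 < T) (j : ℕ) {g g' : ℝ → ℂ} (hg : ∀ t, HasDerivAt g (g' t) t)
    (hg' : Continuous g') : CptC1 (2 * T) (fun t ↦ (cut T j t : ℂ) * g t)
      (fun t ↦ (cut T (j + 1) t : ℂ) * g t + (cut T j t : ℂ) * g' t) where
  deriv t := (hasDerivAt_cut T j t).ofReal_comp.mul (hg t)
  cont := by
    have h1 := continuous_cut T j
    have h2 := continuous_cut T (j + 1)
    have h3 : Continuous g := continuous_iff_continuousAt.2 fun t ↦ (hg t).continuousAt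
    fun_prop
  supp t ht := by simp [cut_eq_zero hT j ht]

namespace WaveODE

variable {κ : ℝ} {E E₁ f : ℝ → ℂ}

theorem continuous_zero (h : WaveODE κ E E₁ f) : Continuous E :=
  continuous_iff_continuousAt.2 fun t ↦ (h.deriv_zero t).continuousAt

theorem continuous_one (h : WaveODE κ E E₁ f) : Continuous E₁ :=
  continuous_iff_continuousAt.2 fun t ↦ (h.deriv_one t).continuousAt

theorem continuous_two (h : WaveODE κ E E₁ f) :
    Continuous fun t ↦ -(κ : ℂ) ^ 2 * E t - f t :=
  (continuous_const.mul h.continuous_zero).sub h.cont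

theorem cptC1_cutV (h : WaveODE κ E E₁ f) {T : ℝ} (hT : 0 < T) :
    CptC1 (2 * T) (cutV T E) (cutD T E E₁) :=
  CptC1.cut_mul hT 0 h.deriv_zero h.continuous_one

theorem cptC1_cutD (h : WaveODE κ E E₁ f) {T : ℝ} (hT : 0 < T) :
    CptC1 (2 * T) (cutD T E E₁) (fun t ↦ -(κ : ℂ) ^ 2 * cutV T E t - cutF T E E₁ f t) := by
  have h1 := CptC1.cut_mul hT 1 h.deriv_zero h.continuous_one
  have h2 := CptC1.cut_mul hT 0 h.deriv_one h.continuous_two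
  have e : (fun t ↦ -(κ : ℂ) ^ 2 * cutV T E t - cutF T E E₁ f t) = fun t ↦
      ((cut T (1 + 1) t : ℂ) * E t + (cut T 1 t : ℂ) * E₁ t) +
        ((cut T (0 + 1) t : ℂ) * E₁ t + (cut T 0 t : ℂ) * (-(κ : ℂ) ^ 2 * E t - f t)) := by
    ext t
    simp only [cutV, cutF]
    ring
  rw [e]
  exact ⟨fun t ↦ (h1.deriv t).add (h2.deriv t), h1.cont.add h2.cont, fun t ht ↦ by
    simp [cutD, cut_eq_zero hT _ ht]⟩

theorem continuous_cutF (h : WaveODE κ E E₁ f) (T : ℝ) : Continuous (cutF T E E₁ f) := by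
  have h0 := continuous_cut T 0
  have h1 := continuous_cut T 1
  have h2 := continuous_cut T 2
  have h3 := h.continuous_zero
  have h4 := h.continuous_one
  have h5 := h.cont
  unfold cutF
  fun_prop

theorem fourier_cutD (h : WaveODE κ E E₁ f) {T : ℝ} (hT : 0 < T) (τ : ℝ) :
    𝓕 (cutD T E E₁) τ = 2 * Real.pi * Complex.I * τ * 𝓕 (cutV T E) τ :=
  (h.cptC1_cutV hT).fourier_deriv τ

theorem cutF_eq_zero {T : ℝ} (hT : 0 < T) {t : ℝ} (ht : 2 * T ≤ |t|) : cutF T E E₁ f t = 0 := by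
  simp [cutF, cut_eq_zero hT _ ht]

/-- Multiplying by the cut-off changes the equation only by terms with derivatives of the cut-off,
which are collected in `cutF`. On the Fourier side the equation trades the symbol of □ for this
source. -/
theorem fourier_cutF (h : WaveODE κ E E₁ f) {T : ℝ} (hT : 0 < T) (τ : ℝ) :
    𝓕 (cutF T E E₁ f) τ = (((2 * Real.pi * τ) ^ 2 - κ ^ 2 : ℝ) : ℂ) * 𝓕 (cutV T E) τ := by
  have h1 := (h.cptC1_cutD hT).fourier_deriv τ
  rw [h.fourier_cutD hT] at h1
  have i1 := integrable_of_support (h.cptC1_cutV hT).continuous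
    fun t ht ↦ (h.cptC1_cutV hT).supp t ht.le
  have i2 := integrable_of_support (h.continuous_cutF T) fun t ht ↦ cutF_eq_zero hT ht.le
  have e : 𝓕 (fun t ↦ -(κ : ℂ) ^ 2 * cutV T E t - cutF T E E₁ f t) τ =
      -(κ : ℂ) ^ 2 * 𝓕 (cutV T E) τ - 𝓕 (cutF T E E₁ f) τ := by
    rw [fourier_sub_apply (i1.const_mul _) i2, fourier_const_mul_apply]
  rw [e] at h1
  push_cast
  linear_combination (-1 : ℂ) * h1 - (4 * Real.pi ^ 2 * τ ^ 2 * 𝓕 (cutV T E) τ) * Complex.I_sq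

end WaveODE

/-- Bounds for the data of a cut-off solution of the wave equation on a fibre. -/
structure FibreBounds (κ T A M L : ℝ) (E E₁ fp fm fp' fm' : ℝ → ℂ) : Prop where
  zero : ∀ t, |t| ≤ 2 * T → ‖E t‖ ≤ A * T
  omega : ∀ t, |t| ≤ 2 * T → κ * ‖E t‖ ≤ A
  one : ∀ t, |t| ≤ 2 * T → ‖E₁ t‖ ≤ A
  plus : ∀ t, |t| ≤ 2 * T → ‖fp t‖ ≤ M
  minus : ∀ t, |t| ≤ 2 * T → ‖fm t‖ ≤ M
  plus_deriv : ∀ t, HasDerivAt fp (fp' t) t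
  minus_deriv : ∀ t, HasDerivAt fm (fm' t) t
  plus_cont : Continuous fp'
  minus_cont : Continuous fm'
  plus' : ∀ t, |t| ≤ 2 * T → ‖fp' t - Complex.I * κ * fp t‖ ≤ L
  minus' : ∀ t, |t| ≤ 2 * T → ‖fm' t - Complex.I * (-κ : ℝ) * fm t‖ ≤ L

/-! ### The kernel bound, by interpolation in powers of Λ₋ -/

section KernelBound

variable {κ T A M L B : ℝ} {E E₁ fp fm fp' fm' : ℝ → ℂ}

theorem FibreBounds.A_nonneg (hb : FibreBounds κ T A M L E E₁ fp fm fp' fm') (hT : 0 < T) :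
    0 ≤ A := (norm_nonneg _).trans (hb.one 0 (by simpa using hT.le))

theorem FibreBounds.M_nonneg (hb : FibreBounds κ T A M L E E₁ fp fm fp' fm') (hT : 0 < T) :
    0 ≤ M := (norm_nonneg _).trans (hb.plus 0 (by simpa using hT.le))

theorem FibreBounds.L_nonneg (hb : FibreBounds κ T A M L E E₁ fp fm fp' fm') (hT : 0 < T) :
    0 ≤ L := (norm_nonneg _).trans (hb.plus' 0 (by simpa using hT.le))

theorem norm_cut_mul_le (hB : ∀ j ≤ 3, ∀ t, |cut T j t| ≤ B * T⁻¹ ^ j) {j : ℕ} (hj : j ≤ 3)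
    {x : ℂ} {a : ℝ} (hx : ‖x‖ ≤ a) (t : ℝ) : ‖(cut T j t : ℂ) * x‖ ≤ B * T⁻¹ ^ j * a := by
  rw [norm_mul, Complex.norm_real, Real.norm_eq_abs]
  exact mul_le_mul (hB j hj t) hx (norm_nonneg _) ((abs_nonneg _).trans (hB j hj t))

/-- The bound for `τ`-frequencies: first power of the distance to the light cone. -/
theorem fourier_cutV_le (h : WaveODE κ E E₁ (fun t ↦ fp t + fm t)) (hκ : 0 ≤ κ)
    (hb : FibreBounds κ T A M L E E₁ fp fm fp' fm') (hT : 0 < T) (hT1 : T ≤ 1) (hB0 : 0 ≤ B)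
    (hB : ∀ j ≤ 3, ∀ t, |cut T j t| ≤ B * T⁻¹ ^ j) (τ : ℝ) :
    (1 + |2 * Real.pi * τ| + κ) * ‖𝓕 (cutV T E) τ‖ +
      ‖𝓕 (cutF T E E₁ (fun t ↦ fp t + fm t)) τ‖ ≤ 28 * B * (A + M * T) := by
  have hA := hb.A_nonneg hT
  have hM := hb.M_nonneg hT
  have hTi : T * T⁻¹ = 1 := mul_inv_cancel₀ hT.ne'
  have h1 := (h.cptC1_cutV hT).decay (by positivity) (a := B * T⁻¹ ^ 0 * (A * T))
    (b := B * T⁻¹ ^ 1 * (A * T) + B * T⁻¹ ^ 0 * A) (c := 0)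
    (fun t ht ↦ norm_cut_mul_le hB (by norm_num) (hb.zero t ht) t)
    (fun t ht ↦ by
      simp only [Complex.ofReal_zero, mul_zero, zero_mul, sub_zero]
      exact (norm_add_le _ _).trans (add_le_add
        (norm_cut_mul_le hB (by norm_num) (hb.zero t ht) t)
        (norm_cut_mul_le hB (by norm_num) (hb.one t ht) t))) τ
  -- The weight κ is moved inside the transform, where `omega` bounds κE by `A` without a loss in κ.
  have h2 := norm_fourier_le_of_support (R := 2 * T) (g := fun t ↦ (κ : ℂ) * cutV T E t)
    (by positivity) (continuous_const.mul (h.cptC1_cutV hT).continuous)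
    (fun t ht ↦ by simp [(h.cptC1_cutV hT).supp t ht.le]) (a := B * T⁻¹ ^ 0 * A)
    (fun t ht ↦ by
      have : (κ : ℂ) * cutV T E t = (cut T 0 t : ℂ) * (κ * E t) := by
        simp only [cutV]; ring
      rw [this]
      refine norm_cut_mul_le hB (by norm_num) ?_ t
      rw [norm_mul, Complex.norm_real, Real.norm_of_nonneg hκ]
      exact hb.omega t ht) τ
  have e2 : 𝓕 (fun t ↦ (κ : ℂ) * cutV T E t) τ = κ * 𝓕 (cutV T E) τ :=
    fourier_const_mul_apply _ _ _
  rw [e2, norm_mul, Complex.norm_real, Real.norm_of_nonneg hκ] at h2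
  have h3 := norm_fourier_le_of_support (R := 2 * T) (by positivity) (h.continuous_cutF T)
    (fun t ht ↦ WaveODE.cutF_eq_zero hT ht.le)
    (a := B * T⁻¹ ^ 0 * (M + M) + B * T⁻¹ ^ 2 * (A * T) + 2 * (B * T⁻¹ ^ 1 * A))
    (fun t ht ↦ by
      refine (norm_sub_le _ _).trans (add_le_add ((norm_sub_le _ _).trans (add_le_add ?_ ?_)) ?_)
      · exact norm_cut_mul_le hB (by norm_num)
          ((norm_add_le _ _).trans (add_le_add (hb.plus t ht) (hb.minus t ht))) t
      · exact norm_cut_mul_le hB (by norm_num) (hb.zero t ht) t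
      · rw [norm_mul, Complex.norm_ofNat]
        exact mul_le_mul_of_nonneg_left (norm_cut_mul_le hB (by norm_num) (hb.one t ht) t)
          (by norm_num)) τ
  simp only [sub_zero, pow_zero, pow_one, mul_one] at h1 h2 h3
  have e3 : (1 + |2 * Real.pi * τ| + κ) * ‖𝓕 (cutV T E) τ‖ =
      (1 + |2 * Real.pi * τ|) * ‖𝓕 (cutV T E) τ‖ + κ * ‖𝓕 (cutV T E) τ‖ := by ring
  rw [e3]
  -- All integrals run over an interval of length 4T. This length, together with E = O(AT), absorbs
  -- the factors T⁻¹ and T⁻² which come from differentiating the cut-off.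
  have b1 : 2 * (2 * T) * (B * (A * T) + (B * T⁻¹ * (A * T) + B * A)) ≤ 12 * (B * A) := by
    have : 2 * (2 * T) * (B * (A * T) + (B * T⁻¹ * (A * T) + B * A)) =
        4 * (B * A) * (T * T + T * (T * T⁻¹) + T) := by ring
    rw [this, hTi]
    have hBA : 0 ≤ 4 * (B * A) := by positivity
    have h4 : T * T + T * 1 + T ≤ 3 := by nlinarith
    have := mul_le_mul_of_nonneg_left h4 hBA
    linarith
  have b2 : 2 * (2 * T) * (B * A) ≤ 4 * (B * A) := by
    have hBA : 0 ≤ B * A := by positivity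
    nlinarith
  have b3 : 2 * (2 * T) * (B * (M + M) + B * T⁻¹ ^ 2 * (A * T) + 2 * (B * T⁻¹ * A)) =
      8 * (B * M * T) + 12 * (B * A) := by
    have : 2 * (2 * T) * (B * (M + M) + B * T⁻¹ ^ 2 * (A * T) + 2 * (B * T⁻¹ * A)) =
      8 * (B * M * T) + 4 * (B * A) * ((T * T⁻¹) * (T * T⁻¹)) + 8 * (B * A) * (T * T⁻¹) := by ring
    rw [this, hTi]
    ring
  have hBM : 0 ≤ B * M * T := by positivity
  nlinarith

/-- `cutF` oscillates near both frequencies ±κ, so it is split into pieces attached to one of them.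
The source is already split into `fp` and `fm`, and 2E₁ is the sum of the half waves E₁ ± iκE.
Applying d/dt ∓ iκ to a half wave leaves only the source, so no power of κ is lost. The term with
the second derivative of the cut-off is harmless at either frequency, because E, κE and E₁ are all
bounded. -/
theorem decay_cutF (h : WaveODE κ E E₁ (fun t ↦ fp t + fm t)) (hκ : 0 ≤ κ)
    (hb : FibreBounds κ T A M L E E₁ fp fm fp' fm') (hT : 0 < T) (hT1 : T ≤ 1) (hB0 : 0 ≤ B)
    (hB : ∀ j ≤ 3, ∀ t, |cut T j t| ≤ B * T⁻¹ ^ j) (τ : ℝ) :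
    (1 + |(|2 * Real.pi * τ| - κ)|) * ‖𝓕 (cutF T E E₁ (fun t ↦ fp t + fm t)) τ‖ ≤
      48 * B * (A * T⁻¹ + M + L * T) := by
  have hA := hb.A_nonneg hT
  have hM := hb.M_nonneg hT
  have hL := hb.L_nonneg hT
  have hTi : T * T⁻¹ = 1 := mul_inv_cancel₀ hT.ne'
  have hT' : 1 ≤ T⁻¹ := (one_le_inv₀ hT).2 hT1
  have hR : 0 ≤ 2 * T := by positivity
  have hIκ : ∀ t, |t| ≤ 2 * T → ‖Complex.I * κ * E t‖ ≤ A := fun t ht ↦ by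
    rw [norm_mul, norm_mul, Complex.norm_I, one_mul, Complex.norm_real, Real.norm_of_nonneg hκ]
    exact hb.omega t ht
  have hf : ∀ t, |t| ≤ 2 * T → ‖fp t + fm t‖ ≤ M + M := fun t ht ↦
    (norm_add_le _ _).trans (add_le_add (hb.plus t ht) (hb.minus t ht))
  have hIc : Complex.I * Complex.I = -1 := Complex.I_mul_I
  -- the half waves
  have dp : ∀ t, HasDerivAt (fun t ↦ E₁ t + Complex.I * κ * E t)
      (-(κ : ℂ) ^ 2 * E t - (fp t + fm t) + Complex.I * κ * E₁ t) t := fun t ↦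
    (h.deriv_one t).add ((h.deriv_zero t).const_mul _)
  have dm : ∀ t, HasDerivAt (fun t ↦ E₁ t - Complex.I * κ * E t)
      (-(κ : ℂ) ^ 2 * E t - (fp t + fm t) - Complex.I * κ * E₁ t) t := fun t ↦
    (h.deriv_one t).sub ((h.deriv_zero t).const_mul _)
  have c1 := CptC1.cut_mul hT 2 h.deriv_zero h.continuous_one
  have c2 := CptC1.cut_mul hT 1 dp (h.continuous_two.add (continuous_const.mul h.continuous_one))
  have c3 := CptC1.cut_mul hT 1 dm (h.continuous_two.sub (continuous_const.mul h.continuous_one))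
  have c4 := CptC1.cut_mul hT 0 hb.plus_deriv hb.plus_cont
  have c5 := CptC1.cut_mul hT 0 hb.minus_deriv hb.minus_cont
  have d2 := c2.decay hR (c := κ) (a := B * T⁻¹ ^ 1 * (A + A))
    (b := B * T⁻¹ ^ 2 * (A + A) + B * T⁻¹ ^ 1 * (M + M))
    (fun t ht ↦ norm_cut_mul_le hB (by norm_num)
      ((norm_add_le _ _).trans (add_le_add (hb.one t ht) (hIκ t ht))) t)
    (fun t ht ↦ by
      have e : (cut T (1 + 1) t : ℂ) * (E₁ t + Complex.I * κ * E t) + (cut T 1 t : ℂ) *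
          (-(κ : ℂ) ^ 2 * E t - (fp t + fm t) + Complex.I * κ * E₁ t) - Complex.I * κ *
          ((cut T 1 t : ℂ) * (E₁ t + Complex.I * κ * E t)) =
          (cut T 2 t : ℂ) * (E₁ t + Complex.I * κ * E t) -
            (cut T 1 t : ℂ) * (fp t + fm t) := by
        linear_combination (-(cut T 1 t : ℂ) * κ ^ 2 * E t) * hIc
      rw [e]
      exact (norm_sub_le _ _).trans (add_le_add (norm_cut_mul_le hB (by norm_num)
        ((norm_add_le _ _).trans (add_le_add (hb.one t ht) (hIκ t ht))) t)
        (norm_cut_mul_le hB (by norm_num) (hf t ht) t))) τ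
  have d3 := c3.decay hR (c := -κ) (a := B * T⁻¹ ^ 1 * (A + A))
    (b := B * T⁻¹ ^ 2 * (A + A) + B * T⁻¹ ^ 1 * (M + M))
    (fun t ht ↦ norm_cut_mul_le hB (by norm_num)
      ((norm_sub_le _ _).trans (add_le_add (hb.one t ht) (hIκ t ht))) t)
    (fun t ht ↦ by
      have e : (cut T (1 + 1) t : ℂ) * (E₁ t - Complex.I * κ * E t) + (cut T 1 t : ℂ) *
          (-(κ : ℂ) ^ 2 * E t - (fp t + fm t) - Complex.I * κ * E₁ t) - Complex.I * (-κ : ℝ) *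
          ((cut T 1 t : ℂ) * (E₁ t - Complex.I * κ * E t)) =
          (cut T 2 t : ℂ) * (E₁ t - Complex.I * κ * E t) -
            (cut T 1 t : ℂ) * (fp t + fm t) := by
        push_cast
        linear_combination (-(cut T 1 t : ℂ) * κ ^ 2 * E t) * hIc
      rw [e]
      exact (norm_sub_le _ _).trans (add_le_add (norm_cut_mul_le hB (by norm_num)
        ((norm_sub_le _ _).trans (add_le_add (hb.one t ht) (hIκ t ht))) t)
        (norm_cut_mul_le hB (by norm_num) (hf t ht) t))) τ
  have d4 := c4.decay hR (c := κ) (a := B * T⁻¹ ^ 0 * M) (b := B * T⁻¹ ^ 1 * M + B * T⁻¹ ^ 0 * L)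
    (fun t ht ↦ norm_cut_mul_le hB (by norm_num) (hb.plus t ht) t)
    (fun t ht ↦ by
      have e : (cut T (0 + 1) t : ℂ) * fp t + (cut T 0 t : ℂ) * fp' t - Complex.I * κ *
          ((cut T 0 t : ℂ) * fp t) = (cut T 1 t : ℂ) * fp t +
            (cut T 0 t : ℂ) * (fp' t - Complex.I * κ * fp t) := by ring
      rw [e]
      exact (norm_add_le _ _).trans (add_le_add (norm_cut_mul_le hB (by norm_num) (hb.plus t ht) t)
        (norm_cut_mul_le hB (by norm_num) (hb.plus' t ht) t))) τ
  have d5 := c5.decay hR (c := -κ) (a := B * T⁻¹ ^ 0 * M) (b := B * T⁻¹ ^ 1 * M + B * T⁻¹ ^ 0 * L)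
    (fun t ht ↦ norm_cut_mul_le hB (by norm_num) (hb.minus t ht) t)
    (fun t ht ↦ by
      have e : (cut T (0 + 1) t : ℂ) * fm t + (cut T 0 t : ℂ) * fm' t - Complex.I * (-κ : ℝ) *
          ((cut T 0 t : ℂ) * fm t) = (cut T 1 t : ℂ) * fm t +
            (cut T 0 t : ℂ) * (fm' t - Complex.I * (-κ : ℝ) * fm t) := by ring
      rw [e]
      exact (norm_add_le _ _).trans (add_le_add
        (norm_cut_mul_le hB (by norm_num) (hb.minus t ht) t)
        (norm_cut_mul_le hB (by norm_num) (hb.minus' t ht) t))) τ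
  have d1 := c1.decay hR (c := κ) (a := B * T⁻¹ ^ 2 * (A * T))
    (b := B * T⁻¹ ^ 3 * (A * T) + B * T⁻¹ ^ 2 * A + B * T⁻¹ ^ 2 * A)
    (fun t ht ↦ norm_cut_mul_le hB (by norm_num) (hb.zero t ht) t)
    (fun t ht ↦ by
      have e : (cut T (2 + 1) t : ℂ) * E t + (cut T 2 t : ℂ) * E₁ t - Complex.I * κ *
          ((cut T 2 t : ℂ) * E t) = (cut T 3 t : ℂ) * E t + (cut T 2 t : ℂ) * E₁ t -
            (cut T 2 t : ℂ) * (Complex.I * κ * E t) := by ring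
      rw [e]
      exact (norm_sub_le _ _).trans (add_le_add ((norm_add_le _ _).trans (add_le_add
        (norm_cut_mul_le hB (by norm_num) (hb.zero t ht) t)
        (norm_cut_mul_le hB (by norm_num) (hb.one t ht) t)))
        (norm_cut_mul_le hB (by norm_num) (hIκ t ht) t))) τ
  have e : 𝓕 (cutF T E E₁ (fun t ↦ fp t + fm t)) τ =
      𝓕 (fun t ↦ (cut T 0 t : ℂ) * fp t) τ + 𝓕 (fun t ↦ (cut T 0 t : ℂ) * fm t) τ -
      𝓕 (fun t ↦ (cut T 2 t : ℂ) * E t) τ -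
      (𝓕 (fun t ↦ (cut T 1 t : ℂ) * (E₁ t + Complex.I * κ * E t)) τ +
        𝓕 (fun t ↦ (cut T 1 t : ℂ) * (E₁ t - Complex.I * κ * E t)) τ) := by
    have i := fun {g g' : ℝ → ℂ} (c : CptC1 (2 * T) g g') ↦
      integrable_of_support c.continuous fun t ht ↦ c.supp t ht.le
    have j : Integrable fun t ↦ (cut T 0 t : ℂ) * fp t + (cut T 0 t : ℂ) * fm t -
        (cut T 2 t : ℂ) * E t := Integrable.sub ((i c4).fun_add (i c5)) (i c1)
    rw [← fourier_add_apply (i c4) (i c5), ← fourier_add_apply (i c2) (i c3),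
      ← fourier_sub_apply ((i c4).fun_add (i c5)) (i c1),
      ← fourier_sub_apply j ((i c2).fun_add (i c3))]
    refine congrArg (fun g : ℝ → ℂ ↦ 𝓕 g τ) (funext fun t ↦ ?_)
    simp only [cutF]
    ring
  -- The distance from |2πτ| to κ is at most the distance from 2πτ to either of ±κ, so decay around
  -- one of the two points is enough for each piece.
  have hD1 : |(|2 * Real.pi * τ| - κ)| ≤ |2 * Real.pi * τ - κ| := by
    have := abs_abs_sub_abs_le_abs_sub (2 * Real.pi * τ) κ
    rwa [abs_of_nonneg hκ] at this
  have hD2 : |(|2 * Real.pi * τ| - κ)| ≤ |2 * Real.pi * τ - -κ| := by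
    have := abs_abs_sub_abs_le_abs_sub (2 * Real.pi * τ) (-κ)
    rwa [abs_neg, abs_of_nonneg hκ] at this
  have hle : ∀ {D D' x y : ℝ}, D ≤ D' → 0 ≤ x → (1 + D') * x ≤ y → (1 + D) * x ≤ y := by
    intro D D' x y hDD hx hxy
    nlinarith
  have k1 := hle hD1 (norm_nonneg _) d1
  have k2 := hle hD1 (norm_nonneg _) d2
  have k3 := hle hD2 (norm_nonneg _) d3
  have k4 := hle hD1 (norm_nonneg _) d4
  have k5 := hle hD2 (norm_nonneg _) d5
  have hn := (norm_sub_le _ _).trans (add_le_add ((norm_sub_le _ _).trans (add_le_add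
    (norm_add_le (𝓕 (fun t ↦ (cut T 0 t : ℂ) * fp t) τ) (𝓕 (fun t ↦ (cut T 0 t : ℂ) * fm t) τ))
    (le_refl ‖𝓕 (fun t ↦ (cut T 2 t : ℂ) * E t) τ‖)))
    (norm_add_le (𝓕 (fun t ↦ (cut T 1 t : ℂ) * (E₁ t + Complex.I * κ * E t)) τ)
      (𝓕 (fun t ↦ (cut T 1 t : ℂ) * (E₁ t - Complex.I * κ * E t)) τ)))
  rw [e]
  have hpos : 0 ≤ 1 + |(|2 * Real.pi * τ| - κ)| := by positivity
  have hm := mul_le_mul_of_nonneg_left hn hpos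
  refine hm.trans ?_
  have t1 : 2 * (2 * T) * (B * T⁻¹ ^ 2 * (A * T) + (B * T⁻¹ ^ 3 * (A * T) + B * T⁻¹ ^ 2 * A +
      B * T⁻¹ ^ 2 * A)) = 4 * (B * A) + 12 * (B * A * T⁻¹) := by
    have : 2 * (2 * T) * (B * T⁻¹ ^ 2 * (A * T) + (B * T⁻¹ ^ 3 * (A * T) + B * T⁻¹ ^ 2 * A +
      B * T⁻¹ ^ 2 * A)) = 4 * (B * A) * (T * T⁻¹) ^ 2 + 4 * (B * A * T⁻¹) * (T * T⁻¹) ^ 2 +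
        8 * (B * A * T⁻¹) * (T * T⁻¹) := by ring
    rw [this, hTi]
    ring
  have t2 : 2 * (2 * T) * (B * T⁻¹ ^ 1 * (A + A) + (B * T⁻¹ ^ 2 * (A + A) +
      B * T⁻¹ ^ 1 * (M + M))) = 8 * (B * A) + 8 * (B * A * T⁻¹) + 8 * (B * M) := by
    have : 2 * (2 * T) * (B * T⁻¹ ^ 1 * (A + A) + (B * T⁻¹ ^ 2 * (A + A) +
      B * T⁻¹ ^ 1 * (M + M))) = (8 * (B * A) + 8 * (B * A * T⁻¹) + 8 * (B * M)) * (T * T⁻¹) := by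
      ring
    rw [this, hTi, mul_one]
  have t4 : 2 * (2 * T) * (B * T⁻¹ ^ 0 * M + (B * T⁻¹ ^ 1 * M + B * T⁻¹ ^ 0 * L)) =
      4 * (B * M * T) + 4 * (B * M) + 4 * (B * L * T) := by
    have : 2 * (2 * T) * (B * T⁻¹ ^ 0 * M + (B * T⁻¹ ^ 1 * M + B * T⁻¹ ^ 0 * L)) =
      4 * (B * M * T) + 4 * (B * M) * (T * T⁻¹) + 4 * (B * L * T) := by ring
    rw [this, hTi, mul_one]
  rw [t1] at k1
  rw [t2] at k2 k3
  rw [t4] at k4 k5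
  have q1 : B * A ≤ B * A * T⁻¹ := le_mul_of_one_le_right (by positivity) hT'
  have q2 : B * M * T ≤ B * M := mul_le_of_le_one_right (by positivity) hT1
  have q3 : 0 ≤ B * L * T := by positivity
  have q4 : 0 ≤ B * A * T⁻¹ := by positivity
  have q5 : 0 ≤ B * M := by positivity
  nlinarith

/-- Geometric interpolation: the exponents 2 - γ and γ - 1 are nonnegative, add up to 1, and produce
the power γ of `m`. -/
theorem rpow_interpolate {x m α β γ : ℝ} (hx : 0 ≤ x) (hm : 0 < m) (h1 : x * m ≤ α)
    (h2 : x * m ^ 2 ≤ β) (hγ1 : 1 ≤ γ) (hγ2 : γ ≤ 2) : x * m ^ γ ≤ α ^ (2 - γ) * β ^ (γ - 1) := by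
  have e : x * m ^ γ = (x * m) ^ (2 - γ) * (x * m ^ 2) ^ (γ - 1) := by
    rcases eq_or_lt_of_le hx with rfl | hx0
    · simp only [zero_mul]
      rcases eq_or_lt_of_le hγ2 with rfl | h
      · norm_num
      · rw [Real.zero_rpow (by linarith), zero_mul]
    · rw [Real.mul_rpow hx hm.le, Real.mul_rpow hx (by positivity), ← Real.rpow_natCast m 2,
        ← Real.rpow_mul hm.le]
      have e1 : x ^ (2 - γ) * m ^ (2 - γ) * (x ^ (γ - 1) * m ^ (((2 : ℕ) : ℝ) * (γ - 1))) =
          (x ^ (2 - γ) * x ^ (γ - 1)) * (m ^ (2 - γ) * m ^ (((2 : ℕ) : ℝ) * (γ - 1))) := by ring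
      rw [e1, ← Real.rpow_add hx0, ← Real.rpow_add hm]
      have e2 : 2 - γ + (γ - 1) = 1 := by ring
      have e3 : 2 - γ + ((2 : ℕ) : ℝ) * (γ - 1) = γ := by push_cast; ring
      rw [e2, e3, Real.rpow_one]
  rw [e]
  exact mul_le_mul (Real.rpow_le_rpow (by positivity) h1 (by linarith))
    (Real.rpow_le_rpow (by positivity) h2 (by linarith)) (by positivity)
    (Real.rpow_nonneg ((by positivity : 0 ≤ x * m).trans h1) _)

/-- The weighted Fourier bound for cut-off solutions. -/
theorem exists_kernel_bound {n : ℕ} {γ : ℝ} (hγ1 : 1 ≤ γ) (hγ2 : γ ≤ 2) : ∃ C : ℝ, 0 ≤ C ∧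
    ∀ (ξ : Sp n) (T A M L : ℝ) (E E₁ fp fm fp' fm' : ℝ → ℂ), 0 < T → T ≤ 1 →
      WaveODE ‖(2 * Real.pi) • ξ‖ E E₁ (fun t ↦ fp t + fm t) →
      FibreBounds ‖(2 * Real.pi) • ξ‖ T A M L E E₁ fp fm fp' fm' → ∀ τ,
        symPlus 1 (pt τ ξ) * symMinus γ (pt τ ξ) * ‖𝓕 (cutV T E) τ‖ ≤
          C * ((A + M * T) ^ (2 - γ) * (A * T⁻¹ + M + L * T) ^ (γ - 1)) := by
  obtain ⟨B, hB0, hB⟩ := exists_bound_cut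
  -- 28 is the constant of `fourier_cutV_le`, and 124 = 28 + 2 · 48, where 48 comes from
  -- `decay_cutF` and 2 from comparing Λ₋ with the distance to the cone.
  refine ⟨(28 * B) ^ (2 - γ) * (124 * B) ^ (γ - 1), by positivity, ?_⟩
  intro ξ T A M L E E₁ fp fm fp' fm' hT hT1 hode hb τ
  have hA := hb.A_nonneg hT
  have hM := hb.M_nonneg hT
  have hL := hb.L_nonneg hT
  have h1 := fourier_cutV_le hode (norm_nonneg _) hb hT hT1 hB0 (hB T hT) τ
  have h2 := decay_cutF hode (norm_nonneg _) hb hT hT1 hB0 (hB T hT) τ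
  set v := ‖𝓕 (cutV T E) τ‖ with hv
  have hv0 : 0 ≤ v := norm_nonneg _
  set F := ‖𝓕 (cutF T E E₁ (fun t ↦ fp t + fm t)) τ‖ with hF
  have hF0 : 0 ≤ F := norm_nonneg _
  have hbox : |symBox (pt τ ξ)| * v = F := by
    rw [hF, hode.fourier_cutF hT, norm_mul, Complex.norm_real, Real.norm_eq_abs]
    rfl
  have hp0 := symPlus_pos 1 (pt τ ξ)
  have hm0 := symMinus_pos 1 (pt τ ξ)
  have hplus := symPlus_one_le (pt τ ξ)
  rw [pt_fst, pt_snd] at hplus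
  have hpm := symPlus_mul_symMinus_le (pt τ ξ)
  -- The first power of Λ₋ is converted by Λ₊Λ₋ ≤ Λ₊ + |□|, and |□| times the transform is the
  -- transform of `cutF`.
  have s1 : symPlus 1 (pt τ ξ) * v * symMinus 1 (pt τ ξ) ≤ 28 * B * (A + M * T) := by
    calc symPlus 1 (pt τ ξ) * v * symMinus 1 (pt τ ξ) =
          symPlus 1 (pt τ ξ) * symMinus 1 (pt τ ξ) * v := by ring
      _ ≤ (symPlus 1 (pt τ ξ) + |symBox (pt τ ξ)|) * v := by gcongr
      _ = symPlus 1 (pt τ ξ) * v + F := by rw [add_mul, hbox]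
      _ ≤ (1 + |2 * Real.pi * τ| + ‖(2 * Real.pi) • ξ‖) * v + F := by gcongr
      _ ≤ _ := h1
  have hminus : symMinus 1 (pt τ ξ) ≤ 2 * (1 + |(|2 * Real.pi * τ| - ‖(2 * Real.pi) • ξ‖)|) :=
    symMinus_one_le_of_le (z := pt τ ξ) le_rfl
  have hT' : 1 ≤ T⁻¹ := (one_le_inv₀ hT).2 hT1
  -- The second power of Λ₋ falls either on the quantity bounded in `s1` or on the transform of
  -- `cutF`, which decays away from the cone.
  have s2 : symPlus 1 (pt τ ξ) * v * symMinus 1 (pt τ ξ) ^ 2 ≤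
      124 * B * (A * T⁻¹ + M + L * T) := by
    calc symPlus 1 (pt τ ξ) * v * symMinus 1 (pt τ ξ) ^ 2 =
          (symPlus 1 (pt τ ξ) * symMinus 1 (pt τ ξ)) * v * symMinus 1 (pt τ ξ) := by ring
      _ ≤ (symPlus 1 (pt τ ξ) + |symBox (pt τ ξ)|) * v * symMinus 1 (pt τ ξ) := by gcongr
      _ = symPlus 1 (pt τ ξ) * v * symMinus 1 (pt τ ξ) + symMinus 1 (pt τ ξ) * F := by
          rw [← hbox]; ring
      _ ≤ 28 * B * (A + M * T) +
          2 * (1 + |(|2 * Real.pi * τ| - ‖(2 * Real.pi) • ξ‖)|) * F := by gcongr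
      _ ≤ 28 * B * (A + M * T) + 2 * (48 * B * (A * T⁻¹ + M + L * T)) := by
          rw [mul_assoc 2]
          gcongr
      _ ≤ _ := by
          have q1 : B * A ≤ B * A * T⁻¹ := le_mul_of_one_le_right (by positivity) hT'
          have q2 : B * M * T ≤ B * M := mul_le_of_le_one_right (by positivity) hT1
          have q3 : 0 ≤ B * L * T := by positivity
          nlinarith
  have := rpow_interpolate (by positivity : 0 ≤ symPlus 1 (pt τ ξ) * v) hm0 s1 s2 hγ1 hγ2
  rw [symMinus_eq_rpow γ]
  calc symPlus 1 (pt τ ξ) * symMinus 1 (pt τ ξ) ^ γ * v =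
        symPlus 1 (pt τ ξ) * v * symMinus 1 (pt τ ξ) ^ γ := by ring
    _ ≤ _ := this
    _ = _ := by
        rw [Real.mul_rpow (x := 28 * B) (by positivity) (by positivity),
          Real.mul_rpow (x := 124 * B) (by positivity) (by positivity)]
        ring

end KernelBound

/-! ### From bounds on Fourier functions to elements of 𝒳^s and operators -/

section Tools

variable {n : ℕ}

theorem ae_snd {P : Sp n → Prop} (h : ∀ᵐ ξ, P ξ) : ∀ᵐ z : ST n, P z.snd := by
  have h1 : ∀ᵐ p : Sp n × ℝ, P p.1 := Measure.quasiMeasurePreserving_fst.ae h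
  rw [← measurePreserving_pt.map_eq]
  exact (measurableEmbedding_pt.ae_map_iff).2 h1

theorem exists_of_wnorm {s : ℝ} {U : ST n → ℂ} (hU : Measurable U)
    (h : wnorm s (fibMass U) < ⊤) : ∃ u : 𝓢'(ST n, ℂ), HasFourierFun u U := by
  set M : ℝ := (n : ℝ) + 1 - s with hM
  have hfin := ae_lt_top_of_wnorm (measurable_fibMass hU).aemeasurable h
  have h1 : Integrable fun ξ ↦ symS (-M) ξ * (fibMass U ξ).toReal := by
    refine integrable_symS_mul_of_wnorm (measurable_fibMass hU).ennreal_toReal.aestronglyMeasurable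
      (lt_of_le_of_lt (wnorm_mono (Filter.Eventually.of_forall fun ξ ↦ ?_)) h)
    rw [Real.enorm_eq_ofReal ENNReal.toReal_nonneg]
    exact ENNReal.ofReal_toReal_le
  have hm : Measurable fun z : ST n ↦ ((symX (-M) z : ℝ) : ℂ) * U z :=
    (Complex.continuous_ofReal.comp (continuous_symX (-M))).measurable.mul hU
  have h2 : Integrable fun z : ST n ↦ ((symX (-M) z : ℝ) : ℂ) * U z := by
    refine ⟨hm.aestronglyMeasurable, ?_⟩
    have hmp : Measurable fun p : Sp n × ℝ ↦ ‖((symX (-M) (pt p.2 p.1) : ℝ) : ℂ) * U (pt p.2 p.1)‖ₑ :=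
      (hm.comp measurable_pt).enorm
    rw [HasFiniteIntegral, lintegral_pt, Measure.volume_eq_prod, lintegral_prod _ hmp.aemeasurable]
    refine lt_of_eq_of_lt ?_ h1.2
    refine lintegral_congr_ae ?_
    filter_upwards [hfin] with ξ hξ
    have e : ∀ τ, ‖((symX (-M) (pt τ ξ) : ℝ) : ℂ) * U (pt τ ξ)‖ₑ =
        ENNReal.ofReal (symS (-M) ξ) * ‖U (pt τ ξ)‖ₑ := by
      intro τ
      rw [enorm_mul, ← ofReal_norm ((_ : ℝ) : ℂ), Complex.norm_real, symX_pt,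
        Real.norm_of_nonneg (symS_pos _ _).le]
    simp only [e]
    rw [lintegral_const_mul' _ _ ENNReal.ofReal_ne_top, enorm_mul,
      Real.enorm_eq_ofReal (symS_pos _ _).le, Real.enorm_eq_ofReal ENNReal.toReal_nonneg,
      ENNReal.ofReal_toReal hξ.ne]
    rfl
  obtain ⟨u, hu⟩ := exists_hasFourierFun (symX_temperate M) h2
  refine ⟨u, hu.congr_ae (Filter.Eventually.of_forall fun z ↦ ?_)⟩
  simp only
  rw [← mul_assoc, ← Complex.ofReal_mul, symX_neg, Complex.ofReal_one, one_mul]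

/-- Enlarging γ only weakens the estimate, because Λ₋ ≥ 1; taking γ ≥ 1 makes interpolation between
the powers 1 and 2 possible. The L^∞ norm in τ is replaced by a majorant `b` depending on ξ alone.
-/
theorem exists_upper {s : ℝ} {X : DistSpace (ST n)} (hX : MainHyp s X) :
    ∃ γ : ℝ, 1 ≤ γ ∧ γ < 2 ∧ ∃ C : ℝ≥0, ∀ (u : 𝓢'(ST n, ℂ)) (U : ST n → ℂ) (b : Sp n → ℝ≥0∞),
      HasFourierFun u U → wnorm (s - 1) b < ⊤ →
      (∀ᵐ ξ : Sp n, ∀ τ : ℝ, ENNReal.ofReal (symPlus 1 (pt τ ξ) * symMinus γ (pt τ ξ)) *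
        ‖U (pt τ ξ)‖ₑ ≤ b ξ) →
      ∃ w : X.carrier, X.toDist w = u ∧ ‖w‖ₑ ≤ C * wnorm (s - 1) b := by
  obtain ⟨γ, hγ, C, hC⟩ := hX.upper
  refine ⟨max γ 1, le_max_right _ _, max_lt hγ (by norm_num), C, fun u U b hU hb hbd ↦ ?_⟩
  have hle : (∫⁻ ξ : Sp n, (eLpNorm (fun τ : ℝ ↦ ((symX (s - 1) (pt τ ξ) * symPlus 1 (pt τ ξ) *
      symMinus γ (pt τ ξ) : ℝ) : ℂ) * U (pt τ ξ)) ⊤ volume) ^ (2 : ℝ)) ^ (1 / 2 : ℝ) ≤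
      wnorm (s - 1) b := by
    refine ENNReal.rpow_le_rpow (lintegral_mono_ae ?_) (by norm_num)
    filter_upwards [hbd] with ξ hξ
    refine ENNReal.rpow_le_rpow ?_ (by norm_num)
    rw [eLpNorm_exponent_top]
    refine eLpNormEssSup_le_of_ae_enorm_bound (Filter.Eventually.of_forall fun τ ↦ ?_)
    have h0 := symX_pos (s - 1) (pt τ ξ)
    have h1 := symPlus_pos 1 (pt τ ξ)
    have h2 := symMinus_pos γ (pt τ ξ)
    rw [enorm_mul, ← ofReal_norm ((_ : ℝ) : ℂ), Complex.norm_real,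
      Real.norm_of_nonneg (by positivity), mul_assoc, ENNReal.ofReal_mul h0.le, mul_assoc]
    refine mul_le_mul' le_rfl (le_trans ?_ (hξ τ))
    have h3 := symMinus_mono (le_max_left γ 1) (pt τ ξ)
    gcongr
  obtain ⟨w, hw, hwle⟩ := hC u U hU (hle.trans_lt hb)
  exact ⟨w, hw, hwle.trans (by gcongr)⟩

/-- A linear relation between a normed space and distributions that takes bounded values in a
Banach space of distributions is a continuous linear map. -/
theorem exists_clm_of_rel {E : Type} [NormedAddCommGroup E] [NormedSpace ℝ E] {B : DistSpace E}
    {V : Type*} [NormedAddCommGroup V] [NormedSpace ℂ V]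
    {P : V → 𝓢'(E, ℂ) → Prop} {C : ℝ} (hC : 0 ≤ C)
    (hex : ∀ v, ∃ w : B.carrier, P v (B.toDist w) ∧ ‖w‖ ≤ C * ‖v‖)
    (huniq : ∀ v d d', P v d → P v d' → d = d')
    (hadd : ∀ v v' d d', P v d → P v' d' → P (v + v') (d + d'))
    (hsmul : ∀ (c : ℂ) v d, P v d → P (c • v) (c • d)) :
    ∃ S : V →L[ℂ] B.carrier, (∀ v, P v (B.toDist (S v))) ∧ ‖S‖ ≤ C := by
  choose f hf hn using hex
  let L : V →ₗ[ℂ] B.carrier :=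
    { toFun := f
      map_add' := fun v v' ↦ B.inj (by
        rw [map_add]
        exact huniq _ _ _ (hf _) (hadd _ _ _ _ (hf v) (hf v')))
      map_smul' := fun c v ↦ B.inj (by
        rw [RingHom.id_apply, map_smul]
        exact huniq _ _ _ (hf _) (hsmul _ _ _ (hf v))) }
  exact ⟨L.mkContinuous C hn, hf, L.mkContinuous_norm_le hC hn⟩

theorem norm_le_of_enorm_le {V W : Type*} [NormedAddCommGroup V] [NormedAddCommGroup W] {v : V}
    {w : W} {C : ℝ≥0} (h : ‖w‖ₑ ≤ C * ‖v‖ₑ) : ‖w‖ ≤ C * ‖v‖ := by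
  rw [enorm_eq_nnnorm, enorm_eq_nnnorm] at h
  exact_mod_cast h

end Tools

/-! ### Explicit solution of the fibre equation -/

section Solution

/-- `sin (κ t) / κ`, extended by continuity to `κ = 0`. -/
def sn (κ t : ℝ) : ℝ := t * Real.sinc (κ * t)

theorem mul_sn (κ t : ℝ) : κ * sn κ t = Real.sin (κ * t) := by
  rw [sn]
  rcases eq_or_ne (κ * t) 0 with h | h
  · rw [h, Real.sinc_zero, Real.sin_zero, mul_one, h]
  · rw [Real.sinc_of_ne_zero h]
    rw [← mul_assoc, mul_div_cancel₀ _ h]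

theorem abs_sn_le (κ t : ℝ) : |sn κ t| ≤ |t| := by
  rw [sn, abs_mul]
  exact mul_le_of_le_one_right (abs_nonneg _) (Real.abs_sinc_le_one _)

theorem hasDerivAt_sn (κ t : ℝ) : HasDerivAt (sn κ) (Real.cos (κ * t)) t := by
  rcases eq_or_ne κ 0 with rfl | h
  · have e : sn 0 = fun t ↦ t := by
      ext t; simp [sn]
    rw [e, zero_mul, Real.cos_zero]
    exact hasDerivAt_id' t
  · have e : sn κ = fun t ↦ κ⁻¹ * Real.sin (κ * t) := by
      ext t
      rw [← mul_sn, ← mul_assoc, inv_mul_cancel₀ h, one_mul]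
    rw [e]
    have h1 := ((Real.hasDerivAt_sin (κ * t)).comp t ((hasDerivAt_id t).const_mul κ)).const_mul κ⁻¹
    refine h1.congr_deriv ?_
    field_simp

theorem continuous_sn_uncurry : Continuous fun p : ℝ × ℝ ↦ sn p.1 p.2 := by
  unfold sn
  exact continuous_snd.mul (Real.continuous_sinc.comp (continuous_fst.mul continuous_snd))

theorem continuous_sn (κ : ℝ) : Continuous (sn κ) :=
  continuous_iff_continuousAt.2 fun t ↦ (hasDerivAt_sn κ t).continuousAt

/-- The integral `∫₀ᵗ cos (κ r) f(r) dr`. -/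
def intCos (κ : ℝ) (f : ℝ → ℂ) (t : ℝ) : ℂ := ∫ r in (0 : ℝ)..t, (Real.cos (κ * r) : ℂ) * f r

/-- The integral `∫₀ᵗ sin (κ r) / κ f(r) dr`. -/
def intSn (κ : ℝ) (f : ℝ → ℂ) (t : ℝ) : ℂ := ∫ r in (0 : ℝ)..t, (sn κ r : ℂ) * f r

/-- The solution of `E'' + κ² E = -f` with `E(0) = a`, `E'(0) = b`. -/
def solE (κ : ℝ) (a b : ℂ) (f : ℝ → ℂ) (t : ℝ) : ℂ :=
  (Real.cos (κ * t) : ℂ) * a + (sn κ t : ℂ) * b -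
    ((sn κ t : ℂ) * intCos κ f t - (Real.cos (κ * t) : ℂ) * intSn κ f t)

/-- The derivative of `solE`. -/
def solD (κ : ℝ) (a b : ℂ) (f : ℝ → ℂ) (t : ℝ) : ℂ :=
  -(κ * Real.sin (κ * t) : ℂ) * a + (Real.cos (κ * t) : ℂ) * b -
    ((Real.cos (κ * t) : ℂ) * intCos κ f t + (κ * Real.sin (κ * t) : ℂ) * intSn κ f t)

variable {κ : ℝ} {f : ℝ → ℂ}

theorem hasDerivAt_intCos (hf : Continuous f) (t : ℝ) :
    HasDerivAt (intCos κ f) ((Real.cos (κ * t) : ℂ) * f t) t := by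
  have hc : Continuous fun r : ℝ ↦ (Real.cos (κ * r) : ℂ) * f r := by fun_prop
  exact intervalIntegral.integral_hasDerivAt_right (hc.intervalIntegrable _ _)
    (hc.stronglyMeasurableAtFilter _ _) hc.continuousAt

theorem hasDerivAt_intSn (hf : Continuous f) (t : ℝ) :
    HasDerivAt (intSn κ f) ((sn κ t : ℂ) * f t) t := by
  have h1 := continuous_sn κ
  have hc : Continuous fun r : ℝ ↦ (sn κ r : ℂ) * f r := by fun_prop
  exact intervalIntegral.integral_hasDerivAt_right (hc.intervalIntegrable _ _)
    (hc.stronglyMeasurableAtFilter _ _) hc.continuousAt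

theorem hasDerivAt_cosC (κ t : ℝ) : HasDerivAt (fun t : ℝ ↦ (Real.cos (κ * t) : ℂ))
    (-(κ * Real.sin (κ * t) : ℂ)) t := by
  have h1 := ((Real.hasDerivAt_cos (κ * t)).comp t ((hasDerivAt_id t).const_mul κ)).ofReal_comp
  refine h1.congr_deriv ?_
  push_cast
  ring

theorem hasDerivAt_sinC (κ t : ℝ) : HasDerivAt (fun t : ℝ ↦ (κ * Real.sin (κ * t) : ℂ))
    ((κ : ℂ) ^ 2 * Real.cos (κ * t)) t := by
  have h1 := (((Real.hasDerivAt_sin (κ * t)).comp t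
    ((hasDerivAt_id t).const_mul κ)).ofReal_comp).const_mul (κ : ℂ)
  refine h1.congr_deriv ?_
  push_cast
  ring

/-- Variation of constants. The kernel sin(κ(t - r))/κ is expanded by the addition theorem, so that
t leaves the integrands and each integral is a plain primitive. -/
theorem waveODE_sol (a b : ℂ) (hf : Continuous f) :
    WaveODE κ (solE κ a b f) (solD κ a b f) f where
  deriv_zero t := by
    have h1 := (((hasDerivAt_cosC κ t).mul_const a).add
      ((hasDerivAt_sn κ t).ofReal_comp.mul_const b)).sub
      (((hasDerivAt_sn κ t).ofReal_comp.mul (hasDerivAt_intCos (κ := κ) hf t)).sub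
        ((hasDerivAt_cosC κ t).mul (hasDerivAt_intSn (κ := κ) hf t)))
    refine h1.congr_deriv ?_
    simp only [solD]
    ring
  deriv_one t := by
    have h1 := (((hasDerivAt_sinC κ t).neg.mul_const a).add ((hasDerivAt_cosC κ t).mul_const b)).sub
      (((hasDerivAt_cosC κ t).mul (hasDerivAt_intCos (κ := κ) hf t)).add
        ((hasDerivAt_sinC κ t).mul (hasDerivAt_intSn (κ := κ) hf t)))
    refine h1.congr_deriv ?_
    have e1 : (κ : ℂ) * sn κ t = Real.sin (κ * t) := by
      rw [← Complex.ofReal_mul, mul_sn]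
    have e2 : (Real.sin (κ * t) : ℂ) ^ 2 + (Real.cos (κ * t) : ℂ) ^ 2 = 1 := by
      rw [← Complex.ofReal_pow, ← Complex.ofReal_pow, ← Complex.ofReal_add,
        Real.sin_sq_add_cos_sq, Complex.ofReal_one]
    simp only [solE]
    linear_combination (κ * b - κ * intCos κ f t - Real.sin (κ * t) * f t) * e1 - f t * e2
  cont := hf

theorem solE_zero (a b : ℂ) (f : ℝ → ℂ) : solE κ a b f 0 = a := by
  simp [solE, sn, intCos, intSn]

theorem solD_zero (a b : ℂ) (f : ℝ → ℂ) : solD κ a b f 0 = b := by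
  simp [solD, intCos, intSn]

theorem norm_intCos_le {t M : ℝ} (hf : ∀ r, |r| ≤ |t| → ‖f r‖ ≤ M) :
    ‖intCos κ f t‖ ≤ M * |t| := by
  have := intervalIntegral.norm_integral_le_of_norm_le_const (a := 0) (b := t) (C := M)
    (f := fun r : ℝ ↦ (Real.cos (κ * r) : ℂ) * f r) fun r hr ↦ by
      rw [norm_mul, Complex.norm_real, Real.norm_eq_abs]
      have hr' : |r| ≤ |t| := by
        rcases Set.mem_uIoc.1 hr with h | h
        · rw [abs_of_pos h.1, abs_of_pos (h.1.trans_le h.2)]; exact h.2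
        · rw [abs_of_nonpos h.2, abs_of_neg (h.1.trans_le h.2)]; linarith [h.1]
      exact (mul_le_of_le_one_left (norm_nonneg _) (Real.abs_cos_le_one _)).trans (hf r hr')
  simpa [intCos] using this

/-- Both bounds are uniform in κ: the first uses |sn κ r| ≤ |r|, the second κ · sn κ r = sin(κr). -/
theorem norm_intSn_le {t M : ℝ} (hf : ∀ r, |r| ≤ |t| → ‖f r‖ ≤ M) :
    ‖intSn κ f t‖ ≤ |t| * M * |t| ∧ ‖(κ : ℂ) * intSn κ f t‖ ≤ M * |t| := by
  have hr' : ∀ r ∈ Set.uIoc 0 t, |r| ≤ |t| := by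
    intro r hr
    rcases Set.mem_uIoc.1 hr with h | h
    · rw [abs_of_pos h.1, abs_of_pos (h.1.trans_le h.2)]; exact h.2
    · rw [abs_of_nonpos h.2, abs_of_neg (h.1.trans_le h.2)]; linarith [h.1]
  constructor
  · have := intervalIntegral.norm_integral_le_of_norm_le_const (a := 0) (b := t) (C := |t| * M)
      (f := fun r : ℝ ↦ (sn κ r : ℂ) * f r) fun r hr ↦ by
        rw [norm_mul, Complex.norm_real, Real.norm_eq_abs]
        exact mul_le_mul ((abs_sn_le κ r).trans (hr' r hr)) (hf r (hr' r hr)) (norm_nonneg _)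
          (abs_nonneg _)
    simpa [intSn] using this
  · have := intervalIntegral.norm_integral_le_of_norm_le_const (a := 0) (b := t) (C := M)
      (f := fun r : ℝ ↦ (κ : ℂ) * ((sn κ r : ℂ) * f r)) fun r hr ↦ by
        rw [← mul_assoc, ← Complex.ofReal_mul, mul_sn, norm_mul, Complex.norm_real,
          Real.norm_eq_abs]
        exact (mul_le_of_le_one_left (norm_nonneg _) (Real.abs_sin_le_one _)).trans
          (hf r (hr' r hr))
    rw [intervalIntegral.integral_const_mul] at this
    simpa [intSn] using this

theorem solE_free (a b : ℂ) (t : ℝ) :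
    solE κ a b (fun _ ↦ 0) t = (Real.cos (κ * t) : ℂ) * a + (sn κ t : ℂ) * b := by
  simp [solE, intCos, intSn]

theorem solD_free (a b : ℂ) (t : ℝ) : solD κ a b (fun _ ↦ 0) t =
    -(κ * Real.sin (κ * t) : ℂ) * a + (Real.cos (κ * t) : ℂ) * b := by
  simp [solD, intCos, intSn]

theorem fibreBounds_free (hκ : 0 ≤ κ) (a b : ℂ) :
    FibreBounds κ 1 ((1 + κ) * ‖a‖ + 2 * ‖b‖) 0 0 (solE κ a b fun _ ↦ 0) (solD κ a b fun _ ↦ 0)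
      (fun _ ↦ 0) (fun _ ↦ 0) (fun _ ↦ 0) (fun _ ↦ 0) where
  zero t ht := by
    rw [solE_free, mul_one]
    refine (norm_add_le _ _).trans ?_
    rw [norm_mul, norm_mul, Complex.norm_real, Complex.norm_real, Real.norm_eq_abs,
      Real.norm_eq_abs]
    have h1 := mul_le_of_le_one_left (norm_nonneg a) (Real.abs_cos_le_one (κ * t))
    have h2 := mul_le_mul_of_nonneg_right ((abs_sn_le κ t).trans ht) (norm_nonneg b)
    have h3 := mul_nonneg hκ (norm_nonneg a)
    linarith
  omega t ht := by
    have e : κ * ‖solE κ a b (fun _ ↦ 0) t‖ = ‖(κ : ℂ) * solE κ a b (fun _ ↦ 0) t‖ := by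
      rw [norm_mul, Complex.norm_real, Real.norm_of_nonneg hκ]
    have e2 : (κ : ℂ) * solE κ a b (fun _ ↦ 0) t = (κ : ℂ) * ((Real.cos (κ * t) : ℂ) * a) +
        (Real.sin (κ * t) : ℂ) * b := by
      rw [solE_free, ← mul_sn κ t]
      push_cast
      ring
    rw [e, e2]
    refine (norm_add_le _ _).trans ?_
    rw [norm_mul, norm_mul, norm_mul, Complex.norm_real, Complex.norm_real, Complex.norm_real,
      Real.norm_eq_abs, Real.norm_eq_abs, Real.norm_eq_abs, abs_of_nonneg hκ]
    have h1 := mul_le_mul_of_nonneg_left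
      (mul_le_of_le_one_left (norm_nonneg a) (Real.abs_cos_le_one (κ * t))) hκ
    have h2 := mul_le_of_le_one_left (norm_nonneg b) (Real.abs_sin_le_one (κ * t))
    have h3 := norm_nonneg a
    have h4 := norm_nonneg b
    linarith
  one t ht := by
    rw [solD_free]
    refine (norm_add_le _ _).trans ?_
    rw [norm_mul, norm_mul, norm_neg, norm_mul, Complex.norm_real, Complex.norm_real,
      Complex.norm_real, Real.norm_eq_abs, Real.norm_eq_abs, Real.norm_eq_abs, abs_of_nonneg hκ]
    have h1 := mul_le_mul_of_nonneg_right
      (mul_le_of_le_one_right hκ (Real.abs_sin_le_one (κ * t))) (norm_nonneg a)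
    have h2 := mul_le_of_le_one_left (norm_nonneg b) (Real.abs_cos_le_one (κ * t))
    have h3 := norm_nonneg a
    have h4 := norm_nonneg b
    linarith
  plus t _ := by simp
  minus t _ := by simp
  plus_deriv t := hasDerivAt_const t 0
  minus_deriv t := hasDerivAt_const t 0
  plus_cont := continuous_const
  minus_cont := continuous_const
  plus' t _ := by simp
  minus' t _ := by simp

/-- With zero data E' is O(MT) and E is O(MT²) on |t| ≤ 2T, whence the choice 16MT for the constant
A. This extra factor T, absent for free waves, is the origin of the smallness of the near-cone
operator. The 16 comes from ‖E‖ ≤ 4M|t|² ≤ 16MT². -/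
theorem fibreBounds_duhamel {T M L : ℝ} {fp fm fp' fm' : ℝ → ℂ} (hκ : 0 ≤ κ) (hT : 0 < T)
    (hp : ∀ t, ‖fp t‖ ≤ M) (hm : ∀ t, ‖fm t‖ ≤ M)
    (hdp : ∀ t, HasDerivAt fp (fp' t) t) (hdm : ∀ t, HasDerivAt fm (fm' t) t)
    (hcp : Continuous fp') (hcm : Continuous fm')
    (hLp : ∀ t, ‖fp' t - Complex.I * κ * fp t‖ ≤ L)
    (hLm : ∀ t, ‖fm' t - Complex.I * (-κ : ℝ) * fm t‖ ≤ L) :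
    FibreBounds κ T (16 * M * T) M L (solE κ 0 0 fun t ↦ fp t + fm t)
      (solD κ 0 0 fun t ↦ fp t + fm t) fp fm fp' fm' := by
  have hM : 0 ≤ M := (norm_nonneg _).trans (hp 0)
  have hf : ∀ t r : ℝ, |r| ≤ |t| → ‖fp r + fm r‖ ≤ 2 * M := fun t r _ ↦
    (norm_add_le _ _).trans (by linarith [hp r, hm r])
  have hE : ∀ t, solE κ 0 0 (fun t ↦ fp t + fm t) t =
      (Real.cos (κ * t) : ℂ) * intSn κ (fun t ↦ fp t + fm t) t -
        (sn κ t : ℂ) * intCos κ (fun t ↦ fp t + fm t) t := fun t ↦ by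
    simp only [solE]; ring
  have hD : ∀ t, solD κ 0 0 (fun t ↦ fp t + fm t) t =
      -((Real.cos (κ * t) : ℂ) * intCos κ (fun t ↦ fp t + fm t) t +
        (Real.sin (κ * t) : ℂ) * (κ * intSn κ (fun t ↦ fp t + fm t) t)) := fun t ↦ by
    simp only [solD]; ring
  have hcos : ∀ (t : ℝ) (x : ℂ), ‖(Real.cos (κ * t) : ℂ) * x‖ ≤ ‖x‖ := fun t x ↦ by
    rw [norm_mul, Complex.norm_real, Real.norm_eq_abs]
    exact mul_le_of_le_one_left (norm_nonneg _) (Real.abs_cos_le_one _)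
  have hsin : ∀ (t : ℝ) (x : ℂ), ‖(Real.sin (κ * t) : ℂ) * x‖ ≤ ‖x‖ := fun t x ↦ by
    rw [norm_mul, Complex.norm_real, Real.norm_eq_abs]
    exact mul_le_of_le_one_left (norm_nonneg _) (Real.abs_sin_le_one _)
  refine ⟨fun t ht ↦ ?_, fun t ht ↦ ?_, fun t ht ↦ ?_, fun t _ ↦ hp t, fun t _ ↦ hm t, hdp, hdm,
    hcp, hcm, fun t _ ↦ hLp t, fun t _ ↦ hLm t⟩
  · have h1 := norm_intCos_le (κ := κ) (hf t)
    have h2 := (norm_intSn_le (κ := κ) (hf t)).1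
    rw [hE]
    refine (norm_sub_le _ _).trans ?_
    have h3 := (hcos t (intSn κ (fun t ↦ fp t + fm t) t)).trans h2
    have h4 : ‖(sn κ t : ℂ) * intCos κ (fun t ↦ fp t + fm t) t‖ ≤ |t| * (2 * M * |t|) := by
      rw [norm_mul, Complex.norm_real, Real.norm_eq_abs]
      exact mul_le_mul (abs_sn_le κ t) h1 (norm_nonneg _) (abs_nonneg _)
    have h5 : |t| * |t| ≤ (2 * T) * (2 * T) := mul_le_mul ht ht (abs_nonneg _) (by positivity)
    have h6 := mul_le_mul_of_nonneg_left h5 (by positivity : 0 ≤ 4 * M)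
    linarith
  · have h1 := norm_intCos_le (κ := κ) (hf t)
    have h2 := (norm_intSn_le (κ := κ) (hf t)).2
    have e : κ * ‖solE κ 0 0 (fun t ↦ fp t + fm t) t‖ =
        ‖(κ : ℂ) * solE κ 0 0 (fun t ↦ fp t + fm t) t‖ := by
      rw [norm_mul, Complex.norm_real, Real.norm_of_nonneg hκ]
    have e2 : (κ : ℂ) * solE κ 0 0 (fun t ↦ fp t + fm t) t =
        (Real.cos (κ * t) : ℂ) * (κ * intSn κ (fun t ↦ fp t + fm t) t) -
          (Real.sin (κ * t) : ℂ) * intCos κ (fun t ↦ fp t + fm t) t := by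
      rw [hE, ← mul_sn κ t]
      push_cast
      ring
    rw [e, e2]
    refine (norm_sub_le _ _).trans ?_
    have h3 := (hcos t _).trans h2
    have h4 := (hsin t _).trans h1
    have h5 := mul_le_mul_of_nonneg_left ht (by positivity : 0 ≤ 4 * M)
    have h6 : 0 ≤ M * T := by positivity
    linarith
  · have h1 := norm_intCos_le (κ := κ) (hf t)
    have h2 := (norm_intSn_le (κ := κ) (hf t)).2
    rw [hD, norm_neg]
    refine (norm_add_le _ _).trans ?_
    have h3 := (hcos t _).trans h1
    have h4 := (hsin t _).trans h2
    have h5 := mul_le_mul_of_nonneg_left ht (by positivity : 0 ≤ 4 * M)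
    have h6 : 0 ≤ M * T := by positivity
    linarith

/-- Rescaling to the interval (0, 1] turns the moving endpoint into a parameter of the integrand. -/
theorem measurable_intervalIntegral {α : Type*} [MeasurableSpace α] {g : α → ℝ → ℂ}
    (hg : Measurable (Function.uncurry g)) :
    Measurable fun p : α × ℝ ↦ ∫ r in (0 : ℝ)..p.2, g p.1 r := by
  have e : (fun p : α × ℝ ↦ ∫ r in (0 : ℝ)..p.2, g p.1 r) =
      fun p ↦ p.2 • ∫ x in Set.Ioc (0 : ℝ) 1, g p.1 (p.2 * x) := by
    ext p
    rw [← intervalIntegral.integral_of_le zero_le_one]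
    have := intervalIntegral.smul_integral_comp_mul_left (a := 0) (b := 1) (g p.1) p.2
    rw [mul_zero, mul_one] at this
    exact this.symm
  rw [e]
  have h1 : Measurable (Function.uncurry fun (p : α × ℝ) (x : ℝ) ↦ g p.1 (p.2 * x)) :=
    hg.comp (by fun_prop : Measurable fun q : (α × ℝ) × ℝ ↦ (q.1.1, q.1.2 * q.2))
  exact measurable_snd.smul
    (StronglyMeasurable.integral_prod_right h1.stronglyMeasurable).measurable

theorem measurable_sol {α : Type*} [MeasurableSpace α] {k : α → ℝ} {a b : α → ℂ} {g : α → ℝ → ℂ}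
    (hk : Measurable k) (ha : Measurable a) (hb : Measurable b)
    (hg : Measurable (Function.uncurry g)) :
    Measurable (Function.uncurry fun x ↦ solE (k x) (a x) (b x) (g x)) ∧
      Measurable (Function.uncurry fun x ↦ solD (k x) (a x) (b x) (g x)) := by
  have hsn : Measurable fun p : α × ℝ ↦ ((sn (k p.1) p.2 : ℝ) : ℂ) :=
    (Complex.continuous_ofReal.comp continuous_sn_uncurry).measurable.comp
      (by fun_prop : Measurable fun p : α × ℝ ↦ (k p.1, p.2))
  have h1 : Measurable fun p : α × ℝ ↦ intCos (k p.1) (g p.1) p.2 :=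
    measurable_intervalIntegral (g := fun x r ↦ (Real.cos (k x * r) : ℂ) * g x r)
      ((by fun_prop : Measurable fun p : α × ℝ ↦ ((Real.cos (k p.1 * p.2) : ℝ) : ℂ)).mul hg)
  have h2 : Measurable fun p : α × ℝ ↦ intSn (k p.1) (g p.1) p.2 :=
    measurable_intervalIntegral (g := fun x r ↦ (sn (k x) r : ℂ) * g x r) (hsn.mul hg)
  simp only [Function.uncurry_def, solE, solD]
  constructor <;> fun_prop

end Solution

/-! ### From solutions on fibres to a distribution -/

section Cut

variable {n : ℕ}

theorem fibBound_of_wnorm {r : ℝ} {p : Sp n → ℝ → ℂ} (hp : Measurable (Function.uncurry p))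
    {A : Sp n → ℝ≥0∞} (hA : Measurable A) (h : wnorm r A < ⊤) {c : ℝ≥0}
    (hb : ∀ᵐ ξ, ∀ t, ‖p ξ t‖ₑ ≤ c * A ξ) : FibBound p := by
  refine ⟨hp, fun ξ ↦ (c * A ξ).toReal, (n : ℝ) + 1 - r, ?_, ?_⟩
  · refine integrable_symS_mul_of_wnorm (hA.const_mul _).ennreal_toReal.aestronglyMeasurable ?_
    refine lt_of_le_of_lt (wnorm_mono (b' := fun ξ ↦ c * A ξ) (Filter.Eventually.of_forall
      fun ξ ↦ ?_)) ?_
    · rw [Real.enorm_eq_ofReal ENNReal.toReal_nonneg]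
      exact ENNReal.ofReal_toReal_le
    · rw [wnorm_const_mul _ ENNReal.coe_ne_top]
      exact ENNReal.mul_lt_top ENNReal.coe_lt_top h
  · filter_upwards [hb, ae_lt_top_of_wnorm hA.aemeasurable h] with ξ h1 h2 t
    have h3 := ENNReal.toReal_mono (ENNReal.mul_lt_top ENNReal.coe_lt_top h2).ne (h1 t)
    rwa [toReal_enorm] at h3

theorem exists_enorm_cut_le {T : ℝ} (hT : 0 < T) :
    ∃ c : ℝ≥0, ∀ j ≤ 2, ∀ t, ‖(cut T j t : ℂ)‖ₑ ≤ c := by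
  obtain ⟨B, hB, h⟩ := exists_bound_cut
  refine ⟨(B * (1 + T⁻¹) ^ 2).toNNReal, fun j hj t ↦ ?_⟩
  rw [← ofReal_norm, Complex.norm_real, Real.norm_eq_abs]
  refine ENNReal.ofReal_le_ofReal ((h T hT j (by omega) t).trans ?_)
  have h1 : 0 < T⁻¹ := inv_pos.2 hT
  refine mul_le_mul_of_nonneg_left ?_ hB
  exact (pow_le_pow_left₀ h1.le (by linarith) j).trans (pow_le_pow_right₀ (by linarith) hj)

/-- Cut-off families of solutions of the wave equation on the fibres. -/
theorem exists_cut {T r : ℝ} (hT : 0 < T) {E E₁ f : Sp n → ℝ → ℂ}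
    (hE : Measurable (Function.uncurry E)) (hE₁ : Measurable (Function.uncurry E₁))
    (hf : Measurable (Function.uncurry f))
    (hode : ∀ᵐ ξ, WaveODE ‖(2 * Real.pi) • ξ‖ (E ξ) (E₁ ξ) (f ξ)) {A : Sp n → ℝ≥0∞}
    (hA : Measurable A) (hAr : wnorm r A < ⊤)
    (hb : ∀ᵐ ξ, ∀ t, |t| ≤ 2 * T → ‖E ξ t‖ₑ ≤ A ξ ∧ ‖E₁ ξ t‖ₑ ≤ A ξ ∧ ‖f ξ t‖ₑ ≤ A ξ) :
    (∃ u : 𝓢'(ST n, ℂ), HasFourierFun u (fun z ↦ 𝓕 (cutV T (E z.snd)) z.fst)) ∧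
    ∀ u : 𝓢'(ST n, ℂ), HasFourierFun u (fun z ↦ 𝓕 (cutV T (E z.snd)) z.fst) →
      (∀ d₀ d₁ : 𝓢'(Sp n, ℂ), HasFourierFun d₀ (fun ξ ↦ E ξ 0) →
        HasFourierFun d₁ (fun ξ ↦ E₁ ξ 0) → HasData u d₀ d₁) ∧
      ∀ (F : 𝓢'(ST n, ℂ)), HasFib F f → EqOnSlab (-T) T (box u) F := by
  obtain ⟨c, hc⟩ := exists_enorm_cut_le hT
  have hcut : ∀ j, Measurable fun p : Sp n × ℝ ↦ (cut T j p.2 : ℂ) := fun j ↦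
    (Complex.continuous_ofReal.comp ((continuous_cut T j).comp continuous_snd)).measurable
  have hV : FibBound fun ξ ↦ cutV T (E ξ) := by
    refine fibBound_of_wnorm ((hcut 0).mul hE) hA hAr (c := c) ?_
    filter_upwards [hb] with ξ hξ t
    rcases le_total (|t|) (2 * T) with ht | ht
    · rw [cutV, enorm_mul]
      exact mul_le_mul' (hc 0 (by omega) t) (hξ t ht).1
    · simp [cutV, cut_eq_zero hT _ ht]
  have hD : FibBound fun ξ ↦ cutD T (E ξ) (E₁ ξ) := by
    refine fibBound_of_wnorm (((hcut 1).mul hE).add ((hcut 0).mul hE₁)) hA hAr (c := c + c) ?_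
    filter_upwards [hb] with ξ hξ t
    rcases le_total (|t|) (2 * T) with ht | ht
    · rw [cutD]
      refine (enorm_add_le _ _).trans ?_
      rw [enorm_mul, enorm_mul, ENNReal.coe_add, add_mul]
      exact add_le_add (mul_le_mul' (hc 1 (by omega) t) (hξ t ht).1)
        (mul_le_mul' (hc 0 (by omega) t) (hξ t ht).2.1)
    · simp [cutD, cut_eq_zero hT _ ht]
  have hF : FibBound fun ξ ↦ cutF T (E ξ) (E₁ ξ) (f ξ) := by
    refine fibBound_of_wnorm ((((hcut 0).mul hf).sub ((hcut 2).mul hE)).sub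
      (((hcut 1).mul hE₁).const_mul 2)) hA hAr (c := c + c + 2 * c) ?_
    filter_upwards [hb] with ξ hξ t
    rcases le_total (|t|) (2 * T) with ht | ht
    · rw [cutF]
      refine enorm_sub_le.trans ?_
      rw [ENNReal.coe_add, add_mul]
      refine add_le_add (enorm_sub_le.trans ?_) ?_
      · rw [enorm_mul, enorm_mul, ENNReal.coe_add, add_mul]
        exact add_le_add (mul_le_mul' (hc 0 (by omega) t) (hξ t ht).2.2)
          (mul_le_mul' (hc 2 (by omega) t) (hξ t ht).1)
      · rw [enorm_mul, enorm_mul, ENNReal.coe_mul, mul_assoc]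
        refine mul_le_mul' ?_ (mul_le_mul' (hc 1 (by omega) t) (hξ t ht).2.1)
        rw [← ofReal_norm]
        simp
    · simp [cutF, cut_eq_zero hT _ ht]
  have hT2 : (0 : ℝ) ≤ 2 * T := by positivity
  have rV := exists_hasFib_of_support hV hT2 fun ξ t ht ↦ by simp [cutV, cut_eq_zero hT _ ht.le]
  have rD := exists_hasFib_of_support hD hT2 fun ξ t ht ↦ by simp [cutD, cut_eq_zero hT _ ht.le]
  have rF := exists_hasFib_of_support hF hT2 fun ξ t ht ↦ by simp [cutF, cut_eq_zero hT _ ht.le]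
  refine ⟨rV.1, fun u hu ↦ ?_⟩
  have fV := rV.2 u hu
  have fD : HasFib (dt u) fun ξ ↦ cutD T (E ξ) (E₁ ξ) := by
    refine rD.2 _ (hu.dt.congr_ae ?_)
    filter_upwards [ae_snd hode] with z hz
    exact (hz.fourier_cutD hT z.fst).symm
  have fF : HasFib (box u) fun ξ ↦ cutF T (E ξ) (E₁ ξ) (f ξ) := by
    refine rF.2 _ (hu.box.congr_ae ?_)
    filter_upwards [ae_snd hode] with z hz
    rw [hz.fourier_cutF hT z.fst]
    rfl
  have h0 : |(0 : ℝ)| < T := by rwa [abs_zero]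
  -- For |t| < T the cut-off is 1 and its derivatives vanish, so data and source are those of the
  -- solution before cutting.
  refine ⟨fun d₀ d₁ hd₀ hd₁ ↦ ⟨?_, ?_⟩, fun F hFf ↦ fF.eqOnSlab hFf ?_⟩
  · obtain ⟨U, hU, hUt⟩ := fV.exists_isPath (by
      filter_upwards [hode] with ξ hξ using (hξ.cptC1_cutV hT).continuous)
    refine ⟨U, hU, (hUt 0).ext hd₀ (Filter.Eventually.of_forall fun ξ ↦ ?_)⟩
    simp [cutV, cut_zero_eq_one hT h0.le]
  · obtain ⟨U, hU, hUt⟩ := fD.exists_isPath (by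
      filter_upwards [hode] with ξ hξ using (hξ.cptC1_cutV hT).cont)
    refine ⟨U, hU, (hUt 0).ext hd₁ (Filter.Eventually.of_forall fun ξ ↦ ?_)⟩
    simp [cutD, cut_zero_eq_one hT h0.le, cut_succ_eq_zero hT 0 h0]
  · refine Filter.Eventually.of_forall fun ξ t ht ↦ ?_
    have ht' : |t| < T := abs_lt.2 ht
    simp [cutF, cut_zero_eq_one hT ht'.le, cut_succ_eq_zero hT _ ht']

end Cut

/-! ### Linearity and conjugation symmetry of the solution formulas -/

section Linearity

theorem intCos_lin {κ : ℝ} {c c' : ℂ} {f f' g : ℝ → ℂ} (hf : Continuous f) (hf' : Continuous f')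
    (h : ∀ t, g t = c * f t + c' * f' t) (t : ℝ) :
    intCos κ g t = c * intCos κ f t + c' * intCos κ f' t := by
  have h1 : IntervalIntegrable (fun r : ℝ ↦ c * ((Real.cos (κ * r) : ℂ) * f r)) volume 0 t :=
    (by fun_prop : Continuous _).intervalIntegrable _ _
  have h2 : IntervalIntegrable (fun r : ℝ ↦ c' * ((Real.cos (κ * r) : ℂ) * f' r)) volume 0 t :=
    (by fun_prop : Continuous _).intervalIntegrable _ _
  simp only [intCos]
  rw [← intervalIntegral.integral_const_mul, ← intervalIntegral.integral_const_mul,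
    ← intervalIntegral.integral_add h1 h2]
  congr 1
  ext r
  rw [h r]
  ring

theorem intSn_lin {κ : ℝ} {c c' : ℂ} {f f' g : ℝ → ℂ} (hf : Continuous f) (hf' : Continuous f')
    (h : ∀ t, g t = c * f t + c' * f' t) (t : ℝ) :
    intSn κ g t = c * intSn κ f t + c' * intSn κ f' t := by
  have hs := continuous_sn κ
  have h1 : IntervalIntegrable (fun r : ℝ ↦ c * ((sn κ r : ℂ) * f r)) volume 0 t :=
    (by fun_prop : Continuous _).intervalIntegrable _ _
  have h2 : IntervalIntegrable (fun r : ℝ ↦ c' * ((sn κ r : ℂ) * f' r)) volume 0 t :=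
    (by fun_prop : Continuous _).intervalIntegrable _ _
  simp only [intSn]
  rw [← intervalIntegral.integral_const_mul, ← intervalIntegral.integral_const_mul,
    ← intervalIntegral.integral_add h1 h2]
  congr 1
  ext r
  rw [h r]
  ring

theorem solE_lin {κ : ℝ} {c c' a a' b b' : ℂ} {f f' g : ℝ → ℂ} (hf : Continuous f)
    (hf' : Continuous f') (h : ∀ t, g t = c * f t + c' * f' t) (t : ℝ) :
    solE κ (c * a + c' * a') (c * b + c' * b') g t =
      c * solE κ a b f t + c' * solE κ a' b' f' t := by
  simp only [solE, intCos_lin hf hf' h, intSn_lin hf hf' h]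
  ring

theorem solE_conj {κ : ℝ} {a b : ℂ} {f g : ℝ → ℂ} (h : ∀ t, g t = (starRingEnd ℂ) (f t)) (t : ℝ) :
    solE κ ((starRingEnd ℂ) a) ((starRingEnd ℂ) b) g t = (starRingEnd ℂ) (solE κ a b f t) := by
  have h1 : intCos κ g t = (starRingEnd ℂ) (intCos κ f t) := by
    simp only [intCos, intervalIntegral, map_sub, ← integral_conj, map_mul, Complex.conj_ofReal, h]
  have h2 : intSn κ g t = (starRingEnd ℂ) (intSn κ f t) := by
    simp only [intSn, intervalIntegral, map_sub, ← integral_conj, map_mul, Complex.conj_ofReal, h]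
  simp only [solE, h1, h2, map_sub, map_add, map_mul, Complex.conj_ofReal]

theorem fourier_cutV_lin {T : ℝ} (hT : 0 < T) {c c' : ℂ} {f f' g : ℝ → ℂ} (hf : Continuous f)
    (hf' : Continuous f') (h : ∀ t, g t = c * f t + c' * f' t) (τ : ℝ) :
    𝓕 (cutV T g) τ = c * 𝓕 (cutV T f) τ + c' * 𝓕 (cutV T f') τ := by
  have hi : ∀ k : ℝ → ℂ, Continuous k → Integrable (cutV T k) := fun k hk ↦ by
    have h1 := continuous_cut T 0
    have h2 : Continuous (cutV T k) := by unfold cutV; fun_prop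
    exact integrable_of_support (R := 2 * T) h2 fun t ht ↦ by simp [cutV, cut_eq_zero hT _ ht.le]
  have e : cutV T g = fun t ↦ c * cutV T f t + c' * cutV T f' t := by
    ext t
    simp only [cutV, h t]
    ring
  rw [e, fourier_add_apply ((hi f hf).const_mul c) ((hi f' hf').const_mul c'),
    fourier_const_mul_apply, fourier_const_mul_apply]

theorem fourier_conj_neg {f g : ℝ → ℂ} (h : ∀ t, g t = (starRingEnd ℂ) (f t)) (τ : ℝ) :
    𝓕 g (-τ) = (starRingEnd ℂ) (𝓕 f τ) := by
  rw [Real.fourier_real_eq_integral_exp_smul, Real.fourier_real_eq_integral_exp_smul,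
    ← integral_conj]
  refine integral_congr_ae (Filter.Eventually.of_forall fun t ↦ ?_)
  simp only [h t, smul_eq_mul, map_mul, ← Complex.exp_conj, Complex.conj_ofReal, Complex.conj_I]
  congr 2
  push_cast
  ring

theorem fourier_cutV_conj {T : ℝ} {f g : ℝ → ℂ} (h : ∀ t, g t = (starRingEnd ℂ) (f t)) (τ : ℝ) :
    𝓕 (cutV T g) (-τ) = (starRingEnd ℂ) (𝓕 (cutV T f) τ) :=
  fourier_conj_neg (fun t ↦ by simp [cutV, h t]) τ

end Linearity

/-! ### Free waves cut off in time -/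

section Free

variable {n : ℕ}

/-- The space-time Fourier transform of the cut-off free wave with data `(a, b)`. -/
def freeFun (a b : Sp n → ℂ) (z : ST n) : ℂ :=
  𝓕 (cutV 1 (solE ‖(2 * Real.pi) • z.snd‖ (a z.snd) (b z.snd) fun _ ↦ 0)) z.fst

theorem continuous_solE {κ : ℝ} {a b : ℂ} {f : ℝ → ℂ} (hf : Continuous f) :
    Continuous (solE κ a b f) := (waveODE_sol a b hf).continuous_zero

theorem freeFun_congr {a b a' b' : Sp n → ℂ} (ha : a =ᵐ[volume] a') (hb : b =ᵐ[volume] b') :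
    freeFun a b =ᵐ[volume] freeFun a' b' := by
  filter_upwards [ae_snd ha, ae_snd hb] with z h1 h2
  rw [freeFun, freeFun, h1, h2]

theorem freeFun_lin {a b a' b' a'' b'' : Sp n → ℂ} {c c' : ℂ} {z : ST n}
    (ha : a'' z.snd = c * a z.snd + c' * a' z.snd)
    (hb : b'' z.snd = c * b z.snd + c' * b' z.snd) :
    freeFun a'' b'' z = c * freeFun a b z + c' * freeFun a' b' z := by
  rw [freeFun, ha, hb]
  refine fourier_cutV_lin one_pos (continuous_solE continuous_const)
    (continuous_solE continuous_const) (fun t ↦ ?_) _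
  exact solE_lin continuous_const continuous_const (fun t ↦ by simp) t

theorem freeFun_neg {a b : Sp n → ℂ} {z : ST n}
    (ha : a (-z.snd) = (starRingEnd ℂ) (a z.snd)) (hb : b (-z.snd) = (starRingEnd ℂ) (b z.snd)) :
    freeFun a b (-z) = (starRingEnd ℂ) (freeFun a b z) := by
  have e1 : (-z).snd = -z.snd := rfl
  have e2 : (-z).fst = -z.fst := rfl
  rw [freeFun, e1, e2, ha, hb, smul_neg, norm_neg]
  exact fourier_cutV_conj (fun t ↦ solE_conj (fun t ↦ by simp) t) _

/-- The size of free waves on a fibre. -/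
def freeSize (a b : Sp n → ℂ) (ξ : Sp n) : ℝ :=
  (1 + ‖(2 * Real.pi) • ξ‖) * ‖a ξ‖ + 2 * ‖b ξ‖

theorem measurable_freeSize {a b : Sp n → ℂ} (ha : Measurable a) (hb : Measurable b) :
    Measurable (freeSize a b) := by
  unfold freeSize
  fun_prop

theorem freeSize_nonneg (a b : Sp n → ℂ) (ξ : Sp n) : 0 ≤ freeSize a b ξ := by
  unfold freeSize
  positivity

/-- The factor 1 + |ξ| is at most twice the symbol of Λ; it turns the (s - 1)-norm into the s-norm
for `f`, while `g` keeps the (s - 1)-norm. -/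
theorem wnorm_freeSize_le {s : ℝ} {f : (H n s).carrier} {g : (H n (s - 1)).carrier}
    {a b : Sp n → ℂ} (ha : Measurable a) (hb : Measurable b)
    (hf : HasFourierFun ((H n s).toDist f) a) (hg : HasFourierFun ((H n (s - 1)).toDist g) b) :
    wnorm (s - 1) (fun ξ ↦ ENNReal.ofReal (freeSize a b ξ)) ≤ 2 * ‖f‖ₑ + 2 * ‖g‖ₑ := by
  have h1 : ∀ ξ, ENNReal.ofReal (freeSize a b ξ) ≤
      2 * (ENNReal.ofReal (symS 1 ξ) * ‖a ξ‖ₑ) + 2 * ‖b ξ‖ₑ := by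
    intro ξ
    have hs := symS_pos 1 ξ
    have e : 2 * (ENNReal.ofReal (symS 1 ξ) * ‖a ξ‖ₑ) + 2 * ‖b ξ‖ₑ =
        ENNReal.ofReal (2 * (symS 1 ξ * ‖a ξ‖) + 2 * ‖b ξ‖) := by
      rw [ENNReal.ofReal_add (by positivity) (by positivity), ENNReal.ofReal_mul (by norm_num),
        ENNReal.ofReal_mul hs.le, ENNReal.ofReal_mul (by norm_num), ofReal_norm, ofReal_norm]
      simp
    rw [e]
    refine ENNReal.ofReal_le_ofReal ?_
    have h2 := norm_le_symS_one ξ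
    have h3 := one_le_symS ξ (zero_le_one' ℝ)
    have h4 := mul_le_mul_of_nonneg_right (by linarith : 1 + ‖(2 * Real.pi) • ξ‖ ≤ 2 * symS 1 ξ)
      (norm_nonneg (a ξ))
    rw [freeSize]
    linarith
  refine (wnorm_mono (Filter.Eventually.of_forall h1)).trans ?_
  have hm : Measurable fun ξ ↦ 2 * (ENNReal.ofReal (symS 1 ξ) * ‖a ξ‖ₑ) :=
    ((continuous_symS 1).measurable.ennreal_ofReal.mul ha.enorm).const_mul 2
  refine (wnorm_add_le hm.aemeasurable (hb.enorm.const_mul 2).aemeasurable).trans ?_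
  rw [wnorm_const_mul _ (by simp), wnorm_const_mul _ (by simp), wnorm_symS, sub_add_cancel,
    ← enorm_H hf, ← enorm_H hg]

theorem HasFib.zero : HasFib (0 : 𝓢'(ST n, ℂ)) fun _ _ ↦ 0 := by
  refine ⟨⟨measurable_const, fun _ ↦ 0, 0, by simp, by simp⟩, fun Ψ ↦ ?_⟩
  rw [FourierTransform.fourier_zero]
  simp

theorem exists_cut_free {s : ℝ} {f : (H n s).carrier} {g : (H n (s - 1)).carrier}
    {a b : Sp n → ℂ} (ha : Measurable a) (hb : Measurable b)
    (hf : HasFourierFun ((H n s).toDist f) a) (hg : HasFourierFun ((H n (s - 1)).toDist g) b) :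
    (∃ u : 𝓢'(ST n, ℂ), HasFourierFun u (freeFun a b)) ∧
    ∀ u : 𝓢'(ST n, ℂ), HasFourierFun u (freeFun a b) →
      HasData u ((H n s).toDist f) ((H n (s - 1)).toDist g) ∧ EqOnSlab (-1) 1 (box u) 0 := by
  have hk : Measurable fun ξ : Sp n ↦ ‖(2 * Real.pi) • ξ‖ := by fun_prop
  have hm := measurable_sol (g := fun _ _ ↦ 0) hk ha hb measurable_const
  have h := exists_cut one_pos (f := fun _ _ ↦ 0) hm.1 hm.2 measurable_const
    (Filter.Eventually.of_forall fun ξ ↦ waveODE_sol (a ξ) (b ξ) continuous_const)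
    (measurable_freeSize ha hb).ennreal_ofReal
    ((wnorm_freeSize_le ha hb hf hg).trans_lt (by finiteness))
    (Filter.Eventually.of_forall fun ξ t ht ↦ by
      have hF := fibreBounds_free (norm_nonneg ((2 * Real.pi) • ξ)) (a ξ) (b ξ)
      refine ⟨?_, ?_, by simp⟩
      · rw [← ofReal_norm]
        refine ENNReal.ofReal_le_ofReal ((hF.zero t ht).trans ?_)
        rw [mul_one, freeSize]
      · rw [← ofReal_norm]
        exact ENNReal.ofReal_le_ofReal (hF.one t ht))
  refine ⟨h.1, fun u hu ↦ ?_⟩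
  obtain ⟨h1, h2⟩ := h.2 u hu
  refine ⟨h1 _ _ ?_ ?_, h2 0 HasFib.zero⟩
  · simpa only [solE_zero] using hf
  · simpa only [solD_zero] using hg

/-- The operator which maps data to a cut-off free wave. -/
theorem exists_free {s : ℝ} {X : DistSpace (ST n)} (hX : MainHyp s X) :
    ∃ W : (H n s).carrier × (H n (s - 1)).carrier →L[ℂ] X.carrier,
      ∀ (f : (H n s).carrier) (g : (H n (s - 1)).carrier) (a b : Sp n → ℂ), Measurable a →
        Measurable b → HasFourierFun ((H n s).toDist f) a →
        HasFourierFun ((H n (s - 1)).toDist g) b →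
        HasFourierFun (X.toDist (W (f, g))) (freeFun a b) := by
  obtain ⟨γ, hγ1, hγ2, C, hC⟩ := exists_upper hX
  obtain ⟨C', hC', hker⟩ := exists_kernel_bound (n := n) hγ1 hγ2.le
  -- Quantifying over all Fourier representatives makes the relation independent of choices, so that
  -- uniqueness and linearity become identities almost everywhere.
  let P : (H n s).carrier × (H n (s - 1)).carrier → 𝓢'(ST n, ℂ) → Prop := fun v d ↦
    ∀ a b : Sp n → ℂ, Measurable a → Measurable b → HasFourierFun ((H n s).toDist v.1) a →
      HasFourierFun ((H n (s - 1)).toDist v.2) b → HasFourierFun d (freeFun a b)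
  suffices h : ∃ W : (H n s).carrier × (H n (s - 1)).carrier →L[ℂ] X.carrier,
      (∀ v, P v (X.toDist (W v))) ∧ ‖W‖ ≤ ((C * C'.toNNReal * 4 : ℝ≥0) : ℝ) by
    obtain ⟨W, hW, -⟩ := h
    exact ⟨W, fun f g ↦ hW (f, g)⟩
  refine exists_clm_of_rel (by positivity) ?_ ?_ ?_ ?_
  · rintro ⟨f, g⟩
    obtain ⟨a, ham, ha⟩ := exists_hasFourierFun_H f
    obtain ⟨b, hbm, hb⟩ := exists_hasFourierFun_H g
    obtain ⟨⟨u, hu⟩, -⟩ := exists_cut_free ham hbm ha hb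
    have hw := wnorm_freeSize_le ham hbm ha hb
    have hw' : wnorm (s - 1) (fun ξ ↦ (C'.toNNReal : ℝ≥0∞) * ENNReal.ofReal (freeSize a b ξ)) ≤
        C'.toNNReal * (2 * ‖f‖ₑ + 2 * ‖g‖ₑ) := by
      rw [wnorm_const_mul _ ENNReal.coe_ne_top]
      gcongr
    obtain ⟨w, hw1, hw2⟩ := hC u _ (fun ξ ↦ C'.toNNReal * ENNReal.ofReal (freeSize a b ξ)) hu
      (hw'.trans_lt (by finiteness)) (Filter.Eventually.of_forall fun ξ τ ↦ by
        have h1 := hker ξ 1 _ 0 0 _ _ _ _ _ _ one_pos le_rfl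
          (by
            simpa using waveODE_sol (κ := ‖(2 * Real.pi) • ξ‖) (a ξ) (b ξ) (f := fun _ ↦ 0)
              continuous_const)
          (fibreBounds_free (norm_nonneg ((2 * Real.pi) • ξ)) (a ξ) (b ξ)) τ
        have h2 := freeSize_nonneg a b ξ
        have e : ((1 + ‖(2 * Real.pi) • ξ‖) * ‖a ξ‖ + 2 * ‖b ξ‖) = freeSize a b ξ := rfl
        -- With T = 1 and no source, both factors of the kernel bound are powers of `freeSize`, with
        -- exponents adding up to 1.
        rw [e, zero_mul, add_zero, inv_one, mul_one, add_zero, add_zero,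
          ← Real.rpow_add_of_nonneg h2 (by linarith) (by linarith),
          (by ring : 2 - γ + (γ - 1) = 1), Real.rpow_one] at h1
        have hs1 := symPlus_pos 1 (pt τ ξ)
        have hs2 := symMinus_pos γ (pt τ ξ)
        have e2 : (C'.toNNReal : ℝ≥0∞) = ENNReal.ofReal C' := rfl
        rw [← ofReal_norm, ← ENNReal.ofReal_mul (by positivity), e2, ← ENNReal.ofReal_mul hC']
        exact ENNReal.ofReal_le_ofReal h1)
    refine ⟨w, fun a' b' ham' hbm' ha' hb' ↦ ?_, norm_le_of_enorm_le (hw2.trans ?_)⟩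
    · rw [hw1]
      exact hu.congr_ae (freeFun_congr (ha.ae_eq ha') (hb.ae_eq hb'))
    · have h3 : 2 * ‖f‖ₑ + 2 * ‖g‖ₑ ≤ 4 * ‖(f, g)‖ₑ := by
        have h4 : ‖f‖ₑ ≤ ‖(f, g)‖ₑ := enorm_le_iff_norm_le.2 (le_max_left _ _)
        have h5 : ‖g‖ₑ ≤ ‖(f, g)‖ₑ := enorm_le_iff_norm_le.2 (le_max_right _ _)
        calc 2 * ‖f‖ₑ + 2 * ‖g‖ₑ ≤ 2 * ‖(f, g)‖ₑ + 2 * ‖(f, g)‖ₑ := by gcongr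
          _ = 4 * ‖(f, g)‖ₑ := by ring
      calc (C : ℝ≥0∞) * wnorm (s - 1) _ ≤ C * (C'.toNNReal * (4 * ‖(f, g)‖ₑ)) := by
            gcongr
            exact hw'.trans (by gcongr)
        _ = _ := by push_cast; ring
  · rintro ⟨f, g⟩ d d' hd hd'
    obtain ⟨a, ham, ha⟩ := exists_hasFourierFun_H f
    obtain ⟨b, hbm, hb⟩ := exists_hasFourierFun_H g
    exact (hd a b ham hbm ha hb).ext (hd' a b ham hbm ha hb) (Filter.EventuallyEq.refl _ _)
  · rintro ⟨f, g⟩ ⟨f', g'⟩ d d' hd hd' a'' b'' ham'' hbm'' ha'' hb''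
    obtain ⟨a, ham, ha⟩ := exists_hasFourierFun_H f
    obtain ⟨b, hbm, hb⟩ := exists_hasFourierFun_H g
    obtain ⟨a', ham', ha'⟩ := exists_hasFourierFun_H f'
    obtain ⟨b', hbm', hb'⟩ := exists_hasFourierFun_H g'
    have hs := (hd a b ham hbm ha hb).add (hd' a' b' ham' hbm' ha' hb')
    refine hs.congr_ae ?_
    have e1 := ha''.ae_eq (V := a + a') (by simpa using ha.add ha')
    have e2 := hb''.ae_eq (V := b + b') (by simpa using hb.add hb')
    filter_upwards [ae_snd e1, ae_snd e2] with z h1 h2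
    rw [freeFun_lin (c := 1) (c' := 1) (a := a) (a' := a') (b := b) (b' := b')
      (by simpa using h1) (by simpa using h2)]
    simp
  · rintro c ⟨f, g⟩ d hd a'' b'' ham'' hbm'' ha'' hb''
    obtain ⟨a, ham, ha⟩ := exists_hasFourierFun_H f
    obtain ⟨b, hbm, hb⟩ := exists_hasFourierFun_H g
    refine ((hd a b ham hbm ha hb).smul c).congr_ae ?_
    have e1 := ha''.ae_eq (V := c • a) (by simpa using ha.smul c)
    have e2 := hb''.ae_eq (V := c • b) (by simpa using hb.smul c)
    filter_upwards [ae_snd e1, ae_snd e2] with z h1 h2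
    rw [freeFun_lin (c := c) (c' := 0) (a := a) (a' := a) (b := b) (b' := b)
      (by simpa using h1) (by simpa using h2)]
    simp

end Free

/-! ### Sources near the light cone -/

section LowFrequency

variable {n : ℕ}

theorem fourierInv_add_apply {f g : ℝ → ℂ} (hf : Integrable f) (hg : Integrable g) (t : ℝ) :
    𝓕⁻ (fun τ ↦ f τ + g τ) t = 𝓕⁻ f t + 𝓕⁻ g t := by
  simp only [Real.fourierInv_eq_fourier_neg]
  exact fourier_add_apply hf hg _

theorem fourierInv_const_mul_apply (c : ℂ) (f : ℝ → ℂ) (t : ℝ) :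
    𝓕⁻ (fun τ ↦ c * f τ) t = c * 𝓕⁻ f t := by
  simp only [Real.fourierInv_eq_fourier_neg]
  exact fourier_const_mul_apply c f _

theorem fourierInv_congr_ae {f g : ℝ → ℂ} (h : f =ᵐ[volume] g) (t : ℝ) : 𝓕⁻ f t = 𝓕⁻ g t := by
  rw [Real.fourierInv_eq', Real.fourierInv_eq']
  refine integral_congr_ae ?_
  filter_upwards [h] with τ hτ
  rw [hτ]

theorem fourierInv_conj_neg {f g : ℝ → ℂ} (h : ∀ᵐ τ : ℝ, g (-τ) = (starRingEnd ℂ) (f τ)) (t : ℝ) :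
    𝓕⁻ g t = (starRingEnd ℂ) (𝓕⁻ f t) := by
  rw [Real.fourierInv_eq', Real.fourierInv_eq', ← integral_conj, ← integral_neg_eq_self]
  refine integral_congr_ae ?_
  filter_upwards [h] with τ hτ
  simp only [hτ, smul_eq_mul, map_mul, ← Complex.exp_conj, Complex.conj_ofReal, Complex.conj_I]
  simp

/-- After removing the oscillation at κ, a time derivative costs only the width `c` of the frequency
support. This yields the constant L of `FibreBounds` without any power of |ξ|. -/
theorem exists_deriv_fourierInv {κ c : ℝ} {h : ℝ → ℂ} (hi : Integrable h)
    (hs : ∀ τ, h τ ≠ 0 → |2 * Real.pi * τ - κ| ≤ c) :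
    ∃ f' : ℝ → ℂ, (∀ t, HasDerivAt (𝓕⁻ h) (f' t) t) ∧ Continuous f' ∧
      ∀ t, ‖f' t - Complex.I * κ * 𝓕⁻ h t‖ ≤ c * ∫ τ, ‖h τ‖ := by
  have hm : ∀ τ : ℝ, 2 * Real.pi * Complex.I * τ * h τ =
      Complex.I * ((2 * Real.pi * τ - κ : ℝ) : ℂ) * h τ + Complex.I * κ * h τ := by
    intro τ
    push_cast
    ring
  have hb : ∀ τ, ‖Complex.I * ((2 * Real.pi * τ - κ : ℝ) : ℂ) * h τ‖ ≤ c * ‖h τ‖ := by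
    intro τ
    rcases eq_or_ne (h τ) 0 with h0 | h0
    · simp [h0]
    · rw [norm_mul, norm_mul, Complex.norm_I, one_mul, Complex.norm_real, Real.norm_eq_abs]
      exact mul_le_mul_of_nonneg_right (hs τ h0) (norm_nonneg _)
  have i1 : Integrable fun τ : ℝ ↦ Complex.I * ((2 * Real.pi * τ - κ : ℝ) : ℂ) * h τ :=
    (hi.norm.const_mul c).mono' ((by fun_prop : Continuous fun τ : ℝ ↦
      Complex.I * ((2 * Real.pi * τ - κ : ℝ) : ℂ)).aestronglyMeasurable.mul hi.1)
      (Filter.Eventually.of_forall hb)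
  have i2 : Integrable fun τ : ℝ ↦ 2 * Real.pi * Complex.I * τ * h τ := by
    simp only [hm]
    exact i1.add (hi.const_mul _)
  refine ⟨𝓕⁻ fun τ : ℝ ↦ 2 * Real.pi * Complex.I * τ * h τ, hasDerivAt_fourierInv hi i2,
    continuous_fourierInv i2, fun t ↦ ?_⟩
  have e : 𝓕⁻ (fun τ : ℝ ↦ 2 * Real.pi * Complex.I * τ * h τ) t =
      𝓕⁻ (fun τ : ℝ ↦ Complex.I * ((2 * Real.pi * τ - κ : ℝ) : ℂ) * h τ) t +
        Complex.I * κ * 𝓕⁻ h t := by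
    rw [← fourierInv_const_mul_apply, ← fourierInv_add_apply i1 (hi.const_mul _)]
    exact congrArg (fun g : ℝ → ℂ ↦ 𝓕⁻ g t) (funext hm)
  rw [e, add_sub_cancel_right, ← integral_const_mul]
  exact (norm_fourierInv_le _ t).trans (integral_mono i1.norm (hi.norm.const_mul c) hb)

/-- On the support |2πτ| is within 2K of |ξ|, so splitting by the sign of τ separates the
frequencies near |ξ| from those near -|ξ|. -/
theorem exists_fibreBounds {K : ℝ} {V : ST n → ℂ} {ξ : Sp n}
    (hi : Integrable fun τ ↦ V (pt τ ξ)) (hs : ∀ τ, V (pt τ ξ) ≠ 0 → symMinus 1 (pt τ ξ) ≤ K) :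
    ∃ fp fm fp' fm' : ℝ → ℂ, (invFib V ξ = fun t ↦ fp t + fm t) ∧ ∀ T, 0 < T →
      FibreBounds ‖(2 * Real.pi) • ξ‖ T (16 * (∫ τ, ‖V (pt τ ξ)‖) * T) (∫ τ, ‖V (pt τ ξ)‖)
        (2 * K * ∫ τ, ‖V (pt τ ξ)‖)
        (solE ‖(2 * Real.pi) • ξ‖ 0 0 fun t ↦ fp t + fm t)
        (solD ‖(2 * Real.pi) • ξ‖ 0 0 fun t ↦ fp t + fm t) fp fm fp' fm' := by
  set κ := ‖(2 * Real.pi) • ξ‖ with hκ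
  set h : ℝ → ℂ := fun τ ↦ V (pt τ ξ) with hh
  let hp : ℝ → ℂ := (Set.Ioi 0).indicator h
  let hm : ℝ → ℂ := (Set.Ioi 0)ᶜ.indicator h
  have ip : Integrable hp := hi.indicator measurableSet_Ioi
  have im : Integrable hm := hi.indicator measurableSet_Ioi.compl
  have hcone : ∀ τ, h τ ≠ 0 → |(|2 * Real.pi * τ| - κ)| ≤ 2 * K := fun τ h0 ↦
    (dist_cone_le (pt τ ξ)).trans (by linarith [hs τ h0])
  have hpi := Real.pi_pos
  obtain ⟨fp', dp, cp, bp⟩ := exists_deriv_fourierInv (κ := κ) (c := 2 * K) ip (by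
    intro τ h0
    have hτ : τ ∈ Set.Ioi (0 : ℝ) := Set.mem_of_indicator_ne_zero h0
    have h1 : h τ ≠ 0 := by simpa [hp, Set.indicator_of_mem hτ] using h0
    have h2 := hcone τ h1
    have h3 : 0 < τ := hτ
    rwa [abs_of_pos (by positivity : 0 < 2 * Real.pi * τ)] at h2)
  obtain ⟨fm', dm, cm, bm⟩ := exists_deriv_fourierInv (κ := -κ) (c := 2 * K) im (by
    intro τ h0
    have hτ : τ ∈ (Set.Ioi (0 : ℝ))ᶜ := Set.mem_of_indicator_ne_zero h0
    have h1 : h τ ≠ 0 := by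
      have : hm τ = h τ := Set.indicator_of_mem hτ _
      rwa [← this]
    have h2 := hcone τ h1
    have h3 : τ ≤ 0 := not_lt.1 hτ
    rw [abs_of_nonpos (by nlinarith : 2 * Real.pi * τ ≤ 0), ← abs_neg] at h2
    convert h2 using 2
    ring)
  have np : ∫ τ, ‖hp τ‖ ≤ ∫ τ, ‖h τ‖ := integral_mono ip.norm hi.norm fun τ ↦
    norm_indicator_le_norm_self _ _
  have nm : ∫ τ, ‖hm τ‖ ≤ ∫ τ, ‖h τ‖ := integral_mono im.norm hi.norm fun τ ↦
    norm_indicator_le_norm_self _ _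
  have hK' : ∀ x, x ≤ ∫ τ, ‖h τ‖ → 0 ≤ x → 2 * K * x ≤ 2 * K * ∫ τ, ‖h τ‖ := by
    intro x hx hx0
    -- No sign of `K` is assumed; a negative value leaves no room for the positive symbol of Λ₋, and
    -- the fibre vanishes.
    rcases le_or_gt 0 K with h0 | h0
    · exact mul_le_mul_of_nonneg_left hx (by linarith)
    · have hz : ∀ τ, h τ = 0 := fun τ ↦ by
        by_contra hne
        linarith [hs τ hne, symMinus_pos 1 (pt τ ξ)]
      have : ∫ τ, ‖h τ‖ = 0 := by simp [hz]
      have hx' : x = 0 := le_antisymm (this ▸ hx) hx0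
      rw [hx', this]
  refine ⟨𝓕⁻ hp, 𝓕⁻ hm, fp', fm', ?_, fun T hT ↦ ?_⟩
  · ext t
    rw [← fourierInv_add_apply ip im, invFib]
    refine congrArg (fun g : ℝ → ℂ ↦ 𝓕⁻ g t) (funext fun τ ↦ ?_)
    exact (congrFun (Set.indicator_self_add_compl (Set.Ioi 0) h) τ).symm
  · refine fibreBounds_duhamel (norm_nonneg _) hT (fun t ↦ (norm_fourierInv_le _ t).trans np)
      (fun t ↦ (norm_fourierInv_le _ t).trans nm) dp dm cp cm (fun t ↦ (bp t).trans ?_)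
      (fun t ↦ (bm t).trans ?_)
    · exact hK' _ np (integral_nonneg fun τ ↦ norm_nonneg _)
    · exact hK' _ nm (integral_nonneg fun τ ↦ norm_nonneg _)

/-- The space-time Fourier transform of the cut-off solution of `□u = F` with zero data, where
`V` is the Fourier transform of `F`. -/
def loFun (T : ℝ) (V : ST n → ℂ) (z : ST n) : ℂ :=
  𝓕 (cutV T (solE ‖(2 * Real.pi) • z.snd‖ 0 0 (invFib V z.snd))) z.fst

theorem invFib_lin {V V' V'' : ST n → ℂ} {c c' : ℂ} {ξ : Sp n}
    (hi : Integrable fun τ ↦ V (pt τ ξ)) (hi' : Integrable fun τ ↦ V' (pt τ ξ))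
    (h : ∀ᵐ τ : ℝ, V'' (pt τ ξ) = c * V (pt τ ξ) + c' * V' (pt τ ξ)) (t : ℝ) :
    invFib V'' ξ t = c * invFib V ξ t + c' * invFib V' ξ t := by
  rw [invFib, fourierInv_congr_ae h, fourierInv_add_apply (hi.const_mul c) (hi'.const_mul c'),
    fourierInv_const_mul_apply, fourierInv_const_mul_apply]
  rfl

theorem loFun_lin {T : ℝ} (hT : 0 < T) {V V' V'' : ST n → ℂ} {c c' : ℂ} {z : ST n}
    (hi : Integrable fun τ ↦ V (pt τ z.snd)) (hi' : Integrable fun τ ↦ V' (pt τ z.snd))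
    (h : ∀ᵐ τ : ℝ, V'' (pt τ z.snd) = c * V (pt τ z.snd) + c' * V' (pt τ z.snd)) :
    loFun T V'' z = c * loFun T V z + c' * loFun T V' z := by
  have c1 : Continuous (invFib V z.snd) := continuous_fourierInv hi
  have c2 : Continuous (invFib V' z.snd) := continuous_fourierInv hi'
  refine fourier_cutV_lin hT (continuous_solE c1) (continuous_solE c2) (fun t ↦ ?_) _
  have := solE_lin (κ := ‖(2 * Real.pi) • z.snd‖) (a := 0) (a' := 0) (b := 0) (b' := 0) c1 c2
    (invFib_lin hi hi' h) t
  simpa using this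

theorem invFib_neg {V : ST n → ℂ} {ξ : Sp n}
    (h : ∀ᵐ τ : ℝ, V (pt (-τ) (-ξ)) = (starRingEnd ℂ) (V (pt τ ξ))) (t : ℝ) :
    invFib V (-ξ) t = (starRingEnd ℂ) (invFib V ξ t) :=
  fourierInv_conj_neg h t

theorem loFun_neg {T : ℝ} {V : ST n → ℂ} {z : ST n}
    (h : ∀ᵐ τ : ℝ, V (pt (-τ) (-z.snd)) = (starRingEnd ℂ) (V (pt τ z.snd))) :
    loFun T V (-z) = (starRingEnd ℂ) (loFun T V z) := by
  have e1 : (-z).snd = -z.snd := rfl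
  have e2 : (-z).fst = -z.fst := rfl
  rw [loFun, e1, e2, smul_neg, norm_neg]
  refine fourier_cutV_conj (fun t ↦ ?_) _
  have := solE_conj (κ := ‖(2 * Real.pi) • z.snd‖) (a := 0) (b := 0) (invFib_neg h) t
  simpa using this

theorem measurable_invFib {V : ST n → ℂ} (hV : Measurable V) :
    Measurable (Function.uncurry (invFib V)) :=
  measurable_fourierInv_fibre (p := fun (q : Sp n × ℝ) τ ↦ V (pt τ q.1))
    ((hV.comp measurable_pt).comp
      (by fun_prop : Measurable fun r : (Sp n × ℝ) × ℝ ↦ (r.1.1, r.2))) measurable_snd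

theorem integral_norm_fibre {V : ST n → ℂ} (hV : Measurable V) (ξ : Sp n) :
    ∫ τ, ‖V (pt τ ξ)‖ = (fibMass V ξ).toReal :=
  integral_norm_eq_lintegral_enorm (hV.comp (continuous_pt_left ξ).measurable).aestronglyMeasurable

theorem exists_cut_lo {r K T : ℝ} (hT : 0 < T) (hT1 : T ≤ 1) {V : ST n → ℂ} (hV : Measurable V)
    (hr : wnorm r (fibMass V) < ⊤) (hs : ∀ z, V z ≠ 0 → symMinus 1 z ≤ K) :
    (∃ u : 𝓢'(ST n, ℂ), HasFourierFun u (loFun T V)) ∧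
    ∀ u : 𝓢'(ST n, ℂ), HasFourierFun u (loFun T V) → HasData u 0 0 ∧
      ∀ F, HasFourierFun F V → EqOnSlab (-T) T (box u) F := by
  have hk : Measurable fun ξ : Sp n ↦ ‖(2 * Real.pi) • ξ‖ := by fun_prop
  have hi := ae_integrable_of_wnorm hV hr
  have hm := measurable_sol (g := invFib V) hk measurable_const measurable_const
    (measurable_invFib hV) (a := fun _ ↦ 0) (b := fun _ ↦ 0)
  have h := exists_cut (r := r) hT hm.1 hm.2 (measurable_invFib hV)
    (hi.mono fun ξ hξ ↦ waveODE_sol 0 0 (continuous_fourierInv hξ))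
    ((measurable_fibMass hV).const_mul (16 : ℝ≥0))
    (by
      rw [wnorm_const_mul _ (by simp)]
      exact ENNReal.mul_lt_top (by simp) hr)
    (by
      filter_upwards [hi, ae_lt_top_of_wnorm (measurable_fibMass hV).aemeasurable hr]
        with ξ hξ hfin t ht
      obtain ⟨fp, fm, fp', fm', e, hb⟩ := exists_fibreBounds hξ fun τ ↦ hs (pt τ ξ)
      have hb := hb T hT
      rw [e]
      have e2 : ((16 : ℝ≥0) : ℝ≥0∞) * fibMass V ξ = ENNReal.ofReal (16 * ∫ τ, ‖V (pt τ ξ)‖) := by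
        rw [integral_norm_fibre hV, ENNReal.ofReal_mul (by norm_num), ENNReal.ofReal_toReal hfin.ne]
        simp
      have hM : 0 ≤ ∫ τ, ‖V (pt τ ξ)‖ := integral_nonneg fun τ ↦ norm_nonneg _
      have hMT := mul_le_of_le_one_right hM hT1
      have hMT' : 0 ≤ (∫ τ, ‖V (pt τ ξ)‖) * T := by positivity
      have hMT2 := mul_le_of_le_one_right hMT' hT1
      rw [e2]
      simp only [← ofReal_norm]
      refine ⟨ENNReal.ofReal_le_ofReal ((hb.zero t ht).trans ?_),
        ENNReal.ofReal_le_ofReal ((hb.one t ht).trans ?_),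
        ENNReal.ofReal_le_ofReal ((norm_add_le _ _).trans ?_)⟩
      · linarith
      · linarith
      · linarith [hb.plus t ht, hb.minus t ht])
  refine ⟨h.1, fun u hu ↦ ?_⟩
  obtain ⟨h1, h2⟩ := h.2 u hu
  refine ⟨h1 0 0 ?_ ?_, fun F hF ↦ h2 F (hasFib_invFib hF hV hr)⟩
  · simp only [solE_zero]
    exact HasFourierFun.zero
  · simp only [solD_zero]
    exact HasFourierFun.zero

/-- Here the power of T appears. With A = 16MT and L = 2KM, the factors of the kernel bound are
O((TM)^{2-γ}) and O(M^{γ-1}), and their product is O(T^{2-γ}M). -/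
theorem exists_lo_bound {γ : ℝ} (hγ1 : 1 ≤ γ) (hγ2 : γ ≤ 2) (K : ℝ) (hK : 0 ≤ K) :
    ∃ C : ℝ≥0, ∀ (T : ℝ) (V : ST n → ℂ), 0 < T → T ≤ 1 → Measurable V →
      (∀ z, V z ≠ 0 → symMinus 1 z ≤ K) → ∀ ξ : Sp n, fibMass V ξ < ⊤ → ∀ τ,
        ENNReal.ofReal (symPlus 1 (pt τ ξ) * symMinus γ (pt τ ξ)) * ‖loFun T V (pt τ ξ)‖ₑ ≤
          C * ENNReal.ofReal (T ^ (2 - γ)) * fibMass V ξ := by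
  obtain ⟨C', hC', hker⟩ := exists_kernel_bound (n := n) hγ1 hγ2
  refine ⟨(C' * (17 ^ (2 - γ) * (17 + 2 * K) ^ (γ - 1))).toNNReal, fun T V hT hT1 hV hs ξ hfin τ ↦ ?_⟩
  have hξ : Integrable fun τ ↦ V (pt τ ξ) :=
    ⟨(hV.comp (continuous_pt_left ξ).measurable).aestronglyMeasurable, hfin⟩
  obtain ⟨fp, fm, fp', fm', e, hb⟩ := exists_fibreBounds hξ fun τ ↦ hs (pt τ ξ)
  have hb := hb T hT
  have hM : 0 ≤ ∫ τ, ‖V (pt τ ξ)‖ := integral_nonneg fun τ ↦ norm_nonneg _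
  have h1 := hker ξ T _ _ _ _ _ _ _ _ _ hT hT1 (e ▸ waveODE_sol 0 0 (continuous_fourierInv hξ)) hb τ
  have e3 : ∫ τ, ‖V (pt τ ξ)‖ = (fibMass V ξ).toReal := integral_norm_fibre hV ξ
  set M := ∫ τ, ‖V (pt τ ξ)‖ with hMdef
  have e4 : fibMass V ξ = ENNReal.ofReal M := by rw [e3, ENNReal.ofReal_toReal hfin.ne]
  have h2 : (16 * M * T + M * T) ^ (2 - γ) * (16 * M * T * T⁻¹ + M + 2 * K * M * T) ^ (γ - 1) ≤
      (17 ^ (2 - γ) * (17 + 2 * K) ^ (γ - 1)) * T ^ (2 - γ) * M := by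
    have e5 : 16 * M * T + M * T = 17 * T * M := by ring
    have e6 : 16 * M * T * T⁻¹ + M + 2 * K * M * T ≤ (17 + 2 * K) * M := by
      rw [mul_assoc (16 * M), mul_inv_cancel₀ hT.ne']
      have := mul_le_of_le_one_right (by positivity : 0 ≤ 2 * K * M) hT1
      linarith
    calc _ ≤ (17 * T * M) ^ (2 - γ) * ((17 + 2 * K) * M) ^ (γ - 1) := by
          rw [e5]
          refine mul_le_mul_of_nonneg_left (Real.rpow_le_rpow (by positivity) e6 (by linarith))
            (by positivity)
      _ = (17 ^ (2 - γ) * (17 + 2 * K) ^ (γ - 1)) * T ^ (2 - γ) * (M ^ (2 - γ) * M ^ (γ - 1)) := by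
          rw [Real.mul_rpow (by positivity) hM, Real.mul_rpow (by positivity) hM,
            Real.mul_rpow (by norm_num) hT.le]
          ring
      _ = _ := by
          rw [← Real.rpow_add_of_nonneg hM (by linarith) (by linarith),
            (by ring : 2 - γ + (γ - 1) = 1), Real.rpow_one]
  have e7 : loFun T V (pt τ ξ) =
      𝓕 (cutV T (solE ‖(2 * Real.pi) • ξ‖ 0 0 fun t ↦ fp t + fm t)) τ := by
    rw [← e]; rfl
  have hs1 := symPlus_pos 1 (pt τ ξ)
  have hs2 := symMinus_pos γ (pt τ ξ)
  rw [e7, e4, ← ofReal_norm, ← ENNReal.ofReal_mul (by positivity)]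
  have e8 : ((C' * (17 ^ (2 - γ) * (17 + 2 * K) ^ (γ - 1))).toNNReal : ℝ≥0∞) =
    ENNReal.ofReal (C' * (17 ^ (2 - γ) * (17 + 2 * K) ^ (γ - 1))) := rfl
  rw [e8, ← ENNReal.ofReal_mul (by positivity), ← ENNReal.ofReal_mul (by positivity)]
  refine ENNReal.ofReal_le_ofReal (h1.trans ?_)
  calc _ ≤ C' * ((17 ^ (2 - γ) * (17 + 2 * K) ^ (γ - 1)) * T ^ (2 - γ) * M) :=
        mul_le_mul_of_nonneg_left h2 hC'
    _ = _ := by ring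

end LowFrequency

/-! ### Data at a fixed time, their reality, and spatial multipliers -/

section Evaluation

variable {n : ℕ}

theorem exists_eval_of {V : Type*} [NormedAddCommGroup V] [NormedSpace ℂ V]
    (L : V →ₗ[ℂ] 𝓢'(ST n, ℂ)) {r : ℝ} {C : ℝ≥0}
    (h : ∀ v, ∃ U : ST n → ℂ, Measurable U ∧ HasFourierFun (L v) U ∧
      wnorm r (fibMass U) ≤ C * ‖v‖ₑ) (t : ℝ) :
    ∃ ev : V →L[ℂ] (H n r).carrier,
      (∀ v, ∃ P, IsPath (L v) P ∧ P t = (H n r).toDist (ev v)) ∧ ‖ev‖ ≤ C := by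
  refine exists_clm_of_rel (B := H n r) (P := fun v d ↦ ∃ P, IsPath (L v) P ∧ P t = d)
    C.coe_nonneg ?_ ?_ ?_ ?_
  · intro v
    obtain ⟨U, hUm, hU, hUn⟩ := h v
    obtain ⟨W, -, hW, -, hWn⟩ := exists_path_H hU hUm (hUn.trans_lt (by finiteness))
    exact ⟨W t, ⟨_, hW, rfl⟩, norm_le_of_enorm_le ((hWn t).trans hUn)⟩
  · rintro v d d' ⟨P, hP, rfl⟩ ⟨P', hP', rfl⟩
    rw [hP.unique hP']
  · rintro v v' d d' ⟨P, hP, rfl⟩ ⟨P', hP', rfl⟩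
    exact ⟨P + P', by rw [map_add]; exact hP.add hP', rfl⟩
  · rintro c v d ⟨P, hP, rfl⟩
    exact ⟨c • P, by rw [map_smul]; exact hP.smul c, rfl⟩

/-- `∂_t` as a linear map. -/
def dtL (n : ℕ) : 𝓢'(ST n, ℂ) →ₗ[ℂ] 𝓢'(ST n, ℂ) where
  toFun := dt
  map_add' := dt_add
  map_smul' := dt_smul

variable {s : ℝ} {X : DistSpace (ST n)}

/-- The data at time `t` of the elements of `𝒳^s`. -/
theorem exists_eval (hX : MainHyp s X) : ∃ C : ℝ≥0, ∀ t : ℝ,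
    ∃ (ev : X.carrier →L[ℂ] (H n s).carrier) (evd : X.carrier →L[ℂ] (H n (s - 1)).carrier),
      ‖ev‖ ≤ C ∧ ‖evd‖ ≤ C ∧
      (∀ u, ∃ P, IsPath (X.toDist u) P ∧ P t = (H n s).toDist (ev u)) ∧
      ∀ u, ∃ P, IsPath (dt (X.toDist u)) P ∧ P t = (H n (s - 1)).toDist (evd u) := by
  obtain ⟨C, hC⟩ := exists_fibre hX
  refine ⟨C, fun t ↦ ?_⟩
  obtain ⟨ev, h1, h2⟩ := exists_eval_of X.toDist (r := s) (C := C) (fun v ↦ by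
    obtain ⟨U, hm, hU, h1, -⟩ := hC v
    exact ⟨U, hm, hU, h1⟩) t
  obtain ⟨evd, h3, h4⟩ := exists_eval_of (dtL n ∘ₗ X.toDist) (r := s - 1) (C := C) (fun v ↦ by
    obtain ⟨U, hm, hU, -, h1⟩ := hC v
    exact ⟨dtFun U, measurable_dtFun hm, hU.dt, h1⟩) t
  exact ⟨ev, evd, h2, h4, h1, h3⟩

theorem exists_fibre_rep (hX : MainHyp s X) : ∃ C : ℝ≥0, ∀ (u : X.carrier) (U : ST n → ℂ),
    HasFourierFun (X.toDist u) U → wnorm s (fibMass U) ≤ C * ‖u‖ₑ ∧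
      wnorm (s - 1) (fibMass (dtFun U)) ≤ C * ‖u‖ₑ := by
  obtain ⟨C, hC⟩ := exists_fibre hX
  refine ⟨C, fun u U hU ↦ ?_⟩
  obtain ⟨V, -, hV, h1, h2⟩ := hC u
  have e := hU.ae_eq hV
  have e' : dtFun U =ᵐ[volume] dtFun V := by
    filter_upwards [e] with z hz
    rw [dtFun, dtFun, hz]
  exact ⟨(wnorm_mono ((fibMass_congr e).mono fun ξ h ↦ h.le)).trans h1,
    (wnorm_mono ((fibMass_congr e').mono fun ξ h ↦ h.le)).trans h2⟩

theorem isRealValued_path {r : ℝ} {u : 𝓢'(ST n, ℂ)} {U : ST n → ℂ} (hU : HasFourierFun u U)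
    (hm : Measurable U) (hr : wnorm r (fibMass U) < ⊤) (hu : IsRealValued u)
    {P : ℝ → 𝓢'(Sp n, ℂ)} (hP : IsPath u P) (t : ℝ) : IsRealValued (P t) := by
  obtain ⟨W, -, hW, hWf, -⟩ := exists_path_H hU hm hr
  rw [hP.unique hW]
  refine (hWf t).isRealValued ?_
  filter_upwards [ae_pt (hU.neg_ae_eq_conj hu)] with ξ hξ
  exact invFib_neg hξ t

theorem isRealValued_dt {u : 𝓢'(ST n, ℂ)} {U : ST n → ℂ} (hU : HasFourierFun u U)
    (hu : IsRealValued u) : IsRealValued (dt u) := by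
  refine hU.dt.isRealValued ?_
  filter_upwards [hU.neg_ae_eq_conj hu] with z hz
  have e2 : (-z).fst = -z.fst := rfl
  rw [hz, e2]
  simp [Complex.conj_ofNat]

/-- The symbol of Λ does not involve τ, so it passes through the inverse transform in time. -/
theorem lam_path {r r' α : ℝ} {u u' : 𝓢'(ST n, ℂ)} {U U' : ST n → ℂ} (hU : HasFourierFun u U)
    (hm : Measurable U) (hr : wnorm r (fibMass U) < ⊤) (hU' : HasFourierFun u' U')
    (hm' : Measurable U') (hr' : wnorm r' (fibMass U') < ⊤) (hu : u' = Lam n α u)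
    {P P' : ℝ → 𝓢'(Sp n, ℂ)} (hP : IsPath u P) (hP' : IsPath u' P') (t : ℝ) :
    P' t = LamS n α (P t) := by
  obtain ⟨W, -, hW, hWf, -⟩ := exists_path_H hU hm hr
  obtain ⟨W', -, hW', hWf', -⟩ := exists_path_H hU' hm' hr'
  rw [hP.unique hW, hP'.unique hW']
  refine (hWf' t).ext ((hWf t).mult (symS_temperate α)) ?_
  have h1 := hU.mult (symX_temperate α)
  rw [hu] at hU'
  filter_upwards [ae_pt (hU'.ae_eq h1), ae_integrable_of_wnorm hm hr] with ξ hξ hi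
  have := invFib_lin (c := (symS α ξ : ℂ)) (c' := 0) (V'' := U') hi hi
    (by filter_upwards [hξ] with τ hτ; rw [hτ, symX_pt]; simp) t
  simpa using this

theorem lam_dt {α : ℝ} {u : 𝓢'(ST n, ℂ)} {U : ST n → ℂ} (hU : HasFourierFun u U) :
    dt (Lam n α u) = Lam n α (dt u) := by
  refine (hU.mult (symX_temperate α)).dt.ext (hU.dt.mult (symX_temperate α))
    (Filter.Eventually.of_forall fun z ↦ ?_)
  simp only
  ring

end Evaluation

/-! ### Bounded Fourier multipliers on 𝒳^s -/

section Multiplier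

variable {n : ℕ} {s : ℝ} {X : DistSpace (ST n)}

/-- Solidity of the norm, since |m U| ≤ |c U|. Solidity speaks of a distribution that is already
given; finiteness of the fibre masses supplies it for m U. -/
theorem exists_multiplier (hX : MainHyp s X) {m : ST n → ℂ} (hm : Measurable m) {c : ℝ}
    (hc : 0 ≤ c) (hmc : ∀ z, ‖m z‖ ≤ c) : ∃ M : X.carrier →L[ℂ] X.carrier,
      (∀ u (U : ST n → ℂ), HasFourierFun (X.toDist u) U →
        HasFourierFun (X.toDist (M u)) (fun z ↦ m z * U z)) ∧ ‖M‖ ≤ c := by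
  obtain ⟨C, hC⟩ := exists_fibre hX
  have hcongr : ∀ {U V : ST n → ℂ}, U =ᵐ[volume] V →
      (fun z ↦ m z * U z) =ᵐ[volume] fun z ↦ m z * V z := fun h ↦ by
    filter_upwards [h] with z hz
    rw [hz]
  refine exists_clm_of_rel (B := X) (P := fun u d ↦ ∀ U : ST n → ℂ,
    HasFourierFun (X.toDist u) U → HasFourierFun d (fun z ↦ m z * U z)) hc ?_ ?_ ?_ ?_
  · intro u
    obtain ⟨U, hUm, hU, hUn, -⟩ := hC u
    have hfin : wnorm s (fibMass fun z ↦ m z * U z) < ⊤ := by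
      refine lt_of_le_of_lt (wnorm_mono (b' := fun ξ ↦ ENNReal.ofReal c * fibMass U ξ)
        (Filter.Eventually.of_forall fun ξ ↦ ?_)) ?_
      · rw [fibMass, fibMass, ← lintegral_const_mul' _ _ ENNReal.ofReal_ne_top]
        refine lintegral_mono fun τ ↦ ?_
        rw [enorm_mul, ← ofReal_norm (m _)]
        exact mul_le_mul' (ENNReal.ofReal_le_ofReal (hmc _)) le_rfl
      · rw [wnorm_const_mul _ ENNReal.ofReal_ne_top]
        exact ENNReal.mul_lt_top ENNReal.ofReal_lt_top (hUn.trans_lt (by finiteness))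
    obtain ⟨d, hd⟩ := exists_of_wnorm (hm.mul hUm) hfin
    have hcU : HasFourierFun (X.toDist ((c : ℂ) • u)) ((c : ℂ) • U) := by
      rw [map_smul]
      exact hU.smul _
    obtain ⟨w, hw, hwn⟩ := hX.solid d _ _ _ hd hcU (Filter.Eventually.of_forall fun z ↦ by
      rw [Pi.smul_apply, smul_eq_mul, Pi.mul_apply, norm_mul, norm_mul, Complex.norm_real,
        Real.norm_of_nonneg hc]
      exact mul_le_mul_of_nonneg_right (hmc z) (norm_nonneg _))
    refine ⟨w, fun V hV ↦ ?_, hwn.trans ?_⟩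
    · rw [hw]
      exact hd.congr_ae (hcongr (hU.ae_eq hV))
    · rw [norm_smul, Complex.norm_real, Real.norm_of_nonneg hc]
  · intro u d d' h h'
    obtain ⟨U, -, hU, -⟩ := hC u
    exact (h U hU).ext (h' U hU) (Filter.EventuallyEq.refl _ _)
  · intro u u' d d' h h' V hV
    obtain ⟨U, -, hU, -⟩ := hC u
    obtain ⟨U', -, hU', -⟩ := hC u'
    have hs : HasFourierFun (X.toDist (u + u')) (U + U') := by rw [map_add]; exact hU.add hU'
    refine (((h U hU).add (h' U' hU')).congr_ae ?_).congr_ae (hcongr (hs.ae_eq hV))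
    exact Filter.Eventually.of_forall fun z ↦ by simp [mul_add]
  · intro k u d h V hV
    obtain ⟨U, -, hU, -⟩ := hC u
    have hs : HasFourierFun (X.toDist (k • u)) (k • U) := by rw [map_smul]; exact hU.smul k
    refine (((h U hU).smul k).congr_ae ?_).congr_ae (hcongr (hs.ae_eq hV))
    exact Filter.Eventually.of_forall fun z ↦ by simp [mul_left_comm]

/-- Time translations are isometries of `𝒳^s`. -/
theorem exists_timeShift (hX : MainHyp s X) (k : ℝ) : ∃ M : X.carrier →L[ℂ] X.carrier,
    (∀ u, X.toDist (M u) = timeShift k (X.toDist u)) ∧ ‖M‖ ≤ 1 := by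
  -- A translation multiplies the Fourier transform by a phase. The bound 1, uniform in `k`, keeps
  -- the time step fixed when solutions are restarted.
  obtain ⟨M, hM, hM1⟩ := exists_multiplier hX
    (m := fun z : ST n ↦ Complex.exp (2 * Real.pi * Complex.I * (z.fst * k : ℝ)))
    (by
      have h := continuous_fst_ST (n := n)
      exact (by fun_prop : Continuous fun z : ST n ↦
        Complex.exp (2 * Real.pi * Complex.I * (z.fst * k : ℝ))).measurable) zero_le_one
    (fun z ↦ by
      have : 2 * Real.pi * Complex.I * (z.fst * k : ℝ) =
        ((2 * Real.pi * (z.fst * k) : ℝ) : ℂ) * Complex.I := by push_cast; ring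
      rw [this, Complex.norm_exp_ofReal_mul_I])
  obtain ⟨C, hC⟩ := exists_fibre hX
  refine ⟨M, fun u ↦ ?_, hM1⟩
  obtain ⟨U, -, hU, -⟩ := hC u
  exact (hM u U hU).ext (hU.timeShift k) (Filter.EventuallyEq.refl _ _)

end Multiplier

/-! ### Properties of the free wave operator -/

section FreeProps

variable {n : ℕ} {s : ℝ} {X : DistSpace (ST n)}

/-- `W` maps data to a wave which is free for `|t| < 1`. -/
structure IsFree (s : ℝ) (X : DistSpace (ST n))
    (W : (H n s).carrier × (H n (s - 1)).carrier →L[ℂ] X.carrier) : Prop where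
  data : ∀ f g, HasData (X.toDist (W (f, g))) ((H n s).toDist f) ((H n (s - 1)).toDist g)
  wave : ∀ v, EqOnSlab (-1) 1 (box (X.toDist (W v))) 0
  real : ∀ f g, IsRealValued ((H n s).toDist f) → IsRealValued ((H n (s - 1)).toDist g) →
    IsRealValued (X.toDist (W (f, g)))
  lam : ∀ (α : ℝ) (f f' : (H n s).carrier) (g g' : (H n (s - 1)).carrier),
    (H n s).toDist f' = LamS n α ((H n s).toDist f) →
    (H n (s - 1)).toDist g' = LamS n α ((H n (s - 1)).toDist g) →
    X.toDist (W (f', g')) = Lam n α (X.toDist (W (f, g)))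

theorem exists_isFree (hX : MainHyp s X) : ∃ W, IsFree s X W := by
  obtain ⟨W, hW⟩ := exists_free hX
  refine ⟨W, ?_, ?_, ?_, ?_⟩
  · intro f g
    obtain ⟨a, ham, ha⟩ := exists_hasFourierFun_H f
    obtain ⟨b, hbm, hb⟩ := exists_hasFourierFun_H g
    exact ((exists_cut_free ham hbm ha hb).2 _ (hW f g a b ham hbm ha hb)).1
  · rintro ⟨f, g⟩
    obtain ⟨a, ham, ha⟩ := exists_hasFourierFun_H f
    obtain ⟨b, hbm, hb⟩ := exists_hasFourierFun_H g
    exact ((exists_cut_free ham hbm ha hb).2 _ (hW f g a b ham hbm ha hb)).2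
  · intro f g hf hg
    obtain ⟨a, ham, ha⟩ := exists_hasFourierFun_H f
    obtain ⟨b, hbm, hb⟩ := exists_hasFourierFun_H g
    refine (hW f g a b ham hbm ha hb).isRealValued ?_
    filter_upwards [ae_snd (ha.neg_ae_eq_conj hf), ae_snd (hb.neg_ae_eq_conj hg)] with z h1 h2
    exact freeFun_neg h1 h2
  · intro α f f' g g' hf hg
    obtain ⟨a, ham, ha⟩ := exists_hasFourierFun_H f
    obtain ⟨b, hbm, hb⟩ := exists_hasFourierFun_H g
    obtain ⟨a', ham', ha'⟩ := exists_hasFourierFun_H f'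
    obtain ⟨b', hbm', hb'⟩ := exists_hasFourierFun_H g'
    have h1 := hW f g a b ham hbm ha hb
    have h2 := hW f' g' a' b' ham' hbm' ha' hb'
    rw [hf] at ha'
    rw [hg] at hb'
    refine h2.ext (h1.mult (symX_temperate α)) ?_
    filter_upwards [ae_snd (ha'.ae_eq (ha.mult (symS_temperate α))),
      ae_snd (hb'.ae_eq (hb.mult (symS_temperate α)))] with z h3 h4
    rw [freeFun_lin (c := (symS α z.snd : ℂ)) (c' := 0) (a := a) (a' := a) (b := b) (b' := b)
      (by simpa using h3) (by simpa using h4), zero_mul, add_zero]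
    rfl

end FreeProps

/-! ### Splitting the source according to the distance from the cone -/

section Duhamel

variable {n : ℕ} {s ε : ℝ} {X : DistSpace (ST n)}

/-- The symbol of `□̃ Λ₋^{-ε}`. -/
def srcMul (ε : ℝ) (z : ST n) : ℝ := symPlus 1 z * (symMinus 1 z * symMinus (-ε) z)

theorem srcMul_pos (ε : ℝ) (z : ST n) : 0 < srcMul ε z := by
  have h1 := symPlus_pos 1 z
  have h2 := symMinus_pos 1 z
  have h3 := symMinus_pos (-ε) z
  unfold srcMul
  positivity

theorem srcMul_neg_arg (ε : ℝ) (z : ST n) : srcMul ε (-z) = srcMul ε z := by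
  rw [srcMul, symPlus_neg_arg, symMinus_neg_arg, symMinus_neg_arg, srcMul]

theorem measurable_srcMul (ε : ℝ) : Measurable (srcMul (n := n) ε) :=
  ((continuous_symPlus 1).mul ((continuous_symMinus 1).mul (continuous_symMinus (-ε)))).measurable

theorem hasFourierFun_Y {G : X.carrier} {U : ST n → ℂ} (hU : HasFourierFun (X.toDist G) U) :
    HasFourierFun ((Yspace X ε).toDist G) (fun z ↦ (srcMul ε z : ℂ) * U z) := by
  have h := ((hU.mult (symMinus_temperate (-ε))).mult (symMinus_temperate 1)).mult
    (symPlus_temperate 1)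
  refine h.congr_ae (Filter.Eventually.of_forall fun z ↦ ?_)
  simp only [srcMul]
  push_cast
  ring

/-- The multiplier which solves `□u = F` far from the light cone. -/
def hiMul (ε K : ℝ) (z : ST n) : ℝ := if symMinus 1 z ≤ K then 0 else srcMul ε z / symBox z

theorem measurableSet_lo (K : ℝ) : MeasurableSet {z : ST n | symMinus 1 z ≤ K} :=
  measurableSet_le (continuous_symMinus 1).measurable measurable_const

theorem measurable_hiMul (ε K : ℝ) : Measurable (hiMul (n := n) ε K) :=
  Measurable.ite (measurableSet_lo K) measurable_const
    ((measurable_srcMul ε).div continuous_symBox.measurable)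

/-- Once the symbol of Λ₋ exceeds 2, the term Λ₊ is less than half of Λ₊Λ₋ and is absorbed; this is
why K is taken at least 2. -/
theorem symPlus_mul_symMinus_le_two {z : ST n} (h : 2 < symMinus 1 z) :
    symPlus 1 z * symMinus 1 z ≤ 2 * |symBox z| := by
  have h1 := symPlus_mul_symMinus_le z
  have h2 := mul_le_mul_of_nonneg_left h.le (symPlus_pos 1 z).le
  linarith

theorem symBox_ne_zero {z : ST n} (h : 2 < symMinus 1 z) : symBox z ≠ 0 := by
  have h1 := symPlus_mul_symMinus_le_two h
  have h2 := mul_pos (symPlus_pos 1 z) (symMinus_pos 1 z)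
  intro h0
  rw [h0, abs_zero, mul_zero] at h1
  linarith

/-- Λ₊Λ₋/|□| is at most 2 away from the cone, and what remains is Λ₋^{-ε} ≤ K^{-ε}. This is the role
of ε > 0. -/
theorem norm_hiMul_le (hε : 0 < ε) {K : ℝ} (hK : 2 ≤ K) (z : ST n) :
    ‖(hiMul ε K z : ℂ)‖ ≤ 2 * K ^ (-ε) := by
  rw [Complex.norm_real, Real.norm_eq_abs]
  have hK0 : (0 : ℝ) < K := by linarith
  unfold hiMul
  split_ifs with h
  · rw [abs_zero]
    positivity
  · have h1 : K < symMinus 1 z := not_le.1 h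
    have h2 := symPlus_mul_symMinus_le_two (hK.trans_lt h1)
    have h3 : 0 < |symBox z| := abs_pos.2 (symBox_ne_zero (hK.trans_lt h1))
    rw [abs_div, abs_of_pos (srcMul_pos ε z), div_le_iff₀ h3, srcMul, ← mul_assoc,
      symMinus_eq_rpow (-ε)]
    have h4 : symMinus 1 z ^ (-ε) ≤ K ^ (-ε) :=
      Real.rpow_le_rpow_of_nonpos hK0 h1.le (by linarith)
    calc _ ≤ (2 * |symBox z|) * K ^ (-ε) :=
          mul_le_mul h2 h4 (Real.rpow_nonneg (symMinus_pos 1 z).le _) (by positivity)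
      _ = _ := by ring

/-- The part of the source near the light cone. -/
def loSrc (ε K : ℝ) (U : ST n → ℂ) (z : ST n) : ℂ :=
  if symMinus 1 z ≤ K then (srcMul ε z : ℂ) * U z else 0

theorem measurable_loSrc {K : ℝ} {U : ST n → ℂ} (hU : Measurable U) : Measurable (loSrc ε K U) :=
  Measurable.ite (measurableSet_lo K)
    ((Complex.continuous_ofReal.measurable.comp (measurable_srcMul ε)).mul hU) measurable_const

theorem loSrc_ne_zero {K : ℝ} {U : ST n → ℂ} (z : ST n) (h : loSrc ε K U z ≠ 0) :
    symMinus 1 z ≤ K := by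
  by_contra h1
  exact h (if_neg h1)

theorem symBox_mul_hiMul {K : ℝ} (hK : 2 ≤ K) (U : ST n → ℂ) (z : ST n) :
    (symBox z : ℂ) * ((hiMul ε K z : ℂ) * U z) + loSrc ε K U z = (srcMul ε z : ℂ) * U z := by
  unfold hiMul loSrc
  split_ifs with h
  · simp
  · have h1 := symBox_ne_zero (hK.trans_lt (not_le.1 h))
    have h2 : (symBox z : ℂ) ≠ 0 := Complex.ofReal_ne_zero.2 h1
    push_cast
    field_simp
    ring

/-- Near the cone Λ₋ costs only K and Λ₋^{-ε} ≤ 1, so the source is bounded by KΛ₊|U|. Since Λ₊ ≤ Λ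
+ |2πτ|, it is controlled by the two fibre masses which the norm of 𝒳^s provides. -/
theorem enorm_loSrc_le (hε : 0 < ε) {K : ℝ} (U : ST n → ℂ) (z : ST n) :
    ‖loSrc ε K U z‖ₑ ≤ ENNReal.ofReal K * (ENNReal.ofReal (symX 1 z) * ‖U z‖ₑ + ‖dtFun U z‖ₑ) := by
  unfold loSrc
  split_ifs with h
  · have hX := symX_pos 1 z
    have h0 := symMinus_pos 1 z
    have hK : 0 ≤ K := h0.le.trans h
    rw [← ofReal_norm, ← ofReal_norm, ← ofReal_norm, ← ENNReal.ofReal_mul hX.le,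
      ← ENNReal.ofReal_add (by positivity) (by positivity), ← ENNReal.ofReal_mul hK]
    refine ENNReal.ofReal_le_ofReal ?_
    have e : ‖dtFun U z‖ = |2 * Real.pi * z.fst| * ‖U z‖ := by
      rw [dtFun, norm_mul]
      congr 1
      have : 2 * Real.pi * Complex.I * z.fst = ((2 * Real.pi * z.fst : ℝ) : ℂ) * Complex.I := by
        push_cast; ring
      rw [this, norm_mul, Complex.norm_I, mul_one, Complex.norm_real, Real.norm_eq_abs]
    rw [norm_mul, Complex.norm_real, Real.norm_of_nonneg (srcMul_pos ε z).le, e, ← add_mul,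
      ← mul_assoc]
    refine mul_le_mul_of_nonneg_right ?_ (norm_nonneg _)
    have h1 : symMinus (-ε) z ≤ 1 := by
      rw [← symMinus_zero z]
      exact symMinus_mono (by linarith) z
    have h2 := symPlus_one_le_symX z
    have h3 := mul_le_mul h h1 (symMinus_pos (-ε) z).le hK
    rw [srcMul, mul_comm]
    exact mul_le_mul (h3.trans (by rw [mul_one])) h2 (symPlus_pos 1 z).le hK
  · simp

theorem wnorm_loSrc_le (hε : 0 < ε) {K : ℝ} {U : ST n → ℂ} (hU : Measurable U) :
    wnorm (s - 1) (fibMass (loSrc ε K U)) ≤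
      ENNReal.ofReal K * (wnorm s (fibMass U) + wnorm (s - 1) (fibMass (dtFun U))) := by
  have h1 : ∀ ξ, fibMass (loSrc ε K U) ξ ≤
      ENNReal.ofReal K * (ENNReal.ofReal (symS 1 ξ) * fibMass U ξ + fibMass (dtFun U) ξ) := by
    intro ξ
    have hm : Measurable fun τ ↦ ‖U (pt τ ξ)‖ₑ := (hU.comp (continuous_pt_left ξ).measurable).enorm
    rw [fibMass, fibMass, fibMass, ← lintegral_const_mul _ hm,
      ← lintegral_add_left (hm.const_mul _), ← lintegral_const_mul' _ _ ENNReal.ofReal_ne_top]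
    exact lintegral_mono fun τ ↦ enorm_loSrc_le hε U (pt τ ξ)
  refine (wnorm_mono (Filter.Eventually.of_forall h1)).trans ?_
  rw [wnorm_const_mul _ ENNReal.ofReal_ne_top]
  refine mul_le_mul' le_rfl ?_
  refine (wnorm_add_le ?_ (measurable_fibMass (measurable_dtFun hU)).aemeasurable).trans ?_
  · exact ((continuous_symS 1).measurable.ennreal_ofReal.mul (measurable_fibMass hU)).aemeasurable
  · rw [wnorm_symS, sub_add_cancel]

theorem loSrc_congr {K : ℝ} {c c' : ℂ} {U U' U'' : ST n → ℂ} {z : ST n}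
    (h : U'' z = c * U z + c' * U' z) :
    loSrc ε K U'' z = c * loSrc ε K U z + c' * loSrc ε K U' z := by
  unfold loSrc
  split_ifs
  · rw [h]; ring
  · simp

end Duhamel

/-! ### The Duhamel operator and its small norm -/

section Duhamel

variable {n : ℕ} {s ε : ℝ} {X : DistSpace (ST n)}

theorem ae_integrable_loSrc (hX : MainHyp s X) (hε : 0 < ε) (K : ℝ) {G : X.carrier} {U : ST n → ℂ}
    (hUm : Measurable U) (hU : HasFourierFun (X.toDist G) U) :
    wnorm (s - 1) (fibMass (loSrc ε K U)) < ⊤ ∧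
      ∀ᵐ ξ : Sp n, Integrable fun τ ↦ loSrc ε K U (pt τ ξ) := by
  obtain ⟨C, hC⟩ := exists_fibre_rep hX
  obtain ⟨h1, h2⟩ := hC G U hU
  have h3 : wnorm (s - 1) (fibMass (loSrc ε K U)) < ⊤ :=
    (wnorm_loSrc_le hε hUm).trans_lt (ENNReal.mul_lt_top ENNReal.ofReal_lt_top
      (ENNReal.add_lt_top.2 ⟨h1.trans_lt (by finiteness), h2.trans_lt (by finiteness)⟩))
  exact ⟨h3, ae_integrable_of_wnorm (measurable_loSrc hUm) h3⟩

/-- The coefficients may depend on ξ, so that one statement covers change of representative, sums,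
scalars and the multiplier Λ^α. -/
theorem loFun_loSrc_lin (hX : MainHyp s X) (hε : 0 < ε) (K : ℝ) {T : ℝ} (hT : 0 < T)
    {G G' : X.carrier} {U U' U'' : ST n → ℂ} (hUm : Measurable U)
    (hU : HasFourierFun (X.toDist G) U) (hUm' : Measurable U')
    (hU' : HasFourierFun (X.toDist G') U') {c c' : Sp n → ℂ}
    (h : ∀ᵐ z, U'' z = c z.snd * U z + c' z.snd * U' z) :
    ∀ᵐ z : ST n, loFun T (loSrc ε K U'') z =
      c z.snd * loFun T (loSrc ε K U) z + c' z.snd * loFun T (loSrc ε K U') z := by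
  filter_upwards [ae_snd (ae_pt h), ae_snd (ae_integrable_loSrc hX hε K hUm hU).2,
    ae_snd (ae_integrable_loSrc hX hε K hUm' hU').2] with z h1 h2 h3
  refine loFun_lin hT h2 h3 ?_
  filter_upwards [h1] with τ hτ
  exact loSrc_congr hτ

/-- The operator for the part of the source near the cone. The exponent is 2 - γ > 0, so for a fixed
K the norm tends to 0 with T, whatever the constant's dependence on K. -/
theorem exists_lo (hX : MainHyp s X) (hε : 0 < ε) {K : ℝ} (hK : 0 ≤ K) :
    ∃ (C : ℝ≥0) (p : ℝ), 0 < p ∧ ∀ T : ℝ, 0 < T → T ≤ 1 →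
      ∃ L : X.carrier →L[ℂ] X.carrier, (∀ (G : X.carrier) (U : ST n → ℂ), Measurable U →
        HasFourierFun (X.toDist G) U → HasFourierFun (X.toDist (L G)) (loFun T (loSrc ε K U))) ∧
        ‖L‖ ≤ C * T ^ p := by
  obtain ⟨γ, hγ1, hγ2, C, hC⟩ := exists_upper hX
  obtain ⟨C', hC'⟩ := exists_lo_bound (n := n) hγ1 hγ2.le K hK
  obtain ⟨C₁, hC₁⟩ := exists_fibre_rep hX
  obtain ⟨C₂, hex⟩ := exists_fibre hX
  refine ⟨C * C' * (K.toNNReal * (C₁ + C₁)), 2 - γ, by linarith, fun T hT hT1 ↦ ?_⟩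
  have hTp : (0 : ℝ) ≤ T ^ (2 - γ) := Real.rpow_nonneg hT.le _
  refine exists_clm_of_rel (B := X) (P := fun G d ↦ ∀ U : ST n → ℂ, Measurable U →
    HasFourierFun (X.toDist G) U → HasFourierFun d (loFun T (loSrc ε K U)))
    (by positivity) ?_ ?_ ?_ ?_
  · intro G
    obtain ⟨U, hUm, hU, -⟩ := hex G
    obtain ⟨hr, -⟩ := ae_integrable_loSrc hX hε K hUm hU
    have hVm := measurable_loSrc (ε := ε) (K := K) hUm
    obtain ⟨⟨u, hu⟩, -⟩ := exists_cut_lo hT hT1 hVm hr loSrc_ne_zero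
    have hle := wnorm_loSrc_le (s := s) (K := K) hε hUm
    obtain ⟨w, hw, hwn⟩ := hC u _ (fun ξ ↦ C' * ENNReal.ofReal (T ^ (2 - γ)) *
      fibMass (loSrc ε K U) ξ) hu (by
        rw [wnorm_const_mul _ (by finiteness)]
        exact ENNReal.mul_lt_top (by finiteness) hr) (by
      filter_upwards [ae_lt_top_of_wnorm (measurable_fibMass hVm).aemeasurable hr] with ξ hξ τ
      exact hC' T _ hT hT1 hVm loSrc_ne_zero ξ hξ τ)
    refine ⟨w, fun V hVm hV ↦ ?_, ?_⟩
    · rw [hw]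
      refine hu.congr_ae ?_
      have := loFun_loSrc_lin hX hε K hT hVm hV hVm hV (c := fun _ ↦ 1) (c' := fun _ ↦ 0)
        (U'' := U) (by filter_upwards [hU.ae_eq hV] with z hz; simp [hz])
      filter_upwards [this] with z hz
      simpa using hz
    · have h1 := hC₁ G U hU
      have h2 : ‖w‖ₑ ≤ ↑(C * C' * (K.toNNReal * (C₁ + C₁)) * (T ^ (2 - γ)).toNNReal) * ‖G‖ₑ := by
        rw [wnorm_const_mul _ (by finiteness)] at hwn
        refine hwn.trans ?_
        have h3 : wnorm (s - 1) (fibMass (loSrc ε K U)) ≤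
            ENNReal.ofReal K * (C₁ * ‖G‖ₑ + C₁ * ‖G‖ₑ) :=
          hle.trans (mul_le_mul' le_rfl (add_le_add h1.1 h1.2))
        calc _ ≤ (C : ℝ≥0∞) * (C' * ENNReal.ofReal (T ^ (2 - γ)) *
              (ENNReal.ofReal K * (C₁ * ‖G‖ₑ + C₁ * ‖G‖ₑ))) := by gcongr
          _ = _ := by
            push_cast
            simp only [ENNReal.ofReal]
            ring
      have h4 := norm_le_of_enorm_le h2
      rw [NNReal.coe_mul, Real.coe_toNNReal _ hTp] at h4
      exact h4
  · intro G d d' h h'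
    obtain ⟨U, hUm, hU, -⟩ := hex G
    exact (h U hUm hU).ext (h' U hUm hU) (Filter.EventuallyEq.refl _ _)
  · intro G G' d d' h h' V hVm hV
    obtain ⟨U, hUm, hU, -⟩ := hex G
    obtain ⟨U', hUm', hU', -⟩ := hex G'
    have hs : HasFourierFun (X.toDist (G + G')) (U + U') := by rw [map_add]; exact hU.add hU'
    refine ((h U hUm hU).add (h' U' hUm' hU')).congr_ae ?_
    have := loFun_loSrc_lin hX hε K hT hUm hU hUm' hU' (c := fun _ ↦ 1) (c' := fun _ ↦ 1)
      (U'' := V) (by filter_upwards [hV.ae_eq hs] with z hz; simp [hz])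
    filter_upwards [this] with z hz
    rw [hz]
    simp
  · intro k G d h V hVm hV
    obtain ⟨U, hUm, hU, -⟩ := hex G
    have hs : HasFourierFun (X.toDist (k • G)) (k • U) := by rw [map_smul]; exact hU.smul k
    refine ((h U hUm hU).smul k).congr_ae ?_
    have := loFun_loSrc_lin hX hε K hT hUm hU hUm hU (c := fun _ ↦ k) (c' := fun _ ↦ 0)
      (U'' := V) (by filter_upwards [hV.ae_eq hs] with z hz; simp [hz])
    filter_upwards [this] with z hz
    rw [hz]
    simp

theorem isRealValued_of_Y (hX : MainHyp s X) {G : X.carrier}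
    (h : IsRealValued ((Yspace X ε).toDist G)) : IsRealValued (X.toDist G) := by
  obtain ⟨C, hC⟩ := exists_fibre hX
  obtain ⟨U, -, hU, -⟩ := hC G
  refine hU.isRealValued ?_
  filter_upwards [(hasFourierFun_Y hU).neg_ae_eq_conj h] with z hz
  rw [srcMul_neg_arg, map_mul, Complex.conj_ofReal] at hz
  exact mul_left_cancel₀ (Complex.ofReal_ne_zero.2 (srcMul_pos ε z).ne') hz

theorem lam_of_Y (hX : MainHyp s X) {G G' : X.carrier} {α : ℝ}
    (h : (Yspace X ε).toDist G' = Lam n α ((Yspace X ε).toDist G)) :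
    X.toDist G' = Lam n α (X.toDist G) := by
  obtain ⟨C, hC⟩ := exists_fibre hX
  obtain ⟨U, -, hU, -⟩ := hC G
  obtain ⟨U', -, hU', -⟩ := hC G'
  have h1 := hasFourierFun_Y (ε := ε) hU'
  rw [h] at h1
  refine hU'.ext (hU.mult (symX_temperate α)) ?_
  filter_upwards [h1.ae_eq ((hasFourierFun_Y hU).mult (symX_temperate α))] with z hz
  rw [mul_left_comm] at hz
  exact mul_left_cancel₀ (Complex.ofReal_ne_zero.2 (srcMul_pos ε z).ne') hz

/-- `S` solves `□u = F` with zero data for `|t| < T`. -/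
structure IsDuhamel (X : DistSpace (ST n)) (ε T : ℝ) (S : X.carrier →L[ℂ] X.carrier) :
    Prop where
  data : ∀ G, HasData (X.toDist (S G)) 0 0
  wave : ∀ G, EqOnSlab (-T) T (box (X.toDist (S G))) ((Yspace X ε).toDist G)
  real : ∀ G, IsRealValued ((Yspace X ε).toDist G) → IsRealValued (X.toDist (S G))
  lam : ∀ (α : ℝ) (G G' : X.carrier),
    (Yspace X ε).toDist G' = Lam n α ((Yspace X ε).toDist G) →
    X.toDist (S G') = Lam n α (X.toDist (S G))

theorem HasData.add {u u' : 𝓢'(ST n, ℂ)} {f g f' g' : 𝓢'(Sp n, ℂ)} (h : HasData u f g)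
    (h' : HasData u' f' g') : HasData (u + u') (f + f') (g + g') := by
  obtain ⟨⟨U, hU, rfl⟩, V, hV, rfl⟩ := h
  obtain ⟨⟨U', hU', rfl⟩, V', hV', rfl⟩ := h'
  exact ⟨⟨U + U', hU.add hU', rfl⟩, V + V', by rw [dt_add]; exact hV.add hV', rfl⟩

theorem HasData.sub {u u' : 𝓢'(ST n, ℂ)} {f g f' g' : 𝓢'(Sp n, ℂ)} (h : HasData u f g)
    (h' : HasData u' f' g') : HasData (u - u') (f - f') (g - g') := by
  obtain ⟨⟨U, hU, rfl⟩, V, hV, rfl⟩ := h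
  obtain ⟨⟨U', hU', rfl⟩, V', hV', rfl⟩ := h'
  exact ⟨⟨U - U', hU.sub hU', rfl⟩, V - V', by rw [dt_sub]; exact hV.sub hV', rfl⟩

theorem IsRealValued.add {E : Type} [NormedAddCommGroup E] [InnerProductSpace ℝ E]
    {u v : 𝓢'(E, ℂ)} (hu : IsRealValued u) (hv : IsRealValued v) : IsRealValued (u + v) := by
  intro φ hφ
  have h1 := hu φ hφ
  have h2 := hv φ hφ
  simp [h1, h2]

theorem IsRealValued.neg {E : Type} [NormedAddCommGroup E] [InnerProductSpace ℝ E]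
    {u : 𝓢'(E, ℂ)} (hu : IsRealValued u) : IsRealValued (-u) := by
  intro φ hφ
  have h1 := hu φ hφ
  simp [h1]

theorem IsRealValued.sub {E : Type} [NormedAddCommGroup E] [InnerProductSpace ℝ E]
    {u v : 𝓢'(E, ℂ)} (hu : IsRealValued u) (hv : IsRealValued v) : IsRealValued (u - v) := by
  rw [sub_eq_add_neg]
  exact hu.add hv.neg

theorem lo_props (hX : MainHyp s X) (hε : 0 < ε) {K T : ℝ} (hT : 0 < T) (hT1 : T ≤ 1)
    {L : X.carrier →L[ℂ] X.carrier} (hL : ∀ (G : X.carrier) (U : ST n → ℂ), Measurable U →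
      HasFourierFun (X.toDist G) U → HasFourierFun (X.toDist (L G)) (loFun T (loSrc ε K U))) :
    (∀ G, HasData (X.toDist (L G)) 0 0) ∧
    (∀ G U F, Measurable U → HasFourierFun (X.toDist G) U → HasFourierFun F (loSrc ε K U) →
      EqOnSlab (-T) T (box (X.toDist (L G))) F) ∧
    (∀ G, IsRealValued (X.toDist G) → IsRealValued (X.toDist (L G))) ∧
    ∀ (α : ℝ) (G G' : X.carrier), X.toDist G' = Lam n α (X.toDist G) →
      X.toDist (L G') = Lam n α (X.toDist (L G)) := by
  obtain ⟨C, hC⟩ := exists_fibre hX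
  refine ⟨fun G ↦ ?_, fun G U F hUm hU hF ↦ ?_, fun G hG ↦ ?_, fun α G G' h ↦ ?_⟩
  · obtain ⟨U, hUm, hU, -⟩ := hC G
    exact ((exists_cut_lo hT hT1 (measurable_loSrc hUm)
      (ae_integrable_loSrc hX hε K hUm hU).1 loSrc_ne_zero).2 _ (hL G U hUm hU)).1
  · exact ((exists_cut_lo hT hT1 (measurable_loSrc hUm)
      (ae_integrable_loSrc hX hε K hUm hU).1 loSrc_ne_zero).2 _ (hL G U hUm hU)).2 F hF
  · obtain ⟨U, hUm, hU, -⟩ := hC G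
    refine (hL G U hUm hU).isRealValued ?_
    filter_upwards [ae_snd (ae_pt (hU.neg_ae_eq_conj hG))] with z hz
    refine loFun_neg ?_
    filter_upwards [hz] with τ hτ
    rw [pt_neg, loSrc, loSrc, symMinus_neg_arg, srcMul_neg_arg, hτ]
    split_ifs <;> simp
  · obtain ⟨U, hUm, hU, -⟩ := hC G
    obtain ⟨U', hUm', hU', -⟩ := hC G'
    refine (hL G' U' hUm' hU').ext ((hL G U hUm hU).mult (symX_temperate α)) ?_
    rw [h] at hU'
    have := loFun_loSrc_lin hX hε K hT hUm hU hUm hU (c := fun ξ ↦ (symS α ξ : ℂ))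
      (c' := fun _ ↦ 0) (U'' := U') (by
        filter_upwards [hU'.ae_eq (hU.mult (symX_temperate α))] with z hz
        rw [hz, zero_mul, add_zero]
        rfl)
    filter_upwards [this] with z hz
    rw [hz, zero_mul, add_zero]
    rfl

set_option maxHeartbeats 1000000 in
-- The operator is (1 - R)Hi + L. `Hi` divides by the symbol of □ far from the cone; `R` forms the
-- free wave with the data of its argument at t = 0, so that 1 - R removes these data without
-- changing □ on (-1, 1); `L` solves for the rest of the source with zero data.
theorem exists_isDuhamel (hX : MainHyp s X) (hε : 0 < ε) {η : ℝ} (hη : 0 < η) :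
    ∃ T : ℝ, 0 < T ∧ T ≤ 1 ∧ ∃ S : X.carrier →L[ℂ] X.carrier, ‖S‖ ≤ η ∧ IsDuhamel X ε T S := by
  obtain ⟨W, hW⟩ := exists_isFree hX
  obtain ⟨Ce, hev⟩ := exists_eval hX
  obtain ⟨ev, evd, hevn, hevdn, hev, hevd⟩ := hev 0
  obtain ⟨Cf, hfib⟩ := exists_fibre hX
  -- A bound for the norm of 1 - R. It does not depend on `K`, so K^{-ε} can be made small against
  -- it.
  set Q : ℝ := 1 + ‖W‖ * Ce with hQ
  have hQ0 : 0 < Q := by positivity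
  obtain ⟨K, hK2, hK⟩ : ∃ K : ℝ, 2 ≤ K ∧ 2 * K ^ (-ε) * Q ≤ η / 2 := by
    have h1 : Filter.Tendsto (fun K : ℝ ↦ 2 * K ^ (-ε) * Q) Filter.atTop (nhds (2 * 0 * Q)) :=
      ((tendsto_rpow_neg_atTop hε).const_mul 2).mul_const Q
    rw [mul_zero, zero_mul] at h1
    exact ((Filter.eventually_ge_atTop 2).and
      (h1.eventually (ge_mem_nhds (half_pos hη)))).exists
  obtain ⟨C, p, hp, hlo⟩ := exists_lo hX hε (by linarith : (0 : ℝ) ≤ K)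
  -- Only now, with `K` and hence `C` fixed, is the time shortened.
  obtain ⟨T, hT, hT1, hTη⟩ : ∃ T : ℝ, 0 < T ∧ T ≤ 1 ∧ C * T ^ p ≤ η / 2 := by
    have h1 : Filter.Tendsto (fun T : ℝ ↦ C * T ^ p) (nhds 0) (nhds (C * 0 ^ p)) :=
      ((Real.continuousAt_rpow_const 0 p (Or.inr hp.le)).tendsto).const_mul _
    rw [Real.zero_rpow hp.ne', mul_zero] at h1
    have h2 : ∀ᶠ T : ℝ in nhdsWithin 0 (Set.Ioi 0), C * T ^ p ≤ η / 2 :=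
      (h1.mono_left nhdsWithin_le_nhds).eventually (ge_mem_nhds (half_pos hη))
    have h3 : ∀ᶠ T : ℝ in nhdsWithin 0 (Set.Ioi 0), T ∈ Set.Ioc (0 : ℝ) 1 :=
      Ioc_mem_nhdsGT one_pos
    obtain ⟨T, h4, h5⟩ := (h3.and h2).exists
    exact ⟨T, h4.1, h4.2, h5⟩
  obtain ⟨L, hL, hLn⟩ := hlo T hT hT1
  obtain ⟨Hi, hHi, hHin⟩ := exists_multiplier hX (m := fun z ↦ (hiMul ε K z : ℂ))
    (Complex.continuous_ofReal.measurable.comp (measurable_hiMul ε K)) (by positivity)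
    (norm_hiMul_le hε hK2)
  obtain ⟨l1, l2, l3, l4⟩ := lo_props hX hε hT hT1 hL
  let R : X.carrier →L[ℂ] X.carrier := W ∘L (ev.prod evd)
  have hRn : ‖R‖ ≤ ‖W‖ * Ce := by
    refine (W.opNorm_comp_le _).trans (mul_le_mul_of_nonneg_left ?_ (norm_nonneg _))
    rw [ContinuousLinearMap.opNorm_prod]
    exact max_le hevn hevdn
  have hR0 : ∀ u, HasData (X.toDist u) ((H n s).toDist (ev u)) ((H n (s - 1)).toDist (evd u)) :=
    fun u ↦ ⟨hev u, hevd u⟩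
  have hRreal : ∀ u, IsRealValued (X.toDist u) → IsRealValued (X.toDist (R u)) := by
    intro u hu
    obtain ⟨U, hUm, hU, h1, h2⟩ := hfib u
    obtain ⟨P, hP, hP0⟩ := hev u
    obtain ⟨P', hP', hP0'⟩ := hevd u
    refine hW.real (ev u) (evd u) ?_ ?_
    · rw [← hP0]
      exact isRealValued_path hU hUm (h1.trans_lt (by finiteness)) hu hP 0
    · rw [← hP0']
      exact isRealValued_path hU.dt (measurable_dtFun hUm) (h2.trans_lt (by finiteness))
        (isRealValued_dt hU hu) hP' 0
  have hRlam : ∀ (α : ℝ) u u', X.toDist u' = Lam n α (X.toDist u) →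
      X.toDist (R u') = Lam n α (X.toDist (R u)) := by
    intro α u u' hu
    obtain ⟨U, hUm, hU, h1, h2⟩ := hfib u
    obtain ⟨U', hUm', hU', h1', h2'⟩ := hfib u'
    obtain ⟨P, hP, hP0⟩ := hev u
    obtain ⟨P', hP', hP0'⟩ := hevd u
    obtain ⟨Q, hQ, hQ0⟩ := hev u'
    obtain ⟨Q', hQ', hQ0'⟩ := hevd u'
    refine hW.lam α (ev u) (ev u') (evd u) (evd u') ?_ ?_
    · rw [← hP0, ← hQ0]
      exact lam_path hU hUm (h1.trans_lt (by finiteness)) hU' hUm' (h1'.trans_lt (by finiteness))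
        hu hP hQ 0
    · rw [← hP0', ← hQ0']
      exact lam_path hU.dt (measurable_dtFun hUm) (h2.trans_lt (by finiteness)) hU'.dt
        (measurable_dtFun hUm') (h2'.trans_lt (by finiteness)) (by rw [hu, lam_dt hU]) hP' hQ' 0
  refine ⟨T, hT, hT1, (Hi - R ∘L Hi) + L, ?_, ?_, ?_, ?_, ?_⟩
  · have h1 : ‖Hi - R ∘L Hi‖ ≤ 2 * K ^ (-ε) * Q := by
      refine (norm_sub_le _ _).trans ?_
      have h2 := (R.opNorm_comp_le Hi).trans (mul_le_mul hRn hHin (norm_nonneg _) (by positivity))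
      rw [hQ]
      linarith
    refine (norm_add_le _ _).trans ?_
    linarith
  · intro G
    have h1 := ((hR0 (Hi G)).sub (hW.data (ev (Hi G)) (evd (Hi G)))).add (l1 G)
    rw [sub_self, sub_self, add_zero] at h1
    have e : X.toDist (((Hi - R ∘L Hi) + L) G) =
        X.toDist (Hi G) - X.toDist (W (ev (Hi G), evd (Hi G))) + X.toDist (L G) := by
      rw [← map_sub, ← map_add]
      rfl
    rwa [e]
  · intro G
    obtain ⟨U, hUm, hU, -⟩ := hfib G
    have e : box (X.toDist (((Hi - R ∘L Hi) + L) G)) =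
        box (X.toDist (Hi G)) - box (X.toDist (R (Hi G))) + box (X.toDist (L G)) := by
      rw [← box_sub, ← box_add, ← map_sub, ← map_add]
      rfl
    obtain ⟨F, hF⟩ := exists_of_wnorm (measurable_loSrc hUm)
      (ae_integrable_loSrc hX hε K hUm hU).1
    have h1 := l2 G U F hUm hU hF
    -- The correction is a free wave on (-1, 1) only; hence the requirement T ≤ 1.
    have h2 := (hW.wave (ev (Hi G), evd (Hi G))).mono (a' := -T) (b' := T) (by linarith) hT1
    have h3 := ((EqOnSlab.refl (-T) T (box (X.toDist (Hi G)))).sub h2).add h1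
    have e2 : box (X.toDist (Hi G)) - 0 + F = (Yspace X ε).toDist G := by
      rw [sub_zero]
      refine ((hHi G U hU).box.add hF).ext (hasFourierFun_Y hU)
        (Filter.Eventually.of_forall fun z ↦ ?_)
      exact symBox_mul_hiMul hK2 U z
    rw [e, ← e2]
    exact h3
  · intro G hG
    have hG' := isRealValued_of_Y hX hG
    have hr : IsRealValued (X.toDist (Hi G)) := by
      obtain ⟨U, hUm, hU, -⟩ := hfib G
      refine (hHi G U hU).isRealValued ?_
      filter_upwards [hU.neg_ae_eq_conj hG'] with z hz
      rw [hz, map_mul, Complex.conj_ofReal]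
      unfold hiMul
      rw [symMinus_neg_arg, srcMul_neg_arg, symBox_neg_arg]
    have e : X.toDist (((Hi - R ∘L Hi) + L) G) =
        X.toDist (Hi G) - X.toDist (R (Hi G)) + X.toDist (L G) := by
      rw [← map_sub, ← map_add]
      rfl
    rw [e]
    exact (hr.sub (hRreal _ hr)).add (l3 G hG')
  · intro α G G' hGY
    have hG := lam_of_Y hX hGY
    have hl : X.toDist (Hi G') = Lam n α (X.toDist (Hi G)) := by
      obtain ⟨U, -, hU, -⟩ := hfib G
      obtain ⟨U', -, hU', -⟩ := hfib G'
      refine (hHi G' U' hU').ext ((hHi G U hU).mult (symX_temperate α)) ?_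
      rw [hG] at hU'
      filter_upwards [hU'.ae_eq (hU.mult (symX_temperate α))] with z hz
      rw [hz]
      ring
    have e : ∀ G, X.toDist (((Hi - R ∘L Hi) + L) G) =
        X.toDist (Hi G) - X.toDist (R (Hi G)) + X.toDist (L G) := by
      intro G
      rw [← map_sub, ← map_add]
      rfl
    rw [e, e, hRlam α _ _ hl, hl, l4 α G G' hG, map_add, map_sub]

end Duhamel

/-! ### Uniqueness for the linear wave equation -/

section LinearUniqueness

variable {n : ℕ}

theorem HasFourierFun.laplace_apply {v : 𝓢'(Sp n, ℂ)} {V : Sp n → ℂ} (h : HasFourierFun v V)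
    (ψ : 𝓢(Sp n, ℂ)) :
    v (∑ i : Fin n, ∂_{EuclideanSpace.single i (1 : ℝ)} (∂_{EuclideanSpace.single i (1 : ℝ)} ψ)) =
      ∫ ξ, (𝓕⁻ ψ : 𝓢(Sp n, ℂ)) ξ * (-((‖(2 * Real.pi) • ξ‖ ^ 2 : ℝ) : ℂ) * V ξ) := by
  have h2 := HasFourierFun.sum (s := Finset.univ) (fun (i : Fin n) _ ↦
    (h.lineDeriv (EuclideanSpace.single i (1 : ℝ))).lineDeriv (EuclideanSpace.single i (1 : ℝ)))
  have h3 := h2.apply ψ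
  rw [_root_.sum_apply] at h3
  rw [map_sum]
  refine Eq.trans (Finset.sum_congr rfl fun i _ ↦ ?_) (h3.trans ?_)
  · rw [TemperedDistribution.lineDerivOp_apply_apply,
      TemperedDistribution.lineDerivOp_apply_apply]
    simp only [lineDerivOp_neg, neg_neg]
  · refine integral_congr_ae (Filter.Eventually.of_forall fun ξ ↦ ?_)
    have e1 : ‖(2 * Real.pi) • ξ‖ ^ 2 = (2 * Real.pi) ^ 2 * ∑ i, (ξ i) ^ 2 := by
      rw [norm_smul, mul_pow, EuclideanSpace.norm_sq_eq, Real.norm_eq_abs, sq_abs]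
      simp
    have e2 : ∀ i : Fin n, inner ℝ ξ (EuclideanSpace.single i (1 : ℝ)) = ξ i := by
      intro i
      rw [real_inner_comm]
      simp [EuclideanSpace.inner_single_left]
    simp only [e1, Finset.sum_apply, e2]
    congr 1
    push_cast
    rw [Finset.mul_sum, ← Finset.sum_neg_distrib, Finset.sum_mul]
    refine Finset.sum_congr rfl fun i _ ↦ ?_
    linear_combination (2 * Real.pi * ξ i : ℂ) ^ 2 * V ξ * Complex.I_sq

/-- The derivative `q` is known to be a primitive of -κ²p on [0, T] only, so it is replaced by the
globally defined `Q`. Rotating (p, Q) backwards by the free flow gives two quantities, `A` and `B`,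
which are constant and initially zero, and p = cos(κt)A + sn(κ, t)B. -/
theorem eq_zero_of_wave_ode {κ T : ℝ} {p q : ℝ → ℂ} (hp : ∀ t, HasDerivAt p (q t) t)
    (hq : ∀ t ∈ Set.Icc 0 T, q t = -(κ : ℂ) ^ 2 * ∫ r in (0 : ℝ)..t, p r) (h0 : p 0 = 0) :
    ∀ t ∈ Set.Icc 0 T, p t = 0 := by
  have hpc : Continuous p := continuous_iff_continuousAt.2 fun t ↦ (hp t).continuousAt
  set Q : ℝ → ℂ := fun t ↦ -(κ : ℂ) ^ 2 * ∫ r in (0 : ℝ)..t, p r with hQ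
  have hQd : ∀ t, HasDerivAt Q (-(κ : ℂ) ^ 2 * p t) t := fun t ↦
    (intervalIntegral.integral_hasDerivAt_right (hpc.intervalIntegrable _ _)
      (hpc.stronglyMeasurableAtFilter _ _) hpc.continuousAt).const_mul _
  have hQ0 : Q 0 = 0 := by simp [hQ]
  have e1 : ∀ t, (κ : ℂ) * sn κ t = Real.sin (κ * t) := fun t ↦ by
    rw [← Complex.ofReal_mul, mul_sn]
  have e2 : ∀ t, (Real.sin (κ * t) : ℂ) ^ 2 + (Real.cos (κ * t) : ℂ) ^ 2 = 1 := fun t ↦ by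
    rw [← Complex.ofReal_pow, ← Complex.ofReal_pow, ← Complex.ofReal_add,
      Real.sin_sq_add_cos_sq, Complex.ofReal_one]
  let A : ℝ → ℂ := fun t ↦ (Real.cos (κ * t) : ℂ) * p t - (sn κ t : ℂ) * Q t
  let B : ℝ → ℂ := fun t ↦ (κ * Real.sin (κ * t) : ℂ) * p t + (Real.cos (κ * t) : ℂ) * Q t
  have hA : ∀ t, HasDerivAt A (-(κ * Real.sin (κ * t) : ℂ) * p t + (Real.cos (κ * t) : ℂ) * q t -
      ((Real.cos (κ * t) : ℂ) * Q t + (sn κ t : ℂ) * (-(κ : ℂ) ^ 2 * p t))) t := fun t ↦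
    ((hasDerivAt_cosC κ t).mul (hp t)).sub ((hasDerivAt_sn κ t).ofReal_comp.mul (hQd t))
  have hB : ∀ t, HasDerivAt B ((κ : ℂ) ^ 2 * Real.cos (κ * t) * p t +
      (κ * Real.sin (κ * t) : ℂ) * q t + (-(κ * Real.sin (κ * t) : ℂ) * Q t +
        (Real.cos (κ * t) : ℂ) * (-(κ : ℂ) ^ 2 * p t))) t := fun t ↦
    ((hasDerivAt_sinC κ t).mul (hp t)).add ((hasDerivAt_cosC κ t).mul (hQd t))
  have hAz : ∀ t ∈ Set.Icc 0 T, A t = A 0 := by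
    refine constant_of_has_deriv_right_zero (fun t _ ↦ (hA t).continuousAt.continuousWithinAt)
      fun t ht ↦ ((hA t).congr_deriv ?_).hasDerivWithinAt
    rw [hq t ⟨ht.1, ht.2.le⟩]
    linear_combination (κ * p t) * e1 t
  have hBz : ∀ t ∈ Set.Icc 0 T, B t = B 0 := by
    refine constant_of_has_deriv_right_zero (fun t _ ↦ (hB t).continuousAt.continuousWithinAt)
      fun t ht ↦ ((hB t).congr_deriv ?_).hasDerivWithinAt
    rw [hq t ⟨ht.1, ht.2.le⟩]
    ring
  intro t ht
  have h1 : A t = 0 := by rw [hAz t ht]; simp [A, h0, hQ0]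
  have h2 : B t = 0 := by rw [hBz t ht]; simp [B, h0, hQ0]
  simp only [A] at h1
  simp only [B] at h2
  linear_combination (Real.cos (κ * t) : ℂ) * h1 + (sn κ t : ℂ) * h2 - p t * e2 t -
    Real.sin (κ * t) * p t * e1 t

set_option maxHeartbeats 400000 in
/-- Uniqueness for the linear wave equation. -/
theorem wave_unique {r r' : ℝ} {u : 𝓢'(ST n, ℂ)} {U : ST n → ℂ} (hU : HasFourierFun u U)
    (hm : Measurable U) (hr : wnorm r (fibMass U) < ⊤) (hr' : wnorm r' (fibMass (dtFun U)) < ⊤)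
    {T : ℝ} (hbox : EqOnSlab 0 T (box u) 0) (hd : HasData u 0 0)
    {P : ℝ → 𝓢'(Sp n, ℂ)} (hP : IsPath u P) {t : ℝ} (ht : t ∈ Set.Icc 0 T) : P t = 0 := by
  obtain ⟨⟨P₀, hP₀, hP00⟩, P₁, hP₁, hP10⟩ := hd
  obtain ⟨W, -, hW, hWf, -⟩ := exists_path_H hU hm hr
  obtain ⟨W', -, hW', hWf', -⟩ := exists_path_H hU.dt (measurable_dtFun hm) hr'
  have eP : P = P₀ := hP.unique hP₀
  subst eP
  have hPf : ∀ t, HasFourierFun (P t) (fun ξ ↦ invFib U ξ t) := fun t ↦ by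
    rw [hP.unique hW]; exact hWf t
  have hPf' : ∀ t, HasFourierFun (P₁ t) (fun ξ ↦ invFib (dtFun U) ξ t) := fun t ↦ by
    rw [hP₁.unique hW']; exact hWf' t
  have hfin := ae_lt_top_of_wnorm (measurable_fibMass hm).aemeasurable hr
  have hbd : ∀ᵐ ξ, ∀ r, ‖invFib U ξ r‖ ≤ (fibMass U ξ).toReal := by
    filter_upwards [hfin] with ξ hξ r
    rw [← toReal_enorm]
    exact ENNReal.toReal_mono hξ.ne (enorm_invFib_le U ξ r)
  set κ : Sp n → ℝ := fun ξ ↦ ‖(2 * Real.pi) • ξ‖ with hκ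
  have hκm : Measurable κ := by fun_prop
  have hmI := measurable_invFib hm
  set M : ℝ := (n : ℝ) + 1 - r with hM
  have hb1 : Integrable fun ξ ↦ symS (-M) ξ * (fibMass U ξ).toReal := by
    refine integrable_symS_mul_of_wnorm (measurable_fibMass hm).ennreal_toReal.aestronglyMeasurable
      (lt_of_le_of_lt (wnorm_mono (Filter.Eventually.of_forall fun ξ ↦ ?_)) hr)
    rw [Real.enorm_eq_ofReal ENNReal.toReal_nonneg]
    exact ENNReal.ofReal_toReal_le
  have hdom : ∀ c : ℝ, 0 ≤ c → ∀ V : Sp n → ℂ, Measurable V →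
      (∀ᵐ ξ, ‖V ξ‖ ≤ c * (κ ξ ^ 2 * (fibMass U ξ).toReal)) →
      ∃ v : 𝓢'(Sp n, ℂ), HasFourierFun v V := by
    intro c hc V hV hVb
    -- Two more powers of the weight absorb the factor |ξ|² of the Laplacian.
    refine exists_hasFourierFun_Sp (M := M + 2) ((hb1.const_mul c).mono'
      ((Complex.continuous_ofReal.comp (continuous_symS _)).measurable.mul
        hV).aestronglyMeasurable ?_)
    filter_upwards [hVb] with ξ hξ
    have hs := symS_pos (-(M + 2)) ξ
    rw [norm_mul, Complex.norm_real, Real.norm_of_nonneg hs.le]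
    have hle : symS (-(M + 2)) ξ * κ ξ ^ 2 ≤ symS (-M) ξ := by
      have e : symS 2 ξ = 1 + κ ξ ^ 2 := by
        rw [← symS_one_sq, sq, ← symS_add]; norm_num
      have e2 : symS (-M) ξ = symS (-(M + 2)) ξ * (1 + κ ξ ^ 2) := by
        rw [← e, ← symS_add]
        congr 1
        ring
      rw [e2]
      exact mul_le_mul_of_nonneg_left (by linarith) hs.le
    calc _ ≤ symS (-(M + 2)) ξ * (c * (κ ξ ^ 2 * (fibMass U ξ).toReal)) :=
          mul_le_mul_of_nonneg_left hξ hs.le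
      _ = c * ((symS (-(M + 2)) ξ * κ ξ ^ 2) * (fibMass U ξ).toReal) := by ring
      _ ≤ _ := mul_le_mul_of_nonneg_left
            (mul_le_mul_of_nonneg_right hle ENNReal.toReal_nonneg) hc
  -- The equation integrated once in time, for each fixed t; the exceptional set of ξ may still
  -- depend on t.
  have key : ∀ t ∈ Set.Icc 0 T, ∀ᵐ ξ, invFib (dtFun U) ξ t =
      -((κ ξ ^ 2 : ℝ) : ℂ) * ∫ r in (0 : ℝ)..t, invFib U ξ r := by
    intro t ht
    obtain ⟨v, hv⟩ := hdom t ht.1 (fun ξ ↦ -((κ ξ ^ 2 : ℝ) : ℂ) * ∫ r in (0 : ℝ)..t, invFib U ξ r)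
      ((by fun_prop : Measurable fun ξ ↦ -((κ ξ ^ 2 : ℝ) : ℂ)).mul
        ((measurable_intervalIntegral hmI).comp (by fun_prop : Measurable fun ξ : Sp n ↦ (ξ, t))))
      (by
        filter_upwards [hbd] with ξ hξ
        have h1 := intervalIntegral.norm_integral_le_of_norm_le_const (a := 0) (b := t)
          (f := invFib U ξ) fun r _ ↦ hξ r
        rw [sub_zero, abs_of_nonneg ht.1] at h1
        rw [norm_mul, norm_neg, Complex.norm_real, Real.norm_of_nonneg (by positivity)]
        calc _ ≤ κ ξ ^ 2 * ((fibMass U ξ).toReal * t) :=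
              mul_le_mul_of_nonneg_left h1 (by positivity)
          _ = _ := by ring)
    have e : P₁ t = v := by
      rw [← sub_eq_zero]
      refine eq_zero_of_forall_hasCompactSupport fun ψ hψ ↦ ?_
      have hev : ∀ ψ : 𝓢(Sp n, ℂ), ∀ {Q : ℝ → 𝓢'(Sp n, ℂ)}, Continuous Q →
          Continuous fun t ↦ Q t ψ := fun ψ Q hQ ↦
        (PointwiseConvergenceCLM.evalCLM (RingHom.id ℂ) ℂ ψ).continuous.comp hQ
      -- Tested against ψ, the equation says that ⟨u(t), Δψ⟩ is the weak derivative of ⟨∂_t u(t),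
      -- ψ⟩, both of which are continuous in t.
      have h1 := sub_eq_integral_of_weak_deriv (hev ψ hP₁.1) (hev _ hP.1)
        (fun φ h1 h2 h3 ↦ hP.wave_weak hP₁ hbox hψ h1 h2 h3) ht
      rw [hP10, _root_.zero_apply, sub_zero] at h1
      rw [_root_.sub_apply, h1, sub_eq_zero, hv.apply ψ, intervalIntegral.integral_of_le ht.1]
      simp only [(hPf _).laplace_apply ψ]
      rw [integral_integral_swap]
      · refine integral_congr_ae (Filter.Eventually.of_forall fun ξ ↦ ?_)
        simp only
        rw [intervalIntegral.integral_of_le ht.1, ← integral_const_mul, ← integral_const_mul]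
      · obtain ⟨v', hv'⟩ := hdom 1 zero_le_one
          (fun ξ ↦ ((κ ξ ^ 2 * (fibMass U ξ).toReal : ℝ) : ℂ))
          (Complex.continuous_ofReal.measurable.comp
            ((hκm.pow_const 2).mul (measurable_fibMass hm).ennreal_toReal))
          (Filter.Eventually.of_forall fun ξ ↦ by
            rw [Complex.norm_real, Real.norm_of_nonneg (by positivity), one_mul])
        have hi := (hv'.2 (𝓕⁻ ψ)).1.norm
        have h1 : Integrable (fun _ : ℝ ↦ (1 : ℝ)) (volume.restrict (Set.Ioc 0 t)) :=
          integrable_const 1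
        refine (h1.mul_prod hi).mono' ?_ ?_
        · refine Measurable.aestronglyMeasurable ?_
          have h2 : Measurable fun q : ℝ × Sp n ↦ Function.uncurry (invFib U) (q.2, q.1) :=
            hmI.comp (measurable_snd.prodMk measurable_fst)
          simp only [Function.uncurry_apply_pair] at h2
          have h3 : Measurable fun q : ℝ × Sp n ↦ (𝓕⁻ ψ : 𝓢(Sp n, ℂ)) q.2 :=
            (SchwartzMap.continuous _).measurable.comp measurable_snd
          exact h3.mul ((by fun_prop : Measurable fun q : ℝ × Sp n ↦
            -((‖(2 * Real.pi) • q.2‖ ^ 2 : ℝ) : ℂ)).mul h2)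
        · filter_upwards [Measure.quasiMeasurePreserving_snd.ae hbd] with q hq
          simp only [Function.uncurry, one_mul]
          rw [norm_mul, norm_mul, norm_mul, norm_neg, Complex.norm_real, Complex.norm_real,
            Real.norm_of_nonneg (by positivity), Real.norm_of_nonneg (by positivity)]
          gcongr
          exact hq q.1
    exact (hPf' t).ae_eq (e ▸ hv)
  have hT : 0 ≤ T := ht.1.trans ht.2
  -- Rational times clamped to [0, T] give a single null set, and continuity in t on the remaining
  -- fibres recovers all times.
  let pr : ℝ → ℝ := fun x ↦ max 0 (min T x)
  have hpr : ∀ x, pr x ∈ Set.Icc 0 T := fun x ↦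
    ⟨le_max_left _ _, max_le hT (min_le_left _ _)⟩
  have hprc : Continuous pr := by fun_prop
  have hall : ∀ᵐ ξ, ∀ k : ℚ, invFib (dtFun U) ξ (pr k) =
      -((κ ξ ^ 2 : ℝ) : ℂ) * ∫ r in (0 : ℝ)..pr k, invFib U ξ r :=
    ae_all_iff.2 fun k ↦ key _ (hpr k)
  have h00 : ∀ᵐ ξ, invFib U ξ 0 = 0 := (hPf 0).ae_eq (by rw [hP00]; exact HasFourierFun.zero)
  refine (hPf t).ext HasFourierFun.zero ?_
  filter_upwards [hall, h00, ae_hasDerivAt_invFib hm hr hr', ae_continuous_invFib hm hr,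
    ae_continuous_invFib (measurable_dtFun hm) hr'] with ξ h1 h2 h3 h4 h5
  refine eq_zero_of_wave_ode (κ := κ ξ) h3 (fun x hx ↦ ?_) h2 t ht
  have hc : Continuous fun x ↦ ∫ r in (0 : ℝ)..x, invFib U ξ r :=
    intervalIntegral.continuous_primitive (fun a b ↦ h4.intervalIntegrable a b) 0
  have := Continuous.ext_on Rat.denseRange_cast (h5.comp hprc)
    (continuous_const.mul (hc.comp hprc)) (by rintro _ ⟨k, rfl⟩; exact h1 k)
  have h6 := congrFun this x
  have e : pr x = x := by
    simp only [pr]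
    rw [min_eq_right hx.2, max_eq_right hx.1]
  simp only [Function.comp_apply, Pi.mul_apply, e] at h6
  rw [h6]
  push_cast
  rfl

end LinearUniqueness

/-! ### The abstract semilinear Cauchy problem -/

/-- The abstract form of a semilinear Cauchy problem: `van a b` are the functions which vanish on
the slab `(a, b)`, `rel a b` the pairs `(u, F)` with `□u = F` on `(a, b)`, `ev t` is the pair of
data at time `t`, and `sh k` is the translation by `k`. -/
structure WaveSys (Z Y D : Type*) [NormedAddCommGroup Z] [NormedSpace ℝ Z]
    [NormedAddCommGroup Y] [NormedSpace ℝ Y] [NormedAddCommGroup D] [NormedSpace ℝ D] where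
  N : Z → Y
  van : ℝ → ℝ → Submodule ℝ Z
  rel : ℝ → ℝ → Submodule ℝ (Z × Y)
  ev : ℝ → Z →L[ℝ] D
  evB : ℝ
  sh : ℝ → Z →L[ℝ] Z
  free : D →L[ℝ] Z
  /-- A further property of the Duhamel operators. -/
  spec : (Y →L[ℝ] Z) → Prop
  ev_le : ∀ t, ‖ev t‖ ≤ evB
  van_closed : ∀ T, 0 < T → IsClosed (van 0 T : Set Z)
  rel_mono : ∀ {a b a' b'}, a ≤ a' → b' ≤ b → rel a b ≤ rel a' b'
  van_union : ∀ {a b c d u}, b < c → u ∈ van a c → u ∈ van b d → u ∈ van a d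
  rel_union : ∀ {a b c d p}, b < c → p ∈ rel a c → p ∈ rel b d → p ∈ rel a d
  ev_van : ∀ {a b t u}, a < b → u ∈ van a b → t ∈ Set.Icc a b → ev t u = 0
  van_rel : ∀ {a b u}, u ∈ van a b → (u, (0 : Y)) ∈ rel a b
  N_local : ∀ {a b u u'}, u - u' ∈ van a b → ((0 : Z), N u - N u') ∈ rel a b
  ev_sh : ∀ t k u, ev t (sh k u) = ev (t + k) u
  van_sh : ∀ {a b k u}, u ∈ van a b → sh k u ∈ van (a - k) (b - k)
  sh_sh : ∀ k u, sh (-k) (sh k u) = u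
  sh_norm : ∀ k u, ‖sh k u‖ ≤ ‖u‖
  sol_sh : ∀ {a b u} k, (u, N u) ∈ rel a b → (sh k u, N (sh k u)) ∈ rel (a - k) (b - k)
  free_ev : ∀ d, ev 0 (free d) = d
  free_rel : ∀ d, (free d, (0 : Y)) ∈ rel (-1) 1
  duhamel : ∀ η : ℝ, 0 < η → ∃ T : ℝ, 0 < T ∧ T ≤ 1 ∧ ∃ S : Y →L[ℝ] Z, ‖S‖ ≤ η ∧ spec S ∧
    ∀ F, ev 0 (S F) = 0 ∧ (S F, F) ∈ rel (-T) T
  unique : ∀ {T u}, 0 < T → (u, (0 : Y)) ∈ rel 0 T → ev 0 u = 0 → u ∈ van 0 T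
  cutoff : ∀ {a c₁ c₂ d}, a < c₁ → c₁ < c₂ → c₂ < d → ∃ M : Z →L[ℝ] Z,
    (∀ u, M u - u ∈ van a c₁) ∧ (∀ u, M u ∈ van c₂ d) ∧ ∀ u b c, u ∈ van b c → M u ∈ van b c
  N_zero : N 0 = 0
  N_lip : ∃ A : ℝ → ℝ, ContinuousOn A (Set.Ici 0) ∧
    ∀ u v, ‖N u - N v‖ ≤ A (max ‖u‖ ‖v‖) * ‖u - v‖

namespace WaveSys

variable {Z Y D : Type*} [NormedAddCommGroup Z] [NormedSpace ℝ Z]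
    [NormedAddCommGroup Y] [NormedSpace ℝ Y] [NormedAddCommGroup D] [NormedSpace ℝ D]
    (P : WaveSys Z Y D)

/-- `u` is a solution on the slab `(a, b)`. -/
def Sol (a b : ℝ) (u : Z) : Prop := (u, P.N u) ∈ P.rel a b

variable {P}

theorem Sol.mono {a b a' b' : ℝ} {u : Z} (h : P.Sol a b u) (ha : a ≤ a') (hb : b' ≤ b) :
    P.Sol a' b' u := P.rel_mono ha hb h

theorem Sol.congr {a b : ℝ} {u u' : Z} (h : P.Sol a b u) (hu : u' - u ∈ P.van a b) :
    P.Sol a b u' := by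
  have := add_mem (add_mem h (P.van_rel hu)) (P.N_local hu)
  simpa [Sol] using this

theorem exists_bound_of_continuousOn {A : ℝ → ℝ} (hA : ContinuousOn A (Set.Ici 0)) (R : ℝ) :
    ∃ K : ℝ, 0 ≤ K ∧ ∀ r, 0 ≤ r → r ≤ R → A r ≤ K := by
  obtain ⟨K, hK⟩ := (isCompact_Icc (a := (0 : ℝ)) (b := R)).exists_bound_of_continuousOn
    (hA.mono Set.Icc_subset_Ici_self)
  exact ⟨max K 0, le_max_right _ _, fun r h0 hr ↦
    (le_abs_self _).trans ((hK r ⟨h0, hr⟩).trans (le_max_left _ _))⟩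

variable (P)

theorem exists_lip (R : ℝ) : ∃ K : ℝ, 0 ≤ K ∧ ∀ u v, ‖u‖ ≤ R → ‖v‖ ≤ R →
    ‖P.N u - P.N v‖ ≤ K * ‖u - v‖ := by
  obtain ⟨A, hA, h⟩ := P.N_lip
  obtain ⟨K, hK0, hK⟩ := exists_bound_of_continuousOn hA R
  refine ⟨K, hK0, fun u v hu hv ↦ (h u v).trans ?_⟩
  gcongr
  exact hK _ (le_max_of_le_left (norm_nonneg _)) (max_le hu hv)

/-- Uniqueness on short time intervals. -/
theorem exists_unique_short (R : ℝ) : ∃ h : ℝ, 0 < h ∧ ∀ u v, ‖u‖ ≤ R → ‖v‖ ≤ R → ∀ T, 0 < T →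
    T ≤ h → P.Sol 0 T u → P.Sol 0 T v → P.ev 0 u = P.ev 0 v → u - v ∈ P.van 0 T := by
  -- The radius must contain v + m = u - (u - v - m), which is at most R + (2R + 1).
  obtain ⟨K, hK0, hK⟩ := P.exists_lip (3 * R + 1)
  obtain ⟨h, hh, -, S, hS, -, hSF⟩ := P.duhamel (1 / (2 * (K + 1))) (by positivity)
  refine ⟨h, hh, fun u v hu hv T hT hTh su sv he ↦ ?_⟩
  have hR : 0 ≤ R := (norm_nonneg _).trans hu
  have hcl := P.van_closed T hT
  have hne : (P.van 0 T : Set Z).Nonempty := ⟨0, zero_mem _⟩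
  -- By locality v may be replaced by v + m, which agrees with it on (0, T). Linear uniqueness then
  -- shows that u - v and S(𝒩(u) - 𝒩(v + m)) differ by a function vanishing there, so the distance
  -- to such functions is at most half of ‖u - v - m‖.
  have key : ∀ m ∈ P.van 0 T, ‖u - v - m‖ ≤ 2 * R + 1 →
      Metric.infDist (u - v) (P.van 0 T) ≤ 1 / 2 * ‖u - v - m‖ := by
    intro m hm hmR
    have hv' : ‖v + m‖ ≤ 3 * R + 1 := by
      calc ‖v + m‖ = ‖u - (u - v - m)‖ := by congr 1; abel
        _ ≤ ‖u‖ + ‖u - v - m‖ := norm_sub_le _ _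
        _ ≤ _ := by linarith
    have hN := P.N_local (u := v + m) (u' := v) (by simpa using hm)
    have hS' := P.rel_mono (a' := 0) (b' := T) (by linarith) hTh (hSF (P.N u - P.N (v + m))).2
    have hw : u - v - S (P.N u - P.N (v + m)) ∈ P.van 0 T := by
      refine P.unique hT ?_ ?_
      · have := sub_mem (sub_mem (sub_mem su sv) hS') hN
        simpa using this
      · simp [he, (hSF _).1]
    calc Metric.infDist (u - v) (P.van 0 T) ≤ dist (u - v) _ :=
          Metric.infDist_le_dist_of_mem hw
      _ = ‖S (P.N u - P.N (v + m))‖ := by rw [dist_eq_norm]; congr 1; abel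
      _ ≤ 1 / (2 * (K + 1)) * (K * ‖u - (v + m)‖) :=
          (S.le_of_opNorm_le hS _).trans (by
            gcongr
            exact hK _ _ (by linarith) hv')
      _ ≤ 1 / 2 * ‖u - v - m‖ := by
          rw [← sub_sub u v m, ← mul_assoc]
          gcongr
          rw [div_mul_eq_mul_div, one_mul, div_le_div_iff₀ (by positivity) (by norm_num)]
          linarith
  rw [← SetLike.mem_coe, hcl.mem_iff_infDist_zero hne]
  by_contra h0
  have he0 : 0 < Metric.infDist (u - v) (P.van 0 T) :=
    lt_of_le_of_ne Metric.infDist_nonneg (Ne.symm h0)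
  have hle : Metric.infDist (u - v) (P.van 0 T) ≤ 2 * R := by
    refine (Metric.infDist_le_dist_of_mem (zero_mem (P.van 0 T))).trans ?_
    rw [dist_zero_right]
    exact (norm_sub_le _ _).trans (by linarith)
  -- If the distance were positive, an m realising it up to a factor below 2 would contradict `key`.
  -- The cap 2R + 1 keeps m within the range of the Lipschitz constant.
  obtain ⟨m, hm, hml⟩ := (Metric.infDist_lt_iff hne
    (r := min (2 * Metric.infDist (u - v) (P.van 0 T)) (2 * R + 1))).1
      (lt_min (by linarith) (by linarith))
  rw [dist_eq_norm, lt_min_iff] at hml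
  have := key m hm hml.2.le
  linarith [hml.1]

variable {P}

theorem van_of_sh {b c : ℝ} {u : Z} (h : P.sh b u ∈ P.van 0 (c - b)) : u ∈ P.van b c := by
  have := P.van_sh (k := -b) h
  rw [P.sh_sh] at this
  simpa using this

/-- Induction in steps of h/2. To pass from a - h/2 to a, the comparison restarts at a - h, where
the data agree by the previous stage; the two slabs overlap, as gluing of open slabs requires. The
length h depends only on the norms, which translation does not increase. -/
theorem sol_unique {T : ℝ} {u v : Z} (hT : 0 < T) (su : P.Sol 0 T u) (sv : P.Sol 0 T v)
    (he : P.ev 0 u = P.ev 0 v) : u - v ∈ P.van 0 T := by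
  obtain ⟨h, hh, H⟩ := P.exists_unique_short (max ‖u‖ ‖v‖)
  suffices hk : ∀ k : ℕ, ∀ a, 0 < a → a ≤ T → a ≤ (k + 1) * (h / 2) → u - v ∈ P.van 0 a by
    obtain ⟨k, hk'⟩ := exists_nat_ge (T / (h / 2))
    refine hk k T hT le_rfl ?_
    rw [div_le_iff₀ (by positivity)] at hk'
    linarith
  have base : ∀ a, 0 < a → a ≤ T → a ≤ h → u - v ∈ P.van 0 a := fun a h0 haT ha ↦
    H u v (le_max_left _ _) (le_max_right _ _) a h0 ha (su.mono le_rfl haT)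
      (sv.mono le_rfl haT) he
  intro k
  induction k with
  | zero => exact fun a h0 haT ha ↦ base a h0 haT (by norm_num at ha; linarith)
  | succ k ih =>
    intro a h0 haT ha
    by_cases hah : a ≤ h
    · exact base a h0 haT hah
    push Not at hah
    push_cast at ha
    have ih' := ih (a - h / 2) (by linarith) (by linarith) (by linarith)
    have hev : P.ev (a - h) u = P.ev (a - h) v := by
      rw [← sub_eq_zero, ← map_sub]
      exact P.ev_van (by linarith) ih' ⟨by linarith, by linarith⟩
    refine P.van_union (b := a - h) (by linarith) ih' (van_of_sh ?_)
    rw [map_sub]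
    refine H _ _ ((P.sh_norm _ _).trans (le_max_left _ _))
      ((P.sh_norm _ _).trans (le_max_right _ _)) _ (by linarith) (by linarith) ?_ ?_ ?_
    · exact Sol.mono (P.sol_sh (a - h) su) (by linarith) (by linarith)
    · exact Sol.mono (P.sol_sh (a - h) sv) (by linarith) (by linarith)
    · rw [P.ev_sh, P.ev_sh, zero_add, hev]

theorem sol_unique_from {b c : ℝ} {u v : Z} (hbc : b < c) (su : P.Sol b c u) (sv : P.Sol b c v)
    (he : P.ev b u = P.ev b v) : u - v ∈ P.van b c := by
  refine van_of_sh ?_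
  rw [map_sub]
  refine sol_unique (by linarith) ?_ ?_ (by rw [P.ev_sh, P.ev_sh, zero_add, he])
  · exact Sol.mono (P.sol_sh b su) (by linarith) le_rfl
  · exact Sol.mono (P.sol_sh b sv) (by linarith) le_rfl

variable (P)

/-- A solution operator on a short time interval for data of norm at most `ρ`. -/
structure IsSolver (ρ R T : ℝ) (S : Y →L[ℝ] Z) (Ψ : D → Z) : Prop where
  sol : ∀ e, ‖e‖ ≤ ρ → P.Sol (-T) T (Ψ e) ∧ P.ev 0 (Ψ e) = e
  lip : ∀ e e', ‖e‖ ≤ ρ → ‖e'‖ ≤ ρ → ‖Ψ e - Ψ e'‖ ≤ 2 * ‖P.free‖ * ‖e - e'‖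
  smooth : ContDiff ℝ ∞ P.N → ∀ e, ‖e‖ < ρ → ContDiffAt ℝ ∞ Ψ e
  maps : ∀ e, ‖e‖ ≤ ρ → ∀ u, ‖u‖ ≤ R → ‖P.free e + S (P.N u)‖ ≤ R
  contr : ∀ e, ‖e‖ ≤ ρ → ∀ u, ‖u‖ ≤ R → ‖P.free e + S (P.N u) - Ψ e‖ ≤ 1 / 2 * ‖u - Ψ e‖

variable [CompleteSpace Z]

/-- Banach's fixed point theorem for u ↦ W e + S 𝒩(u) on a ball of radius R. The radius is fixed
before K' because, for persistence, K' will be the tame constant on that very ball. -/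
theorem exists_solver (ρ : ℝ) (hρ : 0 ≤ ρ) : ∃ R : ℝ, 0 ≤ R ∧ ∀ K' : ℝ, 0 ≤ K' → ∃ T : ℝ,
    0 < T ∧ ∃ (S : Y →L[ℝ] Z) (Ψ : D → Z), P.spec S ∧ ‖S‖ * K' ≤ 1 / 2 ∧
      P.IsSolver ρ R T S Ψ := by
  -- With contraction factor 1/2 the radius 2‖W‖ρ would suffice; the extra 1 puts the fixed points
  -- in the open ball, where derivatives can be estimated.
  set R := 2 * ‖P.free‖ * ρ + 1 with hRdef
  have hR : 0 ≤ R := by positivity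
  refine ⟨R, hR, fun K' hK' ↦ ?_⟩
  obtain ⟨K, hK0, hK⟩ := P.exists_lip R
  obtain ⟨T, hT, hT1, S, hS, hspec, hSF⟩ := P.duhamel (1 / (2 * (K + K' + 1))) (by positivity)
  have hSK : ‖S‖ * K ≤ 1 / 2 := by
    calc ‖S‖ * K ≤ 1 / (2 * (K + K' + 1)) * K := by gcongr
      _ ≤ _ := by
        rw [div_mul_eq_mul_div, one_mul, div_le_div_iff₀ (by positivity) (by norm_num)]
        linarith
  have hSK' : ‖S‖ * K' ≤ 1 / 2 := by
    calc ‖S‖ * K' ≤ 1 / (2 * (K + K' + 1)) * K' := by gcongr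
      _ ≤ _ := by
        rw [div_mul_eq_mul_div, one_mul, div_le_div_iff₀ (by positivity) (by norm_num)]
        linarith
  have hhalf : ∀ u v, ‖u‖ ≤ R → ‖v‖ ≤ R → ‖S (P.N u) - S (P.N v)‖ ≤ 1 / 2 * ‖u - v‖ := by
    intro u v hu hv
    rw [← map_sub]
    calc ‖S (P.N u - P.N v)‖ ≤ ‖S‖ * (K * ‖u - v‖) :=
          (S.le_opNorm _).trans (by gcongr; exact hK _ _ hu hv)
      _ ≤ _ := by
        rw [← mul_assoc]
        gcongr
  have hhalf0 : ∀ u, ‖u‖ ≤ R → ‖S (P.N u)‖ ≤ 1 / 2 * ‖u‖ := by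
    intro u hu
    simpa [P.N_zero] using hhalf u 0 hu (by simpa using hR)
  have hmaps : ∀ e, ‖e‖ ≤ ρ → ∀ u, ‖u‖ ≤ R → ‖P.free e + S (P.N u)‖ ≤ R := by
    intro e he u hu
    have h1 : ‖P.free e‖ ≤ ‖P.free‖ * ρ := (P.free.le_opNorm _).trans (by gcongr)
    calc _ ≤ ‖P.free e‖ + ‖S (P.N u)‖ := norm_add_le _ _
      _ ≤ _ := by linarith [hhalf0 u hu]
  have hfix : ∀ e, ‖e‖ ≤ ρ → ∃ w, ‖w‖ ≤ R ∧ P.free e + S (P.N w) = w := by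
    intro e he
    have hm : Set.MapsTo (fun u ↦ P.free e + S (P.N u)) (Metric.closedBall (0 : Z) R)
        (Metric.closedBall (0 : Z) R) := by
      intro u hu
      simpa using hmaps e he u (by simpa using hu)
    have hc : ContractingWith (1 / 2 : ℝ≥0) (hm.restrict _ _ _) := by
      refine ⟨by rw [← NNReal.coe_lt_coe]; norm_num, LipschitzWith.of_dist_le_mul fun u v ↦ ?_⟩
      have := hhalf u.1 v.1 (mem_closedBall_zero_iff.1 u.2) (mem_closedBall_zero_iff.1 v.2)
      rw [Subtype.dist_eq, Subtype.dist_eq, dist_eq_norm, dist_eq_norm]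
      simpa using this
    obtain ⟨w, hw, hfw, -⟩ := hc.exists_fixedPoint' Metric.isClosed_closedBall.isComplete hm
      (x := 0) (by simpa using hR) (edist_ne_top _ _)
    exact ⟨w, by simpa using hw, hfw⟩
  choose! Ψ hΨR hΨ using hfix
  have hlip : ∀ e e', ‖e‖ ≤ ρ → ‖e'‖ ≤ ρ → ‖Ψ e - Ψ e'‖ ≤ 2 * ‖P.free‖ * ‖e - e'‖ := by
    intro e e' he he'
    have h1 := hhalf _ _ (hΨR e he) (hΨR e' he')
    have h2 : ‖P.free (e - e')‖ ≤ ‖P.free‖ * ‖e - e'‖ := P.free.le_opNorm _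
    have h3 : ‖Ψ e - Ψ e'‖ ≤ ‖P.free (e - e')‖ + ‖S (P.N (Ψ e)) - S (P.N (Ψ e'))‖ := by
      refine le_trans (le_of_eq ?_) (norm_add_le _ _)
      congr 1
      nth_rewrite 1 [← hΨ e he, ← hΨ e' he']
      rw [map_sub]
      abel
    linarith
  refine ⟨T, hT, S, Ψ, hspec, hSK', fun e he ↦ ⟨?_, ?_⟩, hlip, ?_, hmaps, ?_⟩
  · have h := add_mem (P.rel_mono (a' := -T) (b' := T) (by linarith) hT1 (P.free_rel e))
      (hSF (P.N (Ψ e))).2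
    rwa [Prod.mk_add_mk, zero_add, hΨ e he] at h
  · rw [← hΨ e he, map_add, P.free_ev, (hSF _).1, add_zero]
  · intro hN e he
    have hN' : ContDiff ℝ ∞ fun u ↦ S (P.N u) := S.contDiff.comp hN
    have hinf : (∞ : WithTop ℕ∞) ≠ 0 := by simp
    have hd := (hN'.differentiable hinf (Ψ e)).hasFDerivAt
    have hlt : ‖Ψ e‖ < R := by
      have h1 := hΨ e he.le
      have h2 : ‖P.free e‖ ≤ ‖P.free‖ * ρ := (P.free.le_opNorm _).trans (by gcongr)
      have h3 : ‖Ψ e‖ ≤ ‖P.free e‖ + ‖S (P.N (Ψ e))‖ := by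
        nth_rewrite 1 [← h1]
        exact norm_add_le _ _
      linarith [hhalf0 _ (hΨR e he.le)]
    -- Being 1/2-Lipschitz near `Ψ e`, the map S ∘ 𝒩 has a derivative of norm at most 1/2, so the
    -- derivative of id - S ∘ 𝒩 is invertible by a Neumann series.
    have hnorm : ‖fderiv ℝ (fun u ↦ S (P.N u)) (Ψ e)‖ ≤ ((1 / 2 : ℝ≥0) : ℝ) := by
      refine hd.le_of_lipschitzOn (s := Metric.ball (0 : Z) R)
        (Metric.isOpen_ball.mem_nhds (by simpa using hlt)) ?_
      refine LipschitzOnWith.of_dist_le_mul fun u hu v hv ↦ ?_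
      have := hhalf u v (by simpa using (Metric.mem_ball.1 hu).le)
        (by simpa using (Metric.mem_ball.1 hv).le)
      rw [dist_eq_norm, dist_eq_norm]
      simpa using this
    set L := fderiv ℝ (fun u ↦ S (P.N u)) (Ψ e)
    let E : Z ≃L[ℝ] Z := ContinuousLinearEquiv.unitsEquiv ℝ Z
      (Units.oneSub L (lt_of_le_of_lt hnorm (by norm_num)))
    have hθ : ContDiffAt ℝ ∞ (fun u ↦ u - S (P.N u)) (Ψ e) :=
      (contDiff_id.sub hN').contDiffAt
    have hθ' : HasFDerivAt (fun u ↦ u - S (P.N u)) (E : Z →L[ℝ] Z) (Ψ e) := by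
      have := (hasFDerivAt_id (Ψ e)).sub hd
      exact this
    have hloc := hθ.to_localInverse hθ' hinf
    have hleft := (hθ.hasStrictFDerivAt' hθ' hinf).eventually_left_inverse
    have hθΨ : ∀ e', ‖e'‖ ≤ ρ → Ψ e' - S (P.N (Ψ e')) = P.free e' := by
      intro e' he'
      rw [sub_eq_iff_eq_add, hΨ e' he']
    rw [hθΨ e he.le] at hloc
    have hball : ∀ᶠ e' in nhds e, ‖e'‖ ≤ ρ :=
      (continuous_norm.tendsto e).eventually (ge_mem_nhds he)
    -- Continuity of `Ψ` places its values in the region where the local inverse is a left inverse,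
    -- which identifies `Ψ` with the local inverse composed with the free operator.
    have hcont : Filter.Tendsto Ψ (nhds e) (nhds (Ψ e)) := by
      rw [tendsto_iff_norm_sub_tendsto_zero]
      refine squeeze_zero' (Filter.Eventually.of_forall fun _ ↦ norm_nonneg _)
        (hball.mono fun e' h ↦ hlip e' e h he.le) ?_
      have : Continuous fun e' : D ↦ 2 * ‖P.free‖ * ‖e' - e‖ := by fun_prop
      simpa using this.tendsto e
    refine (hloc.comp e P.free.contDiff.contDiffAt).congr_of_eventuallyEq ?_
    filter_upwards [hball, hcont.eventually hleft] with e' h1 h2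
    rw [Function.comp_apply, ← hθΨ e' h1]
    exact h2.symm
  · intro e he u hu
    have h1 := hhalf u _ hu (hΨR e he)
    refine le_trans (le_of_eq ?_) h1
    congr 1
    nth_rewrite 1 [← hΨ e he]
    abel

/-- Contraction gives a time valid on a neighbourhood of each r. Admissible times form an interval,
since solutions can be restricted, so these local choices can be averaged into one continuous
function. -/
theorem exists_lifespan : ∃ T : ℝ → ℝ, Continuous T ∧ (∀ r, 0 < T r) ∧
    ∀ r e, ‖e‖ ≤ r → ∃ u, P.Sol 0 (T r) u ∧ P.ev 0 u = e := by
  let t : ℝ → Set ℝ := fun r ↦ {τ | 0 < τ ∧ ∀ e, ‖e‖ ≤ r → ∃ u, P.Sol 0 τ u ∧ P.ev 0 u = e}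
  obtain ⟨T, hT⟩ := exists_continuous_forall_mem_convex_of_local_const (t := t) (fun r ↦ by
      refine Set.OrdConnected.convex ⟨fun a ha b hb c hc ↦ ⟨ha.1.trans_le hc.1, fun e he ↦ ?_⟩⟩
      obtain ⟨u, hu, hu'⟩ := hb.2 e he
      exact ⟨u, hu.mono le_rfl hc.2, hu'⟩) (fun r ↦ by
      obtain ⟨R, -, h⟩ := P.exists_solver (|r| + 1) (by positivity)
      obtain ⟨τ, hτ, S, Ψ, -, -, hΨ⟩ := h 0 le_rfl
      refine ⟨τ, ?_⟩
      filter_upwards [ge_mem_nhds (show r < |r| + 1 by linarith [le_abs_self r])] with r' hr'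
      refine ⟨hτ, fun e he ↦ ⟨Ψ e, ?_, (hΨ.sol e (he.trans hr')).2⟩⟩
      exact (hΨ.sol e (he.trans hr')).1.mono (by linarith) le_rfl)
  exact ⟨T, T.continuous, fun r ↦ (hT r).1, fun r ↦ (hT r).2⟩

variable {P}

/-- The solutions for data near those of a given solution. -/
theorem exists_family {T : ℝ} {d : D} {u : Z} (hT : 0 < T) (hu : P.Sol 0 T u)
    (hd : P.ev 0 u = d) : ∃ G : D → Z, (∀ᶠ d' in nhds d, P.Sol 0 T (G d') ∧ P.ev 0 (G d') = d') ∧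
      ((fun d' ↦ G d' - G d) =O[nhds d] fun d' ↦ d' - d) ∧
      (ContDiff ℝ ∞ P.N → ContDiffAt ℝ ∞ G d) := by
  have hB : 0 ≤ P.evB := (norm_nonneg _).trans (P.ev_le 0)
  -- `evB * ‖u‖` bounds the data of u at every time, and the 1 leaves room for neighbouring data.
  -- Hence one solver, and one step h, serves along the whole solution.
  set ρ := P.evB * ‖u‖ + 1 with hρ
  have hevu : ∀ b, ‖P.ev b u‖ < ρ := fun b ↦
    lt_of_le_of_lt ((P.ev b).le_of_opNorm_le (P.ev_le b) u) (by rw [hρ]; linarith)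
  obtain ⟨R, -, h⟩ := P.exists_solver ρ (by positivity)
  obtain ⟨h, hh, S, Ψ, -, -, hΨ⟩ := h 0 le_rfl
  have hΨO : ∀ e, ‖e‖ < ρ → (fun e' ↦ Ψ e' - Ψ e) =O[nhds e] fun e' ↦ e' - e := by
    intro e he
    refine Asymptotics.IsBigO.of_bound (2 * ‖P.free‖) ?_
    filter_upwards [(continuous_norm.tendsto e).eventually (ge_mem_nhds he)] with e' he'
    exact hΨ.lip e' e he' he.le
  suffices hk : ∀ k : ℕ, ∀ a, 0 < a → a ≤ T → a ≤ (k + 1) * (h / 2) →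
      ∃ G : D → Z, (∀ᶠ d' in nhds d, P.Sol 0 a (G d') ∧ P.ev 0 (G d') = d') ∧
      ((fun d' ↦ G d' - G d) =O[nhds d] fun d' ↦ d' - d) ∧
      (ContDiff ℝ ∞ P.N → ContDiffAt ℝ ∞ G d) by
    obtain ⟨k, hk'⟩ := exists_nat_ge (T / (h / 2))
    refine hk k T hT le_rfl ?_
    rw [div_le_iff₀ (by positivity)] at hk'
    linarith
  have hd0 : ‖d‖ < ρ := by
    rw [← hd]
    exact hevu 0
  have base : ∀ a, a ≤ h →
      ∃ G : D → Z, (∀ᶠ d' in nhds d, P.Sol 0 a (G d') ∧ P.ev 0 (G d') = d') ∧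
      ((fun d' ↦ G d' - G d) =O[nhds d] fun d' ↦ d' - d) ∧
      (ContDiff ℝ ∞ P.N → ContDiffAt ℝ ∞ G d) := by
    refine fun a ha ↦ ⟨Ψ, ?_, hΨO d hd0, fun hN ↦ hΨ.smooth hN d hd0⟩
    filter_upwards [(continuous_norm.tendsto d).eventually (ge_mem_nhds hd0)] with e' he'
    exact ⟨(hΨ.sol e' he').1.mono (by linarith) ha, (hΨ.sol e' he').2⟩
  intro k
  induction k with
  | zero => exact fun a h0 haT ha ↦ base a (by norm_num at ha; linarith)
  | succ k ih =>
    intro a h0 haT ha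
    by_cases hah : a ≤ h
    · exact base a hah
    push Not at hah
    push_cast at ha
    obtain ⟨G, hG, hGO, hGs⟩ := ih (a - h / 2) (by linarith) (by linarith) (by linarith)
    -- The new piece starts half a step before the end of the old one. The cut-off falls from 1 to 0
    -- between b + h/8 and b + h/4, inside the overlap (b, b + h/2).
    set b := a - h with hb
    obtain ⟨M, hM1, hM2, hM3⟩ := P.cutoff (a := 0) (c₁ := b + h / 8) (c₂ := b + h / 4) (d := a)
      (by linarith) (by linarith) (by linarith)
    have hGt : Filter.Tendsto G (nhds d) (nhds (G d)) := by
      have h1 : Filter.Tendsto (fun d' : D ↦ d' - d) (nhds d) (nhds 0) := by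
        simpa using (continuous_sub_right d).tendsto d
      simpa using (hGO.trans_tendsto h1).add_const (G d)
    have hGd := hG.self_of_nhds
    -- `G d` may differ from u off the slab, but uniqueness gives it the data of u at time b, which
    -- lie in the range of the solver.
    have hevG : P.ev b (G d) = P.ev b u := by
      rw [← sub_eq_zero, ← map_sub]
      exact P.ev_van (by linarith) (sol_unique (by linarith) hGd.1 (hu.mono le_rfl (by linarith))
        (hGd.2.trans hd.symm)) (⟨by linarith, by linarith⟩ : b ∈ Set.Icc 0 (a - h / 2))
    have hevt : Filter.Tendsto (fun d' ↦ P.ev b (G d')) (nhds d) (nhds (P.ev b (G d))) :=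
      ((P.ev b).continuous.tendsto _).comp hGt
    have hevρ : ‖P.ev b (G d)‖ < ρ := hevG ▸ hevu b
    let W : D → Z := fun d' ↦ P.sh (-b) (Ψ (P.ev b (G d')))
    have hWO : (fun d' ↦ W d' - W d) =O[nhds d] fun d' ↦ d' - d := by
      have h1 : (fun d' ↦ Ψ (P.ev b (G d')) - Ψ (P.ev b (G d))) =O[nhds d]
          fun d' ↦ P.ev b (G d' - G d) := by
        simp only [map_sub]
        exact (hΨO _ hevρ).comp_tendsto hevt
      simp only [W, ← map_sub]
      exact ((P.sh (-b)).isBigO_comp _ _).trans (h1.trans (((P.ev b).isBigO_comp _ _).trans hGO))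
    -- This equals `G` before b + h/8 and `W` after b + h/4. In between `G` and `W` coincide by
    -- uniqueness, and M keeps the zeros of their difference, so cutting creates no error. As M is
    -- linear and bounded, the Lipschitz bound and smoothness carry over.
    refine ⟨fun d' ↦ W d' + M (G d' - W d'), ?_, ?_, fun hN ↦ ?_⟩
    · filter_upwards [hG, (hevt.norm).eventually (ge_mem_nhds hevρ)] with d' h1 h2
      have hs := hΨ.sol _ h2
      have hW1 : P.Sol b a (W d') := Sol.mono (P.sol_sh (-b) hs.1) (by linarith) (by linarith)
      have hW2 : P.ev b (W d') = P.ev b (G d') := by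
        rw [P.ev_sh, add_neg_cancel, hs.2]
      have hv : G d' - W d' ∈ P.van b (a - h / 2) :=
        sol_unique_from (by linarith) (h1.1.mono (by linarith) le_rfl)
          (hW1.mono le_rfl (by linarith)) hW2.symm
      have e1 : W d' + M (G d' - W d') - G d' = M (G d' - W d') - (G d' - W d') := by abel
      have hv1 : W d' + M (G d' - W d') - G d' ∈ P.van 0 (b + h / 8) := e1 ▸ hM1 _
      refine ⟨P.rel_union (b := b + h / 4) (c := a - h / 2) (by linarith) ?_ ?_, ?_⟩
      · refine Sol.congr h1.1 (P.van_union (b := b) (by linarith) hv1 ?_)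
        rw [e1]
        exact sub_mem (hM3 _ _ _ hv) hv
      · exact Sol.congr (hW1.mono (by linarith) le_rfl) (by
          rw [add_sub_cancel_left]
          exact hM2 _)
      · have := P.ev_van (t := 0) (by linarith) hv1 ⟨le_rfl, by linarith⟩
        rw [map_sub, sub_eq_zero] at this
        exact this.trans h1.2
    · have : (fun d' ↦ W d' + M (G d' - W d') - (W d + M (G d - W d))) = fun d' ↦
          (W d' - W d) + M ((G d' - G d) - (W d' - W d)) := by
        funext d'
        simp only [map_sub]
        abel
      rw [this]
      exact hWO.add ((M.isBigO_comp _ _).trans (hGO.sub hWO))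
    · have hWs : ContDiffAt ℝ ∞ W d := (P.sh (-b)).contDiff.contDiffAt.comp d
        ((hΨ.smooth hN _ hevρ).comp d ((P.ev b).contDiff.contDiffAt.comp d (hGs hN)))
      exact hWs.add (M.contDiff.contDiffAt.comp d ((hGs hN).sub hWs))

end WaveSys

/-! ### Componentwise operators on real vector-valued distributions -/

section Vector

variable {E E' : Type} [NormedAddCommGroup E] [InnerProductSpace ℝ E]
  [NormedAddCommGroup E'] [InnerProductSpace ℝ E'] {N : ℕ}

theorem RVec.ext_comp {B : DistSpace E} {u v : RVec B N} (h : ∀ i, comp u i = comp v i) :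
    u = v := Subtype.ext (funext fun i ↦ B.inj (h i))

theorem comp_sub {B : DistSpace E} (u v : RVec B N) (i : Fin N) :
    comp (u - v) i = comp u i - comp v i :=
  map_sub B.toDist (u.1 i) (v.1 i)

theorem norm_le_RVec {B : DistSpace E} (u : RVec B N) (i : Fin N) : ‖u.1 i‖ ≤ ‖u‖ :=
  norm_le_pi_norm (u.1 : Fin N → B.carrier) i

theorem norm_RVec_le {B : DistSpace E} {u : RVec B N} {r : ℝ} (hr : 0 ≤ r)
    (h : ∀ i, ‖u.1 i‖ ≤ r) : ‖u‖ ≤ r :=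
  (pi_norm_le_iff_of_nonneg hr).2 h

/-- The action on `ℝ^N`-valued distributions of an operator which preserves the real ones. -/
def liftR {A : DistSpace E} {B : DistSpace E'} (L : A.carrier →L[ℂ] B.carrier)
    (hL : ∀ u, IsRealValued (A.toDist u) → IsRealValued (B.toDist (L u))) :
    RVec A N →L[ℝ] RVec B N :=
  LinearMap.mkContinuous
    { toFun := fun u ↦ ⟨fun i ↦ L (u.1 i), fun i ↦ hL _ (u.2 i)⟩
      map_add' := fun u v ↦ Subtype.ext (funext fun i ↦ map_add L (u.1 i) (v.1 i))
      map_smul' := fun c u ↦ Subtype.ext (funext fun i ↦ map_smul L (c : ℂ) (u.1 i)) } ‖L‖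
    fun u ↦ norm_RVec_le (by positivity) fun i ↦
      (L.le_opNorm _).trans (mul_le_mul_of_nonneg_left (norm_le_RVec u i) (norm_nonneg _))

theorem comp_liftR {A : DistSpace E} {B : DistSpace E'} (L : A.carrier →L[ℂ] B.carrier)
    (hL : ∀ u, IsRealValued (A.toDist u) → IsRealValued (B.toDist (L u))) (u : RVec A N)
    (i : Fin N) : comp (liftR L hL u) i = B.toDist (L (u.1 i)) := rfl

theorem norm_liftR_le {A : DistSpace E} {B : DistSpace E'} (L : A.carrier →L[ℂ] B.carrier)
    (hL : ∀ u, IsRealValued (A.toDist u) → IsRealValued (B.toDist (L u))) :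
    ‖liftR (N := N) L hL‖ ≤ ‖L‖ :=
  LinearMap.mkContinuous_norm_le _ (norm_nonneg _) _

end Vector

/-! ### Reality, completeness, and the objects of the Cauchy problem -/

section Concrete

variable {n N : ℕ} {s ε : ℝ} {X : DistSpace (ST n)}

theorem IsRealValued.timeShift {u : 𝓢'(ST n, ℂ)} (hu : IsRealValued u) (k : ℝ) :
    IsRealValued (timeShift k u) := by
  intro φ hφ
  rw [timeShift_apply]
  exact hu _ fun x ↦ hφ _

theorem IsRealValued.timeMul {φ : ℝ → ℝ} (hφ : ContDiff ℝ ∞ φ) (hφc : HasCompactSupport φ)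
    {u : 𝓢'(ST n, ℂ)} (hu : IsRealValued u) : IsRealValued (timeMul φ u) := by
  intro ψ hψ
  rw [WaveLWP.timeMul, TemperedDistribution.smulLeftCLM_apply_apply]
  refine hu _ fun x ↦ ?_
  rw [SchwartzMap.smulLeftCLM_apply_apply (timeMul_temperate hφ hφc)]
  simp [hψ x]

theorem EqOnSlab.timeMul_zero {φ : ℝ → ℝ} (hφ : ContDiff ℝ ∞ φ) (hφc : HasCompactSupport φ)
    {u : 𝓢'(ST n, ℂ)} {a b : ℝ} (h : EqOnSlab a b u 0) : EqOnSlab a b (timeMul φ u) 0 := by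
  intro Φ hΦ hs
  rw [timeMul, TemperedDistribution.smulLeftCLM_apply_apply]
  have e : Function.support (SchwartzMap.smulLeftCLM ℂ (fun z : ST n ↦ (φ z.fst : ℂ)) Φ) ⊆
      Function.support Φ := by
    intro z hz hz0
    refine hz ?_
    rw [SchwartzMap.smulLeftCLM_apply_apply (timeMul_temperate hφ hφc), hz0, smul_zero]
  exact h _ (hΦ.mono e) ((closure_mono e).trans hs)

theorem continuous_toDist_H (r : ℝ) (φ : 𝓢(Sp n, ℂ)) :
    Continuous fun f : (H n r).carrier ↦ (H n r).toDist f φ :=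
  (PointwiseConvergenceCLM.evalCLM (RingHom.id ℂ) ℂ φ).continuous.comp
    ((LamS n (-r)).comp (Lp.toTemperedDistributionCLM ℂ (volume : Measure (Sp n)) 2)).continuous

theorem isClosed_isRealValued_H (r : ℝ) :
    IsClosed {f : (H n r).carrier | IsRealValued ((H n r).toDist f)} := by
  simp only [IsRealValued, Set.ofPred_forall]
  exact isClosed_iInter fun φ ↦ isClosed_iInter fun _ ↦
    isClosed_eq (Complex.continuous_im.comp (continuous_toDist_H r φ)) continuous_const

theorem IsPath.isRealValued {u : 𝓢'(ST n, ℂ)} {P : ℝ → 𝓢'(Sp n, ℂ)} (hP : IsPath u P)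
    (h : ∀ t, IsRealValued (P t)) : IsRealValued u := by
  intro φ hφ
  rw [(hP.2 φ).2]
  have := integral_im (hP.2 φ).1
  simp only [RCLike.im_to_complex] at this
  rw [← this]
  refine integral_eq_zero_of_ae (Filter.Eventually.of_forall fun t ↦ ?_)
  exact h t _ fun x ↦ hφ _

/-- The map `X.toDist` is merely linear, so reality is tested on the time slices, which depend
continuously on the element through the bounded evaluation maps. -/
theorem isClosed_isRealValued (hX : MainHyp s X) :
    IsClosed {u : X.carrier | IsRealValued (X.toDist u)} := by
  obtain ⟨C, h⟩ := exists_eval hX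
  obtain ⟨C', hU⟩ := exists_fibre hX
  choose ev evd h1 h2 h3 h4 using h
  have : {u : X.carrier | IsRealValued (X.toDist u)} =
      ⋂ t, ev t ⁻¹' {f | IsRealValued ((H n s).toDist f)} := by
    ext u
    simp only [Set.mem_ofPred_eq, Set.mem_iInter, Set.mem_preimage]
    constructor
    · intro hu t
      obtain ⟨P, hP, hPt⟩ := h3 t u
      obtain ⟨U, hm, hF, hw, -⟩ := hU u
      rw [← hPt]
      exact isRealValued_path hF hm (hw.trans_lt (ENNReal.mul_lt_top (by simp) (by simp))) hu hP t
    · intro hu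
      obtain ⟨P, hP, -⟩ := h3 0 u
      refine hP.isRealValued fun t ↦ ?_
      obtain ⟨Q, hQ, hQt⟩ := h3 t u
      rw [hP.unique hQ, hQt]
      exact hu t
  rw [this]
  exact isClosed_iInter fun t ↦ (isClosed_isRealValued_H s).preimage (ev t).continuous

theorem completeSpace_RVec (hX : MainHyp s X) : CompleteSpace (RVec X N) := by
  have hc : IsClosed (realSub X N : Set (Fin N → X.carrier)) := by
    have : (realSub X N : Set (Fin N → X.carrier)) =
        ⋂ i, (fun u ↦ u i) ⁻¹' {u : X.carrier | IsRealValued (X.toDist u)} := by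
      ext u
      simp only [Set.mem_iInter]
      exact Iff.rfl
    rw [this]
    exact isClosed_iInter fun i ↦ (isClosed_isRealValued hX).preimage (continuous_apply i)
  exact hc.completeSpace_coe

/-- The system `P` consists of the objects which define the Cauchy problem. -/
structure WaveSys.Represents (P : WaveSys (RVec X N) (RVec (Yspace X ε) N)
    (RVec (H n s) N × RVec (H n (s - 1)) N)) (Nl : RVec X N → RVec (Yspace X ε) N) : Prop where
  N_eq : P.N = Nl
  van_iff : ∀ {a b u}, u ∈ P.van a b ↔ ∀ i, EqOnSlab a b (comp u i) 0
  rel_iff : ∀ {a b u F}, (u, F) ∈ P.rel a b ↔ ∀ i, EqOnSlab a b (box (comp u i)) (comp F i)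
  ev_fst : ∀ t u i, ∃ Q, IsPath (comp u i) Q ∧ Q t = comp (P.ev t u).1 i
  ev_snd : ∀ t u i, ∃ Q, IsPath (dt (comp u i)) Q ∧ Q t = comp (P.ev t u).2 i
  free_lam : ∀ (α : ℝ) d d', (∀ i, comp d'.1 i = LamS n α (comp d.1 i)) →
    (∀ i, comp d'.2 i = LamS n α (comp d.2 i)) →
      ∀ i, comp (P.free d') i = Lam n α (comp (P.free d) i)
  spec_lam : ∀ S, P.spec S → ∀ (α : ℝ) G G', (∀ i, comp G' i = Lam n α (comp G i)) →
    ∀ i, comp (S G') i = Lam n α (comp (S G) i)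

/-- The elements of `RVec X N` which vanish on a slab. -/
def slabSub (X : DistSpace (ST n)) (N : ℕ) (a b : ℝ) : Submodule ℝ (RVec X N) where
  carrier := {u | ∀ i, EqOnSlab a b (comp u i) 0}
  add_mem' := fun {u v} hu hv i ↦ by
    rw [comp_add]
    simpa using (hu i).add (hv i)
  zero_mem' := fun i ↦ by
    rw [comp_zero]
    exact EqOnSlab.refl _ _ _
  smul_mem' := fun c u hu i φ h1 h2 ↦ by
    rw [comp_smul]
    have := hu i φ h1 h2
    simp only [_root_.smul_apply, this]
    simp

/-- The pairs `(u, F)` with `□u = F` on a slab. -/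
def boxSub (X Y : DistSpace (ST n)) (N : ℕ) (a b : ℝ) : Submodule ℝ (RVec X N × RVec Y N) where
  carrier := {p | ∀ i, EqOnSlab a b (box (comp p.1 i)) (comp p.2 i)}
  add_mem' := fun {u v} hu hv i ↦ by
    rw [Prod.fst_add, Prod.snd_add, comp_add, comp_add, box_add]
    exact (hu i).add (hv i)
  zero_mem' := fun i ↦ by
    rw [Prod.fst_zero, Prod.snd_zero, comp_zero, comp_zero]
    have := box_sub (0 : 𝓢'(ST n, ℂ)) 0
    rw [sub_self, sub_self] at this
    rw [this]
    exact EqOnSlab.refl _ _ _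
  smul_mem' := fun c u hu i φ h1 h2 ↦ by
    rw [Prod.smul_fst, Prod.smul_snd, comp_smul, comp_smul, box_smul]
    have := hu i φ h1 h2
    simp only [_root_.smul_apply, this]

theorem exists_timeMul (hcut : CutoffInvariant X) {φ : ℝ → ℝ} (hφ : ContDiff ℝ ∞ φ)
    (hφc : HasCompactSupport φ) : ∃ M : X.carrier →L[ℂ] X.carrier,
      ∀ u, X.toDist (M u) = timeMul φ (X.toDist u) := by
  obtain ⟨C, hC⟩ := hcut φ hφ hφc
  suffices h : ∃ M : X.carrier →L[ℂ] X.carrier,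
      (∀ u, X.toDist (M u) = timeMul φ (X.toDist u)) ∧ ‖M‖ ≤ |C| from ⟨_, h.choose_spec.1⟩
  refine exists_clm_of_rel (P := fun u d ↦ d = timeMul φ (X.toDist u)) (abs_nonneg C)
    (fun u ↦ ?_) (fun v d d' h h' ↦ h.trans h'.symm) (fun v v' d d' h h' ↦ ?_) fun c v d h ↦ ?_
  · obtain ⟨v, hv, hvn⟩ := hC u
    exact ⟨v, hv, hvn.trans (by gcongr; exact le_abs_self C)⟩
  · rw [h, h', map_add, map_add]
  · rw [h, map_smul, map_smul]

end Concrete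

/-! ### The wave equation as an instance of the abstract problem -/

section Concrete

variable {n N : ℕ} {s ε : ℝ} {X : DistSpace (ST n)}

/-- The data of `u` at time `t`. -/
structure IsEval (s : ℝ) (X : DistSpace (ST n)) (N : ℕ) (t : ℝ)
    (ev : RVec X N →L[ℝ] RVec (H n s) N × RVec (H n (s - 1)) N) : Prop where
  fst : ∀ u i, ∃ Q, IsPath (comp u i) Q ∧ Q t = comp (ev u).1 i
  snd : ∀ u i, ∃ Q, IsPath (dt (comp u i)) Q ∧ Q t = comp (ev u).2 i

theorem exists_isEval (hX : MainHyp s X) (N : ℕ) : ∃ C : ℝ, ∀ t,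
    ∃ ev : RVec X N →L[ℝ] RVec (H n s) N × RVec (H n (s - 1)) N, ‖ev‖ ≤ C ∧ IsEval s X N t ev := by
  obtain ⟨C, h⟩ := exists_eval hX
  obtain ⟨C', hU⟩ := exists_fibre hX
  refine ⟨C, fun t ↦ ?_⟩
  obtain ⟨ev, evd, h1, h2, h3, h4⟩ := h t
  have r1 : ∀ u, IsRealValued (X.toDist u) → IsRealValued ((H n s).toDist (ev u)) := by
    intro u hu
    obtain ⟨P, hP, hPt⟩ := h3 u
    obtain ⟨U, hm, hF, hw, -⟩ := hU u
    rw [← hPt]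
    exact isRealValued_path hF hm (hw.trans_lt (ENNReal.mul_lt_top (by simp) (by simp))) hu hP t
  have r2 : ∀ u, IsRealValued (X.toDist u) → IsRealValued ((H n (s - 1)).toDist (evd u)) := by
    intro u hu
    obtain ⟨P, hP, hPt⟩ := h4 u
    obtain ⟨U, hm, hF, -, hw⟩ := hU u
    rw [← hPt]
    exact isRealValued_path hF.dt (measurable_dtFun hm)
      (hw.trans_lt (ENNReal.mul_lt_top (by simp) (by simp))) (isRealValued_dt hF hu) hP t
  refine ⟨(liftR ev r1).prod (liftR evd r2), ?_, fun u i ↦ h3 (u.1 i), fun u i ↦ h4 (u.1 i)⟩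
  rw [ContinuousLinearMap.opNorm_prod]
  exact max_le ((norm_liftR_le ev r1).trans h1) ((norm_liftR_le evd r2).trans h2)

theorem IsEval.eq_iff {t : ℝ} {ev : RVec X N →L[ℝ] RVec (H n s) N × RVec (H n (s - 1)) N}
    (h : IsEval s X N t ev) {u : RVec X N} {f : RVec (H n s) N} {g : RVec (H n (s - 1)) N} :
    ev u = (f, g) ↔ ∀ i, (∃ U, IsPath (comp u i) U ∧ U t = comp f i) ∧
      ∃ V, IsPath (dt (comp u i)) V ∧ V t = comp g i := by
  constructor
  · intro e i
    have h1 := h.fst u i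
    have h2 := h.snd u i
    rw [e] at h1 h2
    exact ⟨h1, h2⟩
  · intro e
    refine Prod.ext (RVec.ext_comp fun i ↦ ?_) (RVec.ext_comp fun i ↦ ?_)
    · obtain ⟨Q, hQ, hQt⟩ := h.fst u i
      obtain ⟨⟨U, hU, hUt⟩, -⟩ := e i
      rw [← hQt, ← hUt, hQ.unique hU]
    · obtain ⟨Q, hQ, hQt⟩ := h.snd u i
      obtain ⟨-, U, hU, hUt⟩ := e i
      rw [← hQt, ← hUt, hQ.unique hU]

theorem mem_slabSub_iff {ev : ℝ → RVec X N →L[ℝ] RVec (H n s) N × RVec (H n (s - 1)) N}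
    (h : ∀ t, IsEval s X N t (ev t)) {a b : ℝ} (hab : a < b) {u : RVec X N} :
    u ∈ slabSub X N a b ↔ ∀ t ∈ Set.Icc a b, (ev t u).1 = 0 := by
  constructor
  · intro hu t ht
    refine RVec.ext_comp fun i ↦ ?_
    obtain ⟨Q, hQ, hQt⟩ := (h t).fst u i
    rw [comp_zero, ← hQt, hQ.eq_zero_of_eqOnSlab hab (hu i) ht]
  · intro hu i
    obtain ⟨Q, hQ, -⟩ := (h 0).fst u i
    refine hQ.eqOnSlab IsPath.zero fun t ht ↦ ?_
    obtain ⟨Q', hQ', hQt⟩ := (h t).fst u i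
    rw [hQ.unique hQ', hQt, hu t (Set.Ioo_subset_Icc_self ht), comp_zero]
    rfl

/-- Paths are continuous, so vanishing on the open slab and on the closed interval agree; for T = 0
the open slab would be empty and say nothing about u(0). -/
theorem vanishSub_eq (hX : MainHyp s X) {T : ℝ} (hT : 0 < T) :
    vanishSub X N T = slabSub X N 0 T := by
  obtain ⟨C, h⟩ := exists_isEval hX N
  choose ev _ hev using h
  ext u
  constructor
  · intro hu i
    obtain ⟨U, hU, hU0⟩ := hu i
    exact hU.eqOnSlab IsPath.zero fun t ht ↦ hU0 t (Set.Ioo_subset_Icc_self ht)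
  · intro hu i
    obtain ⟨Q, hQ, -⟩ := (hev 0).fst u i
    exact ⟨Q, hQ, fun t ht ↦ hQ.eq_zero_of_eqOnSlab hT (hu i) ht⟩

theorem isClosed_slabSub (hX : MainHyp s X) {a b : ℝ} (hab : a < b) :
    IsClosed (slabSub X N a b : Set (RVec X N)) := by
  obtain ⟨C, h⟩ := exists_isEval hX N
  choose ev _ hev using h
  have : (slabSub X N a b : Set (RVec X N)) = ⋂ t ∈ Set.Icc a b, {u | (ev t u).1 = 0} := by
    ext u
    simp only [SetLike.mem_coe, mem_slabSub_iff hev hab, Set.mem_iInter]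
    rfl
  rw [this]
  exact isClosed_biInter fun t _ ↦ isClosed_eq (ev t).continuous.fst continuous_const

theorem exists_liftFree (hX : MainHyp s X) (N : ℕ) :
    ∃ W : RVec (H n s) N × RVec (H n (s - 1)) N →L[ℝ] RVec X N,
      (∀ d i, HasData (comp (W d) i) (comp d.1 i) (comp d.2 i)) ∧
      (∀ d i, EqOnSlab (-1) 1 (box (comp (W d) i)) 0) ∧
      ∀ (α : ℝ) d d', (∀ i, comp d'.1 i = LamS n α (comp d.1 i)) →
        (∀ i, comp d'.2 i = LamS n α (comp d.2 i)) →
          ∀ i, comp (W d') i = Lam n α (comp (W d) i) := by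
  obtain ⟨W, hW⟩ := exists_isFree hX
  have z : ∀ r, IsRealValued ((H n r).toDist 0) := fun r φ _ ↦ by simp
  let W₁ : RVec (H n s) N →L[ℝ] RVec X N :=
    liftR (W.comp (ContinuousLinearMap.inl ℂ _ _)) fun f hf ↦ hW.real f 0 hf (z _)
  let W₂ : RVec (H n (s - 1)) N →L[ℝ] RVec X N :=
    liftR (W.comp (ContinuousLinearMap.inr ℂ _ _)) fun g hg ↦ hW.real 0 g (z _) hg
  have e : ∀ d i, comp (W₁.coprod W₂ d) i = X.toDist (W (d.1.1 i, d.2.1 i)) := by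
    intro d i
    have h1 : comp (W₁ d.1) i = X.toDist (W (d.1.1 i, 0)) := comp_liftR _ _ _ _
    have h2 : comp (W₂ d.2) i = X.toDist (W (0, d.2.1 i)) := comp_liftR _ _ _ _
    rw [ContinuousLinearMap.coprod_apply, comp_add, h1, h2, ← map_add, ← map_add, Prod.mk_add_mk,
      add_zero, zero_add]
  refine ⟨W₁.coprod W₂, fun d i ↦ ?_, fun d i ↦ ?_, fun α d d' h h' i ↦ ?_⟩
  · rw [e]
    exact hW.data _ _
  · rw [e]
    exact hW.wave _
  · rw [e, e]
    exact hW.lam α _ _ _ _ (h i) (h' i)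

/-- The abstract property `spec` is instantiated by commutation with every Λ^α, which the fixed
point argument merely transports and persistence of regularity uses. -/
theorem exists_waveSys (hX : MainHyp s X) (hε : 0 < ε) (hcut : CutoffInvariant X)
    {Nl : RVec X N → RVec (Yspace X ε) N} (hNshift : CommutesWithTimeShift Nl)
    (hNloc : LocalInTime Nl) (hN0 : Nl 0 = 0) (hNlip : LipschitzOnBalls Nl) :
    ∃ P : WaveSys (RVec X N) (RVec (Yspace X ε) N) (RVec (H n s) N × RVec (H n (s - 1)) N),
      P.Represents Nl := by
  obtain ⟨C, hev'⟩ := exists_isEval hX N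
  choose ev hevC hev using hev'
  obtain ⟨W, hW, hWbox, hWlam⟩ := exists_liftFree hX N
  choose sh' hsh' hshn using exists_timeShift hX
  obtain ⟨C', hfib⟩ := exists_fibre hX
  let sh : ℝ → RVec X N →L[ℝ] RVec X N := fun k ↦ liftR (sh' k) fun u hu ↦ by
    rw [hsh']
    exact hu.timeShift k
  have hsh : ∀ k u i, comp (sh k u) i = timeShift k (comp u i) := fun k u i ↦ hsh' k (u.1 i)
  let P : WaveSys (RVec X N) (RVec (Yspace X ε) N) (RVec (H n s) N × RVec (H n (s - 1)) N) :=
  { N := Nl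
    van := slabSub X N
    rel := boxSub X (Yspace X ε) N
    ev := ev
    evB := C
    sh := sh
    free := W
    spec := fun S ↦ ∀ (α : ℝ) G G', (∀ i, comp G' i = Lam n α (comp G i)) →
      ∀ i, comp (S G') i = Lam n α (comp (S G) i)
    ev_le := hevC
    van_closed := fun T hT ↦ isClosed_slabSub hX hT
    rel_mono := fun ha hb u hu i ↦ (hu i).mono ha hb
    van_union := fun hbc h h' i ↦ (h i).union (h' i) hbc
    rel_union := fun hbc h h' i ↦ (h i).union (h' i) hbc
    ev_van := by
      intro a b t u hab hu ht
      refine ((hev t).eq_iff (f := 0) (g := 0)).2 fun i ↦ ?_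
      obtain ⟨Q, hQ, -⟩ := (hev 0).fst u i
      obtain ⟨Q', hQ', -⟩ := (hev 0).snd u i
      refine ⟨⟨Q, hQ, ?_⟩, Q', hQ', ?_⟩
      · rw [comp_zero, hQ.eq_zero_of_eqOnSlab hab (hu i) ht]
      · have h0 := (hu i).dt
        have : dt (0 : 𝓢'(ST n, ℂ)) = 0 := by
          have := dt_sub (0 : 𝓢'(ST n, ℂ)) 0
          rwa [sub_self, sub_self] at this
        rw [this] at h0
        rw [comp_zero, hQ'.eq_zero_of_eqOnSlab hab h0 ht]
    van_rel := by
      intro a b u hu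
      have := fun i ↦ (hu i).box
      have h0 := box_sub (0 : 𝓢'(ST n, ℂ)) 0
      rw [sub_self, sub_self] at h0
      intro i
      simp only [comp_zero]
      exact h0 ▸ this i
    N_local := by
      intro a b u u' h i
      have h1 := hNloc a b u u' (fun i ↦ by
        have := (h i).add (EqOnSlab.refl a b (comp u' i))
        rwa [comp_sub, sub_add_cancel, zero_add] at this) i
      have h0 := box_sub (0 : 𝓢'(ST n, ℂ)) 0
      rw [sub_self, sub_self] at h0
      simp only [comp_zero, comp_sub, h0]
      have := h1.symm.sub (EqOnSlab.refl a b (comp (Nl u') i))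
      rw [sub_self] at this
      exact this
    ev_sh := by
      intro t k u
      refine ((hev t).eq_iff (f := (ev (t + k) u).1) (g := (ev (t + k) u).2)).2 fun i ↦ ?_
      obtain ⟨Q, hQ, hQt⟩ := (hev (t + k)).fst u i
      obtain ⟨Q', hQ', hQt'⟩ := (hev (t + k)).snd u i
      rw [hsh, timeShift_dt]
      exact ⟨⟨_, hQ.timeShift k, hQt⟩, _, hQ'.timeShift k, hQt'⟩
    van_sh := by
      intro a b k u hu i
      rw [hsh, ← map_zero (timeShift k)]
      exact (hu i).timeShift k
    sh_sh := by
      intro k u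
      refine RVec.ext_comp fun i ↦ ?_
      rw [hsh, hsh, timeShift_timeShift, neg_add_cancel, timeShift_zero]
    sh_norm := by
      intro k u
      have := (sh k).le_of_opNorm_le ((norm_liftR_le _ _).trans (hshn k)) u
      rwa [one_mul] at this
    sol_sh := by
      intro a b u k h i
      have h1 := (h i).timeShift k
      rw [← timeShift_box, ← hsh] at h1
      have h2 := hNshift k u (sh k u) (fun i ↦ hsh k u i) i
      simp only [h2]
      exact h1
    free_ev := fun d ↦ ((hev 0).eq_iff (f := d.1) (g := d.2)).2 fun i ↦ hW d i
    free_rel := fun d i ↦ by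
      simp only [comp_zero]
      exact hWbox d i
    duhamel := by
      intro η hη
      obtain ⟨T, hT, hT1, S, hS, h⟩ := exists_isDuhamel hX hε hη
      let S' : RVec (Yspace X ε) N →L[ℝ] RVec X N := liftR (A := Yspace X ε) (B := X) S h.real
      refine ⟨T, hT, hT1, S', (norm_liftR_le (A := Yspace X ε) (B := X) S h.real).trans hS,
        fun α G G' hG i ↦ h.lam α (G.1 i) (G'.1 i) (hG i), fun F ↦ ⟨?_, fun i ↦ h.wave (F.1 i)⟩⟩
      refine ((hev 0).eq_iff (f := 0) (g := 0)).2 fun i ↦ ?_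
      rw [comp_zero, comp_zero]
      exact h.data (F.1 i)
    unique := by
      intro T u hT hu h0 i
      have hd := ((hev 0).eq_iff (f := 0) (g := 0)).1 h0 i
      rw [comp_zero, comp_zero] at hd
      obtain ⟨U, hm, hF, hw, hw'⟩ := hfib (u.1 i)
      obtain ⟨Q, hQ, -⟩ := (hev 0).fst u i
      have hb := hu i
      simp only [comp_zero] at hb
      exact hQ.eqOnSlab IsPath.zero fun t ht ↦ wave_unique hF hm
        (hw.trans_lt (ENNReal.mul_lt_top (by simp) (by simp)))
        (hw'.trans_lt (ENNReal.mul_lt_top (by simp) (by simp))) hb hd hQ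
        (Set.Ioo_subset_Icc_self ht)
    cutoff := by
      intro a c₁ c₂ d h1 h2 h3
      -- The cut-off is 1 on [a, c₁] and supported before c₂; its shape to the left of a is
      -- immaterial.
      obtain ⟨φ, hφ, hφc, hφ1, hφs⟩ := exists_cutoff (a := a - 1) (b := a) (c := c₁) (d := c₂)
        (by linarith) h1 h2
      obtain ⟨M, hM⟩ := exists_timeMul hcut hφ hφc
      have hr : ∀ u, IsRealValued (X.toDist u) → IsRealValued (X.toDist (M u)) := by
        intro u hu
        rw [hM]
        exact hu.timeMul hφ hφc
      have hMc : ∀ (u : RVec X N) i, comp (liftR M hr u) i = timeMul φ (comp u i) :=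
        fun u i ↦ hM (u.1 i)
      refine ⟨liftR M hr, fun u i ↦ ?_, fun u i ↦ ?_, fun u b c hu i ↦ ?_⟩
      · have := (eqOnSlab_timeMul hφ hφc (c := 1)
          (fun t ht ↦ hφ1 t (Set.Ioo_subset_Icc_self ht)) (comp u i)).sub
            (EqOnSlab.refl a c₁ (comp u i))
        rw [Complex.ofReal_one, one_smul, sub_self] at this
        rwa [comp_sub, hMc]
      · have := eqOnSlab_timeMul hφ hφc (c := 0) (a := c₂) (b := d)
          (fun t ht ↦ image_eq_zero_of_notMem_tsupport fun h ↦ absurd (hφs h).2 (by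
            simpa using ht.1.le)) (comp u i)
        have e : ((0 : ℝ) : ℂ) • comp u i = 0 := by
          ext ψ
          simp
        rw [e] at this
        rwa [hMc]
      · rw [hMc]
        exact (hu i).timeMul_zero hφ hφc
    N_zero := hN0
    N_lip := hNlip }
  exact ⟨P, rfl, Iff.rfl, Iff.rfl, fun t ↦ (hev t).fst, fun t ↦ (hev t).snd, hWlam,
    fun S hS ↦ hS⟩

end Concrete

/-! ### Bounds in the stronger norm that survive limits in the weaker one -/

section Regularity

variable {n N : ℕ} {s ε σ : ℝ} {X : DistSpace (ST n)}

theorem wnorm_indicator (r : ℝ) (b : Sp n → ℝ≥0∞) {A : Set (Sp n)} (hA : MeasurableSet A) :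
    wnorm r (A.indicator b) =
      (∫⁻ ξ in A, (ENNReal.ofReal (symS r ξ) * b ξ) ^ (2 : ℝ)) ^ (1 / 2 : ℝ) := by
  rw [wnorm, ← lintegral_indicator hA]
  congr 2
  funext ξ
  by_cases h : ξ ∈ A <;> simp [h]

/-- A weak limit of functions bounded in the `σ`-norm is bounded in the `σ`-norm. -/
theorem wnorm_le_of_approx {b : Sp n → ℝ≥0∞} (hb : Measurable b) {B : ℝ≥0∞}
    (h : ∀ η : ℝ≥0, 0 < η → ∃ b₁ b₂ : Sp n → ℝ≥0∞, Measurable b₁ ∧ Measurable b₂ ∧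
      (∀ ξ, b ξ ≤ b₁ ξ + b₂ ξ) ∧ wnorm σ b₁ ≤ B ∧ wnorm s b₂ ≤ η) : wnorm σ b ≤ B := by
  have hA : ∀ j : ℕ, MeasurableSet (Metric.closedBall (0 : Sp n) j) :=
    fun j ↦ Metric.isClosed_closedBall.measurableSet
  -- On a ball of frequencies the σ-norm is at most a constant times the s-norm, so the error `b₂`
  -- can be made negligible. Exhausting by balls then gives the bound everywhere.
  have key : ∀ j : ℕ, wnorm σ ((Metric.closedBall (0 : Sp n) j).indicator b) ≤ B := by
    intro j
    obtain ⟨c, hc⟩ := (isCompact_closedBall (0 : Sp n) j).exists_bound_of_continuousOn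
      (continuous_symS (n := n) (σ - s)).continuousOn
    have hc' : ∀ ξ ∈ Metric.closedBall (0 : Sp n) j,
        ENNReal.ofReal (symS (σ - s) ξ) ≤ c.toNNReal := fun ξ hξ ↦
      ENNReal.ofReal_le_ofReal ((le_abs_self _).trans (hc ξ hξ))
    refine ENNReal.le_of_forall_pos_le_add fun η hη _ ↦ ?_
    obtain ⟨b₁, b₂, h₁, h₂, h12, hb₁, hb₂⟩ := h (η / (c.toNNReal + 1)) (by positivity)
    calc wnorm σ ((Metric.closedBall (0 : Sp n) j).indicator b)
        ≤ wnorm σ (fun ξ ↦ b₁ ξ + (Metric.closedBall (0 : Sp n) j).indicator b₂ ξ) := by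
          refine wnorm_mono (Filter.Eventually.of_forall fun ξ ↦ ?_)
          by_cases hξ : ξ ∈ Metric.closedBall (0 : Sp n) j
          · simpa only [Set.indicator_of_mem hξ] using h12 ξ
          · simp only [Set.indicator_of_notMem hξ, zero_le]
      _ ≤ wnorm σ b₁ + wnorm σ ((Metric.closedBall (0 : Sp n) j).indicator b₂) :=
          wnorm_add_le h₁.aemeasurable (h₂.indicator (hA j)).aemeasurable
      _ ≤ B + c.toNNReal * wnorm s b₂ := by
          refine add_le_add hb₁ ?_
          rw [show σ = s + (σ - s) by ring, ← wnorm_symS, ← wnorm_const_mul _ ENNReal.coe_ne_top]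
          refine wnorm_mono (Filter.Eventually.of_forall fun ξ ↦ ?_)
          by_cases hξ : ξ ∈ Metric.closedBall (0 : Sp n) j
          · rw [Set.indicator_of_mem hξ]
            gcongr
            exact hc' ξ hξ
          · simp only [Set.indicator_of_notMem hξ, mul_zero, zero_le]
      _ ≤ B + η := by
          gcongr
          refine (mul_le_mul_right hb₂ _).trans ?_
          rw [← ENNReal.coe_mul, ENNReal.coe_le_coe, mul_div_left_comm]
          exact mul_le_of_le_one_right (zero_le) (div_le_one_of_le₀ (by simp) (zero_le))
  have hm : AEMeasurable fun ξ : Sp n ↦ (ENNReal.ofReal (symS σ ξ) * b ξ) ^ (2 : ℝ) :=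
    (((continuous_symS σ).measurable.ennreal_ofReal.mul hb).pow_const _).aemeasurable
  have hlim := (aecover_closedBall (μ := (volume : Measure (Sp n))) (x := 0)
    tendsto_natCast_atTop_atTop).lintegral_tendsto_of_nat hm
  refine le_of_tendsto ((ENNReal.continuous_rpow_const (y := 1 / 2)).continuousAt.tendsto.comp
    hlim) (Filter.Eventually.of_forall fun j ↦ ?_)
  rw [Function.comp_apply, ← wnorm_indicator σ b (hA j)]
  exact key j

theorem isRealValued_mult {E : Type} [NormedAddCommGroup E] [InnerProductSpace ℝ E]
    [FiniteDimensional ℝ E] [MeasurableSpace E] [BorelSpace E] {u : 𝓢'(E, ℂ)} {U : E → ℂ}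
    (hU : HasFourierFun u U) (hu : IsRealValued u) {m : E → ℝ} (hm : m.HasTemperateGrowth)
    (hm' : ∀ z, m (-z) = m z) : IsRealValued (mult m u) := by
  refine (hU.mult hm).isRealValued ?_
  filter_upwards [hU.neg_ae_eq_conj hu] with z hz
  rw [hz, hm', map_mul, Complex.conj_ofReal]

theorem exists_lam_H {r α : ℝ} {v : 𝓢'(Sp n, ℂ)}
    (h : ∃ w : (H n (r + α)).carrier, (H n (r + α)).toDist w = v) (hv : IsRealValued v) :
    ∃ w : (H n r).carrier, (H n r).toDist w = LamS n α v ∧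
      IsRealValued ((H n r).toDist w) := by
  obtain ⟨w, rfl⟩ := h
  obtain ⟨V, -, hV⟩ := exists_hasFourierFun_H w
  obtain ⟨w', hw'⟩ := exists_H (s := r) (hV.mult (symS_temperate α)) (by
    have e : (fun ξ ↦ ‖((symS α ξ : ℝ) : ℂ) * V ξ‖ₑ) =
        fun ξ ↦ ENNReal.ofReal (symS α ξ) * ‖V ξ‖ₑ := by
      funext ξ
      rw [enorm_mul, ← ofReal_norm ((_ : ℝ) : ℂ), Complex.norm_real,
        Real.norm_of_nonneg (symS_pos _ _).le]
    rw [e, wnorm_symS, ← enorm_H hV]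
    exact enorm_lt_top)
  refine ⟨w', hw', ?_⟩
  rw [hw']
  exact isRealValued_mult hV hv (symS_temperate α) (symS_neg_arg α)

theorem fibMass_symX (α : ℝ) (U : ST n → ℂ) :
    fibMass (fun z ↦ (symX α z : ℂ) * U z) =
      fun ξ ↦ ENNReal.ofReal (symS α ξ) * fibMass U ξ := by
  funext ξ
  rw [fibMass, fibMass, ← lintegral_const_mul' _ _ ENNReal.ofReal_ne_top]
  refine lintegral_congr fun τ ↦ ?_
  rw [enorm_mul, ← ofReal_norm ((_ : ℝ) : ℂ), Complex.norm_real, symX_pt,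
    Real.norm_of_nonneg (symS_pos _ _).le]

theorem fibMass_le_add {U V : ST n → ℂ} (hV : Measurable V) (ξ : Sp n) :
    fibMass U ξ ≤ fibMass V ξ + fibMass (U - V) ξ := by
  have : Measurable fun τ : ℝ ↦ ‖V (pt τ ξ)‖ₑ :=
    (hV.comp (continuous_pt_left ξ).measurable).enorm
  rw [fibMass, fibMass, fibMass, ← lintegral_add_left this]
  refine lintegral_mono fun τ ↦ ?_
  have := enorm_add_le (V (pt τ ξ)) ((U - V) (pt τ ξ))
  simpa using this

/-- If `u` is a limit of elements `v` of `X` for which `Λ^{σ-s} v` is bounded in `X`, then `u` has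
the regularity of the elements of `Λ^{s-σ} X`. -/
theorem exists_regular_of_approx (hX : MainHyp s X) {u : X.carrier} {B : ℝ≥0}
    (h : ∀ η : ℝ≥0, 0 < η → ∃ v w : X.carrier, X.toDist w = Lam n (σ - s) (X.toDist v) ∧
      ‖w‖ₑ ≤ B ∧ ‖u - v‖ₑ ≤ η) :
    ∃ U : ST n → ℂ, Measurable U ∧ HasFourierFun (X.toDist u) U ∧
      wnorm σ (fibMass U) < ⊤ ∧ wnorm (σ - 1) (fibMass (dtFun U)) < ⊤ := by
  obtain ⟨C', hfib⟩ := exists_fibre hX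
  obtain ⟨C, hC⟩ := exists_fibre_rep hX
  obtain ⟨U, hm, hU, -⟩ := hfib u
  -- The bound on w = Λ^{σ-s}v in 𝒳^s is a bound on the fibre masses of v in the σ-norm, while u - v
  -- is small in the s-norm only.
  have key : ∀ η : ℝ≥0, 0 < η → ∃ V : ST n → ℂ, Measurable V ∧
      wnorm σ (fibMass V) ≤ C * B ∧ wnorm (σ - 1) (fibMass (dtFun V)) ≤ C * B ∧
      wnorm s (fibMass (U - V)) ≤ η ∧ wnorm (s - 1) (fibMass (dtFun U - dtFun V)) ≤ η := by
    intro η hη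
    obtain ⟨v, w, hw, hwB, hv⟩ := h (η / (C + 1)) (by positivity)
    obtain ⟨V, hVm, hV, -⟩ := hfib v
    have hW := hV.mult (symX_temperate (σ - s))
    change HasFourierFun (Lam n (σ - s) (X.toDist v)) _ at hW
    rw [← hw] at hW
    obtain ⟨h1, h2⟩ := hC w _ hW
    obtain ⟨h3, h4⟩ := hC (u - v) (U - V) (by
      rw [map_sub]
      exact hU.sub hV)
    have e1 : dtFun (fun z ↦ (symX (σ - s) z : ℂ) * V z) =
        fun z ↦ (symX (σ - s) z : ℂ) * dtFun V z := by
      funext z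
      simp only [dtFun]
      ring
    have e2 : dtFun (U - V) = dtFun U - dtFun V := by
      funext z
      simp only [dtFun, Pi.sub_apply]
      ring
    rw [fibMass_symX, wnorm_symS, add_sub_cancel] at h1
    rw [e1, fibMass_symX, wnorm_symS, show s - 1 + (σ - s) = σ - 1 by ring] at h2
    rw [e2] at h4
    have hle : (C : ℝ≥0∞) * ‖u - v‖ₑ ≤ η := by
      refine (mul_le_mul_right hv _).trans ?_
      rw [← ENNReal.coe_mul, ENNReal.coe_le_coe, mul_div_left_comm]
      exact mul_le_of_le_one_right (zero_le) (div_le_one_of_le₀ (by simp) (zero_le))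
    have hB : (C : ℝ≥0∞) * ‖w‖ₑ ≤ C * B := by gcongr
    exact ⟨V, hVm, h1.trans hB, h2.trans hB, h3.trans hle, h4.trans hle⟩
  refine ⟨U, hm, hU, ?_, ?_⟩
  · refine lt_of_le_of_lt (wnorm_le_of_approx (s := s) (measurable_fibMass hm) fun η hη ↦ ?_)
      (ENNReal.mul_lt_top ENNReal.coe_lt_top ENNReal.coe_lt_top : (C : ℝ≥0∞) * B < ⊤)
    obtain ⟨V, hVm, h1, -, h3, -⟩ := key η hη
    exact ⟨_, _, measurable_fibMass hVm, measurable_fibMass (hm.sub hVm), fibMass_le_add hVm,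
      h1, h3⟩
  · refine lt_of_le_of_lt (wnorm_le_of_approx (s := s - 1)
      (measurable_fibMass (measurable_dtFun hm)) fun η hη ↦ ?_)
      (ENNReal.mul_lt_top ENNReal.coe_lt_top ENNReal.coe_lt_top : (C : ℝ≥0∞) * B < ⊤)
    obtain ⟨V, hVm, -, h2, -, h4⟩ := key η hη
    exact ⟨_, _, measurable_fibMass (measurable_dtFun hVm),
      measurable_fibMass ((measurable_dtFun hm).sub (measurable_dtFun hVm)),
      fibMass_le_add (measurable_dtFun hVm), h2, h4⟩

theorem lam_lam (α : ℝ) (u : 𝓢'(ST n, ℂ)) : Lam n (-α) (Lam n α u) = u :=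
  mult_mult (symX_temperate _) (symX_temperate _) (symX_neg α) u

/-- `B` and `shift B (-α)` have the same carrier, so `v`, read in the shifted space, is the required
element and its norm does not change. -/
theorem exists_shift {B : DistSpace (ST n)} {α : ℝ} {u v : RVec B N}
    (h : ∀ i, comp v i = Lam n α (comp u i)) : ∃ u' : RVec (shift B (-α)) N,
      (∀ i, comp u' i = comp u i) ∧ ‖u'‖ = ‖v‖ := by
  have e : ∀ i, (shift B (-α)).toDist (v.1 i) = comp u i := by
    intro i
    change Lam n (-α) (comp v i) = _
    rw [h i, lam_lam]
  refine ⟨⟨v.1, fun i ↦ ?_⟩, e, rfl⟩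
  rw [e i]
  exact u.2 i

theorem exists_of_shift {B : DistSpace (ST n)} {α : ℝ} {w : RVec (shift B (-α)) N} {u : RVec B N}
    (h : ∀ i, comp w i = comp u i) (hr : ∀ i, IsRealValued (Lam n α (comp u i))) :
    ∃ v : RVec B N, (∀ i, comp v i = Lam n α (comp u i)) ∧ ‖v‖ = ‖w‖ := by
  have e : ∀ i, B.toDist (w.1 i) = Lam n α (comp u i) := by
    intro i
    rw [← h i]
    have := lam_lam (-α) (B.toDist (w.1 i))
    rw [neg_neg] at this
    exact this.symm
  refine ⟨⟨w.1, fun i ↦ ?_⟩, e, rfl⟩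
  rw [e i]
  exact hr i

/-- The tame estimate in terms of `v = Λ^{σ-s} u`. -/
theorem exists_tame (hX : MainHyp s X) {Nl : RVec X N → RVec (Yspace X ε) N}
    (ht : TameEstimate Nl s σ) (R : ℝ) : ∃ K : ℝ, 0 ≤ K ∧ ∀ u v : RVec X N, ‖u‖ ≤ R →
      (∀ i, comp v i = Lam n (σ - s) (comp u i)) → ∃ G : RVec (Yspace X ε) N,
        (∀ i, comp G i = Lam n (σ - s) (comp (Nl u) i)) ∧ ‖G‖ ≤ K * ‖v‖ := by
  obtain ⟨A, hA, h⟩ := ht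
  rw [← neg_sub σ s] at h
  obtain ⟨K, hK0, hK⟩ := WaveSys.exists_bound_of_continuousOn hA R
  refine ⟨K, hK0, fun u v hu hv ↦ ?_⟩
  obtain ⟨u', hu', hn⟩ := exists_shift hv
  obtain ⟨w, hw, hwn⟩ := h u u' hu'
  obtain ⟨C, hC⟩ := exists_fibre hX
  obtain ⟨G, hG, hGn⟩ := exists_of_shift hw fun i ↦ by
    obtain ⟨U, -, hU, -⟩ := hC ((Nl u).1 i)
    exact isRealValued_mult (hasFourierFun_Y hU) ((Nl u).2 i) (symX_temperate _) (symX_neg_arg _)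
  refine ⟨G, hG, ?_⟩
  rw [hGn]
  refine hwn.trans ?_
  rw [hn]
  exact mul_le_mul_of_nonneg_right (hK _ (norm_nonneg _) hu) (norm_nonneg _)

end Regularity

/-! ### Persistence of higher regularity -/

section Persistence

variable {n N : ℕ} {s ε σ : ℝ} {X : DistSpace (ST n)}

/-- The data belong to `H^σ × H^{σ-1}`. -/
def RegData (σ : ℝ) (d : RVec (H n s) N × RVec (H n (s - 1)) N) : Prop :=
  ∀ i, (∃ w : (H n σ).carrier, (H n σ).toDist w = comp d.1 i) ∧
    ∃ w : (H n (σ - 1)).carrier, (H n (σ - 1)).toDist w = comp d.2 i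

theorem RegData.exists_lam {d : RVec (H n s) N × RVec (H n (s - 1)) N} (h : RegData σ d) :
    ∃ d' : RVec (H n s) N × RVec (H n (s - 1)) N,
      (∀ i, comp d'.1 i = LamS n (σ - s) (comp d.1 i)) ∧
      ∀ i, comp d'.2 i = LamS n (σ - s) (comp d.2 i) := by
  have h1 := fun i ↦ exists_lam_H (r := s) (α := σ - s) (v := comp d.1 i) (by
    rw [add_sub_cancel]
    exact (h i).1) (d.1.2 i)
  have h2 := fun i ↦ exists_lam_H (r := s - 1) (α := σ - s) (v := comp d.2 i) (by
    rw [show s - 1 + (σ - s) = σ - 1 by ring]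
    exact (h i).2) (d.2.2 i)
  choose f hf hfr using h1
  choose g hg hgr using h2
  exact ⟨(⟨f, hfr⟩, ⟨g, hgr⟩), hf, hg⟩

variable {P : WaveSys (RVec X N) (RVec (Yspace X ε) N) (RVec (H n s) N × RVec (H n (s - 1)) N)}
  {Nl : RVec X N → RVec (Yspace X ε) N}

/-- `V` and `W` are the curve of the `i`-th component of `u` in `H^σ` and in `H^{σ-1}`, and the time
derivative has values in `H^{σ-1}`. -/
structure RegCurve (P : WaveSys (RVec X N) (RVec (Yspace X ε) N)
    (RVec (H n s) N × RVec (H n (s - 1)) N)) (u : RVec X N) (i : Fin N) (I : Set ℝ)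
    (V : ℝ → (H n σ).carrier) (W : ℝ → (H n (σ - 1)).carrier) : Prop where
  cont : Continuous V
  diff : ContDiff ℝ 1 W
  fst : ∀ t ∈ I, (H n σ).toDist (V t) = comp (P.ev t u).1 i
  snd : ∀ t ∈ I, (H n (σ - 1)).toDist (W t) = comp (P.ev t u).1 i
  deriv : ∀ t ∈ I, ∃ w : (H n (σ - 1)).carrier, (H n (σ - 1)).toDist w = comp (P.ev t u).2 i

theorem exists_regCurve (hP : P.Represents Nl) {u : RVec X N} {i : Fin N}
    {U : ST n → ℂ} (hm : Measurable U) (hU : HasFourierFun (comp u i) U)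
    (h : wnorm σ (fibMass U) < ⊤) (h' : wnorm (σ - 1) (fibMass (dtFun U)) < ⊤) :
    ∃ (V : ℝ → (H n σ).carrier) (W : ℝ → (H n (σ - 1)).carrier),
      RegCurve P u i Set.univ V W := by
  obtain ⟨V, hV, hVp, -⟩ := exists_path_H hU hm h
  obtain ⟨W, hW, hWp⟩ := exists_path_H_deriv hU hm h h'
  obtain ⟨V', -, hVp', -⟩ := exists_path_H hU.dt (measurable_dtFun hm) h'
  refine ⟨V, W, hV, hW, fun t _ ↦ ?_, fun t _ ↦ ?_, fun t _ ↦ ⟨V' t, ?_⟩⟩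
  · obtain ⟨Q, hQ, hQt⟩ := hP.ev_fst t u i
    rw [← hQt, hQ.unique hVp]
  · obtain ⟨Q, hQ, hQt⟩ := hP.ev_fst t u i
    rw [← hQt, hQ.unique hWp]
  · obtain ⟨Q, hQ, hQt⟩ := hP.ev_snd t u i
    rw [← hQt, hQ.unique hVp']

/-- Local solutions with data in `H^σ × H^{σ-1}` are regular. -/
theorem exists_regular_solver (hX : MainHyp s X) (hP : P.Represents Nl)
    (ht : TameEstimate Nl s σ) {ρ : ℝ} (hρ : 0 ≤ ρ) : ∃ h : ℝ, 0 < h ∧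
      ∃ Ψ : RVec (H n s) N × RVec (H n (s - 1)) N → RVec X N, ∀ e, ‖e‖ ≤ ρ →
        P.Sol (-h) h (Ψ e) ∧ P.ev 0 (Ψ e) = e ∧ (RegData σ e → ∀ i,
          ∃ (V : ℝ → (H n σ).carrier) (W : ℝ → (H n (σ - 1)).carrier),
            RegCurve P (Ψ e) i Set.univ V W) := by
  have := completeSpace_RVec (N := N) hX
  obtain ⟨R, hR, hsolver⟩ := P.exists_solver ρ hρ
  obtain ⟨K, hK0, hK⟩ := exists_tame hX ht R
  obtain ⟨h, hh, S, Ψ, hS, hSK, hΨ⟩ := hsolver K hK0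
  refine ⟨h, hh, Ψ, fun e he ↦ ⟨(hΨ.sol e he).1, (hΨ.sol e he).2, fun hreg i ↦ ?_⟩⟩
  obtain ⟨d', hd₁, hd₂⟩ := hreg.exists_lam
  -- Picard iterates from 0, together with their images v under Λ^{σ-s}, which obey a companion
  -- iteration because the free and Duhamel operators commute with Λ^{σ-s}. The tame constant
  -- depends only on ‖u‖ ≤ R, and the bound 2‖W d'‖ reproduces itself because ‖S‖K ≤ 1/2.
  have iter : ∀ k : ℕ, ∃ u v : RVec X N, ‖u‖ ≤ R ∧ (∀ i, comp v i = Lam n (σ - s) (comp u i)) ∧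
      ‖v‖ ≤ 2 * ‖P.free d'‖ ∧ ‖u - Ψ e‖ ≤ (1 / 2) ^ k * ‖Ψ e‖ := by
    intro k
    induction k with
    | zero =>
      refine ⟨0, 0, by simpa using hR, fun i ↦ ?_, ?_, by simp⟩
      · rw [comp_zero, map_zero]
      · rw [norm_zero]
        positivity
    | succ k ih =>
      obtain ⟨u, v, hu, hv, hvn, huΨ⟩ := ih
      obtain ⟨G, hG, hGn⟩ := hK u v hu hv
      refine ⟨P.free e + S (P.N u), P.free d' + S G, hΨ.maps e he u hu, fun i ↦ ?_, ?_, ?_⟩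
      · rw [comp_add, comp_add, map_add, hP.free_lam _ e d' hd₁ hd₂ i, hP.spec_lam S hS _ (P.N u) G
          (fun i ↦ by rw [hP.N_eq]; exact hG i) i]
      · have h1 : ‖S G‖ ≤ 1 / 2 * ‖v‖ := by
          calc ‖S G‖ ≤ ‖S‖ * (K * ‖v‖) := (S.le_opNorm _).trans (by gcongr)
            _ ≤ _ := by
              rw [← mul_assoc]
              gcongr
        exact (norm_add_le _ _).trans (by linarith)
      · refine (hΨ.contr e he u hu).trans ?_
        rw [pow_succ', mul_assoc]
        gcongr
  obtain ⟨U, hm, hU, h1, h2⟩ := exists_regular_of_approx (σ := σ) (B := 2 * ‖P.free d'‖₊) hX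
    (u := (Ψ e).1 i) (fun η hη ↦ by
      obtain ⟨k, hk⟩ := exists_pow_lt_of_lt_one (y := (1 / 2 : ℝ))
        (show (0 : ℝ) < η / (‖Ψ e‖ + 1) by positivity) (by norm_num)
      obtain ⟨u, v, -, hv, hvn, huΨ⟩ := iter k
      refine ⟨u.1 i, v.1 i, hv i, ?_, ?_⟩
      · rw [enorm_le_coe, ← NNReal.coe_le_coe]
        exact (norm_le_RVec v i).trans hvn
      · rw [enorm_le_coe, ← NNReal.coe_le_coe]
        refine (norm_le_RVec (Ψ e - u) i).trans ?_
        rw [norm_sub_rev]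
        refine huΨ.trans ?_
        rw [lt_div_iff₀ (by positivity)] at hk
        refine le_trans ?_ hk.le
        gcongr
        linarith)
  exact exists_regCurve hP hm hU h1 h2

/-- A solution with regular data at time `b` is regular on a time interval of fixed length. -/
theorem exists_regCurve_from (hX : MainHyp s X) (hP : P.Represents Nl)
    (ht : TameEstimate Nl s σ) {T : ℝ} {u : RVec X N} (hu : P.Sol 0 T u) : ∃ h : ℝ, 0 < h ∧
      ∀ b c, 0 ≤ b → b < c → c ≤ T → c ≤ b + h → RegData σ (P.ev b u) → ∀ i,
        ∃ (V : ℝ → (H n σ).carrier) (W : ℝ → (H n (σ - 1)).carrier),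
          RegCurve P u i (Set.Icc b c) V W := by
  have hB : 0 ≤ P.evB := (norm_nonneg _).trans (P.ev_le 0)
  -- This radius bounds the data of u at all times, so h does not depend on b nor on the size of the
  -- data in H^σ.
  obtain ⟨h, hh, Ψ, hΨ⟩ := exists_regular_solver hX hP ht
    (show 0 ≤ P.evB * ‖u‖ by positivity)
  refine ⟨h, hh, fun b c hb hbc hcT hch hreg i ↦ ?_⟩
  obtain ⟨hsol, hev, hΨreg⟩ := hΨ (P.ev b u) ((P.ev b).le_of_opNorm_le (P.ev_le b) u)
  obtain ⟨V, W, hVW⟩ := hΨreg hreg i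
  have hev' : ∀ t ∈ Set.Icc b c, P.ev t u = P.ev (t - b) (Ψ (P.ev b u)) := by
    intro t htI
    have hv : u - P.sh (-b) (Ψ (P.ev b u)) ∈ P.van b c := by
      refine WaveSys.sol_unique_from hbc (hu.mono hb hcT) ?_ ?_
      · exact WaveSys.Sol.mono (P.sol_sh (-b) hsol) (by linarith) (by linarith)
      · rw [P.ev_sh, add_neg_cancel, hev]
    have := P.ev_van hbc hv htI
    rwa [map_sub, P.ev_sh, sub_eq_zero, ← sub_eq_add_neg] at this
  refine ⟨fun t ↦ V (t - b), fun t ↦ W (t - b), hVW.cont.comp (continuous_sub_right b),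
    hVW.diff.comp (contDiff_id.sub contDiff_const), fun t h ↦ ?_, fun t h ↦ ?_, fun t h ↦ ?_⟩
  · rw [hev' t h]
    exact hVW.fst _ trivial
  · rw [hev' t h]
    exact hVW.snd _ trivial
  · rw [hev' t h]
    exact hVW.deriv _ trivial

/-- Regularity of the data travels forward in finitely many steps of fixed length. The pieces define
one curve, since the Sobolev spaces inject into distributions, and continuity and differentiability
are local. -/
theorem inEnergyClass_of_sol (hX : MainHyp s X) (hP : P.Represents Nl)
    (ht : TameEstimate Nl s σ) {T : ℝ} (hT : 0 < T) {u : RVec X N} (hu : P.Sol 0 T u)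
    (h0 : RegData σ (P.ev 0 u)) (i : Fin N) : InEnergyClass σ T (comp u i) := by
  obtain ⟨h, hh, hstep⟩ := exists_regCurve_from hX hP ht hu
  have hreg : ∀ k : ℕ, ∀ t ∈ Set.Icc 0 T, t ≤ k * h → RegData σ (P.ev t u) := by
    intro k
    induction k with
    | zero =>
      intro t ht htk
      have : t = 0 := le_antisymm (by simpa using htk) ht.1
      rwa [this]
    | succ k ih =>
      intro t ht htk
      rcases ht.1.eq_or_lt with rfl | h0t
      · exact h0
      push_cast at htk
      have hb : RegData σ (P.ev (max 0 (t - h)) u) :=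
        ih _ ⟨le_max_left _ _, max_le hT.le (by linarith [ht.2])⟩
          (max_le (by positivity) (by linarith))
      intro j
      obtain ⟨V, W, hVW⟩ := hstep _ t (le_max_left _ _) (max_lt h0t (by linarith)) ht.2
        (by linarith [le_max_right 0 (t - h)]) hb j
      have htI : t ∈ Set.Icc (max 0 (t - h)) t := ⟨max_le h0t.le (by linarith), le_rfl⟩
      exact ⟨⟨V t, hVW.fst t htI⟩, hVW.deriv t htI⟩
  have hreg' : ∀ t ∈ Set.Icc 0 T, RegData σ (P.ev t u) := by
    intro t ht
    obtain ⟨k, hk⟩ := exists_nat_ge (t / h)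
    exact hreg k t ht ((div_le_iff₀ hh).1 hk)
  have hloc : ∀ t₀ ∈ Set.Icc 0 T, ∃ I ∈ nhdsWithin t₀ (Set.Icc 0 T),
      ∃ (V : ℝ → (H n σ).carrier) (W : ℝ → (H n (σ - 1)).carrier), RegCurve P u i I V W := by
    intro t₀ ht₀
    -- Starting half a step earlier makes the resulting interval a neighbourhood of t₀ within [0,
    -- T]; at t₀ = 0 a one-sided interval already is one.
    set b := max 0 (t₀ - h / 2) with hb
    have hbt : b ≤ t₀ := max_le ht₀.1 (by linarith)
    have hbt' : t₀ - h / 2 ≤ b := le_max_right _ _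
    rcases hbt.eq_or_lt with e | hlt
    · have h00 : t₀ = 0 := by
        rcases max_choice 0 (t₀ - h / 2) with h1 | h1 <;> linarith
      refine ⟨Set.Icc 0 (min T h), ?_, hstep 0 (min T h) le_rfl (lt_min hT hh) (min_le_left _ _)
        (by linarith [min_le_right T h]) h0 i⟩
      filter_upwards [self_mem_nhdsWithin, mem_nhdsWithin_of_mem_nhds
        (ge_mem_nhds (show t₀ < h by linarith))] with t h1 h2
      exact ⟨h1.1, le_min h1.2 h2⟩
    · have hbT : b < T := hlt.trans_le ht₀.2
      refine ⟨Set.Icc b (min T (b + h)), ?_, hstep b (min T (b + h)) (le_max_left _ _)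
        (lt_min hbT (by linarith)) (min_le_left _ _) (min_le_right _ _)
        (hreg' b ⟨le_max_left _ _, hbT.le⟩) i⟩
      filter_upwards [self_mem_nhdsWithin, mem_nhdsWithin_of_mem_nhds (le_mem_nhds hlt),
        mem_nhdsWithin_of_mem_nhds (ge_mem_nhds (show t₀ < b + h by linarith))] with t h1 h2 h3
      exact ⟨h2, le_min h1.2 h3⟩
  have hmem : ∀ t ∈ Set.Icc 0 T, ∃ (v : (H n σ).carrier) (w : (H n (σ - 1)).carrier),
      (H n σ).toDist v = comp (P.ev t u).1 i ∧
        (H n (σ - 1)).toDist w = comp (P.ev t u).1 i := by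
    intro t ht
    obtain ⟨I, hI, V, W, hVW⟩ := hloc t ht
    have htI := mem_of_mem_nhdsWithin ht hI
    exact ⟨V t, W t, hVW.fst t htI, hVW.snd t htI⟩
  choose! V W hV hW using hmem
  obtain ⟨Q, hQ, -⟩ := hP.ev_fst 0 u i
  have hQt : ∀ t, Q t = comp (P.ev t u).1 i := by
    intro t
    obtain ⟨Q', hQ', hQt'⟩ := hP.ev_fst t u i
    rw [hQ.unique hQ', hQt']
  refine ⟨Q, hQ, ⟨V, fun t₀ ht₀ ↦ ?_, fun t ht ↦ (hV t ht).trans (hQt t).symm⟩,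
    W, fun t₀ ht₀ ↦ ?_, fun t ht ↦ (hW t ht).trans (hQt t).symm⟩
  · obtain ⟨I, hI, V', W', hVW⟩ := hloc t₀ ht₀
    refine hVW.cont.continuousWithinAt.congr_of_eventuallyEq ?_ ?_
    · filter_upwards [hI, self_mem_nhdsWithin] with t h1 h2
      exact (H n σ).inj ((hV t h2).trans (hVW.fst t h1).symm)
    · exact (H n σ).inj ((hV t₀ ht₀).trans (hVW.fst t₀ (mem_of_mem_nhdsWithin ht₀ hI)).symm)
  · obtain ⟨I, hI, V', W', hVW⟩ := hloc t₀ ht₀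
    refine hVW.diff.contDiffWithinAt.congr_of_eventuallyEq ?_ ?_
    · filter_upwards [hI, self_mem_nhdsWithin] with t h1 h2
      exact (H n (σ - 1)).inj ((hW t h2).trans (hVW.snd t h1).symm)
    · exact (H n (σ - 1)).inj
        ((hW t₀ ht₀).trans (hVW.snd t₀ (mem_of_mem_nhdsWithin ht₀ hI)).symm)

theorem WaveSys.Represents.solves_iff (hP : P.Represents Nl) {T : ℝ} {q : Restr X N T}
    {f : RVec (H n s) N} {g : RVec (H n (s - 1)) N} :
    Solves Nl q f g ↔ ∃ u : RVec X N, (Submodule.Quotient.mk u : Restr X N T) = q ∧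
      P.Sol 0 T u ∧ P.ev 0 u = (f, g) := by
  refine exists_congr fun u ↦ and_congr_right fun _ ↦ and_congr ?_ ?_
  · rw [WaveSys.Sol, hP.rel_iff, hP.N_eq]
  · exact (IsEval.eq_iff ⟨hP.ev_fst 0, hP.ev_snd 0⟩).symm

end Persistence

end WaveLWP

end

/-! ### Well-posedness: assembly of the five assertions -/

open WaveLWP in
theorem mainTheorem2 (n N : ℕ) (hn : 1 ≤ n) (s ε : ℝ) (hε : 0 < ε)
    (X : DistSpace (ST n)) (hX : MainHyp s X) (hshift : TimeInvariant X)
    (hcut : CutoffInvariant X)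
    (Nl : RVec X N → RVec (Yspace X ε) N)
    (hNshift : CommutesWithTimeShift Nl) (hNloc : LocalInTime Nl) (hN0 : Nl 0 = 0)
    (hNlip : LipschitzOnBalls Nl) :
    -- (I) local existence
    (∃ T : ℝ → ℝ, ContinuousOn T (Set.Ici 0) ∧ (∀ r, 0 ≤ r → 0 < T r) ∧
      ∀ (f : RVec (H n s) N) (g : RVec (H n (s - 1)) N),
        ∃ q : Restr X N (T (‖f‖ + ‖g‖)), Solves Nl q f g) ∧
    -- (II) uniqueness
    (∀ T : ℝ, 0 < T → ∀ (f : RVec (H n s) N) (g : RVec (H n (s - 1)) N) (q q' : Restr X N T),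
      Solves Nl q f g → Solves Nl q' f g → q = q') ∧
    -- (III) continuous dependence on the data
    (∀ T : ℝ, 0 < T → ∀ (f : RVec (H n s) N) (g : RVec (H n (s - 1)) N) (q : Restr X N T),
      Solves Nl q f g → ∃ δ : ℝ, 0 < δ ∧ ∃ C : ℝ,
        ∀ (f' : RVec (H n s) N) (g' : RVec (H n (s - 1)) N), ‖f - f'‖ + ‖g - g'‖ < δ →
          ∃ q' : Restr X N T, Solves Nl q' f' g' ∧ ‖q - q'‖ ≤ C * (‖f - f'‖ + ‖g - g'‖)) ∧
    -- (IV) smooth dependence on the data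
    (ContDiff ℝ ∞ Nl →
      ∀ T : ℝ, 0 < T → ∃ _ : IsClosed (vanishSub X N T : Set (RVec X N)),
        ∀ (F : ℝ → RVec (H n s) N × RVec (H n (s - 1)) N), ContDiff ℝ ∞ F →
          ∀ q : Restr X N T, Solves Nl q (F 0).1 (F 0).2 →
            (∃ δ₀ : ℝ, 0 < δ₀ ∧ ∀ δ ∈ Set.Icc (-δ₀) δ₀,
              ∃ w : Restr X N T, Solves Nl w (F δ).1 (F δ).2) ∧
            ∀ δ₀ : ℝ, 0 < δ₀ → ∀ w : ℝ → Restr X N T,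
              (∀ δ ∈ Set.Icc (-δ₀) δ₀, Solves Nl (w δ) (F δ).1 (F δ).2) →
                ContDiffOn ℝ ∞ w (Set.Icc (-δ₀) δ₀)) ∧
    -- (V) persistence of higher regularity
    ((∀ σ : ℝ, s < σ → TameEstimate Nl s σ) →
      ∀ σ : ℝ, s < σ → ∀ T : ℝ, 0 < T →
        ∀ (f : RVec (H n s) N) (g : RVec (H n (s - 1)) N)
          (f' : RVec (H n σ) N) (g' : RVec (H n (σ - 1)) N),
          (∀ i, comp f' i = comp f i) → (∀ i, comp g' i = comp g i) →
            ∀ u : RVec X N, Solves Nl (Submodule.Quotient.mk u : Restr X N T) f g →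
              ∀ i, InEnergyClass σ T (comp u i)) := by
  obtain ⟨P, hP⟩ := exists_waveSys hX hε hcut hNshift hNloc hN0 hNlip
  have hcomplete := completeSpace_RVec (N := N) hX
  have hsol : ∀ {T : ℝ} {q : Restr X N T} {f : RVec (H n s) N} {g : RVec (H n (s - 1)) N},
      Solves Nl q f g ↔ ∃ u : RVec X N, (Submodule.Quotient.mk u : Restr X N T) = q ∧
        P.Sol 0 T u ∧ P.ev 0 u = (f, g) :=
    fun {T q f g} ↦ hP.solves_iff
  have hmk : ∀ {T : ℝ}, 0 < T → ∀ {u v : RVec X N}, P.Sol 0 T u → P.Sol 0 T v →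
      P.ev 0 u = P.ev 0 v → (Submodule.Quotient.mk u : Restr X N T) = Submodule.Quotient.mk v :=
    fun hT u v hu hv he ↦ (Submodule.Quotient.eq _).2 (by
      rw [vanishSub_eq hX hT]
      exact hP.van_iff.1 (WaveSys.sol_unique hT hu hv he))
  refine ⟨?_, ?_, ?_, ?_, ?_⟩
  · obtain ⟨T, hT, hTpos, h⟩ := P.exists_lifespan
    refine ⟨T, hT.continuousOn, fun r _ ↦ hTpos r, fun f g ↦ ?_⟩
    obtain ⟨u, hu, hd⟩ := h (‖f‖ + ‖g‖) (f, g)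
      (max_le (le_add_of_nonneg_right (norm_nonneg _)) (le_add_of_nonneg_left (norm_nonneg _)))
    exact ⟨Submodule.Quotient.mk u, hsol.2 ⟨u, rfl, hu, hd⟩⟩
  · intro T hT f g q q' h h'
    obtain ⟨u, rfl, hu, hd⟩ := hsol.1 h
    obtain ⟨u', rfl, hu', hd'⟩ := hsol.1 h'
    exact hmk hT hu hu' (hd.trans hd'.symm)
  · intro T hT f g q h
    obtain ⟨u, rfl, hu, hd⟩ := hsol.1 h
    obtain ⟨G, hG, hGO, -⟩ := WaveSys.exists_family hT hu hd
    obtain ⟨C, hC0, hC⟩ := hGO.exists_nonneg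
    -- One δ serves both the existence of the neighbouring solutions and the Lipschitz bound.
    obtain ⟨δ, hδ, hball⟩ := Metric.eventually_nhds_iff.1 (hG.and hC.bound)
    have hGd := hG.self_of_nhds
    refine ⟨δ, hδ, C, fun f' g' hlt ↦ ?_⟩
    have hle : ‖(f', g') - (f, g)‖ ≤ ‖f - f'‖ + ‖g - g'‖ := by
      rw [norm_sub_rev]
      exact max_le (le_add_of_nonneg_right (norm_nonneg _))
        (le_add_of_nonneg_left (norm_nonneg _))
    obtain ⟨⟨hs, he⟩, hb⟩ := hball (y := (f', g'))
      (by rw [dist_eq_norm]; exact hle.trans_lt hlt)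
    refine ⟨Submodule.Quotient.mk (G (f', g')), hsol.2 ⟨_, rfl, hs, he⟩, ?_⟩
    rw [hmk hT hu hGd.1 (hd.trans hGd.2.symm), ← Submodule.Quotient.mk_sub]
    refine (Submodule.Quotient.norm_mk_le _ _).trans ?_
    rw [norm_sub_rev]
    exact hb.trans (by gcongr)
  · intro hN T hT
    have hcl : IsClosed (vanishSub X N T : Set (RVec X N)) := by
      rw [vanishSub_eq hX hT]
      exact isClosed_slabSub hX hT
    rw [← hP.N_eq] at hN
    refine ⟨hcl, fun F hF q h ↦ ⟨?_, ?_⟩⟩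
    · obtain ⟨u, rfl, hu, hd⟩ := hsol.1 h
      obtain ⟨G, hG, -, -⟩ := WaveSys.exists_family hT hu hd
      obtain ⟨δ, hδ, hball⟩ := Metric.eventually_nhds_iff.1
        ((hF.continuous.tendsto 0).eventually hG)
      refine ⟨δ / 2, by positivity, fun δ' hδ' ↦ ?_⟩
      obtain ⟨hs, he⟩ := hball (y := δ') (by
        rw [dist_zero_right, Real.norm_eq_abs]
        exact (abs_le.2 hδ').trans_lt (by linarith))
      exact ⟨_, hsol.2 ⟨_, rfl, hs, he⟩⟩
    · intro δ₀ hδ₀ w hw δ₁ hδ₁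
      obtain ⟨u, hq, hu, hd⟩ := hsol.1 (hw δ₁ hδ₁)
      -- Smoothness is checked at each δ₁ separately. Near δ₁ uniqueness forces the given classes `w
      -- δ` to be those of the family built around a representative of `w δ₁`.
      obtain ⟨G, hG, -, hGs⟩ := WaveSys.exists_family hT hu hd
      have hev : ∀ᶠ δ in nhds δ₁, P.Sol 0 T (G (F δ)) ∧ P.ev 0 (G (F δ)) = F δ :=
        (hF.continuous.tendsto δ₁).eventually hG
      let π : RVec X N →L[ℝ] Restr X N T := (vanishSub X N T).mkQL
      have hπ : ContDiffAt ℝ ∞ (fun δ ↦ π (G (F δ))) δ₁ :=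
        π.contDiff.contDiffAt.comp δ₁ ((hGs hN).comp δ₁ hF.contDiffAt)
      have heq : ∀ δ ∈ Set.Icc (-δ₀) δ₀, P.Sol 0 T (G (F δ)) ∧ P.ev 0 (G (F δ)) = F δ →
          w δ = π (G (F δ)) := by
        intro δ hδ h
        obtain ⟨v, hv, hvs, hvd⟩ := hsol.1 (hw δ hδ)
        rw [← hv]
        exact hmk hT hvs h.1 (hvd.trans h.2.symm)
      refine hπ.contDiffWithinAt.congr_of_eventuallyEq ?_ (heq δ₁ hδ₁ hev.self_of_nhds)
      filter_upwards [self_mem_nhdsWithin, mem_nhdsWithin_of_mem_nhds hev] with δ h1 h2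
      exact heq δ h1 h2
  · intro htame σ hσ T hT f g f' g' hf hg u h i
    obtain ⟨v, hv, hvs, hvd⟩ := hsol.1 h
    have hsub : v - u ∈ vanishSub X N T := (Submodule.Quotient.eq _).1 hv
    rw [vanishSub_eq hX hT] at hsub
    -- The solving representative `v` and the given `u` may differ off the time interval; the
    -- equation on (0, T) and the data at 0 are transferred to `u`.
    have huv : u - v ∈ P.van 0 T := hP.van_iff.2 (by
      rw [← neg_sub]
      exact neg_mem hsub)
    have hud : P.ev 0 u = (f, g) := by
      have := P.ev_van hT huv ⟨le_rfl, hT.le⟩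
      rw [map_sub, sub_eq_zero] at this
      exact this.trans hvd
    refine inEnergyClass_of_sol hX hP (htame σ hσ) hT (hvs.congr huv) ?_ i
    rw [hud]
    exact fun j ↦ ⟨⟨f'.1 j, hf j⟩, g'.1 j, hg j⟩
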